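/- Let $n\ge 3$. **Two-valued functions.** A two-valued function $f$ assigns to each $x\in\mathbb R^n$ a pair $\{v,-v\}\subset\mathbb R$. A *single-valued branch* of $f$ on $U$ is a function $g$, harmonic near every point of $U$, with $f(x)=\{g(x),-g(x)\}$ for $x\in U$. Let $\Sigma\subset\mathbb R^n$ be a compact codimension-$2$ submanifold with a chosen orthonormal normal frame $(\nu_1,\nu_2)$, and write $\zeta=re^{i\theta}$ for the normal coordinate of the point $p+r\cos\theta\,\nu_1(p)+r\sin\theta\,\nu_2(p)$, $p\in\Sigma$. The function $f$ is *$\mathbb Z_2$-harmonic with branching set $\Sigma$* if it has a branch near every point of $\mathbb R^n\setminus\Sigma$, if continuation of a branch along every small normal circle around $\Sigma$ changes its sign, and if $|f|,|\nabla f|\in L^2_{loc}(\mathbb R^n)$ (on $\Sigma$ we set $f=0$). It is *non-degenerate* if moreover, near $\Sigma$, $f=\mathrm{Re}(B\zeta^{3/2})+O(|\zeta|^{5/2})$ with $B$ smooth and nowhere zero on $\Sigma$. **The family.** For $h=(h_1,\dots,h_{n-1})$ with all $h_i>0$ put $S(y)=\prod_{i=1}^{n-1}(y+h_i^2)$, $$E_h=\Big\{\sum_{i=1}^{n-1}\frac{x_i^2}{h_i^2}=1,\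 x_n=0\Big\},\qquad a_0(h)=\frac{\prod_j h_j}{2}\int_0^\infty\frac{du}{\sqrt{S(u^2)}},$$ $$a_i(h)=\frac{\prod_j h_j}{2}\int_0^\infty\frac{du}{(u^2+h_i^2)\sqrt{S(u^2)}}\ (1\le i\le n-1),\qquad a_n(h)=-\frac{\prod_j h_j}{2}\int_0^\infty\frac{S'(u^2)\,du}{S(u^2)^{3/2}}.$$ Let $\mathcal F$ be the set of the two-valued functions $f=c\,f_h\circ A^{-1}$, where $h_i>0$, $c>0$, $A\in O(n)$, and $f_h$ is a non-degenerate $\mathbb Z_2$-harmonic function with branching set $E_h$ which on a single-valued branch outside a large ball satisfies $f_h=a_0-\sum_{i=1}^n a_ix_i^2+O(|x|^{2-n})$. Such an $f$ has branching set $A(E_h)$. **Statement.** Let $P$ be a homogeneous harmonic polynomial of degree $2$ on $\mathbb R^n$ whose only critical point is the origin, and let the Morse index of $P$ there be $n-1$. 1. For every $C>0$ there is exactly one $f\in\mathcal F$ (as a two-valued function, that is, up to the choice of sign) that has a single-valued branch outside a large ball on which $$f=C+P+O(|x|^{2-n}),\qquad |x|\to\infty .$$ 2. Denote this function by $f_C$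 and its branching ellipsoid by $E^C$. Then $E^C=\sqrt C\,E^1$; in particular $E^C$ shrinks to the origin as $C\to0$. For every open ball $D$ containing the origin, once $C$ is small enough, $E^C\subset D$ and $f_C$ has a single-valued branch on $\mathbb R^n\setminus D$, which converges to $P$ uniformly on $\mathbb R^n\setminus D$ as $C\to0$. 3. Let $K_n=(0,\infty)^{n-1}$. The map $F_n:(1/h_1,\dots,1/h_{n-1})\mapsto(a_1(h),\dots,a_{n-1}(h))$ maps $K_n$ into $K_n$ and is surjective onto $K_n$. -/

import Mathlib

open Filter Topology MeasureTheory
open scoped ContDiff Pointwise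

noncomputable section

namespace ZTwo

/-- Euclidean `n`-space. -/
abbrev Space (n : ℕ) : Type := EuclideanSpace ℝ (Fin n)

/-- A two-valued function: the values at `x` are meant to be a pair `{v, -v}`. This is the
multivalued function underlying a section of a flat real line bundle with monodromy `±1`; a section
and its negative give the same two-valued function. -/
abbrev TwoValued (n : ℕ) : Type := Space n → Set ℝ

variable {n : ℕ}

/-- `g` is a single-valued (harmonic) branch of `f` on `U`. -/
def IsBranchOn (f : TwoValued n) (U : Set (Space n)) (g : Space n → ℝ) : Prop :=
  InnerProductSpace.HarmonicOnNhd g U ∧ ∀ x ∈ U, f x = {g x, -g x}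

/-- The germ of `g` at `x` is a branch of `f`. -/
def IsBranchAt (f : TwoValued n) (x : Space n) (g : Space n → ℝ) : Prop :=
  InnerProductSpace.HarmonicAt g x ∧ ∀ᶠ y in 𝓝 x, f y = {g y, -g y}

/-- `G t`, as a germ at `γ t`, is a continuation along the path `γ` of a branch of `f`. -/
structure IsContinuation (f : TwoValued n) (γ : ℝ → Space n) (G : ℝ → Space n → ℝ) : Prop where
  branch : ∀ t, IsBranchAt f (γ t) (G t)
  locally_constant : ∀ t, ∀ᶠ s in 𝓝 t, G s =ᶠ[𝓝 (γ s)] G t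

/-- The circle of radius `r` around `p` in the plane spanned by `ν₁ p`, `ν₂ p`. When `ν₁, ν₂` is an
orthonormal frame of the normal bundle of a codimension-two submanifold, this is the small loop
linking the submanifold at `p`, and its point with parameter `θ` is the image under the normal
exponential map of the normal vector with complex coordinate `ζ = r e ^ (i θ)`. -/
def normalCircle (ν₁ ν₂ : Space n → Space n) (p : Space n) (r θ : ℝ) : Space n :=
  p + (r * Real.cos θ) • ν₁ p + (r * Real.sin θ) • ν₂ p

/-- `f` is a `ℤ₂`-harmonic function branching along the codimension-two submanifold `Z`, whose
normal bundle has the orthonormal frame `ν₁, ν₂`. On `Z` itself, where the section is not defined,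
the value is set to `0`. -/
structure IsZ2Harmonic (Z : Set (Space n)) (ν₁ ν₂ : Space n → Space n) (f : TwoValued n) :
    Prop where
  eq_zero : ∀ p ∈ Z, f p = {0}
  /-- `f` is locally `±` a harmonic function off `Z`. -/
  branch : ∀ x ∉ Z, ∃ g, IsBranchAt f x g
  /-- The monodromy along small loops linking `Z` is `-1`. -/
  monodromy : ∀ p ∈ Z, ∃ r₀ : ℝ, 0 < r₀ ∧ ∀ r : ℝ, 0 < r → r < r₀ →
    ∃ G, IsContinuation f (normalCircle ν₁ ν₂ p r) G ∧
      ∀ θ, G (θ + 2 * Real.pi) =ᶠ[𝓝 (normalCircle ν₁ ν₂ p r θ)] fun x => -G θ x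
  /-- `f` is in `L²_loc` of the whole space. -/
  sq_integrable : ∃ D : Space n → ℝ, LocallyIntegrable D volume ∧
    ∀ x g, x ∉ Z → IsBranchAt f x g → D x = (g x) ^ 2
  /-- The derivative of `f` is in `L²_loc` of the whole space. -/
  grad_sq_integrable : ∃ D : Space n → ℝ, LocallyIntegrable D volume ∧
    ∀ x g, x ∉ Z → IsBranchAt f x g → D x = ‖fderiv ℝ g x‖ ^ 2

/-- `f` is non-degenerate along `Z`: it is `ℤ₂`-harmonic and
`f = Re (B ζ ^ (3/2)) + O(|ζ| ^ (5/2))` near `Z`, with `B` smooth and nowhere zero on `Z`. -/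
structure IsNondegenerate (Z : Set (Space n)) (ν₁ ν₂ : Space n → Space n) (f : TwoValued n) :
    Prop extends IsZ2Harmonic Z ν₁ ν₂ f where
  expansion : ∃ B : Space n → ℂ, (∀ p ∈ Z, ContDiffAt ℝ ∞ B p ∧ B p ≠ 0) ∧
    ∃ K r₀ : ℝ, 0 < r₀ ∧ ∀ p ∈ Z, ∀ r : ℝ, 0 < r → r < r₀ →
      ∃ G, IsContinuation f (normalCircle ν₁ ν₂ p r) G ∧
        ∀ θ : ℝ,
          |G θ (normalCircle ν₁ ν₂ p r θ) -
              r ^ (3 / 2 : ℝ) * (B p * Complex.exp ((3 / 2 * θ : ℝ) * Complex.I)).re|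
            ≤ K * r ^ (5 / 2 : ℝ)

/-- At large distance `f` has a single-valued branch, on which `f = Q + O(|x| ^ (2 - n))`. -/
def HasAsymptotics (f : TwoValued n) (Q : Space n → ℝ) : Prop :=
  ∃ (R : ℝ) (g : Space n → ℝ), IsBranchOn f {x | R < ‖x‖} g ∧
    (fun x => g x - Q x) =O[Bornology.cobounded (Space n)] fun x => ‖x‖ ^ ((2 : ℤ) - (n : ℤ))

/-- The Morse index at `x`: the largest dimension of a subspace on which the Hessian of `p` at `x`
is negative definite. -/
def morseIndex (p : Space n → ℝ) (x : Space n) : ℕ :=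
  sSup {d | ∃ V : Submodule ℝ (Space n), Module.finrank ℝ V = d ∧
    ∀ v ∈ V, v ≠ 0 → fderiv ℝ (fderiv ℝ p) x v v < 0}

/-- The function on Euclidean space given by a polynomial. -/
def polyFun (P : MvPolynomial (Fin n) ℝ) (x : Space n) : ℝ := MvPolynomial.eval (fun i => x i) P

/-! From here on the space is `ℝⁿ` with `n = m + 1`; the first `m` coordinates are indexed by
`Fin.castSucc` and the last one by `Fin.last m`. -/

variable {m : ℕ}

/-- The image under the orthogonal map `A` of the ellipsoid
`∑_{i < n} xᵢ² / hᵢ² = 1`, `xₙ = 0`. -/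
def ellipsoid (A : Space (m + 1) ≃ₗᵢ[ℝ] Space (m + 1)) (h : Fin m → ℝ) : Set (Space (m + 1)) :=
  A '' {x | ∑ i, x i.castSucc ^ 2 / h i ^ 2 = 1 ∧ x (Fin.last m) = 0}

/-- The vector `(x₁ / h₁², …, xₙ₋₁ / hₙ₋₁², 0)`, half of the gradient of `∑ xᵢ² / hᵢ²`. -/
def conormal (h : Fin m → ℝ) (x : Space (m + 1)) : Space (m + 1) :=
  WithLp.toLp 2 (Fin.snoc (α := fun _ => ℝ) (fun i => x i.castSucc / h i ^ 2) 0)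

/-- The outer unit normal of `ellipsoid A h` in its hyperplane. -/
def normalOne (A : Space (m + 1) ≃ₗᵢ[ℝ] Space (m + 1)) (h : Fin m → ℝ) (x : Space (m + 1)) :
    Space (m + 1) :=
  A (‖conormal h (A.symm x)‖⁻¹ • conormal h (A.symm x))

/-- The unit normal of the hyperplane containing `ellipsoid A h`. -/
def normalTwo (A : Space (m + 1) ≃ₗᵢ[ℝ] Space (m + 1)) (_x : Space (m + 1)) : Space (m + 1) :=
  A (EuclideanSpace.single (Fin.last m) 1)

/-- `S(y) = ∏ (y + hᵢ²)`. -/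
def S (h : Fin m → ℝ) (y : ℝ) : ℝ := ∏ i, (y + h i ^ 2)

/-- The constant `a₀`. -/
def aZero (h : Fin m → ℝ) : ℝ :=
  (∏ j, h j) / 2 * ∫ u in Set.Ioi (0 : ℝ), 1 / √(S h (u ^ 2))

/-- The constants `a₁, …, aₙ₋₁`. -/
def aCoeff (h : Fin m → ℝ) (i : Fin m) : ℝ :=
  (∏ j, h j) / 2 * ∫ u in Set.Ioi (0 : ℝ), 1 / ((u ^ 2 + h i ^ 2) * √(S h (u ^ 2)))

/-- The constant `aₙ`. -/
def aLast (h : Fin m → ℝ) : ℝ :=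
  -((∏ j, h j) / 2) *
    ∫ u in Set.Ioi (0 : ℝ), deriv (S h) (u ^ 2) / (S h (u ^ 2)) ^ (3 / 2 : ℝ)

/-- The open cone of vectors with positive entries. -/
def cone (m : ℕ) : Set (Fin m → ℝ) := {y | ∀ i, 0 < y i}

/-- The map `(1 / h₁, …, 1 / hₙ₋₁) ↦ (a₁, …, aₙ₋₁)`. -/
def coeffMap (y : Fin m → ℝ) : Fin m → ℝ := aCoeff fun i => (y i)⁻¹

/-- `a₀ - ∑_{i ≤ n} aᵢ xᵢ²`. -/
def modelPoly (h : Fin m → ℝ) (x : Space (m + 1)) : ℝ :=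
  aZero h - (∑ i, aCoeff h i * x i.castSucc ^ 2 + aLast h * x (Fin.last m) ^ 2)

/-- `f` is the function `c • f_h ∘ A⁻¹`, where `f_h` is the non-degenerate `ℤ₂`-harmonic function
that branches along the standard ellipsoid with semi-axes `h` and is asymptotic to `modelPoly h`. -/
structure IsEllipsoidal (A : Space (m + 1) ≃ₗᵢ[ℝ] Space (m + 1)) (h : Fin m → ℝ) (c : ℝ)
    (f : TwoValued (m + 1)) : Prop where
  h_pos : ∀ i, 0 < h i
  c_pos : 0 < c
  nondegenerate : IsNondegenerate (ellipsoid A h) (normalOne A h) (normalTwo A) f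
  asymptotics : HasAsymptotics f fun x => c * modelPoly h (A.symm x)

end ZTwo

end

/-! Existence. On the double cover of the complement of the standard ellipsoid there are coordinates
`(w, v)` with x_n = w v and v² + ∑ xᵢ²/(w² + hᵢ²) = 1; a point determines them up to a common sign
(`IsSol`). For w > 0, `Phi` is ∏ hⱼ / 2 times the finite part of ∫₀ʷ (1 - ∑ xᵢ²/(u² + hᵢ²) -
x_n²/u²) du/√S(u²), with the x_n² term integrated by parts so that nothing singular at u = 0
remains. The bracket vanishes at u = w, so the gradient contains no derivative of w, and harmonicity
reduces to one relation between first derivatives of w and v (`hasFDerivAt_Phi`, `laplacian_Phi`).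
`Phi` is odd in `(w, v)`, and a turn around the ellipsoid exchanges the two sheets, whence the
monodromy. Writing ∫₀ʷ = ∫₀^∞ - ∫_w^∞ gives the asymptotics with exactly the constants aᵢ
(`abs_Phi_sub_modelPoly_le`); near the ellipsoid the leading term is the real part of a cube
(`abs_cube_sub_le`). So `model h` is the function f_h.

Uniqueness of f_h. Cutting along the solid ellipsoid, or along the rest of its hyperplane, makes a
solution single-valued. For two solutions with the same ellipsoid and the same asymptotics, the
absolute value of the difference of matched branches is globally well defined, continuous, zero on
the ellipsoid and zero at infinity, and it is harmonic near each point where it is positive; the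
maximum principle kills it (`eq_of_isNondegenerate`). Hence the family consists of the functions
`transport A c (model h)`.

Parameters. Since aₙ = -∑ aᵢ, and P in suitable orthonormal coordinates is -∑ bᵢ xᵢ² + (∑ bᵢ) xₙ²
with bᵢ > 0 (`exists_diagonal_form`), the problem is to solve c aᵢ(h) = bᵢ and c a₀(h) = C. Positive
solutions of aᵢ(h) = bᵢ come from minimising ∑ bᵢ hᵢ² + 2 ∫ du/√S(u²), whose critical points give
the integrals in aᵢ, followed by a dilation (`exists_integral_eq`, `exists_aCoeff_eq`); this is also
the surjectivity in the third part. Dilating h by t multiplies a₀ by t and divides aᵢ by t, so the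
choice c = t reaches every C. The semi-axes are determined because the gradient of p ↦ ∏ pᵢ^(-1/2)
is strictly monotone (`eq_of_integral_eq`).

Rigidity and scaling. If two members have quadratic parts P and constants C, C', the isometry
relating their axes mixes only axes of equal length, and the two differ by a dilation τ with τ² C' =
C (`exists_isScaledBy`). For C = C' this gives uniqueness; for C' = 1 it gives τ = √C, hence the law
for the ellipsoids, and the explicit decay constant then yields uniform convergence
(`family_converge`). -/

namespace ZTwo

open InnerProductSpace

/-! ### Harmonic functions: the maximum principle and an interior estimate. -/

section Harmonic

variable {E : Type*} [NormedAddCommGroup E] [InnerProductSpace ℝ E]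

/-- Second derivatives at a local maximum are nonpositive. -/
theorem fderiv_fderiv_nonpos_of_isLocalMax {f : E → ℝ} {x : E} (hf : ContDiffAt ℝ 2 f x)
    (hx : IsLocalMax f x) (v : E) : fderiv ℝ (fderiv ℝ f) x v v ≤ 0 := by
  by_contra! hpos
  set φ : ℝ → ℝ := fun t => f (x + t • v) with hφ
  have hline : ∀ t : ℝ, HasDerivAt (fun t : ℝ => x + t • v) v t := fun t => by
    simpa using ((hasDerivAt_id t).smul_const v).const_add x
  have hc : ContinuousAt (fun t : ℝ => x + t • v) 0 := (hline 0).continuousAt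
  have htend : Tendsto (fun t : ℝ => x + t • v) (𝓝 0) (𝓝 x) := by
    simpa [ContinuousAt] using hc
  have hd1 : ∀ᶠ t in 𝓝 (0 : ℝ), HasDerivAt φ (fderiv ℝ f (x + t • v) v) t := by
    have : ∀ᶠ y in 𝓝 x, DifferentiableAt ℝ f y :=
      (hf.eventually (by simp)).mono fun y hy => hy.differentiableAt (by norm_num)
    filter_upwards [htend.eventually this] with t ht
    exact ht.hasFDerivAt.comp_hasDerivAt t (hline t)
  have hD : deriv φ =ᶠ[𝓝 0] fun t => fderiv ℝ f (x + t • v) v := hd1.mono fun t ht => ht.deriv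
  have hfd : DifferentiableAt ℝ (fderiv ℝ f) x :=
    (hf.fderiv_right (m := 1) (by norm_num)).differentiableAt (by norm_num)
  have hd2 : HasDerivAt (fun t : ℝ => fderiv ℝ f (x + t • v) v) (fderiv ℝ (fderiv ℝ f) x v v) 0 := by
    have h0 : HasFDerivAt (fderiv ℝ f) (fderiv ℝ (fderiv ℝ f) x) (x + (0 : ℝ) • v) := by
      simpa using hfd.hasFDerivAt
    have h1 : HasDerivAt (fun t : ℝ => fderiv ℝ f (x + t • v)) (fderiv ℝ (fderiv ℝ f) x v) 0 :=
      h0.comp_hasDerivAt (0 : ℝ) (hline 0)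
    exact ((ContinuousLinearMap.apply ℝ ℝ v).hasFDerivAt).comp_hasDerivAt (0 : ℝ) h1
  have hmax : IsLocalMax φ 0 := by
    have : ∀ᶠ y in 𝓝 x, f y ≤ f x := hx
    filter_upwards [htend.eventually this] with t ht
    simpa [hφ] using ht
  have hdd : deriv (deriv φ) 0 = fderiv ℝ (fderiv ℝ f) x v v := by
    rw [hD.deriv_eq, hd2.deriv]
  -- A positive second derivative would make 0 a local minimum as well as a local maximum, so φ
  -- would be constant near 0.
  have hmin : IsLocalMin φ 0 :=
    isLocalMin_of_deriv_deriv_pos (by rw [hdd]; exact hpos) hmax.deriv_eq_zero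
      hd1.self_of_nhds.continuousAt
  have hconst : φ =ᶠ[𝓝 0] fun _ => φ 0 := by
    filter_upwards [hmax, hmin] with t h1 h2 using le_antisymm h1 h2
  have : deriv φ =ᶠ[𝓝 0] fun _ => 0 := by
    filter_upwards [hconst.eventuallyEq_nhds] with t ht
    rw [ht.deriv_eq]; simp
  rw [← hdd, this.deriv_eq] at hpos
  simp at hpos

variable [FiniteDimensional ℝ E]

/-- The Laplacian as a trace of the second derivative in any orthonormal basis. -/
theorem laplacian_eq_sum_fderiv {ι : Type*} [Fintype ι] (b : OrthonormalBasis ι ℝ E)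
    (f : E → ℝ) (x : E) : Laplacian.laplacian f x = ∑ i, fderiv ℝ (fderiv ℝ f) x (b i) (b i) := by
  rw [laplacian_eq_iteratedFDeriv_orthonormalBasis f b]
  simp [iteratedFDeriv_two_apply]

theorem laplacian_eq_of_hasFDerivAt {ι : Type*} [Fintype ι] (b : OrthonormalBasis ι ℝ E)
    {f : E → ℝ} {f' : E → E →L[ℝ] ℝ} {f'' : E →L[ℝ] E →L[ℝ] ℝ} {x : E}
    (h : ∀ᶠ y in 𝓝 x, HasFDerivAt f (f' y) y) (h' : HasFDerivAt f' f'' x) :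
    Laplacian.laplacian f x = ∑ i, f'' (b i) (b i) := by
  rw [laplacian_eq_sum_fderiv b]
  have : fderiv ℝ f =ᶠ[𝓝 x] f' := h.mono fun y hy => hy.fderiv
  rw [this.fderiv_eq, h'.fderiv]

theorem laplacian_nonpos_of_isLocalMax {f : E → ℝ} {x : E} (hf : ContDiffAt ℝ 2 f x)
    (hx : IsLocalMax f x) : Laplacian.laplacian f x ≤ 0 := by
  rw [laplacian_eq_sum_fderiv (stdOrthonormalBasis ℝ E)]
  exact Finset.sum_nonpos fun i _ => fderiv_fderiv_nonpos_of_isLocalMax hf hx _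

theorem laplacian_norm_sq (x : E) :
    Laplacian.laplacian (fun y : E => ‖y‖ ^ 2) x = 2 * Module.finrank ℝ E := by
  rw [laplacian_eq_of_hasFDerivAt (stdOrthonormalBasis ℝ E)
    (f' := fun y => (2 : ℝ) • innerSL ℝ y) (f'' := (2 : ℝ) • innerSL ℝ)
    (Eventually.of_forall fun y => by
      simpa [two_smul] using (hasStrictFDerivAt_norm_sq y).hasFDerivAt)
    (((2 : ℝ) • innerSL ℝ : E →L[ℝ] E →L[ℝ] ℝ).hasFDerivAt)]
  have : ∀ i, (innerSL ℝ) (stdOrthonormalBasis ℝ E i) (stdOrthonormalBasis ℝ E i) = (1 : ℝ) :=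
    fun i => by rw [innerSL_apply_apply]; simp
  simp [this, mul_comm]

theorem laplacian_inner_sq (e x : E) :
    Laplacian.laplacian (fun y : E => (inner ℝ e y) ^ 2) x = 2 * ‖e‖ ^ 2 := by
  have h1 : ∀ y, HasFDerivAt (fun y : E => (inner ℝ e y) ^ 2)
      ((2 * inner ℝ e y) • innerSL ℝ e) y := fun y => by
    have := ((innerSL ℝ e).hasFDerivAt (x := y)).pow 2
    simpa using this
  have h2 : HasFDerivAt (fun y : E => (2 * inner ℝ e y) • innerSL ℝ e)
      (((2 : ℝ) • innerSL ℝ e).smulRight (innerSL ℝ e)) x := by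
    have := (((2 : ℝ) • innerSL ℝ e).hasFDerivAt (x := x)).smul_const (innerSL ℝ e)
    simpa using this
  rw [laplacian_eq_of_hasFDerivAt (stdOrthonormalBasis ℝ E) (Eventually.of_forall h1) h2,
    ← (stdOrthonormalBasis ℝ E).sum_sq_norm_inner_left e, Finset.mul_sum]
  refine Finset.sum_congr rfl fun i _ => ?_
  simp; ring

theorem laplacian_inner (e x : E) :
    Laplacian.laplacian (fun y : E => inner ℝ e y) x = 0 := by
  rw [laplacian_eq_of_hasFDerivAt (f := fun y : E => inner ℝ e y) (stdOrthonormalBasis ℝ E)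
    (f' := fun _ => innerSL ℝ e) (f'' := 0) (Eventually.of_forall fun y => (innerSL ℝ e).hasFDerivAt) (hasFDerivAt_const _ _)]
  simp

/-- The weak maximum principle. -/
theorem nonpos_of_harmonic [Nontrivial E] {K O : Set E} (hK : IsCompact K) (hO : IsOpen O) (hOK : O ⊆ K)
    {f : E → ℝ} (hc : ContinuousOn f K) (hh : HarmonicOnNhd f O) (hb : ∀ x ∈ K \ O, f x ≤ 0) :
    ∀ x ∈ K, f x ≤ 0 := by
  intro x₀ hx₀
  by_contra! hpos
  obtain ⟨M, hM⟩ := hK.isBounded.exists_norm_le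
  -- With this N, the perturbation ε‖y‖² is at most ε M² < f x₀ on K, so the maximum of the
  -- perturbed function cannot sit outside O; inside O its positive Laplacian forbids a maximum.
  set N : ℝ := M ^ 2 + 1
  have hN : 0 < N := by positivity
  set ε : ℝ := f x₀ / N
  have hε : 0 < ε := by positivity
  set g : E → ℝ := fun y => f y + ε * ‖y‖ ^ 2
  have hgc : ContinuousOn g K := hc.add (by fun_prop)
  obtain ⟨x₁, hx₁, hmax⟩ := hK.exists_isMaxOn ⟨x₀, hx₀⟩ hgc
  have h01 : f x₀ ≤ g x₁ := by
    have := hmax hx₀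
    simp only [Set.mem_ofPred_eq, g] at this
    have : 0 ≤ ε * ‖x₀‖ ^ 2 := by positivity
    linarith
  have hx₁O : x₁ ∈ O := by
    by_contra hn
    have h1 := hb x₁ ⟨hx₁, hn⟩
    have h2 : ‖x₁‖ ^ 2 ≤ M ^ 2 := by
      have := hM x₁ hx₁
      gcongr
    have h3 : ε * N = f x₀ := by simp only [ε]; field_simp
    have h4 : g x₁ ≤ ε * M ^ 2 := by
      simp only [g]
      nlinarith
    simp only [N] at h3
    linarith
  have hloc : IsLocalMax g x₁ := hmax.isLocalMax (mem_of_superset (hO.mem_nhds hx₁O) hOK)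
  have hq : ContDiffAt ℝ 2 (fun y : E => ‖y‖ ^ 2) x₁ := (contDiff_norm_sq ℝ).contDiffAt
  have hq' : ContDiffAt ℝ 2 (fun y : E => ε * ‖y‖ ^ 2) x₁ := contDiffAt_const.mul hq
  have hq'' : ContDiffAt ℝ 2 (ε • fun y : E => ‖y‖ ^ 2) x₁ := hq'
  have hg2 : ContDiffAt ℝ 2 g x₁ := (hh x₁ hx₁O).1.add hq'
  have hlap := laplacian_nonpos_of_isLocalMax hg2 hloc
  have h5 : Laplacian.laplacian g x₁ = ε * (2 * Module.finrank ℝ E) := by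
    have : g = f + ε • (fun y : E => ‖y‖ ^ 2) := rfl
    rw [this, ContDiffAt.laplacian_add (hh x₁ hx₁O).1 hq'', laplacian_smul ε hq, laplacian_norm_sq,
      (hh x₁ hx₁O).2.self_of_nhds]
    simp
  have hdim : 0 < Module.finrank ℝ E := Module.finrank_pos
  have : (0 : ℝ) < ε * (2 * Module.finrank ℝ E) := by positivity
  linarith

/-- The Laplacian commutes with rigid motions. -/
theorem laplacian_comp_isometry (L : E ≃ₗᵢ[ℝ] E) (c : E) (f : E → ℝ) (x : E)
    (hf : ContDiffAt ℝ 2 f (c + L x)) :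
    Laplacian.laplacian (fun y => f (c + L y)) x = Laplacian.laplacian f (c + L x) := by
  have hL : ∀ y, HasFDerivAt (fun y => c + L y) (L.toContinuousLinearEquiv : E →L[ℝ] E) y :=
    fun y => (L.toContinuousLinearEquiv.hasFDerivAt (x := y)).const_add c
  have hd : ∀ᶠ y in 𝓝 x, HasFDerivAt (fun y => f (c + L y))
      ((fderiv ℝ f (c + L y)).comp (L.toContinuousLinearEquiv : E →L[ℝ] E)) y := by
    have : ∀ᶠ y in 𝓝 (c + L x), DifferentiableAt ℝ f y :=
      (hf.eventually (by simp)).mono fun y hy => hy.differentiableAt (by norm_num)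
    filter_upwards [(hL x).continuousAt.eventually this] with y hy
    exact hy.hasFDerivAt.comp y (hL y)
  have hfd : DifferentiableAt ℝ (fderiv ℝ f) (c + L x) :=
    (hf.fderiv_right (m := 1) (by norm_num)).differentiableAt (by norm_num)
  have h1 : HasFDerivAt (fun y => fderiv ℝ f (c + L y))
      ((fderiv ℝ (fderiv ℝ f) (c + L x)).comp (L.toContinuousLinearEquiv : E →L[ℝ] E)) x :=
    hfd.hasFDerivAt.comp x (hL x)
  have h2 := (((ContinuousLinearMap.compL ℝ E E ℝ).flip
    (L.toContinuousLinearEquiv : E →L[ℝ] E)).hasFDerivAt).comp x h1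
  rw [laplacian_eq_of_hasFDerivAt (stdOrthonormalBasis ℝ E) hd h2,
    laplacian_eq_sum_fderiv ((stdOrthonormalBasis ℝ E).map L)]
  simp

theorem HarmonicAt.comp_isometry (L : E ≃ₗᵢ[ℝ] E) (c : E) {f : E → ℝ} {x : E}
    (hf : HarmonicAt f (c + L x)) : HarmonicAt (fun y => f (c + L y)) x := by
  have hL : ContDiffAt ℝ 2 (fun y => c + L y) x :=
    contDiffAt_const.add L.toContinuousLinearEquiv.contDiff.contDiffAt
  refine ⟨ContDiffAt.comp x hf.1 hL, ?_⟩
  filter_upwards [hL.continuousAt.eventually hf.eventually] with y hy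
  rw [laplacian_comp_isometry L c f y hy.1, hy.2.self_of_nhds]
  rfl

theorem HarmonicAt.comp_add_right {f : E → ℝ} {x t : E}
    (hf : HarmonicAt f (x + t)) : HarmonicAt (fun y => f (y + t)) x := by
  have := HarmonicAt.comp_isometry (LinearIsometryEquiv.refl ℝ E) t (f := f) (x := x)
    (by simpa [add_comm] using hf)
  simpa [add_comm] using this

/-- An interior difference estimate for harmonic functions. -/
theorem abs_sub_le_of_harmonic [Nontrivial E] {u : E → ℝ} {c s : E} {d M : ℝ} (hd : 0 < d)
    (hu : HarmonicOnNhd u (Metric.closedBall c d)) (hM : ∀ x ∈ Metric.closedBall c d, |u x| ≤ M)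
    (hs : ‖s‖ ≤ d) :
    u (c + s) - u (c - s) ≤ 2 * Module.finrank ℝ E * M * ‖s‖ / d := by
  set n : ℝ := (Module.finrank ℝ E : ℝ)
  have hM0 : 0 ≤ M := (abs_nonneg _).trans (hM c (by simp [hd.le]))
  rcases eq_or_ne s 0 with rfl | hs0
  · simp
  have hsn : 0 < ‖s‖ := norm_pos_iff.2 hs0
  set e : E := ‖s‖⁻¹ • s
  have he : ‖e‖ = 1 := by simp [e, norm_smul, hsn.ne']
  set L : E ≃ₗᵢ[ℝ] E := (ℝ ∙ e)ᗮ.reflection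
  have hLe : ∀ y, inner ℝ e (L y) = - inner ℝ e y := fun y => by
    have h1 : L e = -e := Submodule.reflection_orthogonalComplement_singleton_eq_neg e
    have h2 : L (L y) = y := Submodule.reflection_reflection _ y
    have := L.inner_map_map e (L y)
    rw [h1, h2] at this
    rw [← this, inner_neg_left]
  have hLs : L s = -s := by
    have h1 : L e = -e := Submodule.reflection_orthogonalComplement_singleton_eq_neg e
    have h2 : s = ‖s‖ • e := by simp [e, smul_smul, hsn.ne']
    rw [h2, map_smul, h1, smul_neg]
  have hfix : ∀ y, inner ℝ e y = 0 → L y = y := fun y hy =>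
    Submodule.reflection_mem_subspace_eq_self (Submodule.mem_orthogonal_singleton_iff_inner_right.2 hy)
  -- A harmonic barrier on the half ball: the Laplacians of ‖y‖² and n⟨e, y⟩² are both 2n. There ψ ≥
  -- ‖y‖², so (2M/d²)ψ ≥ 2M on the spherical part, and this dominates u minus its reflection, which
  -- vanishes on the flat part. At s, ψ is at most n d ‖s‖.
  set ψ : E → ℝ := fun y => ‖y‖ ^ 2 + (n * d) * inner ℝ e y - n * (inner ℝ e y) ^ 2
  set f : E → ℝ := fun y => (u (c + y) - u (c + L y)) - (2 * M / d ^ 2) * ψ y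
  set K : Set E := Metric.closedBall 0 d ∩ {y | 0 ≤ inner ℝ e y}
  set O : Set E := Metric.ball 0 d ∩ {y | 0 < inner ℝ e y}
  have hcont : Continuous fun y : E => (inner ℝ e y : ℝ) := by fun_prop
  have hK : IsCompact K :=
    (isCompact_closedBall 0 d).inter_right (isClosed_le continuous_const hcont)
  have hO : IsOpen O := Metric.isOpen_ball.inter (isOpen_lt continuous_const hcont)
  have hOK : O ⊆ K := fun y hy =>
    ⟨Metric.ball_subset_closedBall hy.1, le_of_lt (show (0 : ℝ) < inner ℝ e y from hy.2)⟩
  have hmem : ∀ y ∈ Metric.closedBall (0 : E) d, c + y ∈ Metric.closedBall c d := fun y hy => by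
    simpa [mem_closedBall_iff_norm] using hy
  have hmemL : ∀ y ∈ Metric.closedBall (0 : E) d, c + L y ∈ Metric.closedBall c d := fun y hy => by
    simpa [mem_closedBall_iff_norm] using hy
  have h1h : HarmonicOnNhd (fun y => u (c + y)) (Metric.closedBall 0 d) := fun y hy =>
    HarmonicAt.comp_isometry (LinearIsometryEquiv.refl ℝ E) c (hu _ (hmem y hy))
  have h2h : HarmonicOnNhd (fun y => u (c + L y)) (Metric.closedBall 0 d) := fun y hy =>
    HarmonicAt.comp_isometry L c (hu _ (hmemL y hy))
  have hc1 : ∀ y, ContDiffAt ℝ 2 (fun y : E => ‖y‖ ^ 2) y :=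
    fun y => (contDiff_norm_sq ℝ).contDiffAt
  have hc2 : ∀ y, ContDiffAt ℝ 2 (fun y : E => (inner ℝ e y : ℝ)) y :=
    fun y => (innerSL ℝ e).contDiff.contDiffAt
  have hc3 : ∀ y, ContDiffAt ℝ 2 (fun y : E => (inner ℝ e y : ℝ) ^ 2) y := fun y => (hc2 y).pow 2
  have hψ : ∀ y, HarmonicAt ψ y := fun y => by
    have hψe : ψ = (fun y : E => ‖y‖ ^ 2) + (n * d) • (fun y : E => (inner ℝ e y : ℝ))
      - n • (fun y : E => (inner ℝ e y : ℝ) ^ 2) := rfl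
    refine ⟨((hc1 y).add (contDiffAt_const.mul (hc2 y))).sub (contDiffAt_const.mul (hc3 y)),
      Eventually.of_forall fun z => ?_⟩
    have d2 : ContDiffAt ℝ 2 ((n * d) • (fun y : E => (inner ℝ e y : ℝ))) z :=
      contDiffAt_const.mul (hc2 z)
    have d3 : ContDiffAt ℝ 2 (n • (fun y : E => (inner ℝ e y : ℝ) ^ 2)) z :=
      contDiffAt_const.mul (hc3 z)
    have d1 : ContDiffAt ℝ 2 ((fun y : E => ‖y‖ ^ 2) + (n * d) • (fun y : E => (inner ℝ e y : ℝ)))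
      z := (hc1 z).add d2
    rw [hψe, ContDiffAt.laplacian_sub d1 d3, ContDiffAt.laplacian_add (hc1 z) d2,
      laplacian_smul _ (hc2 z),
      laplacian_smul _ (hc3 z), laplacian_norm_sq, laplacian_inner, laplacian_inner_sq, he]
    simp [n]; ring
  have hfh : HarmonicOnNhd f (Metric.closedBall 0 d) := fun y hy =>
    ((h1h y hy).sub (h2h y hy)).sub ((hψ y).const_smul (c := 2 * M / d ^ 2))
  have hb : ∀ x ∈ K \ O, f x ≤ 0 := by
    rintro y ⟨⟨hy1, hy2⟩, hyO⟩
    have hy2 : (0 : ℝ) ≤ inner ℝ e y := hy2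
    have hyn : ‖y‖ ≤ d := by simpa using hy1
    have hie : inner ℝ e y ≤ ‖y‖ := by simpa [he] using real_inner_le_norm e y
    have hn : (0 : ℝ) ≤ n := by positivity
    have hψ0 : ‖y‖ ^ 2 ≤ ψ y := by
      have : 0 ≤ n * inner ℝ e y * (d - inner ℝ e y) :=
        mul_nonneg (mul_nonneg hn hy2) (by linarith)
      simp only [ψ]; nlinarith
    have hco : 0 ≤ 2 * M / d ^ 2 := by positivity
    rcases eq_or_lt_of_le hy2 with h0 | h0
    · have : L y = y := hfix y h0.symm
      simp only [f, this, sub_self, zero_sub, neg_nonpos]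
      exact mul_nonneg hco ((sq_nonneg _).trans hψ0)
    · have hyd : ‖y‖ = d := by
        by_contra hne
        exact hyO ⟨by simpa using lt_of_le_of_ne hyn hne, h0⟩
      have a1 := abs_le.1 (hM _ (hmem y hy1))
      have a2 := abs_le.1 (hM _ (hmemL y hy1))
      have a3 : 2 * M ≤ 2 * M / d ^ 2 * ψ y := by
        rw [hyd] at hψ0
        calc 2 * M = 2 * M / d ^ 2 * d ^ 2 := by field_simp
          _ ≤ _ := by gcongr
      simp only [f]; linarith
  have hsK : s ∈ K := by
    refine ⟨by simpa using hs, ?_⟩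
    show (0 : ℝ) ≤ inner ℝ e s
    simp only [e, inner_smul_left, real_inner_self_eq_norm_sq]
    simp; positivity
  have hfc : ContinuousOn f K := (hfh.continuousOn).mono fun y hy => hy.1
  have hres := nonpos_of_harmonic hK hO hOK hfc (hfh.mono fun y hy => (hOK hy).1) hb s hsK
  have his : inner ℝ e s = ‖s‖ := by
    simp only [e, inner_smul_left, real_inner_self_eq_norm_sq]
    simp; field_simp
  have hn1 : (1 : ℝ) ≤ n := by
    have : 0 < Module.finrank ℝ E := Module.finrank_pos
    simp only [n]; exact_mod_cast this
  simp only [f, ψ, hLs, his, ← sub_eq_add_neg] at hres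
  have h6 : 2 * M / d ^ 2 * (‖s‖ ^ 2 + n * d * ‖s‖ - n * ‖s‖ ^ 2) ≤ 2 * M / d ^ 2 * (n * d * ‖s‖) := by
    have : 0 ≤ 2 * M / d ^ 2 := by positivity
    refine mul_le_mul_of_nonneg_left ?_ this
    nlinarith [sq_nonneg ‖s‖]
  have h7 : 2 * M / d ^ 2 * (n * d * ‖s‖) = 2 * n * M * ‖s‖ / d := by field_simp
  linarith

end Harmonic
end ZTwo

/-! ### Unique continuation for harmonic functions, by finite differences. -/

namespace ZTwo

open InnerProductSpace

section UniqueContinuation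

variable {E : Type*} [NormedAddCommGroup E] [InnerProductSpace ℝ E] [FiniteDimensional ℝ E]

/-- Iterated differences of a harmonic function decay geometrically. -/
theorem abs_fwdDiff_iter_le_of_harmonic [Nontrivial E] (k : ℕ) {u : E → ℝ} {a t : E} {R δ M : ℝ}
    (hδ : 0 < δ) (ht : ‖t‖ ≤ δ) (hu : HarmonicOnNhd u (Metric.ball a (R + k * δ)))
    (hM : ∀ x ∈ Metric.ball a (R + k * δ), |u x| ≤ M) :
    ∀ x ∈ Metric.ball a R,
      |(fwdDiff t)^[k] u x| ≤ (2 * Module.finrank ℝ E * ‖t‖ / δ) ^ k * M := by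
  induction k generalizing u M with
  | zero => simpa using hM
  | succ k ih =>
    intro x hx
    rw [Function.iterate_succ_apply, pow_succ, mul_assoc]
    -- The two-point estimate is centred at the midpoint of y and y + t with radius δ/2; each
    -- further difference uses up a collar of width δ.
    have hsub : ∀ y ∈ Metric.ball a (R + k * δ),
        Metric.closedBall (y + (1 / 2 : ℝ) • t) (δ / 2) ⊆ Metric.ball a (R + (k + 1 : ℕ) * δ) := by
      intro y hy z hz
      rw [Metric.mem_ball] at hy ⊢
      rw [Metric.mem_closedBall] at hz
      have h1 : dist (y + (1 / 2 : ℝ) • t) y ≤ δ / 2 := by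
        rw [dist_eq_norm, add_sub_cancel_left, norm_smul]; norm_num; linarith
      have h2 := dist_triangle4 z (y + (1 / 2 : ℝ) • t) y a
      push_cast
      linarith
    have hmem : ∀ y ∈ Metric.ball a (R + k * δ), y + t ∈ Metric.ball a (R + (k + 1 : ℕ) * δ) :=
      fun y hy => hsub y hy (by
        rw [Metric.mem_closedBall, dist_eq_norm]
        have : y + t - (y + (1 / 2 : ℝ) • t) = (1 / 2 : ℝ) • t := by module
        rw [this, norm_smul]; norm_num; linarith)
    have hmem' : ∀ y ∈ Metric.ball a (R + k * δ), y ∈ Metric.ball a (R + (k + 1 : ℕ) * δ) :=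
      fun y hy => hsub y hy (by
        rw [Metric.mem_closedBall, dist_eq_norm]
        have : y - (y + (1 / 2 : ℝ) • t) = -(1 / 2 : ℝ) • t := by module
        rw [this, norm_smul]; norm_num; linarith)
    have hbound : ∀ w : E → ℝ, HarmonicOnNhd w (Metric.ball a (R + (k + 1 : ℕ) * δ)) →
        (∀ x ∈ Metric.ball a (R + (k + 1 : ℕ) * δ), |w x| ≤ M) →
        ∀ y ∈ Metric.ball a (R + k * δ),
          w (y + t) - w y ≤ 2 * Module.finrank ℝ E * ‖t‖ / δ * M := by
      intro w hw hwM y hy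
      have := abs_sub_le_of_harmonic (u := w) (c := y + (1 / 2 : ℝ) • t) (s := (1 / 2 : ℝ) • t)
        (d := δ / 2) (M := M) (by linarith) (hw.mono (hsub y hy))
        (fun z hz => hwM z (hsub y hy hz)) (by rw [norm_smul]; norm_num; linarith)
      have e1 : y + (1 / 2 : ℝ) • t + (1 / 2 : ℝ) • t = y + t := by module
      have e2 : y + (1 / 2 : ℝ) • t - (1 / 2 : ℝ) • t = y := by module
      rw [e1, e2, norm_smul] at this
      refine this.trans (le_of_eq ?_)
      norm_num
      field_simp
    refine ih (u := fwdDiff t u) (fun y hy => ?_) (fun y hy => ?_) x hx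
    · exact (HarmonicAt.comp_add_right (hu _ (hmem y hy))).sub (hu _ (hmem' y hy))
    · rw [fwdDiff, abs_le]
      constructor
      · have := hbound (fun z => -u z) (fun z hz => (hu z hz).neg)
          (fun z hz => by simpa using hM z hz) y hy
        linarith
      · exact hbound u hu hM y hy

/-- If a bounded harmonic function vanishes on a small ball, it vanishes on the ball of twice the
radius. -/
theorem eq_zero_ball_two_mul [Nontrivial E] {u : E → ℝ} {a : E} {d M η : ℝ} (hη : 0 < η)
    (hηd : 64 * Module.finrank ℝ E * η ≤ d) (hu : HarmonicOnNhd u (Metric.ball a d))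
    (hM : ∀ x ∈ Metric.ball a d, |u x| ≤ M) (h0 : ∀ x ∈ Metric.ball a η, u x = 0) :
    ∀ x ∈ Metric.ball a (2 * η), u x = 0 := by
  intro y hy
  have hn : (1 : ℝ) ≤ Module.finrank ℝ E := by
    exact_mod_cast (Module.finrank_pos : 0 < Module.finrank ℝ E)
  set n : ℝ := (Module.finrank ℝ E : ℝ)
  have hd : 0 < d := by nlinarith
  have hM0 : 0 ≤ M := (abs_nonneg _).trans (hM a (by simpa using hd))
  have hya : ‖y - a‖ < 2 * η := by rwa [Metric.mem_ball, dist_eq_norm] at hy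
  -- Newton's formula expands u(y) in differences at a with 2k steps of length ‖y - a‖/(2k).
  -- Differences of order at most k sample only the ball of radius η and vanish. The others, with
  -- collar width d/(2i), are at most (1/8)^k M; this is where 64 n η ≤ d is needed. The binomial
  -- coefficients sum to 4^k.
  have key : ∀ k : ℕ, 0 < k → |u y| ≤ (1 / 2) ^ k * M := by
    intro k hk
    have hk' : (0 : ℝ) < k := by exact_mod_cast hk
    set t : E := (1 / (2 * k) : ℝ) • (y - a)
    have htn : ‖t‖ ≤ η / k := by
      rw [norm_smul, Real.norm_of_nonneg (by positivity)]
      rw [div_mul_eq_mul_div, div_le_div_iff₀ (by positivity) hk']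
      nlinarith
    have hshift := shift_eq_sum_fwdDiff_iter t u (2 * k) a
    have hyt : a + (2 * k : ℕ) • t = y := by
      rw [← Nat.cast_smul_eq_nsmul ℝ, smul_smul]
      push_cast
      rw [mul_one_div_cancel (by positivity)]; simp
    rw [hyt] at hshift
    have hterm : ∀ i ∈ Finset.range (2 * k + 1),
        |(2 * k).choose i • (fwdDiff t)^[i] u a| ≤ (2 * k).choose i * ((1 / 8) ^ k * M) := by
      intro i hi
      rw [Finset.mem_range] at hi
      rw [nsmul_eq_mul, abs_mul, Nat.abs_cast]
      refine mul_le_mul_of_nonneg_left ?_ (by positivity)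
      rcases le_or_gt i k with hik | hik
      · have : (fwdDiff t)^[i] u a = 0 := by
          rw [fwdDiff_iter_eq_sum_shift]
          refine Finset.sum_eq_zero fun j hj => ?_
          rw [Finset.mem_range] at hj
          rw [h0, smul_zero]
          rw [Metric.mem_ball, dist_eq_norm, add_sub_cancel_left, ← Nat.cast_smul_eq_nsmul ℝ,
            smul_smul, norm_smul, Real.norm_of_nonneg (by positivity)]
          have hj' : (j : ℝ) ≤ k := by exact_mod_cast (by omega : j ≤ k)
          have : (j : ℝ) * (1 / (2 * k)) ≤ 1 / 2 := by
            rw [mul_one_div, div_le_div_iff₀ (by positivity) (by norm_num)]; linarith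
          nlinarith [norm_nonneg (y - a)]
        rw [this, abs_zero]; positivity
      · have hi0 : (0 : ℝ) < i := by exact_mod_cast (by omega : 0 < i)
        have hi2 : (i : ℝ) ≤ 2 * k := by exact_mod_cast (by omega : i ≤ 2 * k)
        set δ : ℝ := d / (2 * i)
        have hδ : 0 < δ := by positivity
        have hR : d / 2 + i * δ = d := by simp only [δ]; field_simp; ring
        have hr : 2 * n * ‖t‖ / δ ≤ 1 / 8 := by
          simp only [δ]
          rw [div_div_eq_mul_div, div_le_iff₀ hd]
          have h1 : ‖t‖ * k ≤ η := by rwa [le_div_iff₀ hk'] at htn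
          have h2 : ‖t‖ * i ≤ 2 * η := by nlinarith [norm_nonneg t]
          nlinarith
        have htδ : ‖t‖ ≤ δ := by
          rw [div_le_iff₀ hδ] at hr
          nlinarith [norm_nonneg t]
        have := abs_fwdDiff_iter_le_of_harmonic i (R := d / 2) (a := a) (u := u) (M := M) hδ htδ
          (by rwa [hR]) (by rwa [hR]) a (by simpa using hd)
        refine this.trans (mul_le_mul_of_nonneg_right ?_ hM0)
        calc (2 * n * ‖t‖ / δ) ^ i ≤ (1 / 8) ^ i := by gcongr
          _ ≤ (1 / 8) ^ k := pow_le_pow_of_le_one (by norm_num) (by norm_num) hik.le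
    rw [hshift]
    calc _ ≤ ∑ i ∈ Finset.range (2 * k + 1), |(2 * k).choose i • (fwdDiff t)^[i] u a| :=
          Finset.abs_sum_le_sum_abs _ _
      _ ≤ ∑ i ∈ Finset.range (2 * k + 1), ((2 * k).choose i : ℝ) * ((1 / 8) ^ k * M) :=
          Finset.sum_le_sum hterm
      _ = (2 : ℝ) ^ (2 * k) * ((1 / 8) ^ k * M) := by
          rw [← Finset.sum_mul]
          congr 1
          exact_mod_cast Nat.sum_range_choose (2 * k)
      _ = (1 / 2) ^ k * M := by
          rw [pow_mul, ← mul_assoc, ← mul_pow]; norm_num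
  have hlim : Tendsto (fun k : ℕ => (1 / 2 : ℝ) ^ k * M) atTop (𝓝 0) := by
    simpa using (tendsto_pow_atTop_nhds_zero_of_lt_one (r := (1 / 2 : ℝ)) (by norm_num)
      (by norm_num)).mul_const M
  have : |u y| ≤ 0 := ge_of_tendsto hlim ((eventually_gt_atTop 0).mono key)
  simpa using this

/-- Doubling is iterated until the radius reaches its cap. The cap depends only on d and the
dimension, not on the initial neighbourhood of vanishing; this uniformity is what makes the interior
of the zero set relatively closed. -/
theorem eq_zero_ball_of_harmonic [Nontrivial E] {u : E → ℝ} {a : E} {d M : ℝ} (hd : 0 < d)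
    (hu : HarmonicOnNhd u (Metric.ball a d)) (hM : ∀ x ∈ Metric.ball a d, |u x| ≤ M)
    (h0 : u =ᶠ[𝓝 a] 0) :
    ∀ x ∈ Metric.ball a (d / (64 * Module.finrank ℝ E)), u x = 0 := by
  have hn : (1 : ℝ) ≤ Module.finrank ℝ E := by
    exact_mod_cast (Module.finrank_pos : 0 < Module.finrank ℝ E)
  obtain ⟨η, hη, hη0⟩ := Metric.eventually_nhds_iff_ball.1 h0
  set ρ : ℝ := d / (64 * Module.finrank ℝ E)
  have hρ : 0 < ρ := by positivity
  have hstep : ∀ k : ℕ, ∀ x ∈ Metric.ball a (min (2 ^ k * η) ρ), u x = 0 := by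
    intro k
    induction k with
    | zero => intro x hx; exact hη0 x (Metric.ball_subset_ball (by simp) hx)
    | succ k ih =>
      have := eq_zero_ball_two_mul (η := min (2 ^ k * η) ρ) (by positivity)
        (by
          calc 64 * Module.finrank ℝ E * min (2 ^ k * η) ρ ≤ 64 * Module.finrank ℝ E * ρ := by
                gcongr; exact min_le_right _ _
            _ = d := by simp only [ρ]; field_simp) hu hM ih
      intro x hx
      refine this x (Metric.ball_subset_ball ?_ hx)
      rw [mul_min_of_nonneg _ _ (by norm_num)]
      refine min_le_min (by rw [pow_succ]; linarith) (by linarith)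
  obtain ⟨k, hk⟩ := pow_unbounded_of_one_lt (ρ / η) (one_lt_two (α := ℝ))
  rw [div_lt_iff₀ hη] at hk
  have := hstep k
  rwa [min_eq_right hk.le] at this

/-- Unique continuation for harmonic functions. -/
theorem eqOn_zero_of_harmonic [Nontrivial E] {u : E → ℝ} {U : Set E} (hU : IsOpen U)
    (hc : IsPreconnected U) (hu : HarmonicOnNhd u U) {a : E} (ha : a ∈ U) (h0 : u =ᶠ[𝓝 a] 0) :
    ∀ x ∈ U, u x = 0 := by
  have hn : (1 : ℝ) ≤ Module.finrank ℝ E := by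
    exact_mod_cast (Module.finrank_pos : 0 < Module.finrank ℝ E)
  set V : Set E := {x | u =ᶠ[𝓝 x] 0}
  have hV : IsOpen V := isOpen_iff_mem_nhds.2 fun x (hx : u =ᶠ[𝓝 x] 0) => hx.eventuallyEq_nhds
  have hsub : U ⊆ V := by
    refine hc.subset_of_closure_inter_subset hV ⟨a, ha, h0⟩ ?_
    rintro x ⟨hxc, hxU⟩
    obtain ⟨R, hR, hRU⟩ := Metric.nhds_basis_closedBall.mem_iff.1 (hU.mem_nhds hxU)
    obtain ⟨M, hM⟩ := (isCompact_closedBall x R).exists_bound_of_continuousOn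
      (hu.continuousOn.mono hRU)
    set ρ := (R / 2) / (64 * Module.finrank ℝ E)
    have hρ : 0 < ρ := by positivity
    obtain ⟨b, hbV, hb⟩ := Metric.mem_closure_iff.1 hxc (min ρ (R / 2)) (by positivity)
    have hbs : Metric.ball b (R / 2) ⊆ Metric.closedBall x R := by
      intro z hz
      rw [Metric.mem_ball] at hz
      rw [Metric.mem_closedBall]
      have := dist_triangle z b x
      rw [dist_comm b x] at this
      have := min_le_right ρ (R / 2)
      linarith
    have := eq_zero_ball_of_harmonic (a := b) (half_pos hR) (hu.mono (hbs.trans hRU))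
      (fun z hz => hM z (hbs hz)) hbV
    refine mem_of_superset (Metric.isOpen_ball.mem_nhds (?_ : x ∈ Metric.ball b ρ)) this
    exact Metric.mem_ball.2 (hb.trans_le (min_le_left _ _))
  exact fun x hx => (hsub hx).self_of_nhds

/-- Two harmonic functions on a connected open set that agree up to sign at every point agree up to
a global sign. -/
theorem eqOn_or_eqOn_neg_of_harmonic [Nontrivial E] {u v : E → ℝ} {U : Set E} (hU : IsOpen U)
    (hc : IsPreconnected U) (hu : HarmonicOnNhd u U) (hv : HarmonicOnNhd v U)
    (h : ∀ x ∈ U, u x = v x ∨ u x = -v x) :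
    (∀ x ∈ U, u x = v x) ∨ (∀ x ∈ U, u x = -v x) := by
  by_cases hex : ∃ a ∈ U, u a ≠ v a
  · right
    obtain ⟨a, ha, hne⟩ := hex
    have hcu := (hu a ha).1.continuousAt
    have hcv := (hv a ha).1.continuousAt
    have h0 : (u + v) =ᶠ[𝓝 a] 0 := by
      filter_upwards [hU.mem_nhds ha, (hcu.sub hcv).eventually_ne (sub_ne_zero.2 hne)] with x hx hx'
      rcases h x hx with h | h
      · exact absurd (by simp [h]) hx'
      · simp [h]
    intro x hx
    have := eqOn_zero_of_harmonic hU hc (hu.add hv) ha h0 x hx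
    simp only [Pi.add_apply] at this
    linarith
  · left
    push Not at hex
    exact hex

end UniqueContinuation
end ZTwo

/-! ### Branches of a two-valued function and their continuation along rays. -/

namespace ZTwo

open InnerProductSpace

section Gluing

variable {n : ℕ}

theorem pair_neg_eq_iff {a b : ℝ} : ({a, -a} : Set ℝ) = {b, -b} ↔ a = b ∨ a = -b := by
  constructor
  · intro h
    have : a ∈ ({b, -b} : Set ℝ) := h ▸ Set.mem_insert a _
    simpa using this
  · rintro (rfl | rfl)
    · rfl
    · rw [neg_neg, Set.pair_comm]

theorem IsBranchOn.mono {f : TwoValued n} {U V : Set (Space n)} {g : Space n → ℝ}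
    (h : IsBranchOn f U g) (hVU : V ⊆ U) : IsBranchOn f V g :=
  ⟨h.1.mono hVU, fun x hx => h.2 x (hVU hx)⟩

theorem IsBranchOn.neg {f : TwoValued n} {U : Set (Space n)} {g : Space n → ℝ}
    (h : IsBranchOn f U g) : IsBranchOn f U (fun x => -g x) :=
  ⟨fun x hx => (h.1 x hx).neg, fun x hx => by rw [h.2 x hx, neg_neg, Set.pair_comm]⟩

theorem IsBranchOn.isBranchAt {f : TwoValued n} {U : Set (Space n)} {g : Space n → ℝ}
    (h : IsBranchOn f U g) (hU : IsOpen U) {x : Space n} (hx : x ∈ U) : IsBranchAt f x g :=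
  ⟨h.1 x hx, mem_of_superset (hU.mem_nhds hx) h.2⟩

theorem IsBranchOn.congr {f : TwoValued n} {U : Set (Space n)} {g g' : Space n → ℝ}
    (h : IsBranchOn f U g) (hU : IsOpen U) (hg : ∀ x ∈ U, g' x = g x) : IsBranchOn f U g' :=
  ⟨fun x hx => (harmonicAt_congr_nhds (mem_of_superset (hU.mem_nhds hx) hg)).2 (h.1 x hx),
    fun x hx => by rw [h.2 x hx, hg x hx]⟩

theorem IsBranchAt.congr {f : TwoValued n} {x : Space n} {g g' : Space n → ℝ}
    (h : IsBranchAt f x g) (hg : g' =ᶠ[𝓝 x] g) : IsBranchAt f x g' :=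
  ⟨(harmonicAt_congr_nhds hg).2 h.1, by
    filter_upwards [h.2, hg] with y h1 h2
    rw [h1, h2]⟩

theorem isBranchOn_of_forall {f : TwoValued n} {U : Set (Space n)} {g : Space n → ℝ}
    (h : ∀ x ∈ U, IsBranchAt f x g) : IsBranchOn f U g :=
  ⟨fun x hx => (h x hx).1, fun x hx => (h x hx).2.self_of_nhds⟩

theorem IsBranchAt.exists_ball {f : TwoValued n} {x : Space n} {g : Space n → ℝ}
    (h : IsBranchAt f x g) {U : Set (Space n)} (hU : U ∈ 𝓝 x) :
    ∃ ρ > 0, Metric.ball x ρ ⊆ U ∧ IsBranchOn f (Metric.ball x ρ) g := by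
  obtain ⟨ρ, hρ, hb⟩ := Metric.eventually_nhds_iff_ball.1 (h.1.eventually.and (h.2.and hU))
  exact ⟨ρ, hρ, fun y hy => (hb y hy).2.2, fun y hy => (hb y hy).1, fun y hy => (hb y hy).2.1⟩

theorem IsBranchOn.eq_or_eq_neg [NeZero n] {f : TwoValued n} {U : Set (Space n)}
    {g g' : Space n → ℝ} (h : IsBranchOn f U g) (h' : IsBranchOn f U g') (hU : IsOpen U)
    (hc : IsPreconnected U) : (∀ x ∈ U, g x = g' x) ∨ (∀ x ∈ U, g x = -g' x) :=
  eqOn_or_eqOn_neg_of_harmonic hU hc h.1 h'.1 fun x hx =>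
    pair_neg_eq_iff.1 ((h.2 x hx).symm.trans (h'.2 x hx))

/-- Two branches on a connected open set that agree on a nonempty open subset are equal. -/
theorem IsBranchOn.eqOn [NeZero n] {f : TwoValued n} {U S : Set (Space n)}
    {g g' : Space n → ℝ} (h : IsBranchOn f U g) (h' : IsBranchOn f U g') (hU : IsOpen U)
    (hc : IsPreconnected U) (hS : IsOpen S) (hne : S.Nonempty) (hSU : S ⊆ U)
    (hgg : ∀ x ∈ S, g x = g' x) : ∀ x ∈ U, g x = g' x := by
  obtain ⟨a, ha⟩ := hne
  intro x hx
  have := eqOn_zero_of_harmonic hU hc (h.1.sub h'.1) (hSU ha)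
    (mem_of_superset (hS.mem_nhds ha) fun y hy => by simp [hgg y hy]) x hx
  simpa [sub_eq_zero] using this

/-- Branches can be continued along the radial flow `x ↦ exp (ε s) x`. -/
theorem exists_isBranchOn_of_radial [NeZero n] {f : TwoValued n} {U S₀ : Set (Space n)} (ε : ℝ)
    (hU : IsOpen U) (hloc : ∀ x ∈ U, ∃ g, IsBranchAt f x g)
    (hUinv : ∀ x ∈ U, ∀ s : ℝ, 0 ≤ s → Real.exp (ε * s) • x ∈ U)
    (hS : IsOpen S₀) (hSc : IsConnected S₀) (hSU : S₀ ⊆ U)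
    (hSinv : ∀ x ∈ S₀, ∀ s : ℝ, 0 ≤ s → Real.exp (ε * s) • x ∈ S₀)
    (hflow : ∀ x ∈ U, ∃ s : ℝ, 0 ≤ s ∧ Real.exp (ε * s) • x ∈ S₀)
    {g₀ : Space n → ℝ} (hg₀ : IsBranchOn f S₀ g₀) :
    ∃ g, IsBranchOn f U g ∧ ∀ x ∈ S₀, g x = g₀ x := by
  classical
  set φ : ℝ → Space n → Space n := fun s x => Real.exp (ε * s) • x with hφ
  have hφc : ∀ s, Continuous (φ s) := fun s => continuous_const_smul _
  have hφc' : ∀ x, Continuous fun s => φ s x := fun x => by fun_prop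
  have hφφ : ∀ s t x, φ s (φ t x) = φ (s + t) x := fun s t x => by
    simp only [hφ, smul_smul, ← Real.exp_add]; ring_nf
  have hφ0 : ∀ x, φ 0 x = x := fun x => by simp [hφ]
  -- Flow-invariance is what makes intersections of such domains connected: every point flows into
  -- S₀ without leaving either domain. Hence any two extensions agree where both are defined, and
  -- the union W of all domains carries the largest extension.
  set good : Set (Space n) → (Space n → ℝ) → Prop := fun V g =>
    IsOpen V ∧ S₀ ⊆ V ∧ V ⊆ U ∧ (∀ x ∈ V, ∀ s, 0 ≤ s → φ s x ∈ V) ∧ IsBranchOn f V g ∧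
      ∀ x ∈ S₀, g x = g₀ x with hgood
  have hgood₀ : good S₀ g₀ := ⟨hS, le_rfl, hSU, hSinv, hg₀, fun _ _ => rfl⟩
  have hagree : ∀ V g V' g', good V g → good V' g' → ∀ x ∈ V ∩ V', g x = g' x := by
    rintro V g V' g' ⟨o, s, u, i, b, e⟩ ⟨o', s', u', i', b', e'⟩
    refine (b.mono Set.inter_subset_left).eqOn (b'.mono Set.inter_subset_right) (o.inter o') ?_ hS
      hSc.nonempty (Set.subset_inter s s') fun x hx => by rw [e x hx, e' x hx]
    obtain ⟨a, ha⟩ := hSc.nonempty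
    refine isPreconnected_of_forall a fun y hy => ?_
    obtain ⟨t, ht, hty⟩ := hflow y (u hy.1)
    refine ⟨S₀ ∪ (fun r => φ r y) '' Set.Icc 0 t, ?_, Or.inl ha,
      Or.inr ⟨0, ⟨le_rfl, ht⟩, hφ0 y⟩, ?_⟩
    · refine Set.union_subset (Set.subset_inter s s') ?_
      rintro _ ⟨r, hr, rfl⟩
      exact ⟨i y hy.1 r hr.1, i' y hy.2 r hr.1⟩
    · exact IsPreconnected.union (φ t y) hty ⟨t, ⟨ht, le_rfl⟩, rfl⟩ hSc.isPreconnected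
        (isPreconnected_Icc.image _ (hφc' y).continuousOn)
  set W : Set (Space n) := {x | ∃ V g, good V g ∧ x ∈ V} with hW
  choose! Vx gx hVx hxV using fun (x : Space n) (hx : x ∈ W) => hx
  set G : Space n → ℝ := fun x => gx x x
  have hGV : ∀ V g, good V g → ∀ x ∈ V, G x = g x := fun V g hV x hx => by
    have hxW : x ∈ W := ⟨V, g, hV, hx⟩
    exact hagree _ _ _ _ (hVx x hxW) hV x ⟨hxV x hxW, hx⟩
  have hWgood : good W G := by
    refine ⟨?_, fun x hx => ⟨S₀, g₀, hgood₀, hx⟩, ?_, ?_, ?_, hGV _ _ hgood₀⟩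
    · refine isOpen_iff_mem_nhds.2 ?_
      rintro x ⟨V, g, hV, hx⟩
      exact mem_of_superset (hV.1.mem_nhds hx) fun y hy => ⟨V, g, hV, hy⟩
    · rintro x ⟨V, g, hV, hx⟩
      exact hV.2.2.1 hx
    · rintro x ⟨V, g, hV, hx⟩ s hs
      exact ⟨V, g, hV, hV.2.2.2.1 x hx s hs⟩
    · refine isBranchOn_of_forall ?_
      rintro x ⟨V, g, hV, hx⟩
      exact (hV.2.2.2.2.1.isBranchAt hV.1 hx).congr
        (mem_of_superset (hV.1.mem_nhds hx) (hGV V g hV))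
  have hmaxi : ∀ V g, good V g → V ⊆ W := fun V g hV x hx => ⟨V, g, hV, hx⟩
  obtain ⟨hWo, hSW, hWU, hWi, hWb, hWe⟩ := hWgood
  suffices hUW : U ⊆ W from ⟨G, hWb.mono hUW, hWe⟩
  intro x hxU
  by_contra hxW
  -- If x is missed, its trajectory enters W after some first time s₀; the point y reached then is
  -- outside the open set W, and W will be enlarged around y.
  set T : Set ℝ := {s | 0 ≤ s ∧ φ s x ∈ W}
  have hTne : T.Nonempty := by
    obtain ⟨s, hs, h⟩ := hflow x hxU
    exact ⟨s, hs, hSW h⟩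
  have hTb : BddBelow T := ⟨0, fun s hs => hs.1⟩
  set s₀ := sInf T
  have hs₀ : 0 ≤ s₀ := le_csInf hTne fun s hs => hs.1
  set y := φ s₀ x
  have hyW : y ∉ W := by
    intro hy
    rcases eq_or_lt_of_le hs₀ with h | h
    · apply hxW
      have : y = x := by simp only [y, ← h, hφ0]
      rwa [this] at hy
    · have h1 : ∀ᶠ s in 𝓝 s₀, φ s x ∈ W := (hφc' x).continuousAt.eventually (hWo.mem_nhds hy)
      have h2 : ∀ᶠ s in 𝓝[<] s₀, (φ s x ∈ W ∧ 0 < s) ∧ s < s₀ :=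
        ((h1.and (lt_mem_nhds h)).filter_mono nhdsWithin_le_nhds).and self_mem_nhdsWithin
      obtain ⟨s, ⟨hs1, hs2⟩, hs3⟩ := h2.exists
      exact absurd (csInf_le hTb ⟨hs2.le, hs1⟩) (not_le.2 hs3)
  have hyU : y ∈ U := hUinv x hxU s₀ hs₀
  obtain ⟨g₁, hg₁⟩ := hloc y hyU
  obtain ⟨ρ, hρ, hBU, hB⟩ := hg₁.exists_ball (hU.mem_nhds hyU)
  set B := Metric.ball y ρ
  obtain ⟨δ, hδ, hδB⟩ := Metric.eventually_nhds_iff.1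
    ((hφc' x).continuousAt.eventually (Metric.isOpen_ball.mem_nhds (Metric.mem_ball_self hρ)) :
      ∀ᶠ s in 𝓝 s₀, φ s x ∈ B)
  obtain ⟨s₁, hs₁T, hs₁⟩ := exists_lt_of_csInf_lt hTne (lt_add_of_pos_right s₀ hδ)
  have hs₀₁ : s₀ ≤ s₁ := csInf_le hTb hs₁T
  have hzB : φ s₁ x ∈ B := hδB (by rw [Real.dist_eq, abs_lt]; constructor <;> linarith)
  obtain ⟨η, hη, hβ⟩ := Metric.isOpen_iff.1 (hWo.inter Metric.isOpen_ball) (φ s₁ x) ⟨hs₁T.2, hzB⟩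
  set β := Metric.ball (φ s₁ x) η
  -- Adding all of B could destroy flow-invariance and the connectedness of the overlap. Points of B
  -- that flow into β keep both, so the sign of the local branch fixed on β is correct on the whole
  -- of W ∩ N.
  set N : Set (Space n) := {w | w ∈ B ∧ ∃ s, 0 ≤ s ∧ φ s w ∈ β}
  have hNo : IsOpen N := by
    have : N = ⋃ s : {s : ℝ // 0 ≤ s}, B ∩ φ s ⁻¹' β := by
      ext w; simp [N]
    rw [this]
    exact isOpen_iUnion fun s => Metric.isOpen_ball.inter (Metric.isOpen_ball.preimage (hφc s))
  have hyN : y ∈ N := ⟨Metric.mem_ball_self hρ, s₁ - s₀, by linarith, by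
    simp only [y, hφφ, sub_add_cancel]; exact Metric.mem_ball_self hη⟩
  -- The trajectory between w and φ s w is a segment of a ray, so convexity of the ball B contains
  -- it.
  have hNstep : ∀ w ∈ B, ∀ s, 0 ≤ s → φ s w ∈ β → ∀ t, 0 ≤ t → t ≤ s → φ t w ∈ N := by
    intro w hw s hs hsw t ht hts
    refine ⟨?_, s - t, by linarith, by rw [hφφ, sub_add_cancel]; exact hsw⟩
    have hconv : Convex ℝ {l : ℝ | l • w ∈ B} :=
      (convex_ball y ρ).linear_preimage ((LinearMap.id : ℝ →ₗ[ℝ] ℝ).smulRight w)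
    have h1 : (1 : ℝ) ∈ {l : ℝ | l • w ∈ B} := by simpa using hw
    have h2 : Real.exp (ε * s) ∈ {l : ℝ | l • w ∈ B} := (hβ hsw).2
    have h3 : Real.exp (ε * t) ∈ Set.uIcc 1 (Real.exp (ε * s)) := by
      rcases le_total 0 ε with hε | hε
      · refine Set.mem_uIcc.2 (Or.inl ⟨Real.one_le_exp (by positivity), ?_⟩)
        exact Real.exp_le_exp.2 (mul_le_mul_of_nonneg_left hts hε)
      · refine Set.mem_uIcc.2 (Or.inr ⟨?_, Real.exp_le_one_iff.2 (by nlinarith)⟩)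
        exact Real.exp_le_exp.2 (mul_le_mul_of_nonpos_left hts hε)
    exact hconv.ordConnected.uIcc_subset h1 h2 h3
  have hβN : β ⊆ W ∩ N := fun w hw => ⟨(hβ hw).1, (hβ hw).2, 0, le_rfl, by rwa [hφ0]⟩
  have hβo : IsOpen β := Metric.isOpen_ball
  have hβne : β.Nonempty := ⟨_, Metric.mem_ball_self hη⟩
  have hNB : N ⊆ B := fun w hw => hw.1
  obtain ⟨g₂, hg₂, hg₂β⟩ : ∃ g₂, IsBranchOn f B g₂ ∧ ∀ w ∈ β, G w = g₂ w := by
    rcases (hWb.mono fun w hw => (hβ hw).1).eq_or_eq_neg (hB.mono fun w hw => (hβ hw).2) hβo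
      (convex_ball _ _).isPreconnected with h | h
    · exact ⟨g₁, hB, h⟩
    · exact ⟨fun w => -g₁ w, hB.neg, h⟩
  have hover : ∀ w ∈ W ∩ N, G w = g₂ w := by
    refine (hWb.mono Set.inter_subset_left).eqOn
      (hg₂.mono (Set.inter_subset_right.trans hNB)) (hWo.inter hNo) ?_ hβo hβne hβN hg₂β
    refine isPreconnected_of_forall (φ s₁ x) fun w hw => ?_
    obtain ⟨hwW, hwB, s, hs, hsw⟩ := hw
    refine ⟨β ∪ (fun r => φ r w) '' Set.Icc 0 s, ?_, Or.inl (Metric.mem_ball_self hη),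
      Or.inr ⟨0, ⟨le_rfl, hs⟩, hφ0 w⟩, ?_⟩
    · refine Set.union_subset hβN ?_
      rintro _ ⟨r, hr, rfl⟩
      exact ⟨hWi w hwW r hr.1, hNstep w hwB s hs hsw r hr.1 hr.2⟩
    · exact IsPreconnected.union (φ s w) hsw ⟨s, ⟨hs, le_rfl⟩, rfl⟩
        (convex_ball _ _).isPreconnected (isPreconnected_Icc.image _ (hφc' w).continuousOn)
  set G' : Space n → ℝ := fun w => if w ∈ W then G w else g₂ w
  have hG'W : ∀ w ∈ W, G' w = G w := fun w hw => if_pos hw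
  have hG'N : ∀ w ∈ N, G' w = g₂ w := fun w hw => by
    by_cases hwW : w ∈ W
    · rw [hG'W w hwW, hover w ⟨hwW, hw⟩]
    · exact if_neg hwW
  refine hyW (hmaxi (W ∪ N) G' ⟨hWo.union hNo, hSW.trans Set.subset_union_left,
    Set.union_subset hWU (hNB.trans hBU), ?_, ?_, fun w hw => by rw [hG'W w (hSW hw), hWe w hw]⟩
    (Or.inr hyN))
  · rintro w (hw | hw) t ht
    · exact Or.inl (hWi w hw t ht)
    · obtain ⟨hwB, s, hs, hsw⟩ := hw
      rcases le_total t s with h | h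
      · exact Or.inr (hNstep w hwB s hs hsw t ht h)
      · left
        have := hWi _ (hβ hsw).1 (t - s) (by linarith)
        rwa [hφφ, sub_add_cancel] at this
  · refine isBranchOn_of_forall ?_
    rintro w (hw | hw)
    · exact ((hWb.congr hWo hG'W).isBranchAt hWo hw)
    · exact (((hg₂.mono hNB).congr hNo hG'N).isBranchAt hNo hw)

end Gluing
end ZTwo

/-! ### Geometry of the ellipsoid and of its normal circles. -/

namespace ZTwo

open InnerProductSpace

section Geometry

variable {m : ℕ}

/-- The quadratic form `∑ xᵢ² / hᵢ²` on the first `m` coordinates. -/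
noncomputable def qform (h : Fin m → ℝ) (x : Space (m + 1)) : ℝ := ∑ i, x i.castSucc ^ 2 / h i ^ 2

@[simp] theorem conormal_castSucc (h : Fin m → ℝ) (x : Space (m + 1)) (i : Fin m) :
    conormal h x i.castSucc = x i.castSucc / h i ^ 2 := by
  simp [conormal]

@[simp] theorem conormal_last (h : Fin m → ℝ) (x : Space (m + 1)) :
    conormal h x (Fin.last m) = 0 := by
  simp [conormal]

theorem inner_conormal (h : Fin m → ℝ) (x y : Space (m + 1)) :
    inner ℝ (conormal h x) y = ∑ i : Fin m, x i.castSucc * y i.castSucc / h i ^ 2 := by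
  rw [PiLp.inner_apply, Fin.sum_univ_castSucc]
  simp only [conormal_castSucc, conormal_last]
  simp
  exact Finset.sum_congr rfl fun i _ => by ring

theorem qform_add_smul (h : Fin m → ℝ) (x y : Space (m + 1)) (t : ℝ) :
    qform h (x + t • y) = qform h x + 2 * t * inner ℝ (conormal h x) y + t ^ 2 * qform h y := by
  rw [inner_conormal]
  simp only [qform, Finset.mul_sum, ← Finset.sum_add_distrib]
  refine Finset.sum_congr rfl fun i _ => ?_
  simp
  ring

theorem qform_smul (h : Fin m → ℝ) (x : Space (m + 1)) (t : ℝ) :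
    qform h (t • x) = t ^ 2 * qform h x := by
  simp only [qform, Finset.mul_sum]
  refine Finset.sum_congr rfl fun i _ => ?_
  simp
  ring

theorem qform_nonneg (h : Fin m → ℝ) (x : Space (m + 1)) : 0 ≤ qform h x :=
  Finset.sum_nonneg fun i _ => by positivity

@[fun_prop] theorem continuous_qform (h : Fin m → ℝ) : Continuous (qform h) := by
  unfold qform; fun_prop

theorem mem_ellipsoid_refl {h : Fin m → ℝ} {x : Space (m + 1)} :
    x ∈ ellipsoid (.refl ℝ _) h ↔ qform h x = 1 ∧ x (Fin.last m) = 0 := by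
  simp [ellipsoid, qform]

theorem normalOne_refl (h : Fin m → ℝ) (x : Space (m + 1)) :
    normalOne (.refl ℝ _) h x = ‖conormal h x‖⁻¹ • conormal h x := rfl

theorem normalTwo_refl (x : Space (m + 1)) :
    normalTwo (.refl ℝ _) x = EuclideanSpace.single (Fin.last m) 1 := rfl

theorem inner_single_last (x : Space (m + 1)) :
    inner ℝ (EuclideanSpace.single (Fin.last m) (1 : ℝ)) x = x (Fin.last m) := by
  simp [EuclideanSpace.inner_single_left]

theorem norm_sq_eq_sum (x : Space (m + 1)) :
    ‖x‖ ^ 2 = ∑ i : Fin m, x i.castSucc ^ 2 + x (Fin.last m) ^ 2 := by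
  rw [EuclideanSpace.norm_sq_eq, Fin.sum_univ_castSucc]
  simp

theorem norm_sq_le_of_qform_le {h : Fin m → ℝ} (hh : ∀ i, 0 < h i) {x : Space (m + 1)}
    (hq : qform h x ≤ 1) (hx : x (Fin.last m) = 0) : ‖x‖ ^ 2 ≤ ∑ i, h i ^ 2 := by
  rw [norm_sq_eq_sum, hx]
  simp only [ne_eq, OfNat.ofNat_ne_zero, not_false_eq_true, zero_pow, add_zero]
  refine Finset.sum_le_sum fun i _ => ?_
  have h1 : x i.castSucc ^ 2 / h i ^ 2 ≤ qform h x :=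
    Finset.single_le_sum (f := fun i : Fin m => x i.castSucc ^ 2 / h i ^ 2)
      (fun j _ => by positivity) (Finset.mem_univ i)
  have := h1.trans hq
  rwa [div_le_one (by have := hh i; positivity)] at this

theorem isCompact_ellipsoid_refl {h : Fin m → ℝ} (hh : ∀ i, 0 < h i) :
    IsCompact (ellipsoid (.refl ℝ (Space (m + 1))) h) := by
  refine Metric.isCompact_of_isClosed_isBounded ?_ ?_
  · have : ellipsoid (.refl ℝ (Space (m + 1))) h =
        {x | qform h x = 1} ∩ {x | x (Fin.last m) = 0} := by
      ext x; simp [mem_ellipsoid_refl]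
    rw [this]
    exact (isClosed_eq (by fun_prop) continuous_const).inter
      (isClosed_eq (by fun_prop) continuous_const)
  · refine (Metric.isBounded_closedBall (x := 0) (r := √(∑ i, h i ^ 2))).subset fun x hx => ?_
    rw [mem_ellipsoid_refl] at hx
    rw [mem_closedBall_zero_iff]
    exact Real.le_sqrt_of_sq_le (norm_sq_le_of_qform_le hh hx.1.le hx.2)

theorem inner_conormal_self (h : Fin m → ℝ) (x : Space (m + 1)) :
    inner ℝ (conormal h x) x = qform h x := by
  rw [inner_conormal, qform]
  exact Finset.sum_congr rfl fun i _ => by ring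

theorem conormal_ne_zero {h : Fin m → ℝ} {p : Space (m + 1)}
    (hp : p ∈ ellipsoid (.refl ℝ _) h) : conormal h p ≠ 0 := by
  intro h0
  have := inner_conormal_self h p
  rw [h0, inner_zero_left, (mem_ellipsoid_refl.1 hp).1] at this
  exact zero_ne_one this

/-- Points off the ellipsoid lie on the normal circle around the nearest point. -/
theorem exists_normalCircle {h : Fin m → ℝ} {x p : Space (m + 1)}
    (hp : p ∈ ellipsoid (.refl ℝ _) h)
    (hmin : ∀ p' ∈ ellipsoid (.refl ℝ _) h, dist x p ≤ dist x p') :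
    ∃ θ, x = normalCircle (normalOne (.refl ℝ _) h) (normalTwo (.refl ℝ _)) p (dist x p) θ := by
  set c := conormal h p
  have hc : c ≠ 0 := conormal_ne_zero hp
  have hcn : 0 < ‖c‖ := norm_pos_iff.2 hc
  set e : Space (m + 1) := EuclideanSpace.single (Fin.last m) 1
  obtain ⟨hp1, hp2⟩ := mem_ellipsoid_refl.1 hp
  set d := x - p
  set α : ℝ := inner ℝ c d / ‖c‖
  set β : ℝ := d (Fin.last m)
  set τ := d - (α / ‖c‖) • c - β • e
  have hec : inner ℝ e c = 0 := by rw [inner_single_last]; exact conormal_last h p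
  have hee : inner ℝ e e = (1 : ℝ) := by simp [e]
  have hce : inner ℝ c e = (0 : ℝ) := by rw [real_inner_comm, hec]
  have hcc : inner ℝ c c = ‖c‖ ^ 2 := real_inner_self_eq_norm_sq c
  have hed : inner ℝ e d = β := by simp [e, β, inner_single_last]
  have hcτ : inner ℝ c τ = 0 := by
    simp only [τ, inner_sub_right, inner_smul_right, hcc, hce, α]
    field_simp
    ring
  have heτ : inner ℝ e τ = 0 := by
    simp only [τ, inner_sub_right, inner_smul_right, hec, hee, hed]
    ring
  have hτlast : τ (Fin.last m) = 0 := by rwa [← inner_single_last]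
  have hdτ : inner ℝ d τ = ‖τ‖ ^ 2 := by
    have : d = τ + (α / ‖c‖) • c + β • e := by simp only [τ]; abel
    rw [← real_inner_self_eq_norm_sq]
    conv_lhs => rw [this]
    rw [inner_add_left, inner_add_left, inner_smul_left, inner_smul_left, hcτ, heτ]
    simp
  -- τ is the tangential part of x - p. Rescaling p + tτ back to the ellipsoid gives a curve with
  -- velocity τ at t = 0, so minimality of the distance forces ⟨x - p, τ⟩ = ‖τ‖² to vanish.
  have hτ0 : τ = 0 := by
    set lam : ℝ → ℝ := fun t => (√(1 + t ^ 2 * qform h τ))⁻¹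
    set γ : ℝ → Space (m + 1) := fun t => lam t • (p + t • τ)
    have hpos : ∀ t : ℝ, 0 < 1 + t ^ 2 * qform h τ := fun t => by
      have := qform_nonneg h τ; positivity
    have hγ : ∀ t, γ t ∈ ellipsoid (.refl ℝ _) h := fun t => by
      rw [mem_ellipsoid_refl]
      refine ⟨?_, by simp [γ, hp2, hτlast]⟩
      rw [qform_smul, qform_add_smul, hp1, hcτ]
      simp only [lam, inv_pow, Real.sq_sqrt (hpos t).le]
      have := (hpos t).ne'
      field_simp
      ring
    have hlam : HasDerivAt lam 0 0 := by
      have h1 : HasDerivAt (fun t : ℝ => 1 + t ^ 2 * qform h τ) 0 0 := by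
        have := (((hasDerivAt_id (0 : ℝ)).pow 2).mul_const (qform h τ)).const_add 1
        simpa using this
      have h2 : HasDerivAt lam _ 0 := (h1.sqrt (by simp)).fun_inv (by simp)
      simpa using h2
    have hline : HasDerivAt (fun t : ℝ => p + t • τ) τ 0 := by
      simpa using ((hasDerivAt_id (0 : ℝ)).smul_const τ).const_add p
    have hγd : HasDerivAt γ τ 0 := by
      have h2 : HasDerivAt γ (lam 0 • τ + (0 : ℝ) • (p + (0 : ℝ) • τ)) 0 := hlam.fun_smul hline
      simpa [lam] using h2
    have hF := ((hasDerivAt_const (0 : ℝ) x).sub hγd).norm_sq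
    have hγ0 : γ 0 = p := by simp [γ, lam]
    have hmin' : IsLocalMin (fun t => ‖(fun _ : ℝ => x) t - γ t‖ ^ 2) 0 :=
      Eventually.of_forall fun t => by
        have := hmin _ (hγ t)
        rw [dist_eq_norm, dist_eq_norm] at this
        simp only [hγ0]
        gcongr
    have := hmin'.hasDerivAt_eq_zero hF
    simp only [hγ0, zero_sub, inner_neg_right, Pi.sub_apply] at this
    have h2 : ‖τ‖ ^ 2 = 0 := by rw [← hdτ]; simp only [d]; linarith
    simpa using h2
  have hd : d = (α / ‖c‖) • c + β • e := by
    have : τ = d - (α / ‖c‖) • c - β • e := rfl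
    rw [hτ0] at this
    rw [sub_sub] at this
    exact (sub_eq_zero.1 this.symm)
  -- What remains of x - p lies in the normal plane; the angle is the argument of its complex
  -- coordinate.
  set z : ℂ := ⟨α, β⟩
  have hz : ‖z‖ = dist x p := by
    have h1 : ‖d‖ ^ 2 = α ^ 2 + β ^ 2 := by
      rw [← real_inner_self_eq_norm_sq]
      conv_lhs => rw [hd]
      simp only [inner_add_left, inner_add_right, inner_smul_left, inner_smul_right, hcc, hce, hec,
        hee]
      simp
      field_simp
    rw [dist_eq_norm, ← sq_eq_sq₀ (norm_nonneg _) (norm_nonneg _), h1, Complex.sq_norm,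
      Complex.normSq_apply]
    ring
  refine ⟨z.arg, ?_⟩
  have h1 : dist x p * Real.cos z.arg = α := by rw [← hz, Complex.norm_mul_cos_arg]
  have h2 : dist x p * Real.sin z.arg = β := by rw [← hz, Complex.norm_mul_sin_arg]
  rw [normalCircle, h1, h2, normalOne_refl, normalTwo_refl, smul_smul, ← div_eq_mul_inv, add_assoc,
    ← hd]
  simp [d]

theorem exists_bounds {h : Fin m → ℝ} (hh : ∀ i, 0 < h i) :
    ∃ α β : ℝ, 0 < α ∧ 0 < β ∧ ∀ i, α ≤ h i ∧ h i ≤ β := by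
  have hpos : 0 ≤ ∑ j, (h j)⁻¹ := Finset.sum_nonneg fun j _ => by have := hh j; positivity
  have hpos' : 0 ≤ ∑ j, h j := Finset.sum_nonneg fun j _ => (hh j).le
  -- Adding 1 keeps both bounds positive even when there are no indices.
  refine ⟨(∑ j, (h j)⁻¹ + 1)⁻¹, ∑ j, h j + 1, by positivity, by positivity, fun i => ⟨?_, ?_⟩⟩
  · rw [inv_le_comm₀ (by positivity) (hh i)]
    have := Finset.single_le_sum (f := fun j => (h j)⁻¹) (fun j _ => by have := hh j; positivity)
      (Finset.mem_univ i)
    linarith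
  · have := Finset.single_le_sum (f := h) (fun j _ => (hh j).le) (Finset.mem_univ i)
    linarith

/-- Bounds for the conormal on the ellipsoid. -/
theorem norm_conormal_bounds {h : Fin m → ℝ} {α β : ℝ} (hα : 0 < α)
    (hab : ∀ i, α ≤ h i ∧ h i ≤ β) {p : Space (m + 1)} (hp : p ∈ ellipsoid (.refl ℝ _) h) :
    1 / β ≤ ‖conormal h p‖ ∧ ‖conormal h p‖ ≤ 1 / α := by
  obtain ⟨hp1, -⟩ := mem_ellipsoid_refl.1 hp
  have hn : ‖conormal h p‖ ^ 2 = ∑ i : Fin m, p i.castSucc ^ 2 / h i ^ 2 * (1 / h i ^ 2) := by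
    rw [norm_sq_eq_sum]
    simp only [conormal_castSucc, conormal_last]
    simp
    exact Finset.sum_congr rfl fun i _ => by ring
  have hm : Nonempty (Fin m) := by
    by_contra hne
    rw [not_nonempty_iff] at hne
    simp [qform] at hp1
  obtain ⟨i₀⟩ := hm
  have hβ : 0 < β := hα.trans_le ((hab i₀).1.trans (hab i₀).2)
  constructor
  · refine le_of_sq_le_sq ?_ (norm_nonneg _)
    rw [hn]
    calc (1 / β) ^ 2 = qform h p * (1 / β ^ 2) := by rw [hp1]; ring
      _ ≤ _ := by
        rw [qform, Finset.sum_mul]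
        refine Finset.sum_le_sum fun i _ => ?_
        have h1 := (hab i).1
        have h2 := (hab i).2
        have h3 : 0 < h i := by linarith
        gcongr
  · refine le_of_sq_le_sq ?_ (by positivity)
    rw [hn]
    calc _ ≤ ∑ i : Fin m, p i.castSucc ^ 2 / h i ^ 2 * (1 / α ^ 2) := by
          refine Finset.sum_le_sum fun i _ => ?_
          have h1 := (hab i).1
          gcongr
      _ = (1 / α) ^ 2 := by rw [← Finset.sum_mul]; rw [qform] at hp1; rw [hp1]; ring

theorem qform_normalOne_le {h : Fin m → ℝ} {α β : ℝ} (hα : 0 < α)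
    (hab : ∀ i, α ≤ h i ∧ h i ≤ β) (p : Space (m + 1)) :
    qform h (normalOne (.refl ℝ _) h p) ≤ 1 / α ^ 2 := by
  set ν := normalOne (.refl ℝ _) h p
  have hν : ‖ν‖ ≤ 1 := by
    simp only [ν, normalOne_refl, norm_smul, norm_inv, norm_norm]
    exact inv_mul_le_one
  calc qform h ν ≤ ∑ i : Fin m, ν i.castSucc ^ 2 / α ^ 2 := by
        refine Finset.sum_le_sum fun i _ => ?_
        have h1 := (hab i).1
        gcongr
    _ = (∑ i : Fin m, ν i.castSucc ^ 2) / α ^ 2 := by rw [Finset.sum_div]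
    _ ≤ 1 / α ^ 2 := by
        gcongr
        have := norm_sq_eq_sum ν
        nlinarith [sq_nonneg (ν (Fin.last m)), norm_nonneg ν]

theorem normalCircle_last {h : Fin m → ℝ} {p : Space (m + 1)}
    (hp : p ∈ ellipsoid (.refl ℝ _) h) (r θ : ℝ) :
    normalCircle (normalOne (.refl ℝ _) h) (normalTwo (.refl ℝ _)) p r θ (Fin.last m)
      = r * Real.sin θ := by
  simp [normalCircle, normalOne_refl, normalTwo_refl, (mem_ellipsoid_refl.1 hp).2]

theorem qform_normalCircle {h : Fin m → ℝ} {p : Space (m + 1)}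
    (hp : p ∈ ellipsoid (.refl ℝ _) h) (r θ : ℝ) :
    qform h (normalCircle (normalOne (.refl ℝ _) h) (normalTwo (.refl ℝ _)) p r θ)
      = 1 + 2 * (r * Real.cos θ) * ‖conormal h p‖
        + (r * Real.cos θ) ^ 2 * qform h (normalOne (.refl ℝ _) h p) := by
  have h1 : ∀ y : Space (m + 1), ∀ s : ℝ, qform h (y + s • normalTwo (.refl ℝ _) p) = qform h y := by
    intro y s
    simp [qform, normalTwo_refl]
  rw [normalCircle, h1, qform_add_smul, (mem_ellipsoid_refl.1 hp).1]
  have hc : ‖conormal h p‖ ≠ 0 := norm_ne_zero_iff.2 (conormal_ne_zero hp)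
  congr 3
  rw [normalOne_refl, inner_smul_right, real_inner_self_eq_norm_sq]
  field_simp

/-- Small normal circles do not meet the ellipsoid. -/
theorem exists_normalCircle_notMem {h : Fin m → ℝ} (hh : ∀ i, 0 < h i) :
    ∃ r₁ > 0, ∀ p ∈ ellipsoid (.refl ℝ _) h, ∀ r, 0 < r → r < r₁ →
      (∀ θ, normalCircle (normalOne (.refl ℝ _) h) (normalTwo (.refl ℝ _)) p r θ
        ∉ ellipsoid (.refl ℝ _) h) ∧
      (∀ θ, Real.sin θ = 0 → Real.cos θ = 1 →
        1 < qform h (normalCircle (normalOne (.refl ℝ _) h) (normalTwo (.refl ℝ _)) p r θ)) ∧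
      (∀ θ, Real.sin θ = 0 → Real.cos θ = -1 →
        qform h (normalCircle (normalOne (.refl ℝ _) h) (normalTwo (.refl ℝ _)) p r θ) < 1) := by
  obtain ⟨α, β, hα, hβ, hab⟩ := exists_bounds hh
  -- Below this radius the quadratic term of the form along the outer normal (coefficient at most
  -- 1/α²) is smaller than the linear one (coefficient at least 2/β), so the inward point of the
  -- circle lies strictly inside. Only the inward and outward points of the circle lie in the
  -- hyperplane.
  refine ⟨2 * α ^ 2 / β, by positivity, fun p hp r hr hr1 => ?_⟩
  have hc := (norm_conormal_bounds hα hab hp).1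
  have hq := qform_normalOne_le hα hab p
  have hq0 := qform_nonneg h (normalOne (.refl ℝ _) h p)
  have hcp : 0 < ‖conormal h p‖ := lt_of_lt_of_le (by positivity) hc
  have hlt : r ^ 2 * qform h (normalOne (.refl ℝ _) h p) < 2 * r * ‖conormal h p‖ := by
    have h1 : r * qform h (normalOne (.refl ℝ _) h p) < 2 * ‖conormal h p‖ := by
      calc r * qform h (normalOne (.refl ℝ _) h p) ≤ r * (1 / α ^ 2) := by gcongr
        _ < 2 * α ^ 2 / β * (1 / α ^ 2) := by gcongr
        _ = 2 * (1 / β) := by field_simp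
        _ ≤ _ := by gcongr
    nlinarith
  have hpos : ∀ θ, Real.sin θ = 0 → Real.cos θ = 1 →
      1 < qform h (normalCircle (normalOne (.refl ℝ _) h) (normalTwo (.refl ℝ _)) p r θ) := by
    intro θ _ h1
    rw [qform_normalCircle hp, h1]
    have : 0 < r * ‖conormal h p‖ := by positivity
    nlinarith [mul_nonneg (sq_nonneg r) hq0]
  have hneg : ∀ θ, Real.sin θ = 0 → Real.cos θ = -1 →
      qform h (normalCircle (normalOne (.refl ℝ _) h) (normalTwo (.refl ℝ _)) p r θ) < 1 := by
    intro θ _ h1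
    rw [qform_normalCircle hp, h1]
    nlinarith
  refine ⟨fun θ hmem => ?_, hpos, hneg⟩
  obtain ⟨h1, h2⟩ := mem_ellipsoid_refl.1 hmem
  rw [normalCircle_last hp] at h2
  have hs : Real.sin θ = 0 := by
    rcases mul_eq_zero.1 h2 with h | h
    · exact absurd h hr.ne'
    · exact h
  rcases Real.sin_eq_zero_iff_cos_eq.1 hs with h | h
  · exact absurd h1 (hpos θ hs h).ne'
  · exact absurd h1 (hneg θ hs h).ne

theorem continuous_normalCircle (ν₁ ν₂ : Space (m + 1) → Space (m + 1)) (p : Space (m + 1))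
    (r : ℝ) : Continuous (normalCircle ν₁ ν₂ p r) := by
  unfold normalCircle; fun_prop

/-- A nondegenerate function tends to zero at its branching set. -/
theorem IsNondegenerate.eventually_abs_le {h : Fin m → ℝ} (hh : ∀ i, 0 < h i)
    {f : TwoValued (m + 1)} (hf : IsNondegenerate (ellipsoid (.refl ℝ _) h)
      (normalOne (.refl ℝ _) h) (normalTwo (.refl ℝ _)) f) {p : Space (m + 1)}
    (hp : p ∈ ellipsoid (.refl ℝ _) h) {ε : ℝ} (hε : 0 < ε) :
    ∀ᶠ x in 𝓝 p, ∀ y ∈ f x, |y| ≤ ε := by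
  set Z := ellipsoid (.refl ℝ (Space (m + 1))) h
  have hZ : IsCompact Z := isCompact_ellipsoid_refl hh
  obtain ⟨B, hB, K, r₀, hr₀, hexp⟩ := hf.expansion
  obtain ⟨M, hM⟩ := hZ.exists_bound_of_continuousOn
    (fun q hq => (hB q hq).1.continuousAt.continuousWithinAt)
  have hlim : Tendsto (fun r : ℝ => M * r ^ (3 / 2 : ℝ) + |K| * r ^ (5 / 2 : ℝ)) (𝓝 0) (𝓝 0) := by
    have h1 : Continuous fun r : ℝ => M * r ^ (3 / 2 : ℝ) + |K| * r ^ (5 / 2 : ℝ) := by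
      have := Real.continuous_rpow_const (q := 3 / 2) (by norm_num)
      have := Real.continuous_rpow_const (q := 5 / 2) (by norm_num)
      fun_prop
    have := h1.tendsto 0
    simpa [Real.zero_rpow] using this
  obtain ⟨δ, hδ, hδε⟩ := Metric.eventually_nhds_iff.1 (hlim.eventually (gt_mem_nhds hε))
  filter_upwards [Metric.ball_mem_nhds p (lt_min hδ hr₀)] with x hx y hy
  by_cases hxZ : x ∈ Z
  · rw [hf.eq_zero x hxZ] at hy
    rw [Set.mem_singleton_iff.1 hy]
    simpa using hε.le
  -- The expansion is only available on normal circles; x lies on the one around its nearest point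
  -- of the ellipsoid, with radius equal to the distance.
  obtain ⟨q, hq, hmin⟩ := hZ.exists_isMinOn ⟨p, hp⟩ (f := fun q => dist x q) (by fun_prop)
  have hrpos : 0 < dist x q := dist_pos.2 fun hxq => hxZ (hxq ▸ hq)
  have hrle : dist x q ≤ dist x p := hmin hp
  have hrlt : dist x q < min δ r₀ := hrle.trans_lt hx
  obtain ⟨θ, hθ⟩ := exists_normalCircle hq (fun p' hp' => hmin hp')
  obtain ⟨G, hG, hGexp⟩ := hexp q hq (dist x q) hrpos (hrlt.trans_le (min_le_right _ _))
  have hbr := (hG.branch θ).2.self_of_nhds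
  have hE := hGexp θ
  rw [← hθ] at hbr hE
  set r := dist x q
  have hyabs : |y| = |G θ x| := by
    rw [hbr] at hy
    rcases hy with rfl | rfl
    · rfl
    · simp
  rw [hyabs]
  have h1 : |(B q * Complex.exp ((3 / 2 * θ : ℝ) * Complex.I)).re| ≤ M := by
    refine (Complex.abs_re_le_norm _).trans ?_
    rw [norm_mul, Complex.norm_exp_ofReal_mul_I, mul_one]
    exact hM q hq
  have h2 : |r ^ (3 / 2 : ℝ) * (B q * Complex.exp ((3 / 2 * θ : ℝ) * Complex.I)).re|
      ≤ M * r ^ (3 / 2 : ℝ) := by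
    rw [abs_mul, abs_of_nonneg (by positivity), mul_comm]
    gcongr
  have h3 : K * r ^ (5 / 2 : ℝ) ≤ |K| * r ^ (5 / 2 : ℝ) := by gcongr; exact le_abs_self K
  have h4 := hδε (y := r) (by
    rw [Real.dist_eq, sub_zero, abs_of_pos hrpos]; exact hrlt.trans_le (min_le_left _ _))
  have h5 := abs_sub_abs_le_abs_sub (G θ x)
    (r ^ (3 / 2 : ℝ) * (B q * Complex.exp ((3 / 2 * θ : ℝ) * Complex.I)).re)
  linarith

end Geometry
end ZTwo

/-! ### Uniqueness for a given ellipsoid and given asymptotics. -/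

namespace ZTwo

open InnerProductSpace

section Uniqueness

variable {m : ℕ}

/-- The complement of the flat solid ellipsoid. -/
def outerRegion (h : Fin m → ℝ) : Set (Space (m + 1)) := {x | x (Fin.last m) ≠ 0 ∨ 1 < qform h x}

/-- The complement of the part of the hyperplane outside the ellipsoid. -/
def innerRegion (h : Fin m → ℝ) : Set (Space (m + 1)) := {x | x (Fin.last m) ≠ 0 ∨ qform h x < 1}

theorem isOpen_outerRegion (h : Fin m → ℝ) : IsOpen (outerRegion h) :=
  (isOpen_ne_fun (f := fun x : Space (m + 1) => x (Fin.last m)) (by fun_prop)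
    continuous_const).union (isOpen_lt continuous_const (continuous_qform h))

theorem isOpen_innerRegion (h : Fin m → ℝ) : IsOpen (innerRegion h) :=
  (isOpen_ne_fun (f := fun x : Space (m + 1) => x (Fin.last m)) (by fun_prop)
    continuous_const).union (isOpen_lt (continuous_qform h) continuous_const)

theorem mem_outer_or_inner {h : Fin m → ℝ} {x : Space (m + 1)}
    (hx : x ∉ ellipsoid (.refl ℝ _) h) : x ∈ outerRegion h ∨ x ∈ innerRegion h := by
  rw [mem_ellipsoid_refl] at hx
  by_cases h0 : x (Fin.last m) = 0
  · rcases lt_trichotomy (qform h x) 1 with h1 | h1 | h1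
    · exact Or.inr (Or.inr h1)
    · exact absurd ⟨h1, h0⟩ hx
    · exact Or.inl (Or.inr h1)
  · exact Or.inl (Or.inl h0)

theorem notMem_ellipsoid_of_mem_outer {h : Fin m → ℝ} {x : Space (m + 1)}
    (hx : x ∈ outerRegion h) : x ∉ ellipsoid (.refl ℝ _) h := by
  rw [mem_ellipsoid_refl]
  rintro ⟨h1, h2⟩
  rcases hx with h | h
  · exact h h2
  · exact h.ne' h1

theorem notMem_ellipsoid_of_mem_inner {h : Fin m → ℝ} {x : Space (m + 1)}
    (hx : x ∈ innerRegion h) : x ∉ ellipsoid (.refl ℝ _) h := by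
  rw [mem_ellipsoid_refl]
  rintro ⟨h1, h2⟩
  rcases hx with h | h
  · exact h h2
  · exact h.ne h1

/-- Each point is joined to S₀ by its own trajectory. Outward flow handles the outer region, with
the exterior of a ball as S₀; inward flow handles the inner region, with a small ball. -/
theorem isPreconnected_of_radial {n : ℕ} {U S₀ : Set (Space n)} (ε : ℝ) (hSc : IsConnected S₀)
    (hSU : S₀ ⊆ U) (hUinv : ∀ x ∈ U, ∀ s : ℝ, 0 ≤ s → Real.exp (ε * s) • x ∈ U)
    (hflow : ∀ x ∈ U, ∃ s : ℝ, 0 ≤ s ∧ Real.exp (ε * s) • x ∈ S₀) : IsPreconnected U := by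
  obtain ⟨a, ha⟩ := hSc.nonempty
  refine isPreconnected_of_forall a fun y hy => ?_
  obtain ⟨t, ht, hty⟩ := hflow y hy
  refine ⟨S₀ ∪ (fun r : ℝ => Real.exp (ε * r) • y) '' Set.Icc 0 t, ?_, Or.inl ha,
    Or.inr ⟨0, ⟨le_rfl, ht⟩, by simp⟩, ?_⟩
  · refine Set.union_subset hSU ?_
    rintro _ ⟨r, hr, rfl⟩
    exact hUinv y hy r hr.1
  · exact IsPreconnected.union _ hty ⟨t, ⟨ht, le_rfl⟩, rfl⟩ hSc.isPreconnected
      (isPreconnected_Icc.image _ (by fun_prop))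

/-- The exterior of a ball is connected in dimension at least two. -/
theorem isConnected_norm_gt (hm : 1 ≤ m) {R : ℝ} (hR : 0 ≤ R) :
    IsConnected {x : Space (m + 1) | R < ‖x‖} := by
  have hrank : 1 < Module.rank ℝ (Space (m + 1)) := by
    rw [← Module.finrank_eq_rank, finrank_euclideanSpace_fin]
    exact_mod_cast (by omega : 1 < m + 1)
  have h1 := isConnected_compl_singleton_of_one_lt_rank hrank (0 : Space (m + 1))
  have h2 : {x : Space (m + 1) | R < ‖x‖} =
      (fun x : Space (m + 1) => (1 + R / ‖x‖) • x) '' {0}ᶜ := by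
    ext y
    simp only [Set.mem_ofPred_eq, Set.mem_image, Set.mem_compl_iff, Set.mem_singleton_iff]
    constructor
    · intro hy
      have hy0 : 0 < ‖y‖ := hR.trans_lt hy
      refine ⟨((‖y‖ - R) / ‖y‖) • y, smul_ne_zero (div_pos (by linarith) hy0).ne'
        (norm_pos_iff.1 hy0), ?_⟩
      rw [norm_smul, Real.norm_of_nonneg (div_pos (by linarith) hy0).le, smul_smul]
      have : ‖y‖ - R ≠ 0 := by linarith
      have : (1 + R / ((‖y‖ - R) / ‖y‖ * ‖y‖)) * ((‖y‖ - R) / ‖y‖) = 1 := by field_simp; ring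
      rw [this, one_smul]
    · rintro ⟨x, hx, rfl⟩
      have hx0 : 0 < ‖x‖ := norm_pos_iff.2 hx
      rw [norm_smul, Real.norm_of_nonneg (by positivity)]
      have : (1 + R / ‖x‖) * ‖x‖ = ‖x‖ + R := by field_simp
      linarith
  rw [h2]
  refine h1.image _ fun x hx => ContinuousAt.continuousWithinAt ?_
  have : ‖x‖ ≠ 0 := norm_ne_zero_iff.2 hx
  fun_prop (disch := assumption)

theorem exp_smul_last (x : Space (m + 1)) (t : ℝ) :
    (Real.exp t • x) (Fin.last m) ≠ 0 ↔ x (Fin.last m) ≠ 0 := by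
  simp [(Real.exp_pos t).ne']

theorem outerRegion_radial {h : Fin m → ℝ} {x : Space (m + 1)} (hx : x ∈ outerRegion h) {s : ℝ}
    (hs : 0 ≤ s) : Real.exp (1 * s) • x ∈ outerRegion h := by
  rcases hx with h1 | h1
  · exact Or.inl ((exp_smul_last x _).2 h1)
  · refine Or.inr ?_
    rw [qform_smul]
    have h2 : 1 ≤ Real.exp (1 * s) := Real.one_le_exp (by linarith)
    have h3 : 1 ≤ Real.exp (1 * s) ^ 2 := one_le_pow₀ h2
    nlinarith

theorem innerRegion_radial {h : Fin m → ℝ} {x : Space (m + 1)} (hx : x ∈ innerRegion h) {s : ℝ}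
    (hs : 0 ≤ s) : Real.exp ((-1) * s) • x ∈ innerRegion h := by
  rcases hx with h1 | h1
  · exact Or.inl ((exp_smul_last x _).2 h1)
  · refine Or.inr ?_
    rw [qform_smul]
    have h2 : Real.exp ((-1) * s) ≤ 1 := Real.exp_le_one_iff.2 (by linarith)
    have h3 := Real.exp_pos ((-1) * s)
    have h4 : Real.exp ((-1) * s) ^ 2 ≤ 1 := by nlinarith
    nlinarith [qform_nonneg h x]

theorem exists_exp_smul_norm_gt {x : Space (m + 1)} (hx : x ≠ 0) (R : ℝ) :
    ∃ s : ℝ, 0 ≤ s ∧ R < ‖Real.exp (1 * s) • x‖ := by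
  have hx0 : 0 < ‖x‖ := norm_pos_iff.2 hx
  have h1 : Tendsto (fun s : ℝ => Real.exp (1 * s) * ‖x‖) atTop atTop := by
    simpa using Real.tendsto_exp_atTop.atTop_mul_const hx0
  obtain ⟨s, hs, hs'⟩ := ((h1.eventually_gt_atTop R).and (eventually_ge_atTop 0)).exists
  refine ⟨s, hs', ?_⟩
  rwa [norm_smul, Real.norm_of_nonneg (Real.exp_pos _).le]

theorem exists_exp_smul_mem_ball (x : Space (m + 1)) {ρ : ℝ} (hρ : 0 < ρ) :
    ∃ s : ℝ, 0 ≤ s ∧ Real.exp ((-1) * s) • x ∈ Metric.ball (0 : Space (m + 1)) ρ := by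
  have h1 : Tendsto (fun s : ℝ => Real.exp ((-1) * s) * ‖x‖) atTop (𝓝 0) := by
    simpa using (Real.tendsto_exp_neg_atTop_nhds_zero).mul_const ‖x‖
  obtain ⟨s, hs, hs'⟩ := ((h1.eventually (gt_mem_nhds hρ)).and (eventually_ge_atTop 0)).exists
  refine ⟨s, hs', ?_⟩
  rwa [mem_ball_zero_iff, norm_smul, Real.norm_of_nonneg (Real.exp_pos _).le]

theorem zero_notMem_outerRegion (h : Fin m → ℝ) : (0 : Space (m + 1)) ∉ outerRegion h := by
  rintro (h1 | h1)
  · simp at h1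
  · simp [qform] at h1; linarith

theorem norm_gt_subset_outerRegion {h : Fin m → ℝ} (hh : ∀ i, 0 < h i) {R : ℝ}
    (hR : √(∑ i, h i ^ 2) ≤ R) : {x : Space (m + 1) | R < ‖x‖} ⊆ outerRegion h := by
  intro x hx
  by_contra hn
  simp only [outerRegion, Set.mem_ofPred_eq, not_or, not_not, not_lt] at hn
  have := Real.le_sqrt_of_sq_le (norm_sq_le_of_qform_le hh hn.2 hn.1)
  exact absurd hx (not_lt.2 (this.trans hR))

theorem exists_ball_subset_innerRegion (h : Fin m → ℝ) :
    innerRegion h ∈ 𝓝 (0 : Space (m + 1)) :=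
  (isOpen_innerRegion h).mem_nhds (Or.inr (by simp [qform]))

theorem isPreconnected_outerRegion (hm : 1 ≤ m) {h : Fin m → ℝ} (hh : ∀ i, 0 < h i) :
    IsPreconnected (outerRegion h) :=
  isPreconnected_of_radial 1 (isConnected_norm_gt hm (Real.sqrt_nonneg _))
    (norm_gt_subset_outerRegion hh le_rfl) (fun _ hx _ hs => outerRegion_radial hx hs)
    fun _ hx => exists_exp_smul_norm_gt (fun h0 => zero_notMem_outerRegion h (h0 ▸ hx)) _

theorem isPreconnected_innerRegion (h : Fin m → ℝ) : IsPreconnected (innerRegion h) := by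
  obtain ⟨ρ, hρ, hb⟩ := Metric.mem_nhds_iff.1 (exists_ball_subset_innerRegion h)
  exact isPreconnected_of_radial (-1) (Metric.isConnected_ball hρ) hb
    (fun _ hx _ hs => innerRegion_radial hx hs) fun x _ => exists_exp_smul_mem_ball x hρ

theorem convex_last_pos : Convex ℝ {x : Space (m + 1) | 0 < x (Fin.last m)} :=
  convex_halfSpace_gt ⟨fun x y => by simp, fun c x => by simp⟩ 0

theorem convex_last_neg : Convex ℝ {x : Space (m + 1) | x (Fin.last m) < 0} :=
  convex_halfSpace_lt ⟨fun x y => by simp, fun c x => by simp⟩ 0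

theorem isOpen_last_pos : IsOpen {x : Space (m + 1) | 0 < x (Fin.last m)} :=
  isOpen_lt continuous_const (by fun_prop)

theorem isOpen_last_neg : IsOpen {x : Space (m + 1) | x (Fin.last m) < 0} :=
  isOpen_lt (by fun_prop) continuous_const

theorem ellipsoid_refl_nonempty (hm : 1 ≤ m) {h : Fin m → ℝ} (hh : ∀ i, 0 < h i) :
    (ellipsoid (.refl ℝ (Space (m + 1))) h).Nonempty := by
  set i₀ : Fin m := ⟨0, hm⟩
  refine ⟨EuclideanSpace.single i₀.castSucc (h i₀), mem_ellipsoid_refl.2 ⟨?_, ?_⟩⟩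
  · rw [qform, Finset.sum_eq_single i₀]
    · have := (hh i₀).ne'
      simp [this]
    · intro j _ hj
      simp [hj]
    · simp
  · simp [(Fin.castSucc_lt_last i₀).ne']

/-- A branch defined off the ellipsoid vanishes, by the monodromy condition. -/
theorem eq_zero_of_global_branch (hm : 1 ≤ m) {h : Fin m → ℝ} (hh : ∀ i, 0 < h i)
    {f : TwoValued (m + 1)} (hf : IsZ2Harmonic (ellipsoid (.refl ℝ _) h)
      (normalOne (.refl ℝ _) h) (normalTwo (.refl ℝ _)) f) {g : Space (m + 1) → ℝ}
    (hg : IsBranchOn f (ellipsoid (.refl ℝ _) h)ᶜ g) :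
    ∀ x ∉ ellipsoid (.refl ℝ _) h, g x = 0 := by
  set Z := ellipsoid (.refl ℝ (Space (m + 1))) h
  have hZo : IsOpen Zᶜ := (isCompact_ellipsoid_refl hh).isClosed.isOpen_compl
  have hZc : IsPreconnected Zᶜ := by
    have h1 : Zᶜ = outerRegion h ∪ innerRegion h := by
      ext x
      exact ⟨fun hx => mem_outer_or_inner hx, fun hx => hx.elim
        (fun h => notMem_ellipsoid_of_mem_outer h) fun h => notMem_ellipsoid_of_mem_inner h⟩
    rw [h1]
    have h2 : (EuclideanSpace.single (Fin.last m) (1 : ℝ)) (Fin.last m) ≠ 0 := by simp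
    exact IsPreconnected.union (EuclideanSpace.single (Fin.last m) (1 : ℝ)) (Or.inl h2) (Or.inl h2)
      (isPreconnected_outerRegion hm hh) (isPreconnected_innerRegion h)
  suffices hs : ∃ a ∈ Zᶜ, g =ᶠ[𝓝 a] 0 by
    obtain ⟨a, ha, h0⟩ := hs
    exact eqOn_zero_of_harmonic hZo hZc hg.1 ha h0
  obtain ⟨p, hp⟩ := ellipsoid_refl_nonempty hm hh
  obtain ⟨r₀, hr₀, hmono⟩ := hf.monodromy p hp
  obtain ⟨r₁, hr₁, hcirc⟩ := exists_normalCircle_notMem hh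
  set r := min r₀ r₁ / 2
  have hr : 0 < r := by positivity
  have hrlt : r < min r₀ r₁ := half_lt_self (by positivity)
  obtain ⟨G, hG, hG2⟩ := hmono r hr (hrlt.trans_le (min_le_left _ _))
  have hγ := (hcirc p hp r hr (hrlt.trans_le (min_le_right _ _))).1
  set γ := normalCircle (normalOne (.refl ℝ _) h) (normalTwo (.refl ℝ _)) p r
  have hγc : Continuous γ := continuous_normalCircle _ _ _ _
  -- Along the circle the continued germ is g or -g, and both alternatives are open in θ. If both
  -- occur they meet somewhere and g vanishes there; if only one occurs, the germ returns unchanged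
  -- after a full turn, while monodromy reverses its sign, so again g vanishes.
  have hopen : ∀ σ : ℝ, IsOpen {θ | G θ =ᶠ[𝓝 (γ θ)] fun x => σ * g x} := by
    intro σ
    refine isOpen_iff_mem_nhds.2 fun θ hθ => ?_
    have hθ : G θ =ᶠ[𝓝 (γ θ)] fun x => σ * g x := hθ
    filter_upwards [hG.locally_constant θ,
      hγc.continuousAt.eventually hθ.eventuallyEq_nhds] with s h1 h2
    exact h1.trans h2
  have hcover : ∀ θ, (G θ =ᶠ[𝓝 (γ θ)] fun x => 1 * g x) ∨ (G θ =ᶠ[𝓝 (γ θ)] fun x => (-1) * g x) := by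
    intro θ
    obtain ⟨ρ, hρ, hsub, hb⟩ := (hG.branch θ).exists_ball (hZo.mem_nhds (hγ θ))
    rcases hb.eq_or_eq_neg (hg.mono hsub) Metric.isOpen_ball (convex_ball _ _).isPreconnected
      with h1 | h1
    · left
      filter_upwards [Metric.ball_mem_nhds (γ θ) hρ] with x hx
      rw [h1 x hx, one_mul]
    · right
      filter_upwards [Metric.ball_mem_nhds (γ θ) hρ] with x hx
      rw [h1 x hx, neg_one_mul]
  have hboth : ∀ θ, (G θ =ᶠ[𝓝 (γ θ)] fun x => 1 * g x) →
      (G θ =ᶠ[𝓝 (γ θ)] fun x => (-1) * g x) → ∃ a ∈ Zᶜ, g =ᶠ[𝓝 a] 0 := by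
    intro θ h1 h2
    refine ⟨γ θ, hγ θ, ?_⟩
    filter_upwards [h1, h2] with x h3 h4
    simp only [Pi.zero_apply]
    linarith
  have hconst : ∀ σ : ℝ, (∀ θ, G θ =ᶠ[𝓝 (γ θ)] fun x => σ * g x) → σ ≠ 0 →
      ∃ a ∈ Zᶜ, g =ᶠ[𝓝 a] 0 := by
    intro σ hσ hσ0
    refine ⟨γ 0, hγ 0, ?_⟩
    have hper : γ (0 + 2 * Real.pi) = γ 0 := by
      simp [γ, normalCircle]
    have h1 := hσ (0 + 2 * Real.pi)
    rw [hper] at h1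
    filter_upwards [h1, hG2 0, hσ 0] with x h1 h2 h3
    rw [h2, h3] at h1
    have : σ * g x = 0 := by linarith
    simpa [hσ0] using this
  by_cases hm1 : ∃ θ, G θ =ᶠ[𝓝 (γ θ)] fun x => (-1) * g x
  · by_cases hp1 : ∃ θ, G θ =ᶠ[𝓝 (γ θ)] fun x => 1 * g x
    · obtain ⟨θ, -, h1, h2⟩ := isPreconnected_univ (α := ℝ) _ _ (hopen 1) (hopen (-1))
        (fun θ _ => hcover θ) (by simpa [Set.Nonempty] using hp1)
        (by simpa [Set.Nonempty] using hm1)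
      exact hboth θ h1 h2
    · push Not at hp1
      exact hconst (-1) (fun θ => (hcover θ).resolve_left (hp1 θ)) (by norm_num)
  · push Not at hm1
    exact hconst 1 (fun θ => (hcover θ).resolve_right (hm1 θ)) one_ne_zero

/-- Continuation of the branch at infinity to the two standard regions. -/
theorem exists_branch_pair (hm : 1 ≤ m) {h : Fin m → ℝ} (hh : ∀ i, 0 < h i)
    {f : TwoValued (m + 1)} (hf : IsZ2Harmonic (ellipsoid (.refl ℝ _) h)
      (normalOne (.refl ℝ _) h) (normalTwo (.refl ℝ _)) f) {R : ℝ}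
    (hR : √(∑ i, h i ^ 2) ≤ R) {g₀ : Space (m + 1) → ℝ}
    (hg₀ : IsBranchOn f {x | R < ‖x‖} g₀) :
    ∃ g k, IsBranchOn f (outerRegion h) g ∧ IsBranchOn f (innerRegion h) k ∧
      (∀ x, R < ‖x‖ → g x = g₀ x) ∧ (∀ x, 0 < x (Fin.last m) → k x = g x) ∧
      (∀ x, x (Fin.last m) < 0 → k x = -g x) := by
  classical
  have hR0 : 0 ≤ R := (Real.sqrt_nonneg _).trans hR
  obtain ⟨g, hg, hgg₀⟩ := exists_isBranchOn_of_radial 1 (isOpen_outerRegion h)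
    (fun x hx => hf.branch x (notMem_ellipsoid_of_mem_outer hx))
    (fun x hx s hs => outerRegion_radial hx hs)
    (isOpen_lt continuous_const continuous_norm) (isConnected_norm_gt hm hR0)
    (norm_gt_subset_outerRegion hh hR)
    (fun x hx s hs => by
      have hx : R < ‖x‖ := hx
      show R < ‖_‖
      rw [norm_smul, Real.norm_of_nonneg (Real.exp_pos _).le]
      have : 1 ≤ Real.exp (1 * s) := Real.one_le_exp (by linarith)
      nlinarith [norm_nonneg x])
    (fun x hx => exists_exp_smul_norm_gt (fun h0 => zero_notMem_outerRegion h (h0 ▸ hx)) _) hg₀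
  have h0in : (0 : Space (m + 1)) ∈ innerRegion h := mem_of_mem_nhds (exists_ball_subset_innerRegion h)
  obtain ⟨k₀, hk₀⟩ := hf.branch 0 (notMem_ellipsoid_of_mem_inner h0in)
  obtain ⟨ρ, hρ, hsub, hb⟩ := hk₀.exists_ball (exists_ball_subset_innerRegion h)
  obtain ⟨k, hk, -⟩ := exists_isBranchOn_of_radial (-1) (isOpen_innerRegion h)
    (fun x hx => hf.branch x (notMem_ellipsoid_of_mem_inner hx))
    (fun x hx s hs => innerRegion_radial hx hs) Metric.isOpen_ball (Metric.isConnected_ball hρ) hsub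
    (fun x hx s hs => by
      rw [mem_ball_zero_iff] at hx ⊢
      rw [norm_smul, Real.norm_of_nonneg (Real.exp_pos _).le]
      have h2 : Real.exp ((-1) * s) ≤ 1 := Real.exp_le_one_iff.2 (by linarith)
      nlinarith [norm_nonneg x])
    (fun x _ => exists_exp_smul_mem_ball x hρ) hb
  have hpos : ∀ {x : Space (m + 1)}, 0 < x (Fin.last m) → x (Fin.last m) ≠ 0 := fun h => h.ne'
  have hneg : ∀ {x : Space (m + 1)}, x (Fin.last m) < 0 → x (Fin.last m) ≠ 0 := fun h => h.ne
  obtain ⟨k, hk, hkpos⟩ : ∃ k, IsBranchOn f (innerRegion h) k ∧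
      ∀ x : Space (m + 1), 0 < x (Fin.last m) → k x = g x := by
    rcases (hk.mono fun x (hx : 0 < x (Fin.last m)) => Or.inl (hpos hx)).eq_or_eq_neg
      (hg.mono fun x (hx : 0 < x (Fin.last m)) => Or.inl (hpos hx)) isOpen_last_pos
      convex_last_pos.isPreconnected with h1 | h1
    · exact ⟨k, hk, h1⟩
    · exact ⟨fun x => -k x, hk.neg, fun x hx => by
        have h2 : k x = -g x := h1 x hx
        simp only [h2, neg_neg]⟩
  refine ⟨g, k, hg, hk, hgg₀, hkpos, ?_⟩
  rcases (hk.mono fun x (hx : x (Fin.last m) < 0) => Or.inl (hneg hx)).eq_or_eq_neg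
      (hg.mono fun x (hx : x (Fin.last m) < 0) => Or.inl (hneg hx)) isOpen_last_neg
      convex_last_neg.isPreconnected with h1 | h1
  swap
  · exact h1
  -- In the remaining case k = g on both half spaces, so the two branches glue to one on the whole
  -- complement of the ellipsoid. That branch is zero by monodromy, and then k = -g holds trivially.
  set G : Space (m + 1) → ℝ := fun x => if x ∈ outerRegion h then g x else k x
  have hGo : ∀ x ∈ outerRegion h, G x = g x := fun x hx => if_pos hx
  have hGi : ∀ x ∈ innerRegion h, G x = k x := fun x hx => by
    by_cases hxo : x ∈ outerRegion h
    · rw [hGo x hxo]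
      have hx0 : x (Fin.last m) ≠ 0 := by
        intro h0
        rcases hx with h2 | h2
        · exact h2 h0
        · rcases hxo with h3 | h3
          · exact h3 h0
          · linarith
      rcases lt_or_gt_of_ne hx0 with h2 | h2
      · rw [h1 x h2]
      · rw [hkpos x h2]
    · exact if_neg hxo
  have hGb : IsBranchOn f (ellipsoid (.refl ℝ _) h)ᶜ G := by
    refine isBranchOn_of_forall fun x hx => ?_
    rcases mem_outer_or_inner hx with h2 | h2
    · exact (hg.congr (isOpen_outerRegion h) hGo).isBranchAt (isOpen_outerRegion h) h2
    · exact (hk.congr (isOpen_innerRegion h) hGi).isBranchAt (isOpen_innerRegion h) h2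
  have hG0 := eq_zero_of_global_branch hm hh hf hGb
  intro x hx
  have hxo : x ∈ outerRegion h := Or.inl (hneg hx)
  have h2 := hG0 x (notMem_ellipsoid_of_mem_outer hxo)
  rw [hGo x hxo] at h2
  rw [h1 x hx, h2, neg_zero]

/-- A nondegenerate function is determined by its branching ellipsoid and its behaviour at
infinity. -/
theorem eq_of_isNondegenerate (hm : 2 ≤ m) {h : Fin m → ℝ} (hh : ∀ i, 0 < h i)
    {f f' : TwoValued (m + 1)} (hf : IsNondegenerate (ellipsoid (.refl ℝ _) h)
      (normalOne (.refl ℝ _) h) (normalTwo (.refl ℝ _)) f)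
    (hf' : IsNondegenerate (ellipsoid (.refl ℝ _) h)
      (normalOne (.refl ℝ _) h) (normalTwo (.refl ℝ _)) f') {Q : Space (m + 1) → ℝ}
    (hQ : HasAsymptotics f Q) (hQ' : HasAsymptotics f' Q) : f = f' := by
  classical
  obtain ⟨R₁, g₁, hg₁, hO₁⟩ := hQ
  obtain ⟨R₂, g₂, hg₂, hO₂⟩ := hQ'
  set R := max (√(∑ i, h i ^ 2)) (max R₁ R₂)
  have hRR₁ : R₁ ≤ R := (le_max_left _ _).trans (le_max_right _ _)
  have hRR₂ : R₂ ≤ R := (le_max_right _ _).trans (le_max_right _ _)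
  obtain ⟨g, k, hg, hk, hgg, hkp, hkn⟩ := exists_branch_pair (by omega) hh hf.toIsZ2Harmonic
    (le_max_left _ _ : _ ≤ R) (hg₁.mono fun x (hx : R < ‖x‖) => hRR₁.trans_lt hx)
  obtain ⟨g', k', hg', hk', hgg', hkp', hkn'⟩ := exists_branch_pair (by omega) hh hf'.toIsZ2Harmonic
    (le_max_left _ _ : _ ≤ R) (hg₂.mono fun x (hx : R < ‖x‖) => hRR₂.trans_lt hx)
  set Z := ellipsoid (.refl ℝ (Space (m + 1))) h
  -- Both k and k' change sign relative to g and g' across the hyperplane, so the absolute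
  -- difference does not depend on which cut is used.
  set V : Space (m + 1) → ℝ := fun x =>
    if x ∈ outerRegion h then |g x - g' x| else if x ∈ innerRegion h then |k x - k' x| else 0
  have hVo : ∀ x ∈ outerRegion h, V x = |g x - g' x| := fun x hx => if_pos hx
  have hVi : ∀ x ∈ innerRegion h, V x = |k x - k' x| := fun x hx => by
    by_cases hxo : x ∈ outerRegion h
    · rw [hVo x hxo]
      have hx0 : x (Fin.last m) ≠ 0 := by
        intro h0
        rcases hx with h2 | h2
        · exact h2 h0
        · rcases hxo with h3 | h3
          · exact h3 h0
          · linarith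
      rcases lt_or_gt_of_ne hx0 with h2 | h2
      · rw [hkn x h2, hkn' x h2, neg_sub_neg, abs_sub_comm]
      · rw [hkp x h2, hkp' x h2]
    · simp only [V, if_neg hxo, if_pos hx]
  have hVZ : ∀ x ∈ Z, V x = 0 := fun x hx => by
    have h1 : x ∉ outerRegion h := fun h1 => notMem_ellipsoid_of_mem_outer h1 hx
    have h2 : x ∉ innerRegion h := fun h1 => notMem_ellipsoid_of_mem_inner h1 hx
    simp only [V, if_neg h1, if_neg h2]
  have hloc : ∀ x ∉ Z, ∃ u, HarmonicAt u x ∧ V =ᶠ[𝓝 x] fun y => |u y| := by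
    intro x hx
    rcases mem_outer_or_inner hx with h1 | h1
    · exact ⟨_, (hg.1 x h1).sub (hg'.1 x h1),
        mem_of_superset ((isOpen_outerRegion h).mem_nhds h1) hVo⟩
    · exact ⟨_, (hk.1 x h1).sub (hk'.1 x h1),
        mem_of_superset ((isOpen_innerRegion h).mem_nhds h1) hVi⟩
  have hV0 : ∀ x, 0 ≤ V x := fun x => by
    simp only [V]; split_ifs <;> positivity
  -- At the ellipsoid continuity comes from the expansion, by which both functions tend to zero
  -- there.
  have hVcont : Continuous V := by
    rw [continuous_iff_continuousAt]
    intro x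
    by_cases hx : x ∈ Z
    · rw [Metric.continuousAt_iff']
      intro ε hε
      filter_upwards [hf.eventually_abs_le hh hx (ε := ε / 3) (by positivity),
        hf'.eventually_abs_le hh hx (ε := ε / 3) (by positivity)] with y h1 h2
      rw [hVZ x hx, Real.dist_eq, sub_zero, abs_of_nonneg (hV0 y)]
      by_cases hy : y ∈ Z
      · rwa [hVZ y hy]
      have key : ∀ a b : ℝ, a ∈ f y → b ∈ f' y → |a - b| < ε := fun a b ha hb => by
        have := abs_sub a b
        have := h1 a ha
        have := h2 b hb
        linarith
      rcases mem_outer_or_inner hy with h3 | h3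
      · rw [hVo y h3]
        exact key _ _ (by rw [hg.2 y h3]; simp) (by rw [hg'.2 y h3]; simp)
      · rw [hVi y h3]
        exact key _ _ (by rw [hk.2 y h3]; simp) (by rw [hk'.2 y h3]; simp)
    · obtain ⟨u, hu, hVu⟩ := hloc x hx
      exact (hu.1.continuousAt.abs).congr hVu.symm
  have hVlim : Tendsto V (Bornology.cobounded _) (𝓝 0) := by
    have h1 : (fun x => g₁ x - g₂ x) =O[Bornology.cobounded (Space (m + 1))]
        fun x => ‖x‖ ^ ((2 : ℤ) - ((m + 1 : ℕ) : ℤ)) := by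
      refine (hO₁.sub hO₂).congr_left fun x => by ring
    have h2 : Tendsto (fun x : Space (m + 1) => ‖x‖ ^ ((2 : ℤ) - ((m + 1 : ℕ) : ℤ)))
        (Bornology.cobounded _) (𝓝 0) := by
      have : (2 : ℤ) - ((m + 1 : ℕ) : ℤ) = -((m - 1 : ℕ) : ℤ) := by push_cast; omega
      rw [this]
      exact (tendsto_zpow_atTop_zero (by omega)).comp tendsto_norm_cobounded_atTop
    have h3 := (h1.trans_tendsto h2).abs
    rw [abs_zero] at h3
    refine h3.congr' ?_
    filter_upwards [(tendsto_norm_cobounded_atTop).eventually_gt_atTop R] with x hx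
    rw [hVo x (norm_gt_subset_outerRegion hh (le_max_left _ _) hx), hgg x hx, hgg' x hx]
  have hVzero : ∀ x, V x = 0 := by
    intro x₀
    refine le_antisymm (le_of_forall_pos_le_add fun η hη => ?_) (hV0 x₀)
    rw [zero_add]
    obtain ⟨R₃, -, hR₃⟩ := (Filter.hasBasis_cobounded_norm.eventually_iff).1
      (hVlim.eventually (gt_mem_nhds hη))
    set R₄ := max R₃ ‖x₀‖
    -- V itself need not be harmonic, but on the open set where V > η it is locally one sign of a
    -- harmonic function. Applying the maximum principle there avoids subharmonic functions.
    have hres := nonpos_of_harmonic (K := Metric.closedBall 0 R₄)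
      (O := Metric.ball 0 R₄ ∩ {x | η < V x}) (isCompact_closedBall _ _)
      (Metric.isOpen_ball.inter (isOpen_lt continuous_const hVcont))
      (fun x hx => Metric.ball_subset_closedBall hx.1) (f := fun x => V x - η) (by fun_prop)
      (by
        rintro x ⟨-, hx⟩
        have hx : η < V x := hx
        have hxZ : x ∉ Z := fun h => by rw [hVZ x h] at hx; linarith
        obtain ⟨u, hu, hVu⟩ := hloc x hxZ
        have hux : u x ≠ 0 := by
          intro h0
          have := hVu.self_of_nhds
          simp only [h0, abs_zero] at this
          linarith
        refine HarmonicAt.sub ?_ (harmonicAt_const η)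
        rcases lt_or_gt_of_ne hux with h1 | h1
        · refine (harmonicAt_congr_nhds ?_).2 hu.neg
          filter_upwards [hVu, hu.1.continuousAt.eventually (gt_mem_nhds h1)] with y h2 h3
          rw [h2, abs_of_neg h3]; rfl
        · refine (harmonicAt_congr_nhds ?_).2 hu
          filter_upwards [hVu, hu.1.continuousAt.eventually (lt_mem_nhds h1)] with y h2 h3
          rw [h2, abs_of_pos h3])
      (by
        rintro x ⟨hx1, hx2⟩
        rw [mem_closedBall_zero_iff] at hx1
        by_contra! hcon
        have hηV : η < V x := by linarith
        have hxn : ‖x‖ = R₄ := by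
          by_contra hne
          exact hx2 ⟨mem_ball_zero_iff.2 (lt_of_le_of_ne hx1 hne), hηV⟩
        have : V x < η := hR₃ (by
          show R₃ ≤ ‖x‖
          rw [hxn]; exact le_max_left _ _)
        linarith) x₀ (mem_closedBall_zero_iff.2 (le_max_right _ _))
    linarith
  funext x
  by_cases hx : x ∈ Z
  · rw [hf.eq_zero x hx, hf'.eq_zero x hx]
  · rcases mem_outer_or_inner hx with h1 | h1
    · have h2 := hVzero x
      rw [hVo x h1, abs_eq_zero, sub_eq_zero] at h2
      rw [hg.2 x h1, hg'.2 x h1, h2]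
    · have h2 := hVzero x
      rw [hVi x h1, abs_eq_zero, sub_eq_zero] at h2
      rw [hk.2 x h1, hk'.2 x h1, h2]

end Uniqueness
end ZTwo

/-! ### The constants aᵢ: positivity, scaling and injectivity. -/

namespace ZTwo

section Coefficients

variable {m : ℕ}

theorem S_pos {h : Fin m → ℝ} (hh : ∀ i, 0 < h i) (u : ℝ) : 0 < S h (u ^ 2) :=
  Finset.prod_pos fun i _ => by have := hh i; positivity

theorem sqrt_S_pos {h : Fin m → ℝ} (hh : ∀ i, 0 < h i) (u : ℝ) : 0 < √(S h (u ^ 2)) :=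
  Real.sqrt_pos.2 (S_pos hh u)

@[fun_prop] theorem continuous_S (h : Fin m → ℝ) : Continuous (S h) := by
  unfold S; fun_prop

/-- A lower bound for `√S`, locally uniform in the semi-axes. -/
theorem le_sqrt_S (hm : 2 ≤ m) {h : Fin m → ℝ} {c : ℝ} (hc : 0 < c) (hc1 : c ≤ 1)
    (hch : ∀ i, c ≤ h i) (u : ℝ) : c ^ m * (1 + u ^ 2) ≤ √(S h (u ^ 2)) := by
  refine Real.le_sqrt_of_sq_le ?_
  have h1 : (c ^ 2 * (1 + u ^ 2)) ^ m ≤ S h (u ^ 2) := by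
    have : (c ^ 2 * (1 + u ^ 2)) ^ m = ∏ _i : Fin m, (c ^ 2 * (1 + u ^ 2)) := by simp
    rw [this]
    refine Finset.prod_le_prod (fun i _ => by positivity) fun i _ => ?_
    have h2 : c ^ 2 ≤ h i ^ 2 := by have := hch i; gcongr
    have h3 : c ^ 2 ≤ 1 := by nlinarith
    nlinarith [sq_nonneg u]
  refine le_trans ?_ h1
  rw [mul_pow, mul_pow, ← pow_mul, ← pow_mul, mul_comm m 2]
  gcongr
  nlinarith [sq_nonneg u]

theorem one_div_sqrt_S_le (hm : 2 ≤ m) {h : Fin m → ℝ} {c : ℝ} (hc : 0 < c) (hc1 : c ≤ 1)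
    (hch : ∀ i, c ≤ h i) (u : ℝ) : 1 / √(S h (u ^ 2)) ≤ (c ^ m)⁻¹ * (1 + u ^ 2)⁻¹ := by
  rw [← mul_inv, ← one_div]
  exact one_div_le_one_div_of_le (by positivity) (le_sqrt_S hm hc hc1 hch u)

theorem exists_lower_bound {h : Fin m → ℝ} (hh : ∀ i, 0 < h i) :
    ∃ c : ℝ, 0 < c ∧ c ≤ 1 ∧ ∀ i, c ≤ h i := by
  obtain ⟨α, β, hα, hβ, hab⟩ := exists_bounds hh
  exact ⟨min α 1, by positivity, min_le_right _ _, fun i => (min_le_left _ _).trans (hab i).1⟩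

theorem integrable_bound (c : ℝ) : Integrable (fun u : ℝ => c * (1 + u ^ 2)⁻¹) :=
  integrable_inv_one_add_sq.const_mul c

theorem continuous_one_div_sqrt_S {h : Fin m → ℝ} (hh : ∀ i, 0 < h i) :
    Continuous fun u : ℝ => 1 / √(S h (u ^ 2)) :=
  continuous_const.div (by fun_prop) fun u => (sqrt_S_pos hh u).ne'

theorem continuous_coeff_integrand {h : Fin m → ℝ} (hh : ∀ i, 0 < h i) (i : Fin m) :
    Continuous fun u : ℝ => 1 / ((u ^ 2 + h i ^ 2) * √(S h (u ^ 2))) :=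
  continuous_const.div (by fun_prop) fun u => by
    have := sqrt_S_pos hh u
    have := hh i
    positivity

theorem integrable_one_div_sqrt_S (hm : 2 ≤ m) {h : Fin m → ℝ} (hh : ∀ i, 0 < h i) :
    Integrable fun u : ℝ => 1 / √(S h (u ^ 2)) := by
  obtain ⟨c, hc, hc1, hch⟩ := exists_lower_bound hh
  refine (integrable_bound (c ^ m)⁻¹).mono' (continuous_one_div_sqrt_S hh).aestronglyMeasurable
    (Eventually.of_forall fun u => ?_)
  rw [Real.norm_of_nonneg (by positivity)]
  exact one_div_sqrt_S_le hm hc hc1 hch u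

theorem coeff_integrand_le {h : Fin m → ℝ} (hh : ∀ i, 0 < h i) (i : Fin m) (u : ℝ) :
    1 / ((u ^ 2 + h i ^ 2) * √(S h (u ^ 2))) ≤ (h i ^ 2)⁻¹ * (1 / √(S h (u ^ 2))) := by
  have := sqrt_S_pos hh u
  have := hh i
  rw [one_div, mul_inv, one_div]
  gcongr
  nlinarith [sq_nonneg u]

theorem integrable_coeff_integrand (hm : 2 ≤ m) {h : Fin m → ℝ} (hh : ∀ i, 0 < h i) (i : Fin m) :
    Integrable fun u : ℝ => 1 / ((u ^ 2 + h i ^ 2) * √(S h (u ^ 2))) := by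
  refine ((integrable_one_div_sqrt_S hm hh).const_mul (h i ^ 2)⁻¹).mono'
    (continuous_coeff_integrand hh i).aestronglyMeasurable (Eventually.of_forall fun u => ?_)
  rw [Real.norm_of_nonneg (by positivity)]
  exact coeff_integrand_le hh i u

theorem hasDerivAt_S {h : Fin m → ℝ} (hh : ∀ i, 0 < h i) (u : ℝ) :
    HasDerivAt (S h) (S h (u ^ 2) * ∑ i, 1 / (u ^ 2 + h i ^ 2)) (u ^ 2) := by
  have h1 : HasDerivAt (fun y : ℝ => ∏ i, (y + h i ^ 2))
      (∑ i, (∏ j ∈ Finset.univ.erase i, (u ^ 2 + h j ^ 2)) • (1 : ℝ)) (u ^ 2) :=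
    HasDerivAt.fun_finsetProd fun i _ => (hasDerivAt_id _).add_const _
  refine h1.congr_deriv ?_
  rw [Finset.mul_sum]
  refine Finset.sum_congr rfl fun i _ => ?_
  have hpos : u ^ 2 + h i ^ 2 ≠ 0 := by have := hh i; positivity
  rw [S, ← Finset.mul_prod_erase _ _ (Finset.mem_univ i)]
  simp only [smul_eq_mul, mul_one]
  field_simp

theorem last_integrand_eq {h : Fin m → ℝ} (hh : ∀ i, 0 < h i) (u : ℝ) :
    deriv (S h) (u ^ 2) / (S h (u ^ 2)) ^ (3 / 2 : ℝ) =
      ∑ i, 1 / ((u ^ 2 + h i ^ 2) * √(S h (u ^ 2))) := by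
  have hS := S_pos hh u
  have h32 : (S h (u ^ 2)) ^ (3 / 2 : ℝ) = S h (u ^ 2) * √(S h (u ^ 2)) := by
    rw [Real.sqrt_eq_rpow, ← Real.rpow_one_add' hS.le (by norm_num)]; norm_num
  rw [(hasDerivAt_S hh u).deriv, h32, mul_div_mul_left _ _ hS.ne', Finset.sum_div]
  exact Finset.sum_congr rfl fun i _ => by rw [div_div]

/-- The logarithmic derivative of S is ∑ 1/(y + hᵢ²). The relation expresses that `modelPoly h` is
harmonic. -/
theorem aLast_eq (hm : 2 ≤ m) {h : Fin m → ℝ} (hh : ∀ i, 0 < h i) :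
    aLast h = -∑ i, aCoeff h i := by
  simp only [aLast, aCoeff, last_integrand_eq hh]
  rw [integral_finsetSum _ fun i _ => (integrable_coeff_integrand hm hh i).integrableOn,
    ← Finset.mul_sum, neg_mul]

theorem integral_Ioi_pos {f : ℝ → ℝ} (hf : IntegrableOn f (Set.Ioi 0)) (hpos : ∀ u, 0 < f u) :
    0 < ∫ u in Set.Ioi (0 : ℝ), f u := by
  rw [integral_pos_iff_support_of_nonneg (fun u => (hpos u).le) hf]
  have : Function.support f = Set.univ := by
    ext u; simp [(hpos u).ne']
  rw [this]
  simp

theorem prod_h_pos {h : Fin m → ℝ} (hh : ∀ i, 0 < h i) : 0 < ∏ j, h j :=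
  Finset.prod_pos fun i _ => hh i

theorem aCoeff_pos (hm : 2 ≤ m) {h : Fin m → ℝ} (hh : ∀ i, 0 < h i) (i : Fin m) :
    0 < aCoeff h i := by
  refine mul_pos (half_pos (prod_h_pos hh))
    (integral_Ioi_pos (integrable_coeff_integrand hm hh i).integrableOn fun u => ?_)
  have := sqrt_S_pos hh u
  have := hh i
  positivity

theorem aZero_pos (hm : 2 ≤ m) {h : Fin m → ℝ} (hh : ∀ i, 0 < h i) : 0 < aZero h := by
  refine mul_pos (half_pos (prod_h_pos hh))
    (integral_Ioi_pos (integrable_one_div_sqrt_S hm hh).integrableOn fun u => ?_)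
  have := sqrt_S_pos hh u
  positivity

theorem S_smul (t : ℝ) (h : Fin m → ℝ) (y : ℝ) :
    S (fun i => t * h i) (t ^ 2 * y) = (t ^ 2) ^ m * S h y := by
  simp only [S, mul_pow, ← mul_add, Finset.prod_mul_distrib]
  simp

theorem sqrt_S_smul {t : ℝ} (ht : 0 < t) (h : Fin m → ℝ) (u : ℝ) :
    √(S (fun i => t * h i) ((t * u) ^ 2)) = t ^ m * √(S h (u ^ 2)) := by
  rw [mul_pow, S_smul, Real.sqrt_mul (by positivity), ← pow_mul, mul_comm 2 m, pow_mul,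
    Real.sqrt_sq (by positivity)]

theorem prod_smul_h (t : ℝ) (h : Fin m → ℝ) : ∏ j, (t * h j) = t ^ m * ∏ j, h j := by
  simp [Finset.prod_mul_distrib]

/-- Substitute u ↦ t u. The opposite degrees of homogeneity here (1) and in `aCoeff_smul` (-1) are
what allows C to vary while the quadratic part stays fixed. -/
theorem aZero_smul {t : ℝ} (ht : 0 < t) (h : Fin m → ℝ) :
    aZero (fun i => t * h i) = t * aZero h := by
  have key := integral_comp_mul_left_Ioi
    (fun u => 1 / √(S (fun i => t * h i) (u ^ 2))) 0 ht
  simp only [mul_zero, sqrt_S_smul ht] at key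
  have h2 : ∀ u : ℝ, 1 / (t ^ m * √(S h (u ^ 2))) = (t ^ m)⁻¹ * (1 / √(S h (u ^ 2))) := fun u => by
    rw [one_div, mul_inv, one_div]
  simp only [h2, integral_const_mul, smul_eq_mul] at key
  rw [eq_comm, inv_mul_eq_iff_eq_mul₀ ht.ne'] at key
  rw [aZero, aZero, key, prod_smul_h]
  field_simp

theorem aCoeff_smul {t : ℝ} (ht : 0 < t) (h : Fin m → ℝ) (i : Fin m) :
    aCoeff (fun i => t * h i) i = t⁻¹ * aCoeff h i := by
  have key := integral_comp_mul_left_Ioi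
    (fun u => 1 / ((u ^ 2 + (t * h i) ^ 2) * √(S (fun i => t * h i) (u ^ 2)))) 0 ht
  simp only [mul_zero, sqrt_S_smul ht] at key
  have h2 : ∀ u : ℝ, 1 / (((t * u) ^ 2 + (t * h i) ^ 2) * (t ^ m * √(S h (u ^ 2)))) =
      (t ^ 2 * t ^ m)⁻¹ * (1 / ((u ^ 2 + h i ^ 2) * √(S h (u ^ 2)))) := fun u => by
    rw [one_div, one_div, ← mul_inv]; congr 1; ring
  simp only [h2, integral_const_mul, smul_eq_mul] at key
  rw [eq_comm, inv_mul_eq_iff_eq_mul₀ ht.ne'] at key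
  rw [aCoeff, aCoeff, key, prod_smul_h]
  field_simp

theorem S_comp_perm (σ : Equiv.Perm (Fin m)) (h : Fin m → ℝ) (y : ℝ) :
    S (fun i => h (σ i)) y = S h y :=
  Equiv.prod_comp σ fun i => y + h i ^ 2

theorem aCoeff_comp_perm (σ : Equiv.Perm (Fin m)) (h : Fin m → ℝ) (i : Fin m) :
    aCoeff (fun i => h (σ i)) i = aCoeff h (σ i) := by
  simp only [aCoeff, S_comp_perm, Equiv.prod_comp σ h]

theorem aZero_comp_perm (σ : Equiv.Perm (Fin m)) (h : Fin m → ℝ) :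
    aZero (fun i => h (σ i)) = aZero h := by
  simp only [aZero, S_comp_perm, Equiv.prod_comp σ h]

/-- Strict monotonicity of the gradient of `p ↦ ∏ pᵢ ^ (-1/2)`. -/
theorem sum_mul_sub_neg {p q : Fin m → ℝ} (hp : ∀ i, 0 < p i) (hq : ∀ i, 0 < q i) (hpq : p ≠ q) :
    ∑ i, (p i - q i) * (1 / (p i * √(∏ j, p j)) - 1 / (q i * √(∏ j, q j))) < 0 := by
  set φ := √(∏ j, p j)
  set ψ := √(∏ j, q j)
  have hφ : 0 < φ := Real.sqrt_pos.2 (Finset.prod_pos fun i _ => hp i)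
  have hψ : 0 < ψ := Real.sqrt_pos.2 (Finset.prod_pos fun i _ => hq i)
  -- The bounds 1 - 1/s ≤ log s ≤ s - 1 applied to s = pᵢ/qᵢ estimate the sum by X(1/φ - 1/ψ). This
  -- is nonpositive because φ/ψ = exp(X/2); strictness comes from an index where p and q differ.
  set x : Fin m → ℝ := fun i => Real.log (p i / q i)
  set X : ℝ := ∑ i, x i
  have hlogφ : Real.log φ - Real.log ψ = X / 2 := by
    simp only [φ, ψ, X, x]
    rw [Real.log_sqrt (Finset.prod_nonneg fun i _ => (hp i).le),
      Real.log_sqrt (Finset.prod_nonneg fun i _ => (hq i).le),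
      Real.log_prod (fun i _ => (hp i).ne'), Real.log_prod (fun i _ => (hq i).ne')]
    rw [← sub_div, ← Finset.sum_sub_distrib]
    congr 1
    exact Finset.sum_congr rfl fun i _ => (Real.log_div (hp i).ne' (hq i).ne').symm
  have h1 : ∀ i, 1 - q i / p i ≤ x i := fun i => by
    have := Real.one_sub_inv_le_log_of_pos (div_pos (hp i) (hq i))
    rwa [inv_div] at this
  have h2 : ∀ i, x i ≤ p i / q i - 1 := fun i => Real.log_le_sub_one_of_pos (div_pos (hp i) (hq i))
  have h2' : ∑ i, (p i / q i - 1) > X := by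
    obtain ⟨i₀, hi₀⟩ := Function.ne_iff.1 hpq
    refine Finset.sum_lt_sum (fun i _ => h2 i) ⟨i₀, Finset.mem_univ _, ?_⟩
    refine Real.log_lt_sub_one_of_pos (div_pos (hp i₀) (hq i₀)) ?_
    rw [Ne, div_eq_one_iff_eq (hq i₀).ne']
    exact hi₀
  have h1' : ∑ i, (1 - q i / p i) ≤ X := Finset.sum_le_sum fun i _ => h1 i
  have hX : X / φ ≤ X / ψ := by
    rcases le_total 0 X with h0 | h0
    · have : ψ ≤ φ := by
        rw [← Real.log_le_log_iff hψ hφ]; linarith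
      gcongr
    · have : φ ≤ ψ := by
        rw [← Real.log_le_log_iff hφ hψ]; linarith
      rw [div_le_div_iff₀ hφ hψ]
      nlinarith
  have hsum : ∑ i, (p i - q i) * (1 / (p i * φ) - 1 / (q i * ψ)) =
      (∑ i, (1 - q i / p i)) / φ - (∑ i, (p i / q i - 1)) / ψ := by
    rw [Finset.sum_div, Finset.sum_div, ← Finset.sum_sub_distrib]
    refine Finset.sum_congr rfl fun i _ => ?_
    have := (hp i).ne'
    have := (hq i).ne'
    field_simp
  rw [hsum]
  have e1 : (∑ i, (1 - q i / p i)) / φ ≤ X / φ := by gcongr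
  have e2 : X / ψ < (∑ i, (p i / q i - 1)) / ψ := by gcongr
  linarith

/-- The integrals in the coefficients determine the semi-axes. -/
theorem eq_of_integral_eq (hm : 2 ≤ m) {h k : Fin m → ℝ} (hh : ∀ i, 0 < h i) (hk : ∀ i, 0 < k i)
    (heq : ∀ i, ∫ u in Set.Ioi (0 : ℝ), 1 / ((u ^ 2 + h i ^ 2) * √(S h (u ^ 2))) =
      ∫ u in Set.Ioi (0 : ℝ), 1 / ((u ^ 2 + k i ^ 2) * √(S k (u ^ 2)))) : h = k := by
  by_contra hne
  -- This is the monotonicity pairing at pᵢ = u² + hᵢ², qᵢ = u² + kᵢ². The differences pᵢ - qᵢ do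
  -- not depend on u, so equality of the integrals gives ∫ F = 0, although F is negative everywhere.
  set F : ℝ → ℝ := fun u => ∑ i, (h i ^ 2 - k i ^ 2) *
    (1 / ((u ^ 2 + h i ^ 2) * √(S h (u ^ 2))) - 1 / ((u ^ 2 + k i ^ 2) * √(S k (u ^ 2))))
  have hint : ∀ i, IntegrableOn (fun u => (h i ^ 2 - k i ^ 2) *
    (1 / ((u ^ 2 + h i ^ 2) * √(S h (u ^ 2))) - 1 / ((u ^ 2 + k i ^ 2) * √(S k (u ^ 2)))))
      (Set.Ioi 0) := fun i =>
    (((integrable_coeff_integrand hm hh i).sub (integrable_coeff_integrand hm hk i)).const_mul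
      _).integrableOn
  have hF0 : ∫ u in Set.Ioi (0 : ℝ), F u = 0 := by
    simp only [F]
    rw [integral_finsetSum _ fun i _ => hint i]
    refine Finset.sum_eq_zero fun i _ => ?_
    rw [integral_const_mul, integral_sub (integrable_coeff_integrand hm hh i).integrableOn
      (integrable_coeff_integrand hm hk i).integrableOn, heq i]
    simp
  have hFneg : ∀ u, F u < 0 := fun u => by
    have h1 := sum_mul_sub_neg (p := fun i => u ^ 2 + h i ^ 2) (q := fun i => u ^ 2 + k i ^ 2)
      (fun i => by have := hh i; positivity) (fun i => by have := hk i; positivity) (by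
        intro h2
        apply hne
        funext i
        have h3 := congrFun h2 i
        exact (sq_eq_sq₀ (hh i).le (hk i).le).1 (by linarith))
    simp only [add_sub_add_left_eq_sub] at h1
    exact h1
  have := integral_Ioi_pos (f := fun u => -F u)
    (integrable_finsetSum _ fun i _ => hint i).neg fun u => by
      have := hFneg u; linarith
  rw [integral_neg, hF0] at this
  simp at this

/-- The coefficients determine the semi-axes up to scale. -/
theorem exists_scale_of_aCoeff (hm : 2 ≤ m) {h k : Fin m → ℝ} (hh : ∀ i, 0 < h i)
    (hk : ∀ i, 0 < k i) {μ : ℝ} (hμ : 0 < μ) (heq : ∀ i, aCoeff h i = μ * aCoeff k i) :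
    ∃ τ > 0, ∀ i, h i = τ * k i := by
  have hHh := prod_h_pos hh
  have hHk := prod_h_pos hk
  -- After the prefactors are removed the integrals for h are ρ times those for k. These are
  -- homogeneous of degree -(m + 1) in the semi-axes, and τ solves τ^(-(m+1)) = ρ.
  set ρ : ℝ := μ * (∏ j, k j) / ∏ j, h j
  have hρ : 0 < ρ := by positivity
  set τ : ℝ := ρ ^ (-(1 / (m + 1 : ℝ)))
  have hτ : 0 < τ := by positivity
  have hτp : (τ ^ (m + 1))⁻¹ = ρ := by
    rw [← Real.rpow_natCast, ← Real.rpow_mul hρ.le, ← Real.rpow_neg hρ.le]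
    have : -(-(1 / (m + 1 : ℝ)) * ((m + 1 : ℕ) : ℝ)) = 1 := by push_cast; field_simp
    rw [this, Real.rpow_one]
  refine ⟨τ, hτ, ?_⟩
  have hτk : ∀ i, 0 < τ * k i := fun i => mul_pos hτ (hk i)
  have := eq_of_integral_eq hm hh hτk fun i => by
    have h1 := heq i
    have h2 := aCoeff_smul hτ k i
    simp only [aCoeff, prod_smul_h] at h1 h2
    set Ih := ∫ u in Set.Ioi (0 : ℝ), 1 / ((u ^ 2 + h i ^ 2) * √(S h (u ^ 2)))
    set Ik := ∫ u in Set.Ioi (0 : ℝ), 1 / ((u ^ 2 + k i ^ 2) * √(S k (u ^ 2)))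
    set It := ∫ u in Set.Ioi (0 : ℝ),
      1 / ((u ^ 2 + (τ * k i) ^ 2) * √(S (fun i => τ * k i) (u ^ 2)))
    have e1 : Ih = ρ * Ik := by
      simp only [ρ]
      field_simp
      field_simp at h1
      linarith
    have e2 : It = (τ ^ (m + 1))⁻¹ * Ik := by
      rw [pow_succ]
      field_simp
      field_simp at h2
      linarith
    rw [e1, e2, hτp]
  exact fun i => congrFun this i

/-- The integrands compare pointwise. Consequently, for one ellipsoid, equal coefficients can only
come from equal semi-axes, which is what the rigidity argument needs when eigenvalues coincide. -/
theorem aCoeff_lt_of_lt (hm : 2 ≤ m) {h : Fin m → ℝ} (hh : ∀ i, 0 < h i) {i j : Fin m}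
    (hij : h i < h j) : aCoeff h j < aCoeff h i := by
  refine mul_lt_mul_of_pos_left ?_ (half_pos (prod_h_pos hh))
  rw [← sub_pos, ← integral_sub (integrable_coeff_integrand hm hh i).integrableOn
    (integrable_coeff_integrand hm hh j).integrableOn]
  refine integral_Ioi_pos ((integrable_coeff_integrand hm hh i).sub
    (integrable_coeff_integrand hm hh j)).integrableOn fun u => ?_
  have h1 := sqrt_S_pos hh u
  have h2 := hh i
  have h3 := hh j
  rw [sub_pos]
  refine one_div_lt_one_div_of_lt (by positivity) ?_
  gcongr

theorem eq_of_aCoeff_eq (hm : 2 ≤ m) {h : Fin m → ℝ} (hh : ∀ i, 0 < h i) {i j : Fin m}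
    (hij : aCoeff h i = aCoeff h j) : h i = h j := by
  rcases lt_trichotomy (h i) (h j) with h1 | h1 | h1
  · exact absurd hij (aCoeff_lt_of_lt hm hh h1).ne'
  · exact h1
  · exact absurd hij (aCoeff_lt_of_lt hm hh h1).ne

end Coefficients
end ZTwo

/-! ### Surjectivity of the coefficient map, by minimisation. -/

namespace ZTwo

section Surjectivity

variable {m : ℕ}

/-- The integral `∫ du / √S(u²)` as a function of the semi-axes. -/
noncomputable def axisIntegral (h : Fin m → ℝ) : ℝ := ∫ u in Set.Ioi (0 : ℝ), 1 / √(S h (u ^ 2))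

theorem continuousOn_axisIntegral (hm : 2 ≤ m) {ε : ℝ} (hε : 0 < ε) :
    ContinuousOn (axisIntegral (m := m)) {h | ∀ i, ε ≤ h i} := by
  set c := min ε 1
  have hc : 0 < c := by positivity
  refine continuousOn_of_dominated (bound := fun u => (c ^ m)⁻¹ * (1 + u ^ 2)⁻¹) ?_ ?_
    (integrable_bound _).integrableOn ?_
  · exact fun h hh => (continuous_one_div_sqrt_S fun i => hε.trans_le (hh i)).aestronglyMeasurable
  · refine fun h hh => Eventually.of_forall fun u => ?_
    rw [Real.norm_of_nonneg (by positivity)]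
    exact one_div_sqrt_S_le hm hc (min_le_right _ _) (fun i => (min_le_left _ _).trans (hh i)) u
  · refine Eventually.of_forall fun u => ?_
    refine ContinuousOn.div continuousOn_const ?_ fun h hh =>
      (sqrt_S_pos (fun i => hε.trans_le (hh i)) u).ne'
    unfold S
    fun_prop

theorem S_update (h : Fin m → ℝ) (i : Fin m) (t y : ℝ) :
    S (Function.update h i t) y = (y + t ^ 2) * ∏ j ∈ Finset.univ.erase i, (y + h j ^ 2) := by
  rw [S, ← Finset.mul_prod_erase _ _ (Finset.mem_univ i)]
  congr 1
  · simp
  · refine Finset.prod_congr rfl fun j hj => ?_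
    rw [Function.update_of_ne (Finset.ne_of_mem_erase hj)]

theorem hasDerivAt_one_div_sqrt_S {h : Fin m → ℝ} (hh : ∀ i, 0 < h i) (i : Fin m) {t : ℝ}
    (ht : 0 < t) (u : ℝ) :
    HasDerivAt (fun t => 1 / √(S (Function.update h i t) (u ^ 2)))
      (-t * (1 / ((u ^ 2 + t ^ 2) * √(S (Function.update h i t) (u ^ 2))))) t := by
  set P := ∏ j ∈ Finset.univ.erase i, (u ^ 2 + h j ^ 2)
  have hP : 0 < P := Finset.prod_pos fun j _ => by have := hh j; positivity
  simp only [S_update]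
  change HasDerivAt (fun t => 1 / √((u ^ 2 + t ^ 2) * P))
    (-t * (1 / ((u ^ 2 + t ^ 2) * √((u ^ 2 + t ^ 2) * P)))) t
  have h1 : HasDerivAt (fun t : ℝ => (u ^ 2 + t ^ 2) * P) (2 * t * P) t := by
    have := (((hasDerivAt_id t).pow 2).const_add (u ^ 2)).mul_const P
    simpa using this
  have hpos : 0 < (u ^ 2 + t ^ 2) * P := by positivity
  have h2 := (h1.sqrt hpos.ne').fun_inv (Real.sqrt_pos.2 hpos).ne'
  simp only [← one_div] at h2
  refine h2.congr_deriv ?_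
  have hs := Real.sqrt_pos.2 hpos
  rw [Real.sq_sqrt hpos.le]
  generalize √((u ^ 2 + t ^ 2) * P) = s at hs ⊢
  field_simp

theorem hasDerivAt_axisIntegral (hm : 2 ≤ m) {h : Fin m → ℝ} (hh : ∀ i, 0 < h i) (i : Fin m) :
    HasDerivAt (fun t => axisIntegral (Function.update h i t))
      (-h i * ∫ u in Set.Ioi (0 : ℝ), 1 / ((u ^ 2 + h i ^ 2) * √(S h (u ^ 2)))) (h i) := by
  obtain ⟨c₀, hc₀, hc₀1, hc₀h⟩ := exists_lower_bound hh
  -- Halving the lower bound keeps every t within c of `h i` above c, so one integrable function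
  -- dominates the derivative on that whole ball.
  set c := c₀ / 2
  have hc : 0 < c := by positivity
  have hc1 : c ≤ 1 := by simp only [c]; linarith
  have hball : ∀ t ∈ Metric.ball (h i) c, c ≤ t := fun t ht => by
    rw [Metric.mem_ball, Real.dist_eq, abs_lt] at ht
    have := hc₀h i
    simp only [c] at ht ⊢
    linarith
  have hupd : ∀ t, c ≤ t → ∀ j, c ≤ Function.update h i t j := fun t ht j => by
    rcases eq_or_ne j i with rfl | hj
    · simpa using ht
    · rw [Function.update_of_ne hj]
      have := hc₀h j
      simp only [c]; linarith
  have hupd' : ∀ t, c ≤ t → ∀ j, 0 < Function.update h i t j := fun t ht j =>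
    hc.trans_le (hupd t ht j)
  have hint : Integrable (fun u : ℝ => 1 / √(S (Function.update h i (h i)) (u ^ 2)))
      (volume.restrict (Set.Ioi 0)) := by
    rw [Function.update_eq_self]
    exact (integrable_one_div_sqrt_S hm hh).integrableOn
  have hself : c ≤ h i := hball _ (Metric.mem_ball_self hc)
  have key := hasDerivAt_integral_of_dominated_loc_of_deriv_le (μ := volume.restrict (Set.Ioi 0))
    (F := fun t u => 1 / √(S (Function.update h i t) (u ^ 2)))
    (F' := fun t u => -t * (1 / ((u ^ 2 + t ^ 2) * √(S (Function.update h i t) (u ^ 2)))))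
    (x₀ := h i) (s := Metric.ball (h i) c)
    (bound := fun u => c⁻¹ * ((c ^ m)⁻¹ * (1 + u ^ 2)⁻¹)) (Metric.ball_mem_nhds _ hc)
    (by
      filter_upwards [Metric.ball_mem_nhds (h i) hc] with t ht
      exact (continuous_one_div_sqrt_S (hupd' t (hball t ht))).aestronglyMeasurable)
    hint
    (by
      have := (continuous_coeff_integrand (hupd' (h i) hself) i)
      simp only [Function.update_self] at this
      exact (continuous_const.mul this).aestronglyMeasurable)
    (Eventually.of_forall fun u t ht => by
      have hct := hball t ht
      have ht0 : 0 < t := hc.trans_le hct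
      have h1 := sqrt_S_pos (hupd' t hct) u
      have h2 := one_div_sqrt_S_le hm hc hc1 (hupd t hct) u
      rw [norm_mul, norm_neg, Real.norm_of_nonneg ht0.le, Real.norm_of_nonneg (by positivity)]
      calc t * (1 / ((u ^ 2 + t ^ 2) * √(S (Function.update h i t) (u ^ 2))))
          = t / (u ^ 2 + t ^ 2) * (1 / √(S (Function.update h i t) (u ^ 2))) := by
            field_simp
        _ ≤ c⁻¹ * ((c ^ m)⁻¹ * (1 + u ^ 2)⁻¹) := by
            refine mul_le_mul ?_ h2 (by positivity) (by positivity)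
            rw [inv_eq_one_div, div_le_div_iff₀ (by positivity) hc]
            nlinarith [sq_nonneg u])
    ((integrable_bound _).const_mul _).integrableOn
    (Eventually.of_forall fun u t ht =>
      hasDerivAt_one_div_sqrt_S hh i (hc.trans_le (hball t ht)) u)
  have h2 := key.2
  rw [integral_const_mul, Function.update_eq_self] at h2
  exact h2

/-- The integral blows up as one of the semi-axes tends to zero. -/
theorem le_axisIntegral (hm : 2 ≤ m) {h : Fin m → ℝ} (hh : ∀ i, 0 < h i) {M : ℝ}
    (hM : ∀ i, h i ≤ M) (i : Fin m) :
    (√((1 + M ^ 2) ^ m))⁻¹ * -Real.log (h i) ≤ axisIntegral h := by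
  have hi := hh i
  set C : ℝ := (√((1 + M ^ 2) ^ m))⁻¹
  have hC : 0 < C := inv_pos.2 (Real.sqrt_pos.2 (by positivity))
  -- On (0, 1] the i-th factor of S is at most (u + hᵢ)² and each other factor at most 1 + M², which
  -- leaves an integrand with logarithmic primitive.
  have hpt : ∀ u ∈ Set.Ioc (0 : ℝ) 1, C * (u + h i)⁻¹ ≤ 1 / √(S h (u ^ 2)) := by
    intro u hu
    have hu0 := hu.1
    have h1 : S h (u ^ 2) ≤ (u + h i) ^ 2 * (1 + M ^ 2) ^ m := by
      rw [S, ← Finset.mul_prod_erase _ _ (Finset.mem_univ i)]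
      refine mul_le_mul (by nlinarith) ?_
        (Finset.prod_nonneg fun j _ => by positivity) (by positivity)
      calc ∏ j ∈ Finset.univ.erase i, (u ^ 2 + h j ^ 2)
          ≤ ∏ _j ∈ Finset.univ.erase i, (1 + M ^ 2) := by
            refine Finset.prod_le_prod (fun j _ => by positivity) fun j _ => ?_
            have h2 := hM j
            have h3 := hh j
            have h4 := hu.2
            have : u ^ 2 ≤ 1 := by nlinarith
            gcongr
        _ = (1 + M ^ 2) ^ (m - 1) := by simp
        _ ≤ (1 + M ^ 2) ^ m := pow_le_pow_right₀ (by nlinarith [sq_nonneg M]) (by omega)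
    have h2 : √(S h (u ^ 2)) ≤ (u + h i) * √((1 + M ^ 2) ^ m) := by
      calc √(S h (u ^ 2)) ≤ √((u + h i) ^ 2 * (1 + M ^ 2) ^ m) := Real.sqrt_le_sqrt h1
        _ = _ := by rw [Real.sqrt_mul (by positivity), Real.sqrt_sq (by positivity)]
    calc C * (u + h i)⁻¹ = 1 / ((u + h i) * √((1 + M ^ 2) ^ m)) := by
          simp only [C]; rw [one_div, mul_inv, mul_comm]
      _ ≤ _ := one_div_le_one_div_of_le (sqrt_S_pos hh u) h2
  have hlog : ∫ u in Set.Ioc (0 : ℝ) 1, (u + h i)⁻¹ = Real.log ((1 + h i) / h i) := by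
    rw [← intervalIntegral.integral_of_le zero_le_one,
      intervalIntegral.integral_comp_add_right (fun u => u⁻¹), zero_add,
      integral_inv_of_pos hi (by linarith)]
  have hInt := integrable_one_div_sqrt_S hm hh
  have hcont : ContinuousOn (fun u : ℝ => C * (u + h i)⁻¹) (Set.Icc 0 1) := by
    refine continuousOn_const.mul (ContinuousOn.inv₀ (by fun_prop) fun u hu => ?_)
    have := hu.1; positivity
  calc C * -Real.log (h i) ≤ C * Real.log ((1 + h i) / h i) := by
        rw [Real.log_div (by positivity) hi.ne']
        have : 0 ≤ Real.log (1 + h i) := Real.log_nonneg (by linarith)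
        gcongr
        linarith
    _ = ∫ u in Set.Ioc (0 : ℝ) 1, C * (u + h i)⁻¹ := by rw [integral_const_mul, hlog]
    _ ≤ ∫ u in Set.Ioc (0 : ℝ) 1, 1 / √(S h (u ^ 2)) :=
        setIntegral_mono_on (hcont.integrableOn_Icc.mono_set Set.Ioc_subset_Icc_self)
          hInt.integrableOn measurableSet_Ioc hpt
    _ ≤ axisIntegral h :=
        setIntegral_mono_set hInt.integrableOn (Eventually.of_forall fun u => by positivity)
          Set.Ioc_subset_Ioi_self.eventuallyLE

/-- Every positive vector is a vector of coefficient integrals. -/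
theorem exists_integral_eq (hm : 2 ≤ m) {b : Fin m → ℝ} (hb : ∀ i, 0 < b i) :
    ∃ h : Fin m → ℝ, (∀ i, 0 < h i) ∧
      ∀ i, ∫ u in Set.Ioi (0 : ℝ), 1 / ((u ^ 2 + h i ^ 2) * √(S h (u ^ 2))) = b i := by
  -- The derivative of Ψ in hᵢ is 2hᵢ times bᵢ minus the i-th integral, so an interior minimum
  -- solves the equations.
  set Ψ : (Fin m → ℝ) → ℝ := fun h => ∑ i, b i * h i ^ 2 + 2 * axisIntegral h
  have hI0 : ∀ h : Fin m → ℝ, 0 ≤ axisIntegral h := fun h =>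
    integral_nonneg fun u => by positivity
  have hsum0 : ∀ h : Fin m → ℝ, 0 ≤ ∑ i, b i * h i ^ 2 := fun h =>
    Finset.sum_nonneg fun i _ => by have := hb i; positivity
  set one : Fin m → ℝ := fun _ => 1
  set A := Ψ one
  obtain ⟨c, hc, -, hcb⟩ := exists_lower_bound hb
  have hA0 : 0 ≤ A := add_nonneg (hsum0 _) (by have := hI0 one; linarith)
  -- On the sublevel set of the vector of ones, the quadratic term bounds the semi-axes by M, and
  -- the logarithmic blow-up of the integral bounds them below by ε; the set therefore lies in a
  -- compact box inside the open cone.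
  set M := √(A / c)
  set ε := Real.exp (-(A / 2 * √((1 + M ^ 2) ^ m)))
  have hε : 0 < ε := Real.exp_pos _
  have hsub : ∀ h : Fin m → ℝ, (∀ i, 0 < h i) → Ψ h ≤ A → ∀ i, ε ≤ h i ∧ h i ≤ M := by
    intro h hh hΨ
    have h1 : ∀ i, h i ≤ M := fun i => by
      refine Real.le_sqrt_of_sq_le ?_
      rw [le_div_iff₀ hc]
      have h2 : b i * h i ^ 2 ≤ ∑ i, b i * h i ^ 2 :=
        Finset.single_le_sum (f := fun i => b i * h i ^ 2)
          (fun j _ => by have := hb j; positivity) (Finset.mem_univ i)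
      have h3 := hI0 h
      have h4 : c * h i ^ 2 ≤ b i * h i ^ 2 := by have := hcb i; gcongr
      simp only [Ψ] at hΨ
      linarith
    refine fun i => ⟨?_, h1 i⟩
    have h2 := le_axisIntegral hm hh h1 i
    have h3 : axisIntegral h ≤ A / 2 := by
      have := hsum0 h
      simp only [Ψ] at hΨ
      linarith
    have h4 : 0 < √((1 + M ^ 2) ^ m) := Real.sqrt_pos.2 (by positivity)
    have h5 := h2.trans h3
    rw [inv_mul_le_iff₀ h4] at h5
    rw [← Real.le_log_iff_exp_le (hh i)]
    linarith
  set K : Set (Fin m → ℝ) := Set.Icc (fun _ => ε) (fun _ => M)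
  have hKmem : ∀ h : Fin m → ℝ, h ∈ K ↔ ∀ i, ε ≤ h i ∧ h i ≤ M := fun h => by
    simp only [K, Set.mem_Icc, Pi.le_def]
    exact ⟨fun h i => ⟨h.1 i, h.2 i⟩, fun h => ⟨fun i => (h i).1, fun i => (h i).2⟩⟩
  have honeK : one ∈ K := (hKmem _).2 (hsub one (fun _ => one_pos) le_rfl)
  have hΨc : ContinuousOn Ψ K := by
    refine ContinuousOn.add (by fun_prop) (continuousOn_const.mul ?_)
    exact (continuousOn_axisIntegral hm hε).mono fun h hh i => ((hKmem h).1 hh i).1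
  obtain ⟨h, hhK, hmin⟩ := isCompact_Icc.exists_isMinOn ⟨one, honeK⟩ hΨc
  have hh : ∀ i, 0 < h i := fun i => hε.trans_le ((hKmem h).1 hhK i).1
  have hglob : ∀ k : Fin m → ℝ, (∀ i, 0 < k i) → Ψ h ≤ Ψ k := fun k hk => by
    by_cases hkA : Ψ k ≤ A
    · exact hmin ((hKmem k).2 (hsub k hk hkA))
    · exact (hmin honeK).trans (not_le.1 hkA).le
  refine ⟨h, hh, fun i => ?_⟩
  set J := ∫ u in Set.Ioi (0 : ℝ), 1 / ((u ^ 2 + h i ^ 2) * √(S h (u ^ 2)))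
  have hlocal : IsLocalMin (fun t => Ψ (Function.update h i t)) (h i) := by
    filter_upwards [lt_mem_nhds (hh i)] with t ht
    rw [Function.update_eq_self]
    refine hglob _ fun j => ?_
    rcases eq_or_ne j i with rfl | hj
    · simpa using ht
    · rw [Function.update_of_ne hj]; exact hh j
  have hd1 : HasDerivAt (fun t => ∑ j, b j * (Function.update h i t j) ^ 2) (b i * (2 * h i))
      (h i) := by
    have h1 : ∀ t, ∑ j, b j * (Function.update h i t j) ^ 2 =
        b i * t ^ 2 + ∑ j ∈ Finset.univ.erase i, b j * h j ^ 2 := fun t => by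
      rw [← Finset.add_sum_erase _ _ (Finset.mem_univ i)]
      congr 1
      · simp
      · refine Finset.sum_congr rfl fun j hj => ?_
        rw [Function.update_of_ne (Finset.ne_of_mem_erase hj)]
    simp only [h1]
    have := (((hasDerivAt_id (h i)).pow 2).const_mul (b i)).add_const
      (∑ j ∈ Finset.univ.erase i, b j * h j ^ 2)
    simpa using this
  have hd := hd1.add ((hasDerivAt_axisIntegral hm hh i).const_mul 2)
  have h0 := hlocal.hasDerivAt_eq_zero hd
  have : h i * (b i - J) = 0 := by linarith
  rcases mul_eq_zero.1 this with h1 | h1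
  · exact absurd h1 (hh i).ne'
  · linarith

/-- Once the integrals equal bᵢ, the coefficients are bᵢ times the prefactor ∏ hⱼ / 2; dilating by
that same number divides it out. -/
theorem exists_aCoeff_eq (hm : 2 ≤ m) {b : Fin m → ℝ} (hb : ∀ i, 0 < b i) :
    ∃ h : Fin m → ℝ, (∀ i, 0 < h i) ∧ ∀ i, aCoeff h i = b i := by
  obtain ⟨h, hh, hhb⟩ := exists_integral_eq hm hb
  set t := (∏ j, h j) / 2
  have ht : 0 < t := half_pos (prod_h_pos hh)
  refine ⟨fun i => t * h i, fun i => mul_pos ht (hh i), fun i => ?_⟩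
  rw [aCoeff_smul ht, aCoeff, hhb i, inv_mul_cancel_left₀ ht.ne']

theorem coeffMap_mapsTo (hm : 2 ≤ m) : Set.MapsTo (coeffMap (m := m)) (cone m) (cone m) :=
  fun _ hy i => aCoeff_pos hm (fun j => inv_pos.2 (hy j)) i

theorem coeffMap_surjOn (hm : 2 ≤ m) : Set.SurjOn (coeffMap (m := m)) (cone m) (cone m) := by
  intro b hb
  obtain ⟨h, hh, hhb⟩ := exists_aCoeff_eq hm hb
  refine ⟨fun i => (h i)⁻¹, fun i => inv_pos.2 (hh i), ?_⟩
  funext i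
  simp only [coeffMap, inv_inv]
  exact hhb i

end Surjectivity
end ZTwo

/-! ### Degenerate ellipsoidal coordinates on the double cover. -/

namespace ZTwo

section EllipsoidalCoordinates

variable {m : ℕ}

/-- `(w, v)` are degenerate ellipsoidal coordinates of `x`; they live on the double cover of the
complement of the ellipsoid. -/
structure IsSol (h : Fin m → ℝ) (x : Space (m + 1)) (w v : ℝ) : Prop where
  last_eq : x (Fin.last m) = w * v
  sum_eq : v ^ 2 + ∑ i, x i.castSucc ^ 2 / (w ^ 2 + h i ^ 2) = 1

theorem IsSol.neg {h : Fin m → ℝ} {x : Space (m + 1)} {w v : ℝ} (hs : IsSol h x w v) :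
    IsSol h x (-w) (-v) :=
  ⟨by rw [hs.last_eq]; ring, by simpa using hs.sum_eq⟩

theorem sum_div_le {h : Fin m → ℝ} (hh : ∀ i, 0 < h i) (x : Space (m + 1)) {a b : ℝ} (ha : 0 ≤ a)
    (hab : a ≤ b) : ∑ i, x i.castSucc ^ 2 / (b + h i ^ 2) ≤ ∑ i, x i.castSucc ^ 2 / (a + h i ^ 2) :=
  Finset.sum_le_sum fun i _ => by
    have := hh i
    gcongr

/-- A larger w² lowers the sum and so raises v²; since w²v² = x_n² is fixed, both v must vanish, and
then the strictly decreasing sum cannot equal 1 twice. By symmetry w² is unique, which leads to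
uniqueness of the pair up to a common sign. -/
theorem IsSol.sq_le_sq {h : Fin m → ℝ} (hh : ∀ i, 0 < h i) {x : Space (m + 1)} {w v w' v' : ℝ}
    (hs : IsSol h x w v) (hs' : IsSol h x w' v') : w' ^ 2 ≤ w ^ 2 := by
  by_contra! hlt
  have h1 := sum_div_le hh x (sq_nonneg w) hlt.le
  have e1 := hs.sum_eq
  have e2 := hs'.sum_eq
  have hv : v ^ 2 ≤ v' ^ 2 := by linarith
  have hx : w ^ 2 * v ^ 2 = w' ^ 2 * v' ^ 2 := by
    rw [← mul_pow, ← mul_pow, ← hs.last_eq, ← hs'.last_eq]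
  have hw' : 0 < w' ^ 2 := (sq_nonneg w).trans_lt hlt
  have hv0 : v ^ 2 = 0 := by
    by_contra hne
    have : 0 < v ^ 2 := lt_of_le_of_ne (sq_nonneg v) (Ne.symm hne)
    nlinarith
  have hv'0 : v' ^ 2 = 0 := by
    rw [hv0, mul_zero] at hx
    rcases mul_eq_zero.1 hx.symm with h | h
    · exact absurd h hw'.ne'
    · exact h
  rw [hv0, zero_add] at e1
  rw [hv'0, zero_add] at e2
  have hall : ∀ i : Fin m, x i.castSucc ^ 2 = 0 := by
    intro i
    by_contra hne
    have hxi : 0 < x i.castSucc ^ 2 := lt_of_le_of_ne (sq_nonneg _) (Ne.symm hne)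
    have : ∑ i, x i.castSucc ^ 2 / (w' ^ 2 + h i ^ 2) < ∑ i, x i.castSucc ^ 2 / (w ^ 2 + h i ^ 2) := by
      refine Finset.sum_lt_sum (fun j _ => ?_) ⟨i, Finset.mem_univ i, ?_⟩
      · have := hh j
        gcongr
      · have := hh i
        gcongr
    linarith
  simp [hall] at e1

theorem IsSol.eq_or_eq_neg {h : Fin m → ℝ} (hh : ∀ i, 0 < h i) {x : Space (m + 1)} {w v w' v' : ℝ}
    (hs : IsSol h x w v) (hs' : IsSol h x w' v') : (w' = w ∧ v' = v) ∨ (w' = -w ∧ v' = -v) := by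
  have hw : w' ^ 2 = w ^ 2 := le_antisymm (hs.sq_le_sq hh hs') (hs'.sq_le_sq hh hs)
  have hv : v' ^ 2 = v ^ 2 := by
    have e1 := hs.sum_eq
    have e2 := hs'.sum_eq
    rw [hw] at e2
    linarith
  have hx : w' * v' = w * v := by rw [← hs.last_eq, ← hs'.last_eq]
  rcases sq_eq_sq_iff_eq_or_eq_neg.1 hw with rfl | rfl <;>
    rcases sq_eq_sq_iff_eq_or_eq_neg.1 hv with rfl | rfl
  · exact Or.inl ⟨rfl, rfl⟩
  · have : w' * v = 0 := by linarith
    rcases mul_eq_zero.1 this with rfl | rfl <;> simp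
  · have : w * v' = 0 := by linarith
    rcases mul_eq_zero.1 this with rfl | rfl <;> simp
  · exact Or.inr ⟨rfl, rfl⟩

/-- Intermediate value theorem on [0, ‖x‖]. Off the hyperplane one solves w² T(w) = x_n² and sets v
= x_n / w. On the hyperplane w = 0 for points of the solid ellipsoid, while outside it v = 0 and
T(w) = 0. -/
theorem exists_isSol {h : Fin m → ℝ} (hh : ∀ i, 0 < h i) (x : Space (m + 1)) :
    ∃ w v, 0 ≤ w ∧ IsSol h x w v := by
  set T : ℝ → ℝ := fun w => 1 - ∑ i, x i.castSucc ^ 2 / (w ^ 2 + h i ^ 2)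
  have hTc : Continuous T := by
    refine continuous_const.sub (continuous_finsetSum _ fun i _ => ?_)
    refine continuous_const.div (by fun_prop) fun w => ?_
    have := hh i
    positivity
  have hT0 : T 0 = 1 - qform h x := by simp [T, qform]
  have hsum : ∀ w, w ^ 2 * ∑ i, x i.castSucc ^ 2 / (w ^ 2 + h i ^ 2) ≤ ∑ i : Fin m, x i.castSucc ^ 2 := by
    intro w
    rw [Finset.mul_sum]
    refine Finset.sum_le_sum fun i _ => ?_
    have := hh i
    rw [mul_div_assoc', div_le_iff₀ (by positivity)]
    nlinarith [sq_nonneg (x i.castSucc), mul_nonneg (sq_nonneg (x i.castSucc)) (sq_nonneg (h i))]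
  have hnorm := norm_sq_eq_sum x
  by_cases hx : x (Fin.last m) = 0
  · rcases le_or_gt (qform h x) 1 with hq | hq
    · refine ⟨0, √(1 - qform h x), le_rfl, by simpa using hx, ?_⟩
      rw [Real.sq_sqrt (by linarith)]
      simp [qform]
    · have hxn : ‖x‖ ≠ 0 := by
        intro h0
        rw [norm_eq_zero] at h0
        rw [h0] at hq
        simp [qform] at hq
        linarith
      have hT1 : 0 ≤ T ‖x‖ := by
        have h1 := hsum ‖x‖
        have h2 : 0 < ‖x‖ ^ 2 := by positivity
        have h3 : ‖x‖ ^ 2 * ∑ i, x i.castSucc ^ 2 / (‖x‖ ^ 2 + h i ^ 2) ≤ ‖x‖ ^ 2 * 1 := by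
          rw [mul_one]; nlinarith
        have := le_of_mul_le_mul_left h3 h2
        simp only [T]; linarith
      obtain ⟨w, hw, hTw⟩ := intermediate_value_Icc (norm_nonneg x) hTc.continuousOn
        (⟨by rw [hT0]; linarith, hT1⟩ : (0 : ℝ) ∈ Set.Icc (T 0) (T ‖x‖))
      refine ⟨w, 0, hw.1, by simpa using hx, ?_⟩
      simp only [T] at hTw
      linarith
  · set F : ℝ → ℝ := fun w => w ^ 2 * T w - x (Fin.last m) ^ 2
    have hFc : Continuous F := by fun_prop
    have hF0 : F 0 < 0 := by
      have : 0 < x (Fin.last m) ^ 2 := by positivity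
      simp only [F]; linarith
    have hF1 : 0 ≤ F ‖x‖ := by
      have h1 := hsum ‖x‖
      simp only [F, T]
      nlinarith
    obtain ⟨w, hw, hFw⟩ := intermediate_value_Icc (norm_nonneg x) hFc.continuousOn
      (⟨hF0.le, hF1⟩ : (0 : ℝ) ∈ Set.Icc (F 0) (F ‖x‖))
    have hw0 : w ≠ 0 := by
      rintro rfl
      exact hF0.ne hFw
    refine ⟨w, x (Fin.last m) / w, hw.1, by field_simp, ?_⟩
    have h1 : (x (Fin.last m) / w) ^ 2 = T w := by
      simp only [F] at hFw
      rw [div_pow, div_eq_iff (by positivity)]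
      linarith
    rw [h1]
    simp [T]

theorem IsSol.eq_zero_iff {h : Fin m → ℝ} {x : Space (m + 1)} {w v : ℝ}
    (hs : IsSol h x w v) (hh : ∀ i, 0 < h i) :
    (w = 0 ∧ v = 0) ↔ x ∈ ellipsoid (.refl ℝ _) h := by
  rw [mem_ellipsoid_refl]
  constructor
  · rintro ⟨rfl, rfl⟩
    exact ⟨by simpa [qform] using hs.sum_eq, by simpa using hs.last_eq⟩
  · rintro ⟨h1, h2⟩
    have h3 : IsSol h x 0 0 := ⟨by simpa using h2, by simpa [qform] using h1⟩
    rcases h3.eq_or_eq_neg hh hs with h4 | h4 <;> simpa using h4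

theorem IsSol.abs_v_le {h : Fin m → ℝ} {x : Space (m + 1)} {w v : ℝ} (hs : IsSol h x w v) :
    |v| ≤ 1 := by
  rw [← sq_le_one_iff_abs_le_one]
  have h1 := hs.sum_eq
  have h2 : 0 ≤ ∑ i, x i.castSucc ^ 2 / (w ^ 2 + h i ^ 2) :=
    Finset.sum_nonneg fun i _ => by positivity
  linarith

/-- The weights xᵢ²/(w² + hᵢ²) have sum at most 1, so w² and ‖x‖² differ by a bounded amount. This
controls w both from above and at infinity. -/
theorem IsSol.norm_sq_eq {h : Fin m → ℝ} (hh : ∀ i, 0 < h i) {x : Space (m + 1)} {w v : ℝ}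
    (hs : IsSol h x w v) :
    ‖x‖ ^ 2 = w ^ 2 + ∑ i, x i.castSucc ^ 2 / (w ^ 2 + h i ^ 2) * h i ^ 2 := by
  rw [norm_sq_eq_sum, hs.last_eq]
  have h1 : ∑ i : Fin m, x i.castSucc ^ 2 = w ^ 2 * ∑ i, x i.castSucc ^ 2 / (w ^ 2 + h i ^ 2) +
      ∑ i, x i.castSucc ^ 2 / (w ^ 2 + h i ^ 2) * h i ^ 2 := by
    rw [Finset.mul_sum, ← Finset.sum_add_distrib]
    refine Finset.sum_congr rfl fun i _ => ?_
    have := hh i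
    have : w ^ 2 + h i ^ 2 ≠ 0 := by positivity
    field_simp
  have h2 := hs.sum_eq
  rw [h1]
  have h3 : v ^ 2 = 1 - ∑ i, x i.castSucc ^ 2 / (w ^ 2 + h i ^ 2) := by linarith
  rw [mul_pow, h3]
  ring

theorem IsSol.abs_w_le {h : Fin m → ℝ} (hh : ∀ i, 0 < h i) {x : Space (m + 1)} {w v : ℝ}
    (hs : IsSol h x w v) : |w| ≤ ‖x‖ := by
  refine abs_le_of_sq_le_sq ?_ (norm_nonneg x)
  rw [hs.norm_sq_eq hh]
  have : 0 ≤ ∑ i, x i.castSucc ^ 2 / (w ^ 2 + h i ^ 2) * h i ^ 2 :=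
    Finset.sum_nonneg fun i _ => by positivity
  linarith

open Classical in
/-- The nonnegative coordinate `|w|`, as a function on space. -/
noncomputable def wAbs (h : Fin m → ℝ) (x : Space (m + 1)) : ℝ :=
  if hx : ∃ p : ℝ × ℝ, 0 ≤ p.1 ∧ IsSol h x p.1 p.2 then hx.choose.1 else 0

open Classical in
/-- A coordinate `v` that accompanies `wAbs`. -/
noncomputable def vSel (h : Fin m → ℝ) (x : Space (m + 1)) : ℝ :=
  if hx : ∃ p : ℝ × ℝ, 0 ≤ p.1 ∧ IsSol h x p.1 p.2 then hx.choose.2 else 0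

theorem wAbs_spec {h : Fin m → ℝ} (hh : ∀ i, 0 < h i) (x : Space (m + 1)) :
    0 ≤ wAbs h x ∧ IsSol h x (wAbs h x) (vSel h x) := by
  have hx : ∃ p : ℝ × ℝ, 0 ≤ p.1 ∧ IsSol h x p.1 p.2 := by
    obtain ⟨w, v, h1, h2⟩ := exists_isSol hh x
    exact ⟨(w, v), h1, h2⟩
  simp only [wAbs, vSel, dif_pos hx]
  exact hx.choose_spec

theorem IsSol.abs_eq {h : Fin m → ℝ} (hh : ∀ i, 0 < h i) {x : Space (m + 1)} {w v : ℝ}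
    (hs : IsSol h x w v) : |w| = wAbs h x ∧ |v| = |vSel h x| := by
  obtain ⟨h1, h2⟩ := wAbs_spec hh x
  rcases h2.eq_or_eq_neg hh hs with ⟨h3, h4⟩ | ⟨h3, h4⟩
  · rw [h3, h4, abs_of_nonneg h1]; simp
  · rw [h3, h4, abs_neg, abs_neg, abs_of_nonneg h1]; simp

/-- The coordinates stay in a compact box, and every cluster point satisfies the limiting equations,
whose solution is unique up to sign. No formula is needed, and the argument also covers points of
the ellipsoid. -/
theorem continuous_abs_sol {h : Fin m → ℝ} (hh : ∀ i, 0 < h i) :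
    Continuous fun x : Space (m + 1) => (wAbs h x, |vSel h x|) := by
  rw [continuous_iff_continuousAt]
  intro x₀
  refine (isCompact_Icc (a := ((0 : ℝ), (0 : ℝ))) (b := (‖x₀‖ + 1, (1 : ℝ)))).tendsto_nhds_of_unique_mapClusterPt
    (l := 𝓝 x₀) ?_ ?_
  · filter_upwards [Metric.ball_mem_nhds x₀ one_pos] with x hx
    obtain ⟨h1, h2⟩ := wAbs_spec hh x
    have h3 := h2.abs_w_le hh
    rw [abs_of_nonneg h1] at h3
    have h4 : ‖x‖ ≤ ‖x₀‖ + 1 := by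
      have := norm_sub_norm_le x x₀
      rw [Metric.mem_ball, dist_eq_norm] at hx
      linarith
    exact ⟨⟨h1, abs_nonneg _⟩, ⟨h3.trans h4, h2.abs_v_le⟩⟩
  · rintro ⟨w, v⟩ hwv hcl
    obtain ⟨⟨hw0, hv0⟩, -⟩ := hwv
    simp only at hw0 hv0
    obtain ⟨U, hU, hlim⟩ := mapClusterPt_iff_ultrafilter.1 hcl
    have hlw : Tendsto (wAbs h) U (𝓝 w) := (continuous_fst.tendsto _).comp hlim
    have hlv : Tendsto (fun x => |vSel h x|) U (𝓝 v) := (continuous_snd.tendsto _).comp hlim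
    have hid : Tendsto (fun x : Space (m + 1) => x) U (𝓝 x₀) := hU
    have hcoord : ∀ j, Tendsto (fun x : Space (m + 1) => x j) U (𝓝 (x₀ j)) := fun j =>
      ((by fun_prop : Continuous fun x : Space (m + 1) => x j).tendsto x₀).comp hid
    have e1 : |x₀ (Fin.last m)| = w * v := by
      refine tendsto_nhds_unique (hcoord (Fin.last m)).abs ((hlw.mul hlv).congr fun x => ?_)
      obtain ⟨h1, h2⟩ := wAbs_spec hh x
      rw [h2.last_eq, abs_mul, abs_of_nonneg h1]
    have e2 : v ^ 2 + ∑ i, x₀ i.castSucc ^ 2 / (w ^ 2 + h i ^ 2) = 1 := by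
      have h1 : Tendsto (fun x : Space (m + 1) => |vSel h x| ^ 2 +
          ∑ i, x i.castSucc ^ 2 / (wAbs h x ^ 2 + h i ^ 2)) U
          (𝓝 (v ^ 2 + ∑ i, x₀ i.castSucc ^ 2 / (w ^ 2 + h i ^ 2))) := by
        refine (hlv.pow 2).add (tendsto_finsetSum _ fun i _ => ?_)
        refine ((hcoord i.castSucc).pow 2).div ((hlw.pow 2).add_const _) ?_
        have := hh i
        positivity
      refine tendsto_nhds_unique h1 (tendsto_const_nhds.congr fun x => ?_)
      rw [sq_abs, (wAbs_spec hh x).2.sum_eq]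
    -- The limit only retains |x_n| = w v; the sign of x_n is put back into v.
    have hsol : ∃ σ : ℝ, |σ| = 1 ∧ IsSol h x₀ w (σ * v) := by
      rcases le_total 0 (x₀ (Fin.last m)) with h1 | h1
      · exact ⟨1, by simp, by rw [one_mul, ← e1, abs_of_nonneg h1], by simpa using e2⟩
      · exact ⟨-1, by simp, by rw [abs_of_nonpos h1] at e1; linarith, by simpa using e2⟩
    obtain ⟨σ, hσ, hsol⟩ := hsol
    obtain ⟨h3, h4⟩ := hsol.abs_eq hh
    rw [abs_of_nonneg hw0] at h3
    rw [abs_mul, hσ, one_mul, abs_of_nonneg hv0] at h4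
    rw [h3, h4]

theorem continuous_wAbs {h : Fin m → ℝ} (hh : ∀ i, 0 < h i) : Continuous (wAbs h) :=
  continuous_fst.comp (continuous_abs_sol hh)

theorem continuous_abs_vSel {h : Fin m → ℝ} (hh : ∀ i, 0 < h i) :
    Continuous fun x => |vSel h x| :=
  continuous_snd.comp (continuous_abs_sol hh)

theorem wAbs_eq_zero_iff {h : Fin m → ℝ} (hh : ∀ i, 0 < h i) {x : Space (m + 1)} :
    wAbs h x = 0 ↔ x (Fin.last m) = 0 ∧ qform h x ≤ 1 := by
  obtain ⟨h1, h2⟩ := wAbs_spec hh x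
  constructor
  · intro h0
    rw [h0] at h2
    refine ⟨by simpa using h2.last_eq, ?_⟩
    have := h2.sum_eq
    simp only [ne_eq, OfNat.ofNat_ne_zero, not_false_eq_true, zero_pow, zero_add] at this
    rw [qform]
    nlinarith [sq_nonneg (vSel h x)]
  · rintro ⟨h3, h4⟩
    have h5 : IsSol h x 0 (√(1 - qform h x)) := ⟨by simpa using h3, by
      rw [Real.sq_sqrt (by linarith)]; simp [qform]⟩
    have := (h5.abs_eq hh).1
    simpa using this.symm

theorem vSel_eq_zero_of {h : Fin m → ℝ} (hh : ∀ i, 0 < h i) {x : Space (m + 1)}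
    (hx : x (Fin.last m) = 0) (hq : 1 ≤ qform h x) : vSel h x = 0 := by
  obtain ⟨h1, h2⟩ := wAbs_spec hh x
  have h3 := h2.last_eq
  rw [hx] at h3
  rcases mul_eq_zero.1 h3.symm with h4 | h4
  · have := h2.sum_eq
    rw [h4] at this
    simp only [ne_eq, OfNat.ofNat_ne_zero, not_false_eq_true, zero_pow, zero_add] at this
    rw [qform] at hq
    have h5 : vSel h x ^ 2 = 0 := le_antisymm (by linarith) (sq_nonneg _)
    simpa using h5
  · exact h4

end EllipsoidalCoordinates
end ZTwo

/-! ### The explicit two-valued function and its local coordinates. -/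

namespace ZTwo

open InnerProductSpace

section ExplicitSolution

variable {m : ℕ}

/-- `∫₀ʷ du / √S(u²)`. -/
noncomputable def primZero (h : Fin m → ℝ) (w : ℝ) : ℝ := ∫ u in (0 : ℝ)..w, 1 / √(S h (u ^ 2))

/-- `∫₀ʷ du / ((u² + hᵢ²) √S(u²))`. -/
noncomputable def primCoeff (h : Fin m → ℝ) (i : Fin m) (w : ℝ) : ℝ :=
  ∫ u in (0 : ℝ)..w, 1 / ((u ^ 2 + h i ^ 2) * √(S h (u ^ 2)))

theorem integral_neg_of_even {f : ℝ → ℝ} (hf : ∀ u, f (-u) = f u) (w : ℝ) :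
    ∫ u in (0 : ℝ)..(-w), f u = -∫ u in (0 : ℝ)..w, f u := by
  have h1 := intervalIntegral.integral_comp_neg (a := 0) (b := w) f
  simp only [hf, neg_zero] at h1
  rw [h1, intervalIntegral.integral_symm]

theorem primZero_neg (h : Fin m → ℝ) (w : ℝ) : primZero h (-w) = -primZero h w :=
  integral_neg_of_even (fun u => by simp) w

theorem primCoeff_neg (h : Fin m → ℝ) (i : Fin m) (w : ℝ) :
    primCoeff h i (-w) = -primCoeff h i w :=
  integral_neg_of_even (fun u => by simp) w

theorem hasDerivAt_primZero {h : Fin m → ℝ} (hh : ∀ i, 0 < h i) (w : ℝ) :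
    HasDerivAt (primZero h) (1 / √(S h (w ^ 2))) w :=
  (continuous_one_div_sqrt_S hh).integral_hasStrictDerivAt 0 w |>.hasDerivAt

theorem hasDerivAt_primCoeff {h : Fin m → ℝ} (hh : ∀ i, 0 < h i) (i : Fin m) (w : ℝ) :
    HasDerivAt (primCoeff h i) (1 / ((w ^ 2 + h i ^ 2) * √(S h (w ^ 2)))) w :=
  (continuous_coeff_integrand hh i).integral_hasStrictDerivAt 0 w |>.hasDerivAt

theorem contDiff_sqrt_S {h : Fin m → ℝ} (hh : ∀ i, 0 < h i) :
    ContDiff ℝ ∞ fun u : ℝ => √(S h (u ^ 2)) := by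
  refine ContDiff.sqrt ?_ fun u => (S_pos hh u).ne'
  unfold S
  fun_prop

theorem contDiff_primZero {h : Fin m → ℝ} (hh : ∀ i, 0 < h i) : ContDiff ℝ ∞ (primZero h) := by
  rw [contDiff_infty_iff_deriv]
  refine ⟨fun w => (hasDerivAt_primZero hh w).differentiableAt, ?_⟩
  rw [show deriv (primZero h) = fun w => 1 / √(S h (w ^ 2)) from
    funext fun w => (hasDerivAt_primZero hh w).deriv]
  exact contDiff_const.div (contDiff_sqrt_S hh) fun u => (sqrt_S_pos hh u).ne'

theorem contDiff_primCoeff {h : Fin m → ℝ} (hh : ∀ i, 0 < h i) (i : Fin m) :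
    ContDiff ℝ ∞ (primCoeff h i) := by
  rw [contDiff_infty_iff_deriv]
  refine ⟨fun w => (hasDerivAt_primCoeff hh i w).differentiableAt, ?_⟩
  rw [show deriv (primCoeff h i) = fun w => 1 / ((w ^ 2 + h i ^ 2) * √(S h (w ^ 2))) from
    funext fun w => (hasDerivAt_primCoeff hh i w).deriv]
  refine contDiff_const.div (ContDiff.mul (by fun_prop) (contDiff_sqrt_S hh)) fun u => ?_
  have := sqrt_S_pos hh u
  have := hh i
  positivity

/-- The explicit harmonic function on the double cover. -/
noncomputable def Phi (h : Fin m → ℝ) (x : Space (m + 1)) (w v : ℝ) : ℝ :=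
  (∏ j, h j) / 2 * (primZero h w - ∑ i, x i.castSucc ^ 2 * primCoeff h i w
    + x (Fin.last m) ^ 2 * ∑ i, primCoeff h i w + x (Fin.last m) * v / √(S h (w ^ 2)))

theorem Phi_neg (h : Fin m → ℝ) (x : Space (m + 1)) (w v : ℝ) :
    Phi h x (-w) (-v) = -Phi h x w v := by
  simp only [Phi, primZero_neg, primCoeff_neg, neg_sq, mul_neg, Finset.sum_neg_distrib, neg_div]
  ring

/-- The explicit two-valued function. -/
noncomputable def model (h : Fin m → ℝ) : TwoValued (m + 1) :=
  fun x => {y | ∃ w v, IsSol h x w v ∧ y = Phi h x w v}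

theorem model_eq {h : Fin m → ℝ} (hh : ∀ i, 0 < h i) {x : Space (m + 1)} {w v : ℝ}
    (hs : IsSol h x w v) : model h x = {Phi h x w v, -Phi h x w v} := by
  ext y
  simp only [model, Set.mem_ofPred_eq, Set.mem_insert_iff, Set.mem_singleton_iff]
  constructor
  · rintro ⟨w', v', hs', rfl⟩
    rcases hs.eq_or_eq_neg hh hs' with ⟨rfl, rfl⟩ | ⟨rfl, rfl⟩
    · exact Or.inl rfl
    · exact Or.inr (Phi_neg h x w v)
  · rintro (rfl | rfl)
    · exact ⟨w, v, hs, rfl⟩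
    · exact ⟨-w, -v, hs.neg, (Phi_neg h x w v).symm⟩

/-- This is half the Jacobian determinant in `(w, v)` of the two coordinate equations. It can vanish
only at w = v = 0, that is on the ellipsoid, because v = 0 together with xᵢ = 0 for all i < n
contradicts the second equation. -/
theorem IsSol.discr_ne_zero {h : Fin m → ℝ} (hh : ∀ i, 0 < h i) {x₀ : Space (m + 1)} {w₀ v₀ : ℝ}
    (hs : IsSol h x₀ w₀ v₀) (hx₀ : x₀ ∉ ellipsoid (.refl ℝ _) h) :
    v₀ ^ 2 + w₀ ^ 2 * ∑ i, x₀ i.castSucc ^ 2 / (w₀ ^ 2 + h i ^ 2) ^ 2 ≠ 0 := by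
  have hpos : ∀ (i : Fin m) (w : ℝ), 0 < w ^ 2 + h i ^ 2 := fun i w => by
    have := hh i; positivity
  set q : ℝ := ∑ i, x₀ i.castSucc ^ 2 / (w₀ ^ 2 + h i ^ 2) ^ 2
  have hq : 0 ≤ q := Finset.sum_nonneg fun i _ => by positivity
  intro h0
  have h1 : 0 ≤ w₀ ^ 2 * q := by positivity
  have hv : v₀ = 0 := by
    have : v₀ ^ 2 = 0 := by nlinarith [sq_nonneg v₀]
    simpa using this
  have hwq : w₀ ^ 2 * q = 0 := by nlinarith [sq_nonneg v₀]
  rcases mul_eq_zero.1 hwq with h2 | h2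
  · exact hx₀ ((hs.eq_zero_iff hh).1 ⟨by simpa using h2, hv⟩)
  · have h3 : ∀ i : Fin m, x₀ i.castSucc = 0 := fun i => by
      have := (Finset.sum_eq_zero_iff_of_nonneg (fun i _ => by positivity)).1 h2 i
        (Finset.mem_univ i)
      rw [div_eq_zero_iff] at this
      rcases this with h | h
      · simpa using h
      · exact absurd h (pow_ne_zero 2 (hpos i w₀).ne')
    have := hs.sum_eq
    simp [h3, hv] at this

/-- Smooth local coordinates `(w, v)` off the ellipsoid. -/
theorem exists_local_sol {h : Fin m → ℝ} (hh : ∀ i, 0 < h i) {x₀ : Space (m + 1)} {w₀ v₀ : ℝ}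
    (hs : IsSol h x₀ w₀ v₀) (hx₀ : x₀ ∉ ellipsoid (.refl ℝ _) h) :
    ∃ w v : Space (m + 1) → ℝ, ContDiffAt ℝ ∞ w x₀ ∧ ContDiffAt ℝ ∞ v x₀ ∧ w x₀ = w₀ ∧ v x₀ = v₀ ∧
      ∀ᶠ x in 𝓝 x₀, IsSol h x (w x) (v x) := by
  have hpos : ∀ (i : Fin m) (w : ℝ), 0 < w ^ 2 + h i ^ 2 := fun i w => by
    have := hh i; positivity
  set F : Space (m + 1) × (ℝ × ℝ) → ℝ × ℝ := fun z =>
    (z.2.1 * z.2.2 - z.1 (Fin.last m), z.2.2 ^ 2 + ∑ i, z.1 i.castSucc ^ 2 / (z.2.1 ^ 2 + h i ^ 2))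
  have hcoord : ∀ j, ContDiff ℝ ∞ fun z : Space (m + 1) × (ℝ × ℝ) => z.1 j := fun j => by fun_prop
  have hF : ContDiff ℝ ∞ F := by
    refine ContDiff.prodMk (by fun_prop) (ContDiff.add (by fun_prop) ?_)
    refine ContDiff.sum fun i _ => ContDiff.div (by fun_prop) (by fun_prop) fun z => (hpos i _).ne'
  set q : ℝ := ∑ i, x₀ i.castSucc ^ 2 / (w₀ ^ 2 + h i ^ 2) ^ 2
  have hN : v₀ ^ 2 + w₀ ^ 2 * q ≠ 0 := hs.discr_ne_zero hh hx₀
  set u₀ : Space (m + 1) × (ℝ × ℝ) := (x₀, (w₀, v₀))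
  -- The partial derivative of the coordinate equations in `(w, v)`, computed along a line; its
  -- invertibility is the input of the implicit function theorem.
  have hder : ∀ a b : ℝ, fderiv ℝ F u₀ (0, (a, b)) =
      (a * v₀ + w₀ * b, 2 * v₀ * b - 2 * w₀ * q * a) := by
    intro a b
    have hcurve : HasDerivAt (fun t : ℝ => u₀ + t • ((0 : Space (m + 1)), (a, b)))
        ((0 : Space (m + 1)), (a, b)) 0 := by
      simpa using ((hasDerivAt_id (0 : ℝ)).smul_const ((0 : Space (m + 1)), (a, b))).const_add u₀
    have hFd : HasFDerivAt F (fderiv ℝ F u₀) (u₀ + (0 : ℝ) • ((0 : Space (m + 1)), (a, b))) := by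
      simpa using (hF.differentiable (by simp) u₀).hasFDerivAt
    have h1 := hFd.comp_hasDerivAt (0 : ℝ) hcurve
    have hw : HasDerivAt (fun t : ℝ => w₀ + t * a) a 0 := by
      simpa using ((hasDerivAt_id (0 : ℝ)).mul_const a).const_add w₀
    have hv : HasDerivAt (fun t : ℝ => v₀ + t * b) b 0 := by
      simpa using ((hasDerivAt_id (0 : ℝ)).mul_const b).const_add v₀
    have h2 : HasDerivAt (fun t : ℝ => (w₀ + t * a) * (v₀ + t * b) - x₀ (Fin.last m))
        (a * v₀ + w₀ * b) 0 := by
      simpa using (hw.mul hv).sub_const (x₀ (Fin.last m))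
    have h3 : HasDerivAt (fun t : ℝ => (v₀ + t * b) ^ 2 +
        ∑ i, x₀ i.castSucc ^ 2 / ((w₀ + t * a) ^ 2 + h i ^ 2))
        (2 * v₀ * b - 2 * w₀ * q * a) 0 := by
      have e1 : HasDerivAt (fun t : ℝ => (v₀ + t * b) ^ 2) (2 * v₀ * b) 0 := by
        simpa using hv.fun_pow 2
      have e2 : ∀ i ∈ (Finset.univ : Finset (Fin m)),
          HasDerivAt (fun t : ℝ => x₀ i.castSucc ^ 2 / ((w₀ + t * a) ^ 2 + h i ^ 2))
          (-(2 * w₀ * a) * (x₀ i.castSucc ^ 2 / (w₀ ^ 2 + h i ^ 2) ^ 2)) 0 := fun i _ => by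
        have e3 : HasDerivAt (fun t : ℝ => (w₀ + t * a) ^ 2 + h i ^ 2) (2 * w₀ * a) 0 := by
          simpa using (hw.pow 2).add_const (h i ^ 2)
        have e4 := (hasDerivAt_const (0 : ℝ) (x₀ i.castSucc ^ 2)).fun_div e3 (hpos i _).ne'
        refine e4.congr_deriv ?_
        simp
        ring
      have e5 := e1.add (HasDerivAt.fun_sum e2)
      refine e5.congr_deriv ?_
      rw [← Finset.mul_sum]
      simp only [q]
      ring
    have h4 := h2.prodMk h3
    have h5 : (F ∘ fun t : ℝ => u₀ + t • ((0 : Space (m + 1)), (a, b))) = fun t : ℝ =>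
        ((w₀ + t * a) * (v₀ + t * b) - x₀ (Fin.last m),
        (v₀ + t * b) ^ 2 + ∑ i, x₀ i.castSucc ^ 2 / ((w₀ + t * a) ^ 2 + h i ^ 2)) := by
      funext t
      simp [F, u₀]
    rw [h5] at h1
    exact h1.unique h4
  have hinv : (fderiv ℝ F u₀ ∘L .inr ℝ (Space (m + 1)) (ℝ × ℝ)).IsInvertible := by
    set Λ : ℝ × ℝ →L[ℝ] ℝ × ℝ := fderiv ℝ F u₀ ∘L .inr ℝ (Space (m + 1)) (ℝ × ℝ)
    have hΛ : ∀ a b : ℝ, Λ (a, b) = (a * v₀ + w₀ * b, 2 * v₀ * b - 2 * w₀ * q * a) := fun a b => by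
      simp only [Λ, ContinuousLinearMap.comp_apply, ContinuousLinearMap.inr_apply]
      exact hder a b
    have hinj : Function.Injective (Λ : ℝ × ℝ →ₗ[ℝ] ℝ × ℝ) := by
      rw [← LinearMap.ker_eq_bot, LinearMap.ker_eq_bot']
      rintro ⟨a, b⟩ hab
      have hab : Λ (a, b) = 0 := hab
      rw [hΛ, Prod.mk_eq_zero] at hab
      obtain ⟨e1, e2⟩ := hab
      have ha : (v₀ ^ 2 + w₀ ^ 2 * q) * a = 0 := by linear_combination v₀ * e1 - w₀ / 2 * e2
      have hb : (v₀ ^ 2 + w₀ ^ 2 * q) * b = 0 := by linear_combination (w₀ * q) * e1 + v₀ / 2 * e2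
      rw [mul_eq_zero, or_iff_right hN] at ha hb
      simp [ha, hb]
    refine ⟨(LinearEquiv.ofInjectiveEndo _ hinj).toContinuousLinearEquiv, ?_⟩
    ext <;> simp
  have hFat : ContDiffAt ℝ ∞ F u₀ := hF.contDiffAt
  set ψ := hFat.implicitFunction (by simp) hinv
  have hψ : ContDiffAt ℝ ∞ ψ x₀ := hFat.contDiffAt_implicitFunction (by simp) hinv
  have hψ0 : ψ x₀ = (w₀, v₀) := hFat.implicitFunction_apply_self (by simp) hinv
  have hFu : F u₀ = (0, 1) := by
    simp only [F, u₀, hs.last_eq, sub_self, hs.sum_eq]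
  refine ⟨fun x => (ψ x).1, fun x => (ψ x).2, contDiffAt_fst.comp x₀ hψ, contDiffAt_snd.comp x₀ hψ,
    by simp [hψ0], by simp [hψ0], ?_⟩
  filter_upwards [hFat.eventually_apply_implicitFunction (by simp) hinv] with x hx
  rw [hFu] at hx
  have e1 := congrArg Prod.fst hx
  have e2 := congrArg Prod.snd hx
  simp only [F] at e1 e2
  exact ⟨by linarith, e2⟩

end ExplicitSolution
end ZTwo

/-! ### Harmonicity of the explicit function. -/

namespace ZTwo

open InnerProductSpace

section Harmonicity

variable {m : ℕ}

theorem hasDerivAt_one_div_sqrt_S_sq {h : Fin m → ℝ} (hh : ∀ i, 0 < h i) (u : ℝ) :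
    HasDerivAt (fun u : ℝ => 1 / √(S h (u ^ 2)))
      (-(u * (∑ i, 1 / (u ^ 2 + h i ^ 2)) / √(S h (u ^ 2)))) u := by
  have h1 : HasDerivAt (fun u : ℝ => u ^ 2) (2 * u) u := by simpa using hasDerivAt_pow 2 u
  have h2 : HasDerivAt (fun u : ℝ => S h (u ^ 2))
      (S h (u ^ 2) * (∑ i, 1 / (u ^ 2 + h i ^ 2)) * (2 * u)) u :=
    HasDerivAt.comp (h₂ := S h) u (hasDerivAt_S hh u) h1
  have h3 := (h2.sqrt (S_pos hh u).ne').fun_inv (sqrt_S_pos hh u).ne'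
  simp only [← one_div] at h3
  refine h3.congr_deriv ?_
  rw [Real.sq_sqrt (S_pos hh u).le]
  have hS := S_pos hh u
  have hs := sqrt_S_pos hh u
  generalize √(S h (u ^ 2)) = s at hs ⊢
  generalize S h (u ^ 2) = t at hS ⊢
  generalize ∑ i, 1 / (u ^ 2 + h i ^ 2) = σ
  field_simp

theorem hasFDerivAt_coord (j : Fin (m + 1)) (x : Space (m + 1)) :
    HasFDerivAt (fun y : Space (m + 1) => y j)
      (EuclideanSpace.proj j : Space (m + 1) →L[ℝ] ℝ) x :=
  (EuclideanSpace.proj j : Space (m + 1) →L[ℝ] ℝ).hasFDerivAt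

theorem hasFDerivAt_sq {f : Space (m + 1) → ℝ} {f' : Space (m + 1) →L[ℝ] ℝ} {x : Space (m + 1)}
    (hf : HasFDerivAt f f' x) : HasFDerivAt (fun y => f y ^ 2) ((2 * f x) • f') x := by
  have h1 : HasDerivAt (fun u : ℝ => u ^ 2) (2 * f x) (f x) := by simpa using hasDerivAt_pow 2 (f x)
  exact HasDerivAt.comp_hasFDerivAt (h₂ := fun u : ℝ => u ^ 2) x h1 hf

theorem proj_apply (j : Fin (m + 1)) (ξ : Space (m + 1)) :
    (EuclideanSpace.proj j : Space (m + 1) →L[ℝ] ℝ) ξ = ξ j := rfl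

/-- The differentiated coordinate equations. -/
theorem sol_deriv_relations {h : Fin m → ℝ} (hh : ∀ i, 0 < h i) {x : Space (m + 1)}
    {w v : Space (m + 1) → ℝ} (hw : DifferentiableAt ℝ w x) (hv : DifferentiableAt ℝ v x)
    (hs : ∀ᶠ y in 𝓝 x, IsSol h y (w y) (v y)) (ξ : Space (m + 1)) :
    ξ (Fin.last m) = w x * fderiv ℝ v x ξ + v x * fderiv ℝ w x ξ ∧
    v x * fderiv ℝ v x ξ + ∑ i, x i.castSucc / (w x ^ 2 + h i ^ 2) * ξ i.castSucc
      - w x * (∑ i, (x i.castSucc / (w x ^ 2 + h i ^ 2)) ^ 2) * fderiv ℝ w x ξ = 0 := by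
  have hpos : ∀ i : Fin m, w x ^ 2 + h i ^ 2 ≠ 0 := fun i => by have := hh i; positivity
  constructor
  · have h1 : HasFDerivAt (fun y => w y * v y) _ x := hw.hasFDerivAt.fun_mul hv.hasFDerivAt
    have h2 : (fun y : Space (m + 1) => y (Fin.last m)) =ᶠ[𝓝 x] fun y => w y * v y :=
      hs.mono fun y hy => hy.last_eq
    have h3 := (h1.congr_of_eventuallyEq h2).unique (hasFDerivAt_coord (Fin.last m) x)
    have h4 := congrArg (fun L : Space (m + 1) →L[ℝ] ℝ => L ξ) h3
    simp only [add_apply, smul_apply, smul_eq_mul, proj_apply] at h4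
    linarith
  · have h1 : HasFDerivAt (fun y => v y ^ 2) ((2 * v x) • fderiv ℝ v x) x := 
      hasFDerivAt_sq hv.hasFDerivAt
    have h2 : ∀ i ∈ (Finset.univ : Finset (Fin m)), HasFDerivAt
        (fun y : Space (m + 1) => y i.castSucc ^ 2 * (w y ^ 2 + h i ^ 2)⁻¹)
        (x i.castSucc ^ 2 • (-((w x ^ 2 + h i ^ 2) ^ 2)⁻¹ • ((2 * w x) • fderiv ℝ w x)) +
          (w x ^ 2 + h i ^ 2)⁻¹ • ((2 * x i.castSucc) •
            (EuclideanSpace.proj i.castSucc : Space (m + 1) →L[ℝ] ℝ))) x := fun i _ => by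
      have e1 : HasFDerivAt (fun y : Space (m + 1) => y i.castSucc ^ 2) ((2 * x i.castSucc) •
            (EuclideanSpace.proj i.castSucc : Space (m + 1) →L[ℝ] ℝ)) x := 
        hasFDerivAt_sq (hasFDerivAt_coord i.castSucc x)
      have e2 : HasFDerivAt (fun y => w y ^ 2 + h i ^ 2) ((2 * w x) • fderiv ℝ w x) x := 
        (hasFDerivAt_sq hw.hasFDerivAt).add_const (h i ^ 2)
      have e3 : HasFDerivAt (fun y => (w y ^ 2 + h i ^ 2)⁻¹)
          (-((w x ^ 2 + h i ^ 2) ^ 2)⁻¹ • ((2 * w x) • fderiv ℝ w x)) x :=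
        (hasDerivAt_inv (hpos i)).comp_hasFDerivAt x e2
      exact e1.fun_mul e3
    have h3 := h1.add (HasFDerivAt.fun_sum h2)
    have h4 : (fun y => v y ^ 2 + ∑ i, y i.castSucc ^ 2 * (w y ^ 2 + h i ^ 2)⁻¹)
        =ᶠ[𝓝 x] fun _ => (1 : ℝ) := hs.mono fun y hy => by
      have := hy.sum_eq
      simpa only [div_eq_mul_inv] using this
    have h5 := h3.unique ((hasFDerivAt_const (1 : ℝ) x).congr_of_eventuallyEq h4)
    have h6 := congrArg (fun L : Space (m + 1) →L[ℝ] ℝ => L ξ) h5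
    simp only [add_apply, smul_apply, smul_eq_mul,
      sum_apply, zero_apply, proj_apply] at h6
    have h7 : ∑ i : Fin m, (x i.castSucc ^ 2 * (-((w x ^ 2 + h i ^ 2) ^ 2)⁻¹ *
        (2 * w x * fderiv ℝ w x ξ)) + (w x ^ 2 + h i ^ 2)⁻¹ * (2 * x i.castSucc * ξ i.castSucc)) =
        2 * ∑ i, x i.castSucc / (w x ^ 2 + h i ^ 2) * ξ i.castSucc
        - 2 * (w x * (∑ i, (x i.castSucc / (w x ^ 2 + h i ^ 2)) ^ 2) * fderiv ℝ w x ξ) := by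
      rw [Finset.mul_sum, Finset.mul_sum, Finset.sum_mul, Finset.mul_sum, ← Finset.sum_sub_distrib]
      refine Finset.sum_congr rfl fun i _ => ?_
      have := hpos i
      field_simp
      ring
    rw [h7] at h6
    linarith

/-- The last component of the gradient of the explicit solution. -/
noncomputable def gradLast (h : Fin m → ℝ) (x : Space (m + 1)) (w v : ℝ) : ℝ :=
  x (Fin.last m) * ∑ i, primCoeff h i w + v * (1 / √(S h (w ^ 2)))

/-- The derivative of the explicit solution. -/
noncomputable def gradForm (h : Fin m → ℝ) (x : Space (m + 1)) (w v : ℝ) :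
    Space (m + 1) →L[ℝ] ℝ :=
  (∏ j, h j) • (gradLast h x w v • (EuclideanSpace.proj (Fin.last m) : Space (m + 1) →L[ℝ] ℝ) -
    ∑ i : Fin m, (x i.castSucc * primCoeff h i w) •
      (EuclideanSpace.proj i.castSucc : Space (m + 1) →L[ℝ] ℝ))

/-- All derivatives of w and v cancel by the coordinate equations, the integrand being zero at its
upper limit; only the explicit dependence on x contributes. In particular the gradient is again a
simple expression in the same primitives. -/
theorem hasFDerivAt_Phi {h : Fin m → ℝ} (hh : ∀ i, 0 < h i) {x : Space (m + 1)}
    {w v : Space (m + 1) → ℝ} (hw : DifferentiableAt ℝ w x) (hv : DifferentiableAt ℝ v x)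
    (hs : ∀ᶠ y in 𝓝 x, IsSol h y (w y) (v y)) :
    HasFDerivAt (fun y => Phi h y (w y) (v y)) (gradForm h x (w x) (v x)) x := by
  have hsx := hs.self_of_nhds
  set dw := fderiv ℝ w x
  set dv := fderiv ℝ v x
  set pr : Fin (m + 1) → Space (m + 1) →L[ℝ] ℝ := fun j => EuclideanSpace.proj j
  set s := √(S h (w x ^ 2))
  have hspos : 0 < s := sqrt_S_pos hh (w x)
  set c : Fin m → ℝ := fun i => 1 / ((w x ^ 2 + h i ^ 2) * s)
  have hprim : ∀ i, HasFDerivAt (fun y => primCoeff h i (w y)) (c i • dw) x := fun i =>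
    (hasDerivAt_primCoeff hh i (w x)).comp_hasFDerivAt x hw.hasFDerivAt
  have hA : HasFDerivAt (fun y => primZero h (w y)) ((1 / s) • dw) x :=
    (hasDerivAt_primZero hh (w x)).comp_hasFDerivAt x hw.hasFDerivAt
  have hsq : ∀ j, HasFDerivAt (fun y : Space (m + 1) => y j ^ 2) ((2 * x j) • pr j) x := fun j => 
    hasFDerivAt_sq (hasFDerivAt_coord j x)
  have hB : HasFDerivAt (fun y : Space (m + 1) => ∑ i, y i.castSucc ^ 2 * primCoeff h i (w y))
      (∑ i : Fin m, (x i.castSucc ^ 2 • (c i • dw) +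
        primCoeff h i (w x) • ((2 * x i.castSucc) • pr i.castSucc))) x :=
    HasFDerivAt.fun_sum fun i _ => (hsq i.castSucc).fun_mul (hprim i)
  have hC : HasFDerivAt (fun y : Space (m + 1) => y (Fin.last m) ^ 2 * ∑ i, primCoeff h i (w y))
      (x (Fin.last m) ^ 2 • (∑ i, c i • dw) +
        (∑ i, primCoeff h i (w x)) • ((2 * x (Fin.last m)) • pr (Fin.last m))) x :=
    (hsq (Fin.last m)).fun_mul (HasFDerivAt.fun_sum fun i _ => hprim i)
  have hr : HasFDerivAt (fun y => 1 / √(S h (w y ^ 2)))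
      (-(w x * (∑ i, 1 / (w x ^ 2 + h i ^ 2)) / s) • dw) x :=
    (hasDerivAt_one_div_sqrt_S_sq hh (w x)).comp_hasFDerivAt x hw.hasFDerivAt
  have hD := ((hasFDerivAt_coord (Fin.last m) x).fun_mul hv.hasFDerivAt).fun_mul hr
  have hall := (((hA.sub hB).add hC).add hD).const_mul ((∏ j, h j) / 2)
  have hfun : (fun y => Phi h y (w y) (v y)) = fun y => (∏ j, h j) / 2 *
      ((((primZero h (w y)) - ∑ i, y i.castSucc ^ 2 * primCoeff h i (w y)) +
        y (Fin.last m) ^ 2 * ∑ i, primCoeff h i (w y)) +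
        y (Fin.last m) * v y * (1 / √(S h (w y ^ 2)))) := by
    funext y
    rw [Phi, mul_one_div]
  rw [hfun]
  refine hall.congr_fderiv ?_
  ext ξ
  obtain ⟨r1, -⟩ := sol_deriv_relations hh hw hv hs ξ
  have e1 := hsx.last_eq
  have e2 := hsx.sum_eq
  simp only [gradForm, gradLast, pr, add_apply, sub_apply,
    smul_apply, smul_eq_mul, sum_apply,
    proj_apply]
  have hσ : ∑ i, c i * dw ξ = (∑ i, 1 / (w x ^ 2 + h i ^ 2)) * (1 / s) * dw ξ := by
    rw [Finset.sum_mul, Finset.sum_mul]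
    refine Finset.sum_congr rfl fun i _ => ?_
    simp only [c]
    rw [one_div, mul_inv, one_div, one_div]
  have hBsum : ∑ i : Fin m, (x i.castSucc ^ 2 * (c i * dw ξ) +
      primCoeff h i (w x) * (2 * x i.castSucc * ξ i.castSucc)) =
      (1 - v x ^ 2) * (1 / s) * dw ξ +
        2 * ∑ i : Fin m, x i.castSucc * primCoeff h i (w x) * ξ i.castSucc := by
    have e3 : 1 - v x ^ 2 = ∑ i, x i.castSucc ^ 2 / (w x ^ 2 + h i ^ 2) := by linarith
    rw [e3, Finset.sum_mul, Finset.sum_mul, Finset.mul_sum, ← Finset.sum_add_distrib]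
    refine Finset.sum_congr rfl fun i _ => ?_
    simp only [c]
    rw [one_div, mul_inv, one_div]
    ring
  rw [hσ, hBsum]
  change ξ (Fin.last m) = w x * dv ξ + v x * dw ξ at r1
  change (∏ j, h j) / 2 * _ = _
  linear_combination ((∏ j, h j) / 2) * ((x (Fin.last m) * (∑ i, 1 / (w x ^ 2 + h i ^ 2)) *
    (1 / s) * dw ξ + (1 / s) * dv ξ) * e1 - (1 / s) * v x * r1)

/-- Taking the divergence of `gradForm`, the primitives cancel between the last direction and the
others, and the terms in ∂ₙw cancel since x_n = w v. What is left is a multiple of ∂ₙv - ∑ xᵢ/(w² +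
hᵢ²) ∂ᵢw. -/
theorem laplacian_Phi {h : Fin m → ℝ} (hh : ∀ i, 0 < h i) {x : Space (m + 1)}
    (hx : x ∉ ellipsoid (.refl ℝ _) h)
    {w v : Space (m + 1) → ℝ} (hw : ContDiffAt ℝ 1 w x) (hv : ContDiffAt ℝ 1 v x)
    (hs : ∀ᶠ y in 𝓝 x, IsSol h y (w y) (v y)) :
    Laplacian.laplacian (fun y => Phi h y (w y) (v y)) x = 0 := by
  have hsx := hs.self_of_nhds
  have hwd : DifferentiableAt ℝ w x := hw.differentiableAt (by simp)
  have hvd : DifferentiableAt ℝ v x := hv.differentiableAt (by simp)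
  set dw := fderiv ℝ w x with hdw
  set dv := fderiv ℝ v x with hdv
  set s := √(S h (w x ^ 2)) with hsdef
  have hspos : 0 < s := sqrt_S_pos hh (w x)
  set c : Fin m → ℝ := fun i => 1 / ((w x ^ 2 + h i ^ 2) * s)
  have hprim : ∀ i, HasFDerivAt (fun y => primCoeff h i (w y)) (c i • dw) x := fun i =>
    (hasDerivAt_primCoeff hh i (w x)).comp_hasFDerivAt x hwd.hasFDerivAt
  have hr : HasFDerivAt (fun y => 1 / √(S h (w y ^ 2)))
      (-(w x * (∑ i, 1 / (w x ^ 2 + h i ^ 2)) / s) • dw) x :=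
    (hasDerivAt_one_div_sqrt_S_sq hh (w x)).comp_hasFDerivAt x hwd.hasFDerivAt
  have hL : HasFDerivAt (fun y => gradLast h y (w y) (v y)) _ x :=
    ((hasFDerivAt_coord (Fin.last m) x).fun_mul (HasFDerivAt.fun_sum (u := Finset.univ)
      fun i _ => hprim i)).fun_add (hvd.hasFDerivAt.fun_mul hr)
  have hI : ∀ i ∈ (Finset.univ : Finset (Fin m)), HasFDerivAt
      (fun y : Space (m + 1) => (y i.castSucc * primCoeff h i (w y)) •
        (EuclideanSpace.proj i.castSucc : Space (m + 1) →L[ℝ] ℝ))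
      ((x i.castSucc • (c i • dw) + primCoeff h i (w x) •
        (EuclideanSpace.proj i.castSucc : Space (m + 1) →L[ℝ] ℝ)).smulRight
        (EuclideanSpace.proj i.castSucc : Space (m + 1) →L[ℝ] ℝ)) x := fun i _ =>
    HasFDerivAt.smul_const (F := Space (m + 1) →L[ℝ] ℝ)
      ((hasFDerivAt_coord i.castSucc x).fun_mul (hprim i)) (EuclideanSpace.proj i.castSucc)
  have h2 : HasFDerivAt (fun y => gradForm h y (w y) (v y)) _ x :=
    ((HasFDerivAt.smul_const (F := Space (m + 1) →L[ℝ] ℝ) hL (EuclideanSpace.proj (Fin.last m))).sub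
      (HasFDerivAt.fun_sum hI)).const_smul (∏ j, h j)
  have h1 : ∀ᶠ y in 𝓝 x, HasFDerivAt (fun y => Phi h y (w y) (v y))
      (gradForm h y (w y) (v y)) y := by
    filter_upwards [hs.eventually_nhds, hw.eventually (by simp),
      hv.eventually (by simp)] with y h1 h2 h3
    exact hasFDerivAt_Phi hh (h2.differentiableAt (by simp)) (h3.differentiableAt (by simp)) h1
  rw [laplacian_eq_of_hasFDerivAt (EuclideanSpace.basisFun (Fin (m + 1)) ℝ) h1 h2]
  have hN := hsx.discr_ne_zero hh hx
  set q : ℝ := ∑ i, x i.castSucc ^ 2 / (w x ^ 2 + h i ^ 2) ^ 2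
  have hq : ∑ i, (x i.castSucc / (w x ^ 2 + h i ^ 2)) ^ 2 = q := by simp only [div_pow, q]
  have hrel := sol_deriv_relations hh hwd hvd hs
  simp only [← hdw, ← hdv, hq] at hrel
  set e : Fin (m + 1) → Space (m + 1) := fun j => EuclideanSpace.single j 1
  have hee : ∀ j k, e j k = if k = j then 1 else 0 := fun j k => by simp [e]
  have hn : (v x ^ 2 + w x ^ 2 * q) * dv (e (Fin.last m)) = w x * q := by
    obtain ⟨r1, r2⟩ := hrel (e (Fin.last m))
    have h3 : ∑ i : Fin m, x i.castSucc / (w x ^ 2 + h i ^ 2) * e (Fin.last m) i.castSucc = 0 :=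
      Finset.sum_eq_zero fun i _ => by simp [hee, (Fin.castSucc_lt_last i).ne]
    rw [h3] at r2
    rw [hee, if_pos rfl] at r1
    linear_combination v x * r2 - w x * q * r1
  have hi : ∀ i : Fin m, (v x ^ 2 + w x ^ 2 * q) * dw (e i.castSucc) =
      w x * (x i.castSucc / (w x ^ 2 + h i ^ 2)) := fun i => by
    obtain ⟨r1, r2⟩ := hrel (e i.castSucc)
    have h3 : ∑ k : Fin m, x k.castSucc / (w x ^ 2 + h k ^ 2) * e i.castSucc k.castSucc =
        x i.castSucc / (w x ^ 2 + h i ^ 2) := by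
      simp [hee]
    rw [h3] at r2
    rw [hee, if_neg (Fin.castSucc_lt_last i).ne'] at r1
    linear_combination -v x * r1 - w x * r2
  -- The differentiated coordinate equations determine both sides up to the nonzero discriminant: it
  -- multiplies ∂ₙv to w q and ∂ᵢw to w xᵢ/(w² + hᵢ²), where q = ∑ xᵢ²/(w² + hᵢ²)².
  have hsum : dv (e (Fin.last m)) = ∑ i : Fin m, x i.castSucc / (w x ^ 2 + h i ^ 2) *
      dw (e i.castSucc) := by
    refine mul_left_cancel₀ hN ?_
    have h3 : ∀ i : Fin m, (v x ^ 2 + w x ^ 2 * q) * (x i.castSucc / (w x ^ 2 + h i ^ 2) *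
        dw (e i.castSucc)) = w x * (x i.castSucc / (w x ^ 2 + h i ^ 2)) ^ 2 := fun i => by
      linear_combination (x i.castSucc / (w x ^ 2 + h i ^ 2)) * hi i
    rw [Finset.mul_sum Finset.univ _ (v x ^ 2 + w x ^ 2 * q), Finset.sum_congr rfl fun i _ => h3 i,
      ← Finset.mul_sum, hq, hn]
  have hbasis : ∀ j, EuclideanSpace.basisFun (Fin (m + 1)) ℝ j = e j := fun j => by simp [e]
  simp only [hbasis]
  rw [Fin.sum_univ_castSucc]
  simp only [smul_apply, sub_apply, add_apply, sum_apply, ContinuousLinearMap.smulRight_apply,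
    smul_eq_mul, proj_apply, hee, Fin.castSucc_inj, Fin.castSucc_ne_last, (Fin.castSucc_ne_last _).symm,
    if_true, if_false, mul_zero, mul_one, mul_ite, Finset.sum_ite_eq', Finset.mem_univ, zero_sub,
    Finset.sum_const_zero, sub_zero]
  have hfirst : ∑ i : Fin m, (∏ j, h j) * -(x i.castSucc * (c i * dw (e i.castSucc)) +
      primCoeff h i (w x)) = -(∏ j, h j) * ((1 / s) * dv (e (Fin.last m)) +
        ∑ i, primCoeff h i (w x)) := by
    rw [hsum, Finset.mul_sum, ← Finset.sum_add_distrib, Finset.mul_sum]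
    refine Finset.sum_congr rfl fun i _ => ?_
    simp only [c]
    rw [one_div, mul_inv, one_div]
    ring
  have hσ : ∑ i, c i * dw (e (Fin.last m)) =
      (∑ i, 1 / (w x ^ 2 + h i ^ 2)) * (1 / s) * dw (e (Fin.last m)) := by
    rw [Finset.sum_mul, Finset.sum_mul]
    refine Finset.sum_congr rfl fun i _ => ?_
    simp only [c]
    rw [one_div, mul_inv, one_div, one_div]
  rw [hfirst, hσ, ← hdv, ← hsdef, hsx.last_eq]
  ring

theorem contDiffAt_Phi {h : Fin m → ℝ} (hh : ∀ i, 0 < h i) {x : Space (m + 1)}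
    {w v : Space (m + 1) → ℝ} (hw : ContDiffAt ℝ ∞ w x) (hv : ContDiffAt ℝ ∞ v x) :
    ContDiffAt ℝ ∞ (fun y => Phi h y (w y) (v y)) x := by
  have hcoord : ∀ j, ContDiffAt ℝ ∞ (fun y : Space (m + 1) => y j) x := fun j => by fun_prop
  have h0 : ContDiffAt ℝ ∞ (fun y => primZero h (w y)) x := (contDiff_primZero hh).contDiffAt.comp x hw
  have hi : ∀ i, ContDiffAt ℝ ∞ (fun y => primCoeff h i (w y)) x := fun i =>
    (contDiff_primCoeff hh i).contDiffAt.comp x hw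
  have hS : ContDiffAt ℝ ∞ (fun y => √(S h (w y ^ 2))) x :=
    (contDiff_sqrt_S hh).contDiffAt.comp x hw
  unfold Phi
  refine contDiffAt_const.mul (((h0.sub (ContDiffAt.sum fun i _ => ((hcoord _).pow 2).mul (hi i))).add
    (((hcoord _).pow 2).mul (ContDiffAt.sum fun i _ => hi i))).add
    (((hcoord _).mul hv).div hS (sqrt_S_pos hh _).ne'))

/-- The value of the explicit function at the coordinates `(w, v)` with `a w + b v > 0`. -/
noncomputable def gBr (h : Fin m → ℝ) (a b : ℝ) (x : Space (m + 1)) : ℝ :=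
  open Classical in
  if 0 < a * wAbs h x + b * vSel h x then Phi h x (wAbs h x) (vSel h x)
  else Phi h x (-wAbs h x) (-vSel h x)

theorem gBr_eq {h : Fin m → ℝ} (hh : ∀ i, 0 < h i) {x : Space (m + 1)} {w v a b : ℝ}
    (hs : IsSol h x w v) (hab : 0 < a * w + b * v) : gBr h a b x = Phi h x w v := by
  rcases (wAbs_spec hh x).2.eq_or_eq_neg hh hs with ⟨rfl, rfl⟩ | ⟨rfl, rfl⟩
  · rw [gBr, if_pos hab]
  · rw [gBr, if_neg (by linarith)]

/-- The sign of a w + b v singles out a sheet, and stays positive along the smooth local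
coordinates. Off the ellipsoid `(a, b) = (w₀, v₀)` always works; on the outer region `(1, 0)` works
everywhere at once. -/
theorem gBr_germ {h : Fin m → ℝ} (hh : ∀ i, 0 < h i) {x₀ : Space (m + 1)} {w₀ v₀ a b : ℝ}
    (hs : IsSol h x₀ w₀ v₀) (hx₀ : x₀ ∉ ellipsoid (.refl ℝ _) h) (hab : 0 < a * w₀ + b * v₀) :
    IsBranchAt (model h) x₀ (gBr h a b) ∧ fderiv ℝ (gBr h a b) x₀ = gradForm h x₀ w₀ v₀ := by
  obtain ⟨w, v, hw, hv, rfl, rfl, hsol⟩ := exists_local_sol hh hs hx₀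
  have hpos : ∀ᶠ y in 𝓝 x₀, 0 < a * w y + b * v y :=
    ((hw.continuousAt.const_mul a).add (hv.continuousAt.const_mul b)).eventually_const_lt hab
  have heq : gBr h a b =ᶠ[𝓝 x₀] fun y => Phi h y (w y) (v y) := by
    filter_upwards [hsol, hpos] with y h1 h2 using gBr_eq hh h1 h2
  have hlap : ∀ᶠ y in 𝓝 x₀, Laplacian.laplacian (fun y => Phi h y (w y) (v y)) y = 0 := by
    filter_upwards [hsol.eventually_nhds, (hw.of_le (by simp) : ContDiffAt ℝ 1 w x₀).eventually (by simp),
      (hv.of_le (by simp) : ContDiffAt ℝ 1 v x₀).eventually (by simp),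
      (isCompact_ellipsoid_refl hh).isClosed.isOpen_compl.mem_nhds hx₀] with y h1 h2 h3 h4
    exact laplacian_Phi hh h4 h2 h3 h1
  have hharm : HarmonicAt (fun y => Phi h y (w y) (v y)) x₀ :=
    ⟨(contDiffAt_Phi hh hw hv).of_le (by norm_cast), hlap⟩
  refine ⟨⟨(harmonicAt_congr_nhds heq).2 hharm, ?_⟩, ?_⟩
  · filter_upwards [hsol, heq] with y h1 h2
    rw [h2, model_eq hh h1]
  · rw [heq.fderiv_eq]
    exact (hasFDerivAt_Phi hh (hw.differentiableAt (by simp)) (hv.differentiableAt (by simp)) hsol).fderiv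

theorem gBr_eventuallyEq {h : Fin m → ℝ} (hh : ∀ i, 0 < h i) {x₀ : Space (m + 1)}
    {w₀ v₀ a b a' b' : ℝ} (hs : IsSol h x₀ w₀ v₀) (hx₀ : x₀ ∉ ellipsoid (.refl ℝ _) h)
    (hab : 0 < a * w₀ + b * v₀) (hab' : 0 < a' * w₀ + b' * v₀) :
    gBr h a b =ᶠ[𝓝 x₀] gBr h a' b' := by
  obtain ⟨w, v, hw, hv, rfl, rfl, hsol⟩ := exists_local_sol hh hs hx₀
  have hpos : ∀ {a b : ℝ}, 0 < a * w x₀ + b * v x₀ → ∀ᶠ y in 𝓝 x₀, 0 < a * w y + b * v y :=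
    fun hab => ((hw.continuousAt.const_mul _).add (hv.continuousAt.const_mul _)).eventually_const_lt hab
  filter_upwards [hsol, hpos hab, hpos hab'] with y h1 h2 h3
  rw [gBr_eq hh h1 h2, gBr_eq hh h1 h3]

theorem gBr_neg_eventuallyEq {h : Fin m → ℝ} (hh : ∀ i, 0 < h i) {x₀ : Space (m + 1)}
    {w₀ v₀ a b : ℝ} (hs : IsSol h x₀ w₀ v₀) (hx₀ : x₀ ∉ ellipsoid (.refl ℝ _) h)
    (hab : 0 < a * w₀ + b * v₀) : gBr h (-a) (-b) =ᶠ[𝓝 x₀] fun y => -gBr h a b y := by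
  obtain ⟨w, v, hw, hv, rfl, rfl, hsol⟩ := exists_local_sol hh hs hx₀
  have hpos : ∀ᶠ y in 𝓝 x₀, 0 < a * w y + b * v y :=
    ((hw.continuousAt.const_mul a).add (hv.continuousAt.const_mul b)).eventually_const_lt hab
  filter_upwards [hsol, hpos] with y h1 h2
  rw [gBr_eq hh h1 h2, gBr_eq hh h1.neg (by linarith : 0 < -a * -w y + -b * -v y), Phi_neg]

theorem norm_gradForm_sq (h : Fin m → ℝ) (x : Space (m + 1)) (w v : ℝ) :
    ‖gradForm h x w v‖ ^ 2 = (∏ j, h j) ^ 2 *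
      (∑ i : Fin m, (x i.castSucc * primCoeff h i w) ^ 2 + gradLast h x w v ^ 2) := by
  set u : Space (m + 1) := WithLp.toLp 2 (Fin.snoc (α := fun _ => ℝ)
    (fun i => -(x i.castSucc * primCoeff h i w)) (gradLast h x w v))
  have hu : gradForm h x w v = innerSL ℝ ((∏ j, h j) • u) := by
    ext ξ
    simp only [gradForm, smul_apply, sub_apply, sum_apply, smul_eq_mul, proj_apply, map_smul,
      innerSL_apply_apply]
    rw [PiLp.inner_apply, Fin.sum_univ_castSucc]
    simp [u, Finset.sum_neg_distrib, mul_comm]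
    exact Or.inl (by ring)
  rw [hu, innerSL_apply_norm, norm_smul, mul_pow, Real.norm_eq_abs, sq_abs, norm_sq_eq_sum]
  simp [u]

end Harmonicity
end ZTwo

/-! ### The explicit function is ℤ₂-harmonic. -/

namespace ZTwo

open InnerProductSpace

section ModelHarmonic

variable {m : ℕ}

theorem model_eq_zero {h : Fin m → ℝ} (hh : ∀ i, 0 < h i) {p : Space (m + 1)}
    (hp : p ∈ ellipsoid (.refl ℝ _) h) : model h p = {0} := by
  obtain ⟨-, hs⟩ := wAbs_spec hh p
  obtain ⟨h1, h2⟩ := (hs.eq_zero_iff hh).2 hp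
  rw [model_eq hh hs, h1, h2]
  simp [Phi, primZero, primCoeff]

theorem IsSol.sq_add_sq_pos {h : Fin m → ℝ} (hh : ∀ i, 0 < h i) {x : Space (m + 1)} {w v : ℝ}
    (hs : IsSol h x w v) (hx : x ∉ ellipsoid (.refl ℝ _) h) : 0 < w * w + v * v := by
  rcases eq_or_ne w 0 with hw | hw
  · have hv : v ≠ 0 := fun hv => hx ((hs.eq_zero_iff hh).1 ⟨hw, hv⟩)
    have := mul_self_pos.2 hv
    have := mul_self_nonneg w
    linarith
  · have := mul_self_pos.2 hw
    have := mul_self_nonneg v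
    linarith

theorem exists_isBranchAt_model {h : Fin m → ℝ} (hh : ∀ i, 0 < h i) {x : Space (m + 1)}
    (hx : x ∉ ellipsoid (.refl ℝ _) h) : ∃ g, IsBranchAt (model h) x g := by
  obtain ⟨-, hs⟩ := wAbs_spec hh x
  exact ⟨_, (gBr_germ hh hs hx (hs.sq_add_sq_pos hh hx)).1⟩

theorem IsBranchAt.eventuallyEq_or {n : ℕ} [NeZero n] {f : TwoValued n} {x : Space n}
    {g g' : Space n → ℝ} (hg : IsBranchAt f x g) (hg' : IsBranchAt f x g') :
    g =ᶠ[𝓝 x] g' ∨ g =ᶠ[𝓝 x] fun y => -g' y := by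
  obtain ⟨ρ, hρ, -, h1⟩ := hg.exists_ball univ_mem
  obtain ⟨ρ', hρ', hsub, h2⟩ := hg'.exists_ball (Metric.ball_mem_nhds x hρ)
  rcases (h1.mono hsub).eq_or_eq_neg h2 Metric.isOpen_ball
    (Metric.isConnected_ball hρ').isPreconnected with h3 | h3
  · exact Or.inl (mem_of_superset (Metric.ball_mem_nhds x hρ') h3)
  · exact Or.inr (mem_of_superset (Metric.ball_mem_nhds x hρ') h3)

theorem model_sq {h : Fin m → ℝ} (hh : ∀ i, 0 < h i) {x : Space (m + 1)}
    {g : Space (m + 1) → ℝ} (hg : IsBranchAt (model h) x g) :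
    Phi h x (wAbs h x) (vSel h x) ^ 2 = g x ^ 2 := by
  have h1 := hg.2.self_of_nhds
  rw [model_eq hh (wAbs_spec hh x).2, pair_neg_eq_iff] at h1
  rcases h1 with h1 | h1 <;> rw [h1]
  ring

/-- The selected v need not be continuous, but it enters only through x_n v = w |v|², and w and |v|
are continuous on the whole space. Local square integrability follows from continuity, here and for
the gradient below. -/
theorem continuous_Phi_sel {h : Fin m → ℝ} (hh : ∀ i, 0 < h i) :
    Continuous fun x => Phi h x (wAbs h x) (vSel h x) := by
  have hw := continuous_wAbs hh
  have hv := continuous_abs_vSel hh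
  have hcoord : ∀ j, Continuous fun y : Space (m + 1) => y j := fun j => by fun_prop
  have h0 : Continuous fun y => primZero h (wAbs h y) := (contDiff_primZero hh).continuous.comp hw
  have hi : ∀ i, Continuous fun y => primCoeff h i (wAbs h y) := fun i =>
    (contDiff_primCoeff hh i).continuous.comp hw
  have hS : Continuous fun y => √(S h (wAbs h y ^ 2)) := (contDiff_sqrt_S hh).continuous.comp hw
  have heq : (fun x => Phi h x (wAbs h x) (vSel h x)) = fun x => (∏ j, h j) / 2 *
      (primZero h (wAbs h x) - ∑ i, x i.castSucc ^ 2 * primCoeff h i (wAbs h x)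
      + x (Fin.last m) ^ 2 * ∑ i, primCoeff h i (wAbs h x) +
      wAbs h x * |vSel h x| ^ 2 / √(S h (wAbs h x ^ 2))) := by
    funext x
    have h1 : x (Fin.last m) * vSel h x = wAbs h x * |vSel h x| ^ 2 := by
      rw [(wAbs_spec hh x).2.last_eq, sq_abs]; ring
    rw [Phi, h1]
  rw [heq]
  exact continuous_const.mul (((h0.sub (continuous_finsetSum _ fun i _ =>
    ((hcoord _).pow 2).mul (hi i))).add (((hcoord _).pow 2).mul (continuous_finsetSum _ fun i _ => hi i))).add
    ((hw.mul (hv.pow 2)).div hS fun x => (sqrt_S_pos hh _).ne'))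

theorem continuous_norm_gradForm_sq {h : Fin m → ℝ} (hh : ∀ i, 0 < h i) :
    Continuous fun x => ‖gradForm h x (wAbs h x) (vSel h x)‖ ^ 2 := by
  have hw := continuous_wAbs hh
  have hv := continuous_abs_vSel hh
  have hcoord : ∀ j, Continuous fun y : Space (m + 1) => y j := fun j => by fun_prop
  have hi : ∀ i, Continuous fun y => primCoeff h i (wAbs h y) := fun i =>
    (contDiff_primCoeff hh i).continuous.comp hw
  have hS : Continuous fun y => √(S h (wAbs h y ^ 2)) := (contDiff_sqrt_S hh).continuous.comp hw
  have heq : (fun x => ‖gradForm h x (wAbs h x) (vSel h x)‖ ^ 2) = fun x => (∏ j, h j) ^ 2 *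
      (∑ i : Fin m, (x i.castSucc * primCoeff h i (wAbs h x)) ^ 2 + (|vSel h x| *
        (wAbs h x * ∑ i, primCoeff h i (wAbs h x) + 1 / √(S h (wAbs h x ^ 2)))) ^ 2) := by
    funext x
    rw [norm_gradForm_sq, gradLast, (wAbs_spec hh x).2.last_eq, mul_pow |vSel h x|, sq_abs]
    ring
  rw [heq]
  have hS' : Continuous fun y => 1 / √(S h (wAbs h y ^ 2)) :=
    continuous_const.div hS fun x => (sqrt_S_pos hh _).ne'
  fun_prop

theorem model_grad_sq {h : Fin m → ℝ} (hh : ∀ i, 0 < h i) {x : Space (m + 1)}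
    (hx : x ∉ ellipsoid (.refl ℝ _) h) {g : Space (m + 1) → ℝ} (hg : IsBranchAt (model h) x g) :
    ‖gradForm h x (wAbs h x) (vSel h x)‖ ^ 2 = ‖fderiv ℝ g x‖ ^ 2 := by
  obtain ⟨-, hs⟩ := wAbs_spec hh x
  obtain ⟨h1, h2⟩ := gBr_germ hh hs hx (hs.sq_add_sq_pos hh hx)
  rw [← h2]
  rcases hg.eventuallyEq_or h1 with h3 | h3
  · rw [h3.fderiv_eq]
  · rw [h3.fderiv_eq, fderiv_fun_neg, norm_neg]

/-- The sign jumps only at zeros of a, where b vanishes too. This is how w and v are continued along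
a circle: the sign is that of cos(θ/2) or sin(θ/2), and the size is the continuous absolute value.
-/
theorem continuous_sign_mul {a b : ℝ → ℝ} (ha : Continuous a) (hb : Continuous b)
    (hab : ∀ t, a t = 0 → b t = 0) : Continuous fun t => Real.sign (a t) * b t := by
  rw [continuous_iff_continuousAt]
  intro t
  rcases lt_trichotomy (a t) 0 with h | h | h
  · refine (hb.neg.continuousAt).congr ?_
    filter_upwards [ha.continuousAt.eventually_lt_const h] with s hs
    rw [Real.sign_of_neg hs]; simp
  · have h1 : Real.sign (a t) * b t = 0 := by rw [hab t h, mul_zero]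
    rw [ContinuousAt, h1]
    refine squeeze_zero_norm (fun s => ?_) (?_ : Tendsto (fun s => |b s|) (𝓝 t) (𝓝 0))
    · rw [Real.norm_eq_abs, abs_mul]
      have : |Real.sign (a s)| ≤ 1 := by
        rcases Real.sign_apply_eq (a s) with h | h | h <;> rw [h] <;> simp
      exact mul_le_of_le_one_left (abs_nonneg _) this
    · have := hb.abs.continuousAt (x := t)
      rw [ContinuousAt, hab t h, abs_zero] at this
      exact this
  · refine hb.continuousAt.congr ?_
    filter_upwards [ha.continuousAt.eventually_const_lt h] with s hs
    rw [Real.sign_of_pos hs]; simp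

/-- The point of the circle around `p` normal to the standard ellipsoid. -/
noncomputable abbrev circPt (h : Fin m → ℝ) (p : Space (m + 1)) (r θ : ℝ) : Space (m + 1) :=
  normalCircle (normalOne (.refl ℝ _) h) (normalTwo (.refl ℝ _)) p r θ

/-- The coordinate `w` continued along a normal circle. -/
noncomputable def circW (h : Fin m → ℝ) (p : Space (m + 1)) (r θ : ℝ) : ℝ :=
  Real.sign (Real.cos (θ / 2)) * wAbs h (circPt h p r θ)

/-- The coordinate `v` continued along a normal circle. -/
noncomputable def circV (h : Fin m → ℝ) (p : Space (m + 1)) (r θ : ℝ) : ℝ :=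
  Real.sign (Real.sin (θ / 2)) * |vSel h (circPt h p r θ)|

theorem circPt_add_two_pi (h : Fin m → ℝ) (p : Space (m + 1)) (r θ : ℝ) :
    circPt h p r (θ + 2 * Real.pi) = circPt h p r θ := by
  simp [circPt, normalCircle]

theorem circW_add_two_pi (h : Fin m → ℝ) (p : Space (m + 1)) (r θ : ℝ) :
    circW h p r (θ + 2 * Real.pi) = -circW h p r θ := by
  have : (θ + 2 * Real.pi) / 2 = θ / 2 + Real.pi := by ring
  rw [circW, circW, circPt_add_two_pi, this, Real.cos_add_pi, Real.sign_neg]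
  ring

theorem circV_add_two_pi (h : Fin m → ℝ) (p : Space (m + 1)) (r θ : ℝ) :
    circV h p r (θ + 2 * Real.pi) = -circV h p r θ := by
  have : (θ + 2 * Real.pi) / 2 = θ / 2 + Real.pi := by ring
  rw [circV, circV, circPt_add_two_pi, this, Real.sin_add_pi, Real.sign_neg]
  ring

/-- A radius below which the normal circles avoid the ellipsoid and wind around it once. -/
structure IsSmallRadius (h : Fin m → ℝ) (r : ℝ) : Prop where
  pos : 0 < r
  notMem : ∀ p ∈ ellipsoid (.refl ℝ _) h, ∀ θ, circPt h p r θ ∉ ellipsoid (.refl ℝ _) h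
  outer : ∀ p ∈ ellipsoid (.refl ℝ _) h, ∀ θ, Real.cos θ = 1 → 1 < qform h (circPt h p r θ)
  inner : ∀ p ∈ ellipsoid (.refl ℝ _) h, ∀ θ, Real.cos θ = -1 → qform h (circPt h p r θ) < 1

theorem cos_eq_half (θ : ℝ) : Real.cos θ = 2 * Real.cos (θ / 2) ^ 2 - 1 := by
  rw [← Real.cos_two_mul]; ring_nf

theorem cos_eq_half' (θ : ℝ) : Real.cos θ = 1 - 2 * Real.sin (θ / 2) ^ 2 := by
  have := Real.sin_sq_add_cos_sq (θ / 2)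
  rw [cos_eq_half]; linarith

theorem sin_eq_half (θ : ℝ) : Real.sin θ = 2 * Real.sin (θ / 2) * Real.cos (θ / 2) := by
  rw [← Real.sin_two_mul]; ring_nf

theorem wAbs_circPt_eq_zero
    {h : Fin m → ℝ} (hh : ∀ i, 0 < h i) {r : ℝ} (hr : IsSmallRadius h r) {p : Space (m + 1)}
    (hp : p ∈ ellipsoid (.refl ℝ _) h)
    {θ : ℝ} (hθ : Real.cos (θ / 2) = 0) : wAbs h (circPt h p r θ) = 0 := by
  rw [wAbs_eq_zero_iff hh]
  have h1 : Real.cos θ = -1 := by rw [cos_eq_half, hθ]; norm_num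
  refine ⟨?_, (hr.inner p hp θ h1).le⟩
  rw [normalCircle_last hp, sin_eq_half, hθ]
  ring

theorem vSel_circPt_eq_zero
    {h : Fin m → ℝ} (hh : ∀ i, 0 < h i) {r : ℝ} (hr : IsSmallRadius h r) {p : Space (m + 1)}
    (hp : p ∈ ellipsoid (.refl ℝ _) h)
    {θ : ℝ} (hθ : Real.sin (θ / 2) = 0) : vSel h (circPt h p r θ) = 0 := by
  have h1 : Real.cos θ = 1 := by rw [cos_eq_half', hθ]; norm_num
  refine vSel_eq_zero_of hh ?_ (hr.outer p hp θ h1).le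
  rw [normalCircle_last hp, sin_eq_half, hθ]
  ring

/-- The chosen signs match the first coordinate equation since x_n = r sin θ = 2 r sin(θ/2)
cos(θ/2). Where a sign is 0 the corresponding coordinate is already 0, because there the circle
crosses the hyperplane inside or outside the ellipsoid. -/
theorem circ_isSol
    {h : Fin m → ℝ} (hh : ∀ i, 0 < h i) {r : ℝ} (hr : IsSmallRadius h r) {p : Space (m + 1)}
    (hp : p ∈ ellipsoid (.refl ℝ _) h)
    (θ : ℝ) : IsSol h (circPt h p r θ) (circW h p r θ) (circV h p r θ) := by
  obtain ⟨hw0, hs⟩ := wAbs_spec hh (circPt h p r θ)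
  have hsq : ∀ {c y : ℝ}, (c = 0 → y = 0) → (Real.sign c * y) ^ 2 = y ^ 2 := by
    intro c y hcy
    rcases lt_trichotomy c 0 with h | h | h
    · rw [Real.sign_of_neg h]; ring
    · rw [hcy h]; ring
    · rw [Real.sign_of_pos h]; ring
  have hW : circW h p r θ ^ 2 = wAbs h (circPt h p r θ) ^ 2 :=
    hsq fun h0 => wAbs_circPt_eq_zero hh hr hp h0
  have hV : circV h p r θ ^ 2 = vSel h (circPt h p r θ) ^ 2 := by
    rw [← sq_abs (vSel _ _)]
    exact hsq fun h0 => by rw [vSel_circPt_eq_zero hh hr hp h0, abs_zero]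
  refine ⟨?_, by rw [hW, hV]; exact hs.sum_eq⟩
  have hlast := normalCircle_last hp r θ
  have habs : |circPt h p r θ (Fin.last m)| = wAbs h (circPt h p r θ) * |vSel h (circPt h p r θ)| := by
    rw [hs.last_eq, abs_mul, abs_of_nonneg hw0]
  have h1 : circW h p r θ * circV h p r θ = Real.sign (Real.sin (θ / 2)) * Real.sign (Real.cos (θ / 2)) *
      |circPt h p r θ (Fin.last m)| := by
    rw [habs, circW, circV]; ring
  rw [h1]
  change circPt h p r θ (Fin.last m) = _ at hlast
  rw [hlast, sin_eq_half, abs_mul, abs_of_pos hr.pos, abs_mul, abs_mul, abs_two]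
  have hsabs : ∀ y : ℝ, Real.sign y * |y| = y := fun y => by
    rcases lt_trichotomy y 0 with h | h | h
    · rw [Real.sign_of_neg h, abs_of_neg h]; ring
    · simp [h]
    · rw [Real.sign_of_pos h, abs_of_pos h]; ring
  calc r * (2 * Real.sin (θ / 2) * Real.cos (θ / 2))
      = r * (2 * (Real.sign (Real.sin (θ / 2)) * |Real.sin (θ / 2)|) *
          (Real.sign (Real.cos (θ / 2)) * |Real.cos (θ / 2)|)) := by rw [hsabs, hsabs]
    _ = _ := by ring

theorem continuous_circW
    {h : Fin m → ℝ} (hh : ∀ i, 0 < h i) {r : ℝ} (hr : IsSmallRadius h r) {p : Space (m + 1)}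
    (hp : p ∈ ellipsoid (.refl ℝ _) h) : Continuous (circW h p r) :=
  continuous_sign_mul (by fun_prop) ((continuous_wAbs hh).comp (continuous_normalCircle ..))
    fun _ hθ => wAbs_circPt_eq_zero hh hr hp hθ

theorem continuous_circV
    {h : Fin m → ℝ} (hh : ∀ i, 0 < h i) {r : ℝ} (hr : IsSmallRadius h r) {p : Space (m + 1)}
    (hp : p ∈ ellipsoid (.refl ℝ _) h) : Continuous (circV h p r) :=
  continuous_sign_mul (by fun_prop) ((continuous_abs_vSel hh).comp (continuous_normalCircle ..))
    fun _ hθ => by simp [vSel_circPt_eq_zero hh hr hp hθ]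

/-- At each angle the sheet is selected by the continued coordinates themselves. For nearby angles
the pairing w w' + v v' is positive by continuity, so the selected sheets agree as germs. -/
theorem isContinuation_circ
    {h : Fin m → ℝ} (hh : ∀ i, 0 < h i) {r : ℝ} (hr : IsSmallRadius h r) {p : Space (m + 1)}
    (hp : p ∈ ellipsoid (.refl ℝ _) h) : IsContinuation (model h) (circPt h p r)
    fun θ => gBr h (circW h p r θ) (circV h p r θ) := by
  have hpos := fun θ => (circ_isSol hh hr hp θ).sq_add_sq_pos hh (hr.notMem p hp θ)
  refine ⟨fun θ => (gBr_germ hh (circ_isSol hh hr hp θ) (hr.notMem p hp θ) (hpos θ)).1, fun θ => ?_⟩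
  have h1 : ∀ᶠ s in 𝓝 θ, 0 < circW h p r θ * circW h p r s + circV h p r θ * circV h p r s :=
    (((continuous_circW hh hr hp).const_mul _).add
      ((continuous_circV hh hr hp).const_mul _)).continuousAt.eventually_const_lt (hpos θ)
  filter_upwards [h1] with s hs
  exact gBr_eventuallyEq hh (circ_isSol hh hr hp s) (hr.notMem p hp s) (hpos s) hs

theorem circ_monodromy
    {h : Fin m → ℝ} (hh : ∀ i, 0 < h i) {r : ℝ} (hr : IsSmallRadius h r) {p : Space (m + 1)}
    (hp : p ∈ ellipsoid (.refl ℝ _) h)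
    (θ : ℝ) :
    gBr h (circW h p r (θ + 2 * Real.pi)) (circV h p r (θ + 2 * Real.pi)) =ᶠ[𝓝 (circPt h p r θ)]
      fun x => -gBr h (circW h p r θ) (circV h p r θ) x := by
  rw [circW_add_two_pi, circV_add_two_pi]
  exact gBr_neg_eventuallyEq hh (circ_isSol hh hr hp θ) (hr.notMem p hp θ)
    ((circ_isSol hh hr hp θ).sq_add_sq_pos hh (hr.notMem p hp θ))

theorem exists_isSmallRadius {h : Fin m → ℝ} (hh : ∀ i, 0 < h i) :
    ∃ r₁ : ℝ, 0 < r₁ ∧ ∀ r, 0 < r → r < r₁ → IsSmallRadius h r := by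
  obtain ⟨r₁, hr₁, hall⟩ := exists_normalCircle_notMem hh
  have hsin : ∀ θ : ℝ, Real.cos θ ^ 2 = 1 → Real.sin θ = 0 := fun θ hθ => by
    have := Real.sin_sq_add_cos_sq θ
    have : Real.sin θ ^ 2 = 0 := by linarith
    simpa using this
  refine ⟨r₁, hr₁, fun r h0 h1 => ⟨h0, fun p hp => (hall p hp r h0 h1).1, fun p hp θ hθ => ?_,
    fun p hp θ hθ => ?_⟩⟩
  · exact (hall p hp r h0 h1).2.1 θ (hsin θ (by rw [hθ]; norm_num)) hθ
  · exact (hall p hp r h0 h1).2.2 θ (hsin θ (by rw [hθ]; norm_num)) hθ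

theorem isZ2Harmonic_model {h : Fin m → ℝ} (hh : ∀ i, 0 < h i) :
    IsZ2Harmonic (ellipsoid (.refl ℝ _) h) (normalOne (.refl ℝ _) h) (normalTwo (.refl ℝ _))
      (model h) where
  eq_zero _ hp := model_eq_zero hh hp
  branch _ hx := exists_isBranchAt_model hh hx
  monodromy p hp := by
    obtain ⟨r₁, hr₁, hsm⟩ := exists_isSmallRadius hh
    exact ⟨r₁, hr₁, fun r h0 h1 => ⟨_, isContinuation_circ hh (hsm r h0 h1) hp,
      circ_monodromy hh (hsm r h0 h1) hp⟩⟩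
  sq_integrable := ⟨_, ((continuous_Phi_sel hh).pow 2).locallyIntegrable,
    fun _ _ _ hg => model_sq hh hg⟩
  grad_sq_integrable := ⟨_, (continuous_norm_gradForm_sq hh).locallyIntegrable,
    fun _ _ hx hg => model_grad_sq hh hx hg⟩

end ModelHarmonic
end ZTwo

/-! ### Expansion of the explicit function in small coordinates. -/

namespace ZTwo

open InnerProductSpace

section Expansion

variable {m : ℕ}

theorem S_zero (h : Fin m → ℝ) : S h 0 = (∏ j, h j) ^ 2 := by
  simp [S, Finset.prod_pow]

theorem one_div_sqrt_S_le_one_div_prod {h : Fin m → ℝ} (hh : ∀ i, 0 < h i) (u : ℝ) :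
    1 / √(S h (u ^ 2)) ≤ 1 / ∏ j, h j := by
  have hH := prod_h_pos hh
  refine one_div_le_one_div_of_le hH (Real.le_sqrt_of_sq_le ?_)
  rw [← S_zero]
  exact Finset.prod_le_prod (fun i _ => by positivity) fun i _ => by nlinarith [sq_nonneg u]

theorem abs_one_div_sqrt_S_sub_le {h : Fin m → ℝ} (hh : ∀ i, 0 < h i) (u : ℝ) :
    |1 / √(S h (u ^ 2)) - 1 / ∏ j, h j| ≤ (∑ i, 1 / h i ^ 2) / (∏ j, h j) * u ^ 2 := by
  have hH := prod_h_pos hh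
  have hσ : 0 ≤ ∑ i, 1 / h i ^ 2 := Finset.sum_nonneg fun i _ => by positivity
  have h1 := Convex.norm_image_sub_le_of_norm_hasDerivWithin_le (𝕜 := ℝ)
    (f := fun u : ℝ => 1 / √(S h (u ^ 2))) (s := Metric.closedBall 0 |u|) (x := 0) (y := u)
    (C := |u| * ((∑ i, 1 / h i ^ 2) / (∏ j, h j)))
    (fun t _ => (hasDerivAt_one_div_sqrt_S_sq hh t).hasDerivWithinAt) (fun t ht => ?_)
    (convex_closedBall _ _) (by simp) (by simp)
  · have h0 : √(S h ((0 : ℝ) ^ 2)) = ∏ j, h j := by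
      rw [zero_pow two_ne_zero, S_zero, Real.sqrt_sq hH.le]
    rw [h0, Real.norm_eq_abs, Real.norm_eq_abs, sub_zero] at h1
    refine h1.trans_eq ?_
    rw [← sq_abs u]; ring
  · rw [Metric.mem_closedBall, dist_zero_right, Real.norm_eq_abs] at ht
    rw [Real.norm_eq_abs, abs_neg, mul_div_assoc, abs_mul]
    refine mul_le_mul ht ?_ (abs_nonneg _) (abs_nonneg _)
    have hσt : 0 ≤ ∑ i, 1 / (t ^ 2 + h i ^ 2) := Finset.sum_nonneg fun i _ => by positivity
    rw [abs_of_nonneg (div_nonneg hσt (Real.sqrt_nonneg _)), div_eq_mul_one_div,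
      div_eq_mul_one_div (∑ i, 1 / h i ^ 2)]
    refine mul_le_mul (Finset.sum_le_sum fun i _ => ?_) (one_div_sqrt_S_le_one_div_prod hh t)
      (by positivity) hσ
    have := hh i
    exact one_div_le_one_div_of_le (by positivity) (by nlinarith [sq_nonneg t])

theorem abs_primCoeff_le {h : Fin m → ℝ} (hh : ∀ i, 0 < h i) (i : Fin m) (w : ℝ) :
    |primCoeff h i w| ≤ 1 / h i ^ 2 * (1 / ∏ j, h j) * |w| := by
  have h1 := intervalIntegral.norm_integral_le_of_norm_le_const (a := 0) (b := w)
    (f := fun u => 1 / ((u ^ 2 + h i ^ 2) * √(S h (u ^ 2))))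
    (C := 1 / h i ^ 2 * (1 / ∏ j, h j)) fun u _ => by
      have := hh i
      have := sqrt_S_pos hh u
      have heq : 1 / ((u ^ 2 + h i ^ 2) * √(S h (u ^ 2))) =
          1 / (u ^ 2 + h i ^ 2) * (1 / √(S h (u ^ 2))) := by field_simp
      rw [Real.norm_eq_abs, abs_of_pos (by positivity), heq]
      refine mul_le_mul (one_div_le_one_div_of_le (by positivity) (by nlinarith [sq_nonneg u]))
        (one_div_sqrt_S_le_one_div_prod hh u) (by positivity) (by positivity)
  rw [sub_zero] at h1
  exact h1

theorem abs_sum_div_mul_sub_le {h : Fin m → ℝ} (hh : ∀ i, 0 < h i) {x : Space (m + 1)} {M e u w : ℝ}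
    (hM : ∀ i : Fin m, x i.castSucc ^ 2 ≤ M) (he : e ≤ 1) (he0 : 0 ≤ e) (hw : w ^ 2 ≤ e ^ 2)
    (hu : u ^ 2 ≤ w ^ 2) :
    |∑ i, x i.castSucc ^ 2 / ((u ^ 2 + h i ^ 2) * (w ^ 2 + h i ^ 2)) -
      ∑ i, x i.castSucc ^ 2 / h i ^ 4| ≤ M * (∑ i, (1 + 2 * h i ^ 2) / h i ^ 8) * e ^ 2 := by
  rw [← Finset.sum_sub_distrib, Finset.mul_sum, Finset.sum_mul]
  refine (Finset.abs_sum_le_sum_abs _ _).trans (Finset.sum_le_sum fun i _ => ?_)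
  have hi := hh i
  have hA : 0 < u ^ 2 + h i ^ 2 := by positivity
  have hB : 0 < w ^ 2 + h i ^ 2 := by positivity
  have heq : x i.castSucc ^ 2 / ((u ^ 2 + h i ^ 2) * (w ^ 2 + h i ^ 2)) - x i.castSucc ^ 2 / h i ^ 4 =
      -(x i.castSucc ^ 2 * ((u ^ 2 * w ^ 2 + h i ^ 2 * (u ^ 2 + w ^ 2)) /
        (h i ^ 4 * ((u ^ 2 + h i ^ 2) * (w ^ 2 + h i ^ 2))))) := by
    field_simp
    ring
  rw [heq, abs_neg, abs_of_nonneg (by positivity), mul_assoc]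
  refine mul_le_mul (hM i) ?_ (by positivity) ((sq_nonneg _).trans (hM i))
  rw [div_mul_eq_mul_div]
  have he2 : e ^ 2 ≤ 1 := by nlinarith
  refine div_le_div₀ (by positivity) ?_ (by positivity) ?_
  · have : u ^ 2 * w ^ 2 ≤ 1 * e ^ 2 := mul_le_mul (by linarith) hw (sq_nonneg _) zero_le_one
    nlinarith [sq_nonneg (h i)]
  · calc h i ^ 8 = h i ^ 4 * (h i ^ 2 * h i ^ 2) := by ring
      _ ≤ _ := by gcongr <;> nlinarith [sq_nonneg u, sq_nonneg w]

/-- Substituting the second coordinate equation for the constant 1 removes the zeroth-order part of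
the integrand and leaves a factor that is visibly quadratic in the small quantities w and v. -/
theorem primZero_sub_eq {h : Fin m → ℝ} (hh : ∀ i, 0 < h i) {x : Space (m + 1)} {w v : ℝ}
    (hs : IsSol h x w v) :
    primZero h w - ∑ i, x i.castSucc ^ 2 * primCoeff h i w = ∫ u in (0 : ℝ)..w,
      (v ^ 2 - (w ^ 2 - u ^ 2) * ∑ i, x i.castSucc ^ 2 / ((u ^ 2 + h i ^ 2) * (w ^ 2 + h i ^ 2))) *
        (1 / √(S h (u ^ 2))) := by
  have hi : ∀ i, IntervalIntegrable (fun u : ℝ => 1 / ((u ^ 2 + h i ^ 2) * √(S h (u ^ 2)))) volume 0 w :=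
    fun i => (continuous_coeff_integrand hh i).intervalIntegrable _ _
  have hc : Continuous fun u : ℝ => ∑ i : Fin m, x i.castSucc ^ 2 *
      (1 / ((u ^ 2 + h i ^ 2) * √(S h (u ^ 2)))) :=
    continuous_finsetSum _ fun i _ => continuous_const.mul (continuous_coeff_integrand hh i)
  simp only [primZero, primCoeff, ← intervalIntegral.integral_const_mul]
  rw [← intervalIntegral.integral_finsetSum fun i _ => (hi i).const_mul _,
    ← intervalIntegral.integral_sub ((continuous_one_div_sqrt_S hh).intervalIntegrable _ _)
      (hc.intervalIntegrable _ _)]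
  refine intervalIntegral.integral_congr fun u _ => ?_
  have e1 : v ^ 2 = 1 - ∑ i, x i.castSucc ^ 2 / (w ^ 2 + h i ^ 2) := by linarith [hs.sum_eq]
  have e2 : (w ^ 2 - u ^ 2) * ∑ i, x i.castSucc ^ 2 / ((u ^ 2 + h i ^ 2) * (w ^ 2 + h i ^ 2)) =
      ∑ i, x i.castSucc ^ 2 / (u ^ 2 + h i ^ 2) - ∑ i, x i.castSucc ^ 2 / (w ^ 2 + h i ^ 2) := by
    rw [Finset.mul_sum, ← Finset.sum_sub_distrib]
    refine Finset.sum_congr rfl fun i _ => ?_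
    have := hh i
    field_simp
    ring
  have e3 : ∑ i, x i.castSucc ^ 2 * (1 / ((u ^ 2 + h i ^ 2) * √(S h (u ^ 2)))) =
      (∑ i, x i.castSucc ^ 2 / (u ^ 2 + h i ^ 2)) * (1 / √(S h (u ^ 2))) := by
    rw [Finset.sum_mul]
    refine Finset.sum_congr rfl fun i _ => ?_
    rw [one_div, mul_inv, one_div]; ring
  simp only []
  rw [e1, e2, e3]
  ring

/-- Freezing √S at ∏ hⱼ and the sum at κ, the integral contributes v²w/2 - κw³/3 and the boundary
term x_n v/√S contributes another v²w/2. Each replacement costs a relative error of order e², hence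
the fifth power; the x_n² term is itself of fifth order. -/
theorem exists_Phi_approx {h : Fin m → ℝ} (hh : ∀ i, 0 < h i) {M : ℝ} (hM : 0 ≤ M) :
    ∃ K : ℝ, 0 ≤ K ∧ ∀ (x : Space (m + 1)) (w v e κ : ℝ), IsSol h x w v → 0 ≤ e → e ≤ 1 →
      |w| ≤ e → |v| ≤ e → (∀ i : Fin m, x i.castSucc ^ 2 ≤ M) → 0 ≤ κ → κ ≤ M →
      |∑ i, x i.castSucc ^ 2 / h i ^ 4 - κ| ≤ M * e ^ 2 →
      |Phi h x w v - (v ^ 2 * w - κ * w ^ 3 / 3)| ≤ K * e ^ 5 := by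
  set H := ∏ j, h j with hHdef
  have hH : 0 < H := prod_h_pos hh
  set σ := ∑ i, 1 / h i ^ 2
  have hσ : 0 ≤ σ := Finset.sum_nonneg fun i _ => by positivity
  set c := ∑ i, (1 + 2 * h i ^ 2) / h i ^ 8
  have hc : 0 ≤ c := Finset.sum_nonneg fun i _ => by positivity
  set K₁ := (M * c + M) * (1 / H) + (1 + M) * (σ / H)
  have hK₁ : 0 ≤ K₁ := by positivity
  refine ⟨H / 2 * (K₁ + σ / H + σ / H), by positivity, ?_⟩
  intro x w v e κ hs he0 he1 hw hv hxM hκ0 hκM hκ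
  have hw2 : w ^ 2 ≤ e ^ 2 := sq_le_sq' (by linarith [neg_abs_le w]) (by linarith [le_abs_self w])
  have hv2 : v ^ 2 ≤ e ^ 2 := sq_le_sq' (by linarith [neg_abs_le v]) (by linarith [le_abs_self v])
  set F : ℝ → ℝ := fun u => (v ^ 2 - (w ^ 2 - u ^ 2) *
    ∑ i, x i.castSucc ^ 2 / ((u ^ 2 + h i ^ 2) * (w ^ 2 + h i ^ 2))) * (1 / √(S h (u ^ 2))) with hF
  set F₀ : ℝ → ℝ := fun u => (v ^ 2 - (w ^ 2 - u ^ 2) * κ) * (1 / H) with hF₀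
  have hFc : Continuous F := by
    refine Continuous.mul (continuous_const.sub (Continuous.mul (by fun_prop)
      (continuous_finsetSum _ fun i _ => continuous_const.div (by fun_prop) fun u => ?_)))
      (continuous_one_div_sqrt_S hh)
    have := hh i
    positivity
  have hF₀c : Continuous F₀ := by fun_prop
  have hint₀ : ∫ u in (0 : ℝ)..w, F₀ u = (v ^ 2 * w - κ * (2 * w ^ 3 / 3)) * (1 / H) := by
    have hd : ∀ u : ℝ, HasDerivAt (fun u : ℝ => (v ^ 2 * u - (w ^ 2 * u - u ^ 3 / 3) * κ) * (1 / H))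
        (F₀ u) u := fun u => by
      have h3 : HasDerivAt (fun u : ℝ => u ^ 3 / 3) (u ^ 2) u := by
        have := (hasDerivAt_pow 3 u).div_const 3
        refine this.congr_deriv ?_
        norm_num
      have h1 := (hasDerivAt_id u).const_mul (v ^ 2)
      have h2 := (hasDerivAt_id u).const_mul (w ^ 2)
      simp only [mul_one] at h1 h2
      exact (h1.sub ((h2.sub h3).mul_const κ)).mul_const (1 / H)
    rw [intervalIntegral.integral_eq_sub_of_hasDerivAt (fun u _ => hd u)
      (hF₀c.intervalIntegrable _ _)]
    ring
  have hdiff : |(∫ u in (0 : ℝ)..w, F u) - ∫ u in (0 : ℝ)..w, F₀ u| ≤ K₁ * e ^ 4 * e := by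
    rw [← intervalIntegral.integral_sub (hFc.intervalIntegrable _ _) (hF₀c.intervalIntegrable _ _)]
    have hb := intervalIntegral.norm_integral_le_of_norm_le_const (a := 0) (b := w)
      (f := fun u => F u - F₀ u) (C := K₁ * e ^ 4) fun u hu => by
        have hu2 : u ^ 2 ≤ w ^ 2 := by
          rw [Set.uIoc, Set.mem_Ioc] at hu
          rcases le_total 0 w with h0 | h0
          · rw [min_eq_left h0, max_eq_right h0] at hu
            nlinarith
          · rw [min_eq_right h0, max_eq_left h0] at hu
            nlinarith
        have e1 := abs_sum_div_mul_sub_le hh hxM he1 he0 hw2 hu2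
        set κu := ∑ i, x i.castSucc ^ 2 / ((u ^ 2 + h i ^ 2) * (w ^ 2 + h i ^ 2)) with hκu
        have e2 : |κu - κ| ≤ (M * c + M) * e ^ 2 := by
          calc |κu - κ| = |(κu - ∑ i, x i.castSucc ^ 2 / h i ^ 4) +
                (∑ i, x i.castSucc ^ 2 / h i ^ 4 - κ)| := by ring_nf
            _ ≤ _ := (abs_add_le _ _).trans (by linarith)
        have e3 := abs_one_div_sqrt_S_sub_le hh u
        have e4 := one_div_sqrt_S_le_one_div_prod hh u
        have e5 : 0 ≤ 1 / √(S h (u ^ 2)) := by positivity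
        rw [← hHdef] at e3 e4
        change |_ - 1 / H| ≤ σ / H * u ^ 2 at e3
        have e6 : F u - F₀ u = -((w ^ 2 - u ^ 2) * (κu - κ) * (1 / √(S h (u ^ 2)))) +
            (v ^ 2 - (w ^ 2 - u ^ 2) * κ) * (1 / √(S h (u ^ 2)) - 1 / H) := by
          simp only [hF, hF₀, ← hκu]; ring
        have e7 : |w ^ 2 - u ^ 2| ≤ e ^ 2 := by
          rw [abs_of_nonneg (by linarith)]; nlinarith [sq_nonneg u]
        have e8 : |v ^ 2 - (w ^ 2 - u ^ 2) * κ| ≤ (1 + M) * e ^ 2 := by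
          calc |v ^ 2 - (w ^ 2 - u ^ 2) * κ| ≤ |v ^ 2| + |(w ^ 2 - u ^ 2) * κ| := abs_sub _ _
            _ ≤ e ^ 2 + e ^ 2 * M := by
                rw [abs_mul, abs_of_nonneg (sq_nonneg v), abs_of_nonneg hκ0]
                gcongr
            _ = _ := by ring
        rw [Real.norm_eq_abs, e6]
        calc _ ≤ |(w ^ 2 - u ^ 2) * (κu - κ) * (1 / √(S h (u ^ 2)))| +
              |(v ^ 2 - (w ^ 2 - u ^ 2) * κ) * (1 / √(S h (u ^ 2)) - 1 / H)| := by
                refine (abs_add_le _ _).trans ?_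
                rw [abs_neg]
          _ ≤ e ^ 2 * ((M * c + M) * e ^ 2) * (1 / H) + (1 + M) * e ^ 2 * (σ / H * e ^ 2) := by
                rw [abs_mul, abs_mul, abs_mul, abs_of_nonneg e5]
                have : σ / H * u ^ 2 ≤ σ / H * e ^ 2 :=
                  mul_le_mul_of_nonneg_left (hu2.trans hw2) (by positivity)
                gcongr
                exact e3.trans this
          _ = K₁ * e ^ 4 := by simp only [K₁]; ring
    rw [sub_zero] at hb
    exact hb.trans (mul_le_mul_of_nonneg_left hw (by positivity))
  have hγ : |∑ i, primCoeff h i w| ≤ σ / H * e := by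
    refine (Finset.abs_sum_le_sum_abs _ _).trans ?_
    calc ∑ i, |primCoeff h i w| ≤ ∑ i, 1 / h i ^ 2 * (1 / H) * |w| :=
          Finset.sum_le_sum fun i _ => abs_primCoeff_le hh i w
      _ = σ / H * |w| := by rw [← Finset.sum_mul, ← Finset.sum_mul, mul_one_div]
      _ ≤ _ := by gcongr
  have hsw := abs_one_div_sqrt_S_sub_le hh w
  rw [← hHdef] at hsw
  change |_ - 1 / H| ≤ σ / H * w ^ 2 at hsw
  have hPhi : Phi h x w v - (v ^ 2 * w - κ * w ^ 3 / 3) = H / 2 * (((∫ u in (0 : ℝ)..w, F u) -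
      ∫ u in (0 : ℝ)..w, F₀ u) + (w * v) ^ 2 * (∑ i, primCoeff h i w) +
      w * v ^ 2 * (1 / √(S h (w ^ 2)) - 1 / H)) := by
    rw [Phi, primZero_sub_eq hh hs, hint₀, hs.last_eq, ← hHdef]
    change H / 2 * ((∫ u in (0 : ℝ)..w, F u) + _ + _) - _ = _
    field_simp
    ring
  rw [hPhi, abs_mul, abs_of_pos (by positivity : 0 < H / 2), mul_assoc (H / 2)]
  refine mul_le_mul_of_nonneg_left ?_ (by positivity)
  have hwv : (w * v) ^ 2 ≤ e ^ 4 := by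
    calc (w * v) ^ 2 = w ^ 2 * v ^ 2 := by ring
      _ ≤ e ^ 2 * e ^ 2 := by gcongr
      _ = e ^ 4 := by ring
  calc _ ≤ |(∫ u in (0 : ℝ)..w, F u) - ∫ u in (0 : ℝ)..w, F₀ u| +
        |(w * v) ^ 2 * (∑ i, primCoeff h i w)| + |w * v ^ 2 * (1 / √(S h (w ^ 2)) - 1 / H)| :=
          abs_add_three _ _ _
    _ ≤ K₁ * e ^ 4 * e + e ^ 4 * (σ / H * e) + e * e ^ 2 * (σ / H * e ^ 2) := by
        have h1 : σ / H * w ^ 2 ≤ σ / H * e ^ 2 := by gcongr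
        rw [abs_mul, abs_mul (w * v ^ 2), abs_mul w, abs_of_nonneg (sq_nonneg (w * v)),
          abs_of_nonneg (sq_nonneg v)]
        gcongr
        exact hsw.trans h1
    _ = _ := by ring

/-- Comparison of a cube with the cube of the appropriate square root. -/
theorem abs_cube_sub_le {k w v ρ θ c C : ℝ} (hk : 0 < k) (hρ : 0 < ρ) (hc : 0 ≤ c)
    (hcos : 0 ≤ w * Real.cos (θ / 2)) (hsin : 0 ≤ v * Real.sin (θ / 2))
    (hwv : w * v = ρ ^ 2 * Real.sin θ) (hC : k * |w| + |v| ≤ C * ρ) (hC' : √(2 * k) ≤ C)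
    (hre : |k ^ 2 * w ^ 2 - v ^ 2 - 2 * k * ρ ^ 2 * Real.cos θ| ≤ c * ρ ^ 4) :
    |(v ^ 2 * w - k ^ 2 * w ^ 3 / 3) + 2 * √(2 * k) / 3 * ρ ^ 3 * Real.cos (3 / 2 * θ)| ≤
      c * C ^ 2 / (k * √(2 * k)) * ρ ^ 5 := by
  set t := √(2 * k) with ht
  have htpos : 0 < t := Real.sqrt_pos.2 (by positivity)
  have ht2 : t ^ 2 = 2 * k := Real.sq_sqrt (by positivity)
  -- The quantity to be estimated is -Re(Z³)/(3k), up to the same expression in the model root a =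
  -- √(2k) ρ e^(iθ/2). The hypotheses say that Z² is close to a², the imaginary parts being equal.
  set Z : ℂ := ⟨k * w, v⟩ with hZ
  set a : ℂ := (t * ρ : ℝ) * Complex.exp ((θ / 2 : ℝ) * Complex.I) with ha
  have hare : a.re = t * ρ * Real.cos (θ / 2) := by
    rw [ha, Complex.re_ofReal_mul, Complex.exp_ofReal_mul_I_re]
  have haim : a.im = t * ρ * Real.sin (θ / 2) := by
    rw [ha, Complex.im_ofReal_mul, Complex.exp_ofReal_mul_I_im]
  have hanorm : ‖a‖ = t * ρ := by
    rw [ha, norm_mul, Complex.norm_exp_ofReal_mul_I, mul_one, Complex.norm_real, Real.norm_eq_abs,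
      abs_of_pos (by positivity)]
  have hZnorm : ‖Z‖ ≤ C * ρ := by
    refine (Complex.norm_le_abs_re_add_abs_im Z).trans ?_
    rw [hZ]
    simp only
    rwa [abs_mul, abs_of_pos hk]
  have hsq : Z ^ 2 - a ^ 2 = ((k ^ 2 * w ^ 2 - v ^ 2 - 2 * k * ρ ^ 2 * Real.cos θ : ℝ) : ℂ) := by
    have h1 := Real.sin_sq_add_cos_sq (θ / 2)
    apply Complex.ext
    · simp only [pow_two, Complex.sub_re, Complex.mul_re, hare, haim, Complex.ofReal_re]
      simp only [hZ]
      rw [cos_eq_half θ]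
      linear_combination (-ρ ^ 2 * (Real.cos (θ / 2) ^ 2 - Real.sin (θ / 2) ^ 2)) * ht2 + 2 * k * ρ ^ 2 * h1
    · simp only [pow_two, Complex.sub_im, Complex.mul_im, hare, haim, Complex.ofReal_im]
      simp only [hZ]
      rw [sin_eq_half θ] at hwv
      linear_combination (2 * k) * hwv -
        2 * ρ ^ 2 * Real.sin (θ / 2) * Real.cos (θ / 2) * ht2
  -- The sign conditions put Z in the same closed quadrant as a, so Z + a is no smaller than a;
  -- dividing Z² - a² by it shows that Z approximates a and not -a.
  have hplus : t * ρ ≤ ‖Z + a‖ := by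
    rw [← hanorm]
    refine le_of_sq_le_sq ?_ (norm_nonneg _)
    rw [← Complex.normSq_eq_norm_sq, ← Complex.normSq_eq_norm_sq, Complex.normSq_apply,
      Complex.normSq_apply, Complex.add_re, Complex.add_im, hare, haim]
    simp only [hZ]
    have h1 : 0 ≤ t * ρ * k * (w * Real.cos (θ / 2)) := by positivity
    have h2 : 0 ≤ t * ρ * (v * Real.sin (θ / 2)) := by positivity
    nlinarith [sq_nonneg (k * w), sq_nonneg v]
  have hminus : ‖Z - a‖ ≤ c / t * ρ ^ 3 := by
    have h1 : ‖Z - a‖ * ‖Z + a‖ ≤ c * ρ ^ 4 := by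
      rw [← norm_mul, show (Z - a) * (Z + a) = Z ^ 2 - a ^ 2 by ring, hsq, Complex.norm_real]
      exact hre
    have h2 : ‖Z - a‖ * (t * ρ) ≤ c * ρ ^ 4 :=
      (mul_le_mul_of_nonneg_left hplus (norm_nonneg _)).trans h1
    rw [div_mul_eq_mul_div, le_div_iff₀ htpos]
    have h3 : ‖Z - a‖ * t * ρ ≤ c * ρ ^ 3 * ρ := by linarith
    exact le_of_mul_le_mul_right h3 hρ
  have hcube : ‖Z ^ 3 - a ^ 3‖ ≤ c / t * ρ ^ 3 * (3 * C ^ 2 * ρ ^ 2) := by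
    rw [show Z ^ 3 - a ^ 3 = (Z - a) * (Z ^ 2 + Z * a + a ^ 2) by ring, norm_mul]
    refine mul_le_mul hminus ?_ (norm_nonneg _) (by positivity)
    have ha' : ‖a‖ ≤ C * ρ := by rw [hanorm]; gcongr
    calc ‖Z ^ 2 + Z * a + a ^ 2‖ ≤ ‖Z ^ 2‖ + ‖Z * a‖ + ‖a ^ 2‖ := norm_add₃_le
      _ ≤ (C * ρ) ^ 2 + (C * ρ) * (C * ρ) + (C * ρ) ^ 2 := by
          rw [norm_pow, norm_mul, norm_pow]
          have := (norm_nonneg Z).trans hZnorm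
          gcongr
      _ = _ := by ring
  have hZ3 : (Z ^ 3).re = k ^ 3 * w ^ 3 - 3 * k * w * v ^ 2 := by
    simp only [pow_succ, pow_zero, one_mul, Complex.mul_re, Complex.mul_im, hZ]
    ring
  have ha3 : (a ^ 3).re = 2 * k * t * ρ ^ 3 * Real.cos (3 / 2 * θ) := by
    have : a ^ 3 = ((t * ρ) ^ 3 : ℝ) * Complex.exp ((3 / 2 * θ : ℝ) * Complex.I) := by
      rw [ha, mul_pow, ← Complex.exp_nat_mul]
      push_cast
      congr 2
      ring
    rw [this, Complex.re_ofReal_mul, Complex.exp_ofReal_mul_I_re, mul_pow, pow_succ t, ht2]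
  have hfin : (v ^ 2 * w - k ^ 2 * w ^ 3 / 3) + 2 * t / 3 * ρ ^ 3 * Real.cos (3 / 2 * θ) =
      -(1 / (3 * k)) * (Z ^ 3 - a ^ 3).re := by
    rw [Complex.sub_re, hZ3, ha3]
    field_simp
    ring
  rw [hfin, abs_mul, abs_neg, abs_of_pos (by positivity : 0 < 1 / (3 * k))]
  calc 1 / (3 * k) * |(Z ^ 3 - a ^ 3).re| ≤ 1 / (3 * k) * (c / t * ρ ^ 3 * (3 * C ^ 2 * ρ ^ 2)) := by
        gcongr
        exact (Complex.abs_re_le_norm _).trans hcube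
    _ = _ := by field_simp

end Expansion
end ZTwo

/-! ### Non-degeneracy of the explicit function along the ellipsoid. -/

namespace ZTwo

open InnerProductSpace

section Nondegeneracy

variable {m : ℕ}

theorem circPt_castSucc (h : Fin m → ℝ) (p : Space (m + 1)) (r θ : ℝ) (i : Fin m) :
    circPt h p r θ i.castSucc = p i.castSucc +
      r * Real.cos θ * (‖conormal h p‖⁻¹ * (p i.castSucc / h i ^ 2)) := by
  simp [circPt, normalCircle, normalOne_refl, normalTwo_refl]

theorem norm_conormal_sq (h : Fin m → ℝ) (p : Space (m + 1)) :
    ‖conormal h p‖ ^ 2 = ∑ i : Fin m, p i.castSucc ^ 2 / h i ^ 4 := by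
  rw [norm_sq_eq_sum]
  simp only [conormal_castSucc, conormal_last, div_pow, ← pow_mul]
  simp

theorem abs_coord_le {h : Fin m → ℝ} (hh : ∀ i, 0 < h i) {p : Space (m + 1)}
    (hp : p ∈ ellipsoid (.refl ℝ _) h) (i : Fin m) : |p i.castSucc| ≤ h i := by
  have h1 : p i.castSucc ^ 2 / h i ^ 2 ≤ qform h p :=
    Finset.single_le_sum (f := fun i : Fin m => p i.castSucc ^ 2 / h i ^ 2)
      (fun i _ => by positivity) (Finset.mem_univ i)
  rw [(mem_ellipsoid_refl.1 hp).1, div_le_one (by have := hh i; positivity)] at h1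
  exact abs_le_of_sq_le_sq h1 (hh i).le

theorem abs_normalOne_coord_le (h : Fin m → ℝ) (p : Space (m + 1)) (i : Fin m) :
    |‖conormal h p‖⁻¹ * (p i.castSucc / h i ^ 2)| ≤ 1 := by
  have h1 := PiLp.norm_apply_le (conormal h p) i.castSucc
  rw [conormal_castSucc, Real.norm_eq_abs] at h1
  rw [abs_mul, abs_of_nonneg (by positivity)]
  exact inv_mul_le_one_of_le₀ h1 (norm_nonneg _)

theorem abs_coord_sq_sub_le {h : Fin m → ℝ} (hh : ∀ i, 0 < h i) {p : Space (m + 1)}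
    (hp : p ∈ ellipsoid (.refl ℝ _) h) {β : ℝ} (hβ : ∀ i, h i ≤ β) {r : ℝ} (hr0 : 0 < r) (hr1 : r ≤ 1)
    (θ : ℝ) (i : Fin m) :
    |circPt h p r θ i.castSucc ^ 2 - p i.castSucc ^ 2| ≤ (2 * β + 1) * r := by
  have h1 := (abs_coord_le hh hp i).trans (hβ i)
  have h2 := abs_normalOne_coord_le h p i
  rw [circPt_castSucc]
  set η := ‖conormal h p‖⁻¹ * (p i.castSucc / h i ^ 2)
  have h3 : |r * Real.cos θ * η| ≤ r := by
    rw [abs_mul, abs_mul, abs_of_pos hr0]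
    calc r * |Real.cos θ| * |η| ≤ r * 1 * 1 := by
          gcongr
          exact Real.abs_cos_le_one θ
      _ = r := by ring
  set δ := r * Real.cos θ * η
  calc |(p i.castSucc + δ) ^ 2 - p i.castSucc ^ 2| = |(2 * p i.castSucc + δ) * δ| := by ring_nf
    _ ≤ (2 * β + 1) * r := by
      rw [abs_mul]
      refine mul_le_mul ?_ h3 (abs_nonneg _) (by linarith [abs_nonneg (p i.castSucc)])
      refine (abs_add_le _ _).trans ?_
      rw [abs_mul, abs_two]
      linarith

/-- Subtract the second coordinate equation from the quadratic form. With w v = x_n this gives the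
real and imaginary parts of a complex square: near the ellipsoid the coordinates behave like a
square root of ζ. -/
theorem IsSol.mul_sq_sub_sq {h : Fin m → ℝ} (hh : ∀ i, 0 < h i) {x : Space (m + 1)} {w v : ℝ}
    (hs : IsSol h x w v) :
    (∑ i, x i.castSucc ^ 2 / (h i ^ 2 * (w ^ 2 + h i ^ 2))) * w ^ 2 - v ^ 2 = qform h x - 1 := by
  have h1 := hs.sum_eq
  have h2 : (∑ i, x i.castSucc ^ 2 / (h i ^ 2 * (w ^ 2 + h i ^ 2))) * w ^ 2 =
      qform h x - ∑ i, x i.castSucc ^ 2 / (w ^ 2 + h i ^ 2) := by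
    rw [qform, Finset.sum_mul, ← Finset.sum_sub_distrib]
    refine Finset.sum_congr rfl fun i _ => ?_
    have := hh i
    field_simp
    ring
  rw [h2]
  linarith

-- A crude bound on w keeps the factor κ of `mul_sq_sub_sq` away from zero. Then (κw² + v²)² = (κw²
-- - v²)² + 4κ(wv)² is O(r²), so w² and v² are O(r). Finally κ differs from ‖conormal h p‖² by O(r),
-- which upgrades the identity to the last estimate with error O(r²).
set_option maxHeartbeats 1000000 in
theorem exists_circ_bounds {h : Fin m → ℝ} (hh : ∀ i, 0 < h i) :
    ∃ C r₀ : ℝ, 0 < C ∧ 0 < r₀ ∧ ∀ r, 0 < r → r < r₀ → IsSmallRadius h r ∧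
      ∀ p ∈ ellipsoid (.refl ℝ _) h, ∀ θ,
        circW h p r θ ^ 2 ≤ C * r ∧ circV h p r θ ^ 2 ≤ C * r ∧
        (∀ i : Fin m, circPt h p r θ i.castSucc ^ 2 ≤ C) ∧
        |∑ i : Fin m, circPt h p r θ i.castSucc ^ 2 / h i ^ 4 - ‖conormal h p‖ ^ 2| ≤ C * r ∧
        |‖conormal h p‖ ^ 2 * circW h p r θ ^ 2 - circV h p r θ ^ 2 -
          2 * ‖conormal h p‖ * r * Real.cos θ| ≤ C * r ^ 2 := by
  obtain ⟨α, β, hα, hβ, hab⟩ := exists_bounds hh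
  obtain ⟨r₁, hr₁, hsm⟩ := exists_isSmallRadius hh
  -- M₁ bounds the squared first coordinates, c₁ r the deviation of the quadratic form from 1, c₂ is
  -- a lower bound for κ, c₃ r bounds κw² + v², and C₁ r bounds w² and v². The radius restriction c₁
  -- r ≤ 1/2 keeps the quadratic form at least 1/2, as used for c₂.
  set M₁ := β ^ 2 + (2 * β + 1)
  have hM₁ : 0 < M₁ := by positivity
  set s₄ := ∑ i, 1 / h i ^ 4
  have hs₄ : 0 ≤ s₄ := Finset.sum_nonneg fun i _ => by positivity
  set s₆ := ∑ i, 1 / h i ^ 6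
  have hs₆ : 0 ≤ s₆ := Finset.sum_nonneg fun i _ => by have := hh i; positivity
  set c₁ := 2 / α + 1 / α ^ 2
  have hc₁ : 0 < c₁ := by positivity
  set c₂ := 1 / (2 * (m * M₁ + 1 + β ^ 2))
  have hc₂ : 0 < c₂ := by positivity
  set c₃ := √(c₁ ^ 2 + 8 / α ^ 2)
  have hc₃ : 0 ≤ c₃ := Real.sqrt_nonneg _
  set C₁ := c₃ + c₃ / c₂
  have hC₁ : 0 ≤ C₁ := by positivity
  set c₄ := (2 * β + 1) * s₄
  have hc₄ : 0 ≤ c₄ := by positivity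
  set c₅ := (c₄ + C₁ * (M₁ * s₆)) * C₁ + 1 / α ^ 2
  have hc₅ : 0 ≤ c₅ := by positivity
  refine ⟨C₁ + M₁ + c₄ + c₅, min r₁ (min 1 (1 / (2 * c₁))), by positivity, by positivity, ?_⟩
  intro r hr0 hr
  have hr1 : r ≤ 1 := (hr.trans_le ((min_le_right _ _).trans (min_le_left _ _))).le
  have hrc : r * c₁ ≤ 1 / 2 := by
    have : r ≤ 1 / (2 * c₁) := (hr.trans_le ((min_le_right _ _).trans (min_le_right _ _))).le
    rw [le_div_iff₀ (by positivity)] at this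
    linarith
  have hsr := hsm r hr0 (hr.trans_le (min_le_left _ _))
  refine ⟨hsr, fun p hp θ => ?_⟩
  have hs := circ_isSol hh hsr hp θ
  set x := circPt h p r θ with hx
  set w := circW h p r θ
  set v := circV h p r θ
  set k := ‖conormal h p‖
  obtain ⟨hk1, hk2⟩ := norm_conormal_bounds hα hab hp
  have hk0 : 0 ≤ k := norm_nonneg _
  have hcos := Real.abs_cos_le_one θ
  have hsin := Real.abs_sin_le_one θ
  have hdx : ∀ i : Fin m, |x i.castSucc ^ 2 - p i.castSucc ^ 2| ≤ (2 * β + 1) * r := fun i =>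
    abs_coord_sq_sub_le hh hp (fun i => (hab i).2) hr0 hr1 θ i
  have hxM : ∀ i : Fin m, x i.castSucc ^ 2 ≤ M₁ := fun i => by
    have h1 := (abs_le.1 (hdx i)).2
    have h2 : p i.castSucc ^ 2 ≤ β ^ 2 := by
      rw [← sq_abs]
      have := (abs_coord_le hh hp i).trans (hab i).2
      gcongr
    have h3 : (2 * β + 1) * r ≤ (2 * β + 1) * 1 := by gcongr
    simp only [M₁]
    linarith
  have hlast : x (Fin.last m) = r * Real.sin θ := normalCircle_last hp r θ
  have hq : qform h x - 1 = 2 * r * k * Real.cos θ +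
      r ^ 2 * Real.cos θ ^ 2 * qform h (normalOne (.refl ℝ _) h p) := by
    rw [hx, circPt, qform_normalCircle hp]; ring
  have hQ0 := qform_nonneg h (normalOne (.refl ℝ _) h p)
  have hQ1 := qform_normalOne_le hα hab p
  set Q := qform h (normalOne (.refl ℝ _) h p)
  have hcos2 : Real.cos θ ^ 2 ≤ 1 := Real.cos_sq_le_one θ
  have hQr : |r ^ 2 * Real.cos θ ^ 2 * Q| ≤ 1 / α ^ 2 * r ^ 2 := by
    rw [abs_of_nonneg (by positivity)]
    calc r ^ 2 * Real.cos θ ^ 2 * Q ≤ r ^ 2 * 1 * (1 / α ^ 2) := by gcongr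
      _ = _ := by ring
  have hδ : |qform h x - 1| ≤ c₁ * r := by
    rw [hq]
    refine (abs_add_le _ _).trans ?_
    have h1 : |2 * r * k * Real.cos θ| ≤ 2 / α * r := by
      rw [abs_mul, abs_of_nonneg (by positivity)]
      calc 2 * r * k * |Real.cos θ| ≤ 2 * r * (1 / α) * 1 := by gcongr
        _ = _ := by ring
    have h2 : 1 / α ^ 2 * r ^ 2 ≤ 1 / α ^ 2 * r := by
      gcongr
      exact pow_le_of_le_one hr0.le hr1 two_ne_zero
    calc _ ≤ 2 / α * r + 1 / α ^ 2 * r := by linarith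
      _ = c₁ * r := by simp only [c₁]; ring
  have hqx := abs_le.1 hδ
  have hrel := hs.mul_sq_sub_sq hh
  set κ := ∑ i, x i.castSucc ^ 2 / (h i ^ 2 * (w ^ 2 + h i ^ 2)) with hκ
  have hw2 : w ^ 2 ≤ m * M₁ + 1 := by
    have h1 : w ^ 2 ≤ ‖x‖ ^ 2 := by
      rw [← sq_abs]
      have := hs.abs_w_le hh
      gcongr
    rw [norm_sq_eq_sum, hlast] at h1
    have h2 : ∑ i : Fin m, x i.castSucc ^ 2 ≤ m * M₁ := by
      have := Finset.sum_le_card_nsmul Finset.univ (fun i : Fin m => x i.castSucc ^ 2) M₁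
        (fun i _ => hxM i)
      simpa using this
    have h3 : (r * Real.sin θ) ^ 2 ≤ 1 := by
      rw [← sq_abs, abs_mul, abs_of_pos hr0]
      have : r * |Real.sin θ| ≤ 1 * 1 := by gcongr
      exact pow_le_one₀ (by positivity) (this.trans_eq (one_mul 1))
    linarith
  have hκlow : c₂ ≤ κ := by
    have h1 : qform h x / (m * M₁ + 1 + β ^ 2) ≤ κ := by
      rw [qform, Finset.sum_div]
      refine Finset.sum_le_sum fun i _ => ?_
      rw [div_div]
      have := hh i
      have := (hab i).2
      gcongr
    refine le_trans ?_ h1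
    simp only [c₂]
    rw [← div_div]
    gcongr
    linarith
  have hκ0 : 0 < κ := hc₂.trans_le hκlow
  have hκhigh : κ ≤ 2 / α ^ 2 := by
    have h1 : κ ≤ qform h x / α ^ 2 := by
      rw [qform, Finset.sum_div]
      refine Finset.sum_le_sum fun i _ => ?_
      rw [div_div]
      have h3 := hh i
      have h2 : α ^ 2 ≤ h i ^ 2 := by
        have := (hab i).1
        gcongr
      gcongr
      exact h2.trans (le_add_of_nonneg_left (sq_nonneg w))
    refine h1.trans ?_
    gcongr
    linarith
  have hsumsq : (κ * w ^ 2 + v ^ 2) ^ 2 ≤ (c₃ * r) ^ 2 := by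
    have h1 : (κ * w ^ 2 + v ^ 2) ^ 2 = (κ * w ^ 2 - v ^ 2) ^ 2 + 4 * κ * (w * v) ^ 2 := by ring
    rw [h1, hrel, ← hs.last_eq, hlast, mul_pow c₃, Real.sq_sqrt (by positivity)]
    have h2 : (qform h x - 1) ^ 2 ≤ (c₁ * r) ^ 2 := by
      rw [← sq_abs]; gcongr
    have h3 : 4 * κ * (r * Real.sin θ) ^ 2 ≤ 4 * (2 / α ^ 2) * r ^ 2 := by
      have : (r * Real.sin θ) ^ 2 ≤ r ^ 2 := by
        have : Real.sin θ ^ 2 ≤ 1 := Real.sin_sq_le_one θ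
        rw [mul_pow]
        exact mul_le_of_le_one_right (sq_nonneg r) this
      gcongr
    calc _ ≤ (c₁ * r) ^ 2 + 4 * (2 / α ^ 2) * r ^ 2 := add_le_add h2 h3
      _ = _ := by ring
  have hsum : κ * w ^ 2 + v ^ 2 ≤ c₃ * r := abs_le_of_sq_le_sq' hsumsq (by positivity) |>.2
  have hv : v ^ 2 ≤ c₃ * r := by
    have : 0 ≤ κ * w ^ 2 := by positivity
    linarith
  have hw : w ^ 2 ≤ c₃ / c₂ * r := by
    rw [div_mul_eq_mul_div, le_div_iff₀ hc₂]
    have : w ^ 2 * c₂ ≤ w ^ 2 * κ := by gcongr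
    have := sq_nonneg v
    linarith
  have hwC : w ^ 2 ≤ C₁ * r := hw.trans (by
    have : 0 ≤ c₃ * r := by positivity
    simp only [C₁]; linarith)
  have hvC : v ^ 2 ≤ C₁ * r := hv.trans (by
    have : 0 ≤ c₃ / c₂ * r := by positivity
    simp only [C₁]; linarith)
  have hκ4 : |∑ i : Fin m, x i.castSucc ^ 2 / h i ^ 4 - k ^ 2| ≤ c₄ * r := by
    rw [norm_conormal_sq, ← Finset.sum_sub_distrib]
    refine (Finset.abs_sum_le_sum_abs _ _).trans ?_
    simp only [c₄, s₄]
    rw [Finset.mul_sum, Finset.sum_mul]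
    refine Finset.sum_le_sum fun i _ => ?_
    have := hh i
    rw [← sub_div, abs_div, abs_of_pos (by positivity : 0 < h i ^ 4), div_le_iff₀ (by positivity)]
    have := hdx i
    field_simp
    exact this
  have hκ6 : |κ - ∑ i : Fin m, x i.castSucc ^ 2 / h i ^ 4| ≤ C₁ * (M₁ * s₆) * r := by
    rw [hκ, ← Finset.sum_sub_distrib]
    refine (Finset.abs_sum_le_sum_abs _ _).trans ?_
    simp only [s₆]
    rw [Finset.mul_sum, Finset.mul_sum, Finset.sum_mul]
    refine Finset.sum_le_sum fun i _ => ?_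
    have := hh i
    have h1 : x i.castSucc ^ 2 / (h i ^ 2 * (w ^ 2 + h i ^ 2)) - x i.castSucc ^ 2 / h i ^ 4 =
        -(w ^ 2 * (x i.castSucc ^ 2 * (1 / (h i ^ 4 * (w ^ 2 + h i ^ 2))))) := by
      field_simp
      ring
    rw [h1, abs_neg, abs_of_nonneg (by positivity)]
    have h2 : 1 / (h i ^ 4 * (w ^ 2 + h i ^ 2)) ≤ 1 / h i ^ 6 := by
      refine one_div_le_one_div_of_le (by positivity) ?_
      have : 0 ≤ h i ^ 4 * w ^ 2 := by positivity
      linarith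
    calc _ ≤ (C₁ * r) * (M₁ * (1 / h i ^ 6)) := by
          have := hxM i
          gcongr
      _ = _ := by ring
  have hfin : |k ^ 2 * w ^ 2 - v ^ 2 - 2 * k * r * Real.cos θ| ≤ c₅ * r ^ 2 := by
    have h1 : k ^ 2 * w ^ 2 - v ^ 2 - 2 * k * r * Real.cos θ =
        -((κ - ∑ i : Fin m, x i.castSucc ^ 2 / h i ^ 4) +
          (∑ i : Fin m, x i.castSucc ^ 2 / h i ^ 4 - k ^ 2)) * w ^ 2 +
          r ^ 2 * Real.cos θ ^ 2 * Q := by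
      linear_combination hrel + hq
    rw [h1]
    refine (abs_add_le _ _).trans ?_
    rw [abs_mul, abs_neg, abs_of_nonneg (sq_nonneg w)]
    have h2 : |(κ - ∑ i : Fin m, x i.castSucc ^ 2 / h i ^ 4) +
          (∑ i : Fin m, x i.castSucc ^ 2 / h i ^ 4 - k ^ 2)| ≤ (c₄ + C₁ * (M₁ * s₆)) * r := by
      refine (abs_add_le _ _).trans ?_
      linarith
    calc _ ≤ (c₄ + C₁ * (M₁ * s₆)) * r * (C₁ * r) + 1 / α ^ 2 * r ^ 2 := by gcongr
      _ = _ := by simp only [c₅]; ring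
  refine ⟨?_, ?_, ?_, ?_, ?_⟩
  · refine hwC.trans ?_
    gcongr
    linarith
  · refine hvC.trans ?_
    gcongr
    linarith
  · intro i
    linarith [hxM i]
  · refine hκ4.trans ?_
    gcongr
    linarith
  · refine hfin.trans ?_
    gcongr
    linarith

theorem sign_mul_nonneg {c y : ℝ} (hy : 0 ≤ y) : 0 ≤ Real.sign c * y * c := by
  rcases lt_trichotomy c 0 with h | h | h
  · rw [Real.sign_of_neg h]; nlinarith
  · simp [h]
  · rw [Real.sign_of_pos h]; positivity

theorem contDiff_conormal (h : Fin m → ℝ) : ContDiff ℝ ∞ (conormal h) := by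
  rw [contDiff_piLp]
  intro j
  refine Fin.lastCases ?_ (fun i => ?_) j
  · simp only [conormal_last]; exact contDiff_const
  · simp only [conormal_castSucc]
    have : ContDiff ℝ ∞ fun p : Space (m + 1) => p i.castSucc := by fun_prop
    exact this.div_const _

/-- Both approximations apply with e = √(C r) and k = ‖conormal h p‖. The leading coefficient is the
real number -(2/3)√(2k), smooth and nonzero because the conormal does not vanish on the ellipsoid,
and the bounds on k make the error constants uniform. -/
theorem isNondegenerate_model {h : Fin m → ℝ} (hh : ∀ i, 0 < h i) :
    IsNondegenerate (ellipsoid (.refl ℝ _) h) (normalOne (.refl ℝ _) h) (normalTwo (.refl ℝ _))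
      (model h) := by
  refine ⟨isZ2Harmonic_model hh, ?_⟩
  obtain ⟨α, β, hα, hβ, hab⟩ := exists_bounds hh
  obtain ⟨C, r₀, hC, hr₀, hbd⟩ := exists_circ_bounds hh
  set M := C + 1 / α ^ 2 + 1
  have hM0 : 0 ≤ M := by positivity
  obtain ⟨K₁, hK₁, happ⟩ := exists_Phi_approx hh hM0
  set C₂ := (1 / α + 1) * √C + √(2 * (1 / α))
  refine ⟨fun p => ((-(2 / 3 * √(2 * ‖conormal h p‖)) : ℝ) : ℂ), fun p hp => ⟨?_, ?_⟩,
    K₁ * √C ^ 5 + C * C₂ ^ 2 / (1 / β * √(2 * (1 / β))), min r₀ (1 / C), by positivity, ?_⟩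
  · have hne := conormal_ne_zero hp
    refine Complex.ofRealCLM.contDiff.contDiffAt.comp p (ContDiffAt.neg (contDiffAt_const.mul
      (ContDiffAt.sqrt (contDiffAt_const.mul ((contDiff_conormal h).contDiffAt.norm ℝ hne)) ?_)))
    simpa using hne
  · have : 0 < ‖conormal h p‖ := norm_pos_iff.2 (conormal_ne_zero hp)
    rw [Ne, Complex.ofReal_eq_zero]
    have : 0 < √(2 * ‖conormal h p‖) := Real.sqrt_pos.2 (by positivity)
    linarith
  intro p hp r hr0 hr
  obtain ⟨hsr, hall⟩ := hbd r hr0 (hr.trans_le (min_le_left _ _))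
  have hrC : C * r ≤ 1 := by
    have := (hr.trans_le (min_le_right _ _)).le
    rw [le_div_iff₀ hC] at this
    linarith
  refine ⟨_, isContinuation_circ hh hsr hp, fun θ => ?_⟩
  obtain ⟨hw, hv, hx, hκ, hre⟩ := hall p hp θ
  have hs := circ_isSol hh hsr hp θ
  have hval : gBr h (circW h p r θ) (circV h p r θ) (circPt h p r θ) =
      Phi h (circPt h p r θ) (circW h p r θ) (circV h p r θ) :=
    gBr_eq hh hs (hs.sq_add_sq_pos hh (hsr.notMem p hp θ))
  have hcos : 0 ≤ circW h p r θ * Real.cos (θ / 2) := sign_mul_nonneg (wAbs_spec hh _).1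
  have hsin : 0 ≤ circV h p r θ * Real.sin (θ / 2) := sign_mul_nonneg (abs_nonneg _)
  have hlast : circPt h p r θ (Fin.last m) = r * Real.sin θ := normalCircle_last hp r θ
  have hwv := hs.last_eq
  rw [hlast] at hwv
  change |gBr h (circW h p r θ) (circV h p r θ) (circPt h p r θ) - _| ≤ _
  rw [hval]
  set x := circPt h p r θ
  set w := circW h p r θ
  set v := circV h p r θ
  obtain ⟨hk1, hk2⟩ := norm_conormal_bounds hα hab hp
  set k := ‖conormal h p‖
  have hk : 0 < k := lt_of_lt_of_le (by positivity) hk1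
  set ρ := √r with hρdef
  have hρ : 0 < ρ := Real.sqrt_pos.2 hr0
  have hρ2 : r = ρ ^ 2 := (Real.sq_sqrt hr0.le).symm
  have hr3 : r ^ (3 / 2 : ℝ) = ρ ^ 3 := by
    rw [hρdef, Real.sqrt_eq_rpow, ← Real.rpow_natCast, ← Real.rpow_mul hr0.le]; norm_num
  have hr5 : r ^ (5 / 2 : ℝ) = ρ ^ 5 := by
    rw [hρdef, Real.sqrt_eq_rpow, ← Real.rpow_natCast, ← Real.rpow_mul hr0.le]; norm_num
  have heq : √C * ρ = √(C * r) := (Real.sqrt_mul hC.le r).symm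
  have hwe : |w| ≤ √C * ρ := by rw [heq]; exact Real.abs_le_sqrt hw
  have hve : |v| ≤ √C * ρ := by rw [heq]; exact Real.abs_le_sqrt hv
  have he1 : √C * ρ ≤ 1 := by rw [heq]; exact Real.sqrt_le_one.2 hrC
  have hk2' : k ^ 2 ≤ M := by
    have : k ^ 2 ≤ (1 / α) ^ 2 := by gcongr
    rw [div_pow, one_pow] at this
    simp only [M]; linarith
  have h1 := happ x w v (√C * ρ) (k ^ 2) hs (by positivity) he1 hwe hve
    (fun i => (hx i).trans (by simp only [M]; have : 0 < 1 / α ^ 2 := by positivity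
                               linarith)) (by positivity) hk2' (hκ.trans (by
      rw [mul_pow, Real.sq_sqrt hC.le, ← hρ2]
      refine le_mul_of_one_le_left (by positivity) ?_
      have : 0 < 1 / α ^ 2 := by positivity
      simp only [M]; linarith))
  have h2 := abs_cube_sub_le (k := k) (C := C₂) (c := C) hk hρ hC.le hcos hsin
    (by rw [← hρ2]; exact hwv.symm) (by
      have : 0 ≤ √(2 * (1 / α)) * ρ := by positivity
      calc k * |w| + |v| ≤ 1 / α * (√C * ρ) + √C * ρ := by gcongr
        _ ≤ C₂ * ρ := by simp only [C₂]; linarith)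
    (by
      have : 0 ≤ (1 / α + 1) * √C := by positivity
      have : √(2 * k) ≤ √(2 * (1 / α)) := by gcongr
      simp only [C₂]; linarith)
    (by rw [← hρ2, show ρ ^ 4 = r ^ 2 by rw [hρ2]; ring]; exact hre)
  have h3 : C * C₂ ^ 2 / (k * √(2 * k)) * ρ ^ 5 ≤
      C * C₂ ^ 2 / (1 / β * √(2 * (1 / β))) * ρ ^ 5 := by gcongr
  have hmain : ((((-(2 / 3 * √(2 * k)) : ℝ) : ℂ)) * Complex.exp ((3 / 2 * θ : ℝ) * Complex.I)).re =
      -(2 / 3 * √(2 * k)) * Real.cos (3 / 2 * θ) := by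
    rw [Complex.re_ofReal_mul, Complex.exp_ofReal_mul_I_re]
  rw [hmain, hr3, hr5]
  calc _ = |(Phi h x w v - (v ^ 2 * w - k ^ 2 * w ^ 3 / 3)) + ((v ^ 2 * w - k ^ 2 * w ^ 3 / 3) +
        2 * √(2 * k) / 3 * ρ ^ 3 * Real.cos (3 / 2 * θ))| := by congr 1; ring
    _ ≤ K₁ * (√C * ρ) ^ 5 + C * C₂ ^ 2 / (1 / β * √(2 * (1 / β))) * ρ ^ 5 :=
        (abs_add_le _ _).trans (add_le_add h1 (h2.trans h3))
    _ = _ := by ring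

end Nondegeneracy
end ZTwo

/-! ### Asymptotics of the explicit function at infinity. -/

namespace ZTwo

open InnerProductSpace

section Asymptotics

variable {m : ℕ}

theorem rpow_le_sqrt_S (h : Fin m → ℝ) {u : ℝ} (hu : 0 < u) : u ^ (m : ℝ) ≤ √(S h (u ^ 2)) := by
  rw [Real.rpow_natCast]
  refine Real.le_sqrt_of_sq_le ?_
  calc (u ^ m) ^ 2 = ∏ _i : Fin m, u ^ 2 := by simp [← pow_mul, mul_comm]
    _ ≤ S h (u ^ 2) := Finset.prod_le_prod (fun i _ => by positivity) fun i _ => by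
        nlinarith [sq_nonneg (h i)]

theorem one_div_sqrt_S_le_rpow (h : Fin m → ℝ) {u : ℝ} (hu : 0 < u) :
    1 / √(S h (u ^ 2)) ≤ u ^ (-(m : ℝ)) := by
  rw [Real.rpow_neg hu.le, ← one_div]
  exact one_div_le_one_div_of_le (Real.rpow_pos_of_pos hu _) (rpow_le_sqrt_S h hu)

theorem coeff_integrand_le_rpow (h : Fin m → ℝ) (i : Fin m) {u : ℝ} (hu : 0 < u) :
    1 / ((u ^ 2 + h i ^ 2) * √(S h (u ^ 2))) ≤ u ^ (-((m : ℝ) + 2)) := by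
  have h1 := rpow_le_sqrt_S h hu
  have h2 : 0 < u ^ (m : ℝ) := Real.rpow_pos_of_pos hu _
  rw [Real.rpow_neg hu.le, ← one_div, Real.rpow_add hu, Real.rpow_two, mul_comm (u ^ (m : ℝ))]
  refine one_div_le_one_div_of_le (by positivity) ?_
  gcongr
  nlinarith [sq_nonneg (h i)]

theorem tail_bound {f : ℝ → ℝ} {w s : ℝ} (hw : 0 < w) (hs : 0 < s)
    (hf : IntegrableOn f (Set.Ioi w)) (h0 : ∀ u, 0 ≤ f u) (hle : ∀ u, 0 < u → f u ≤ u ^ (-(s + 1))) :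
    |∫ u in Set.Ioi w, f u| ≤ 1 / s * w ^ (-s) := by
  rw [abs_of_nonneg (integral_nonneg h0)]
  have h1 : -(s + 1) < -1 := by linarith
  calc ∫ u in Set.Ioi w, f u ≤ ∫ u in Set.Ioi w, u ^ (-(s + 1)) :=
        setIntegral_mono_on hf (integrableOn_Ioi_rpow_of_lt h1 hw) measurableSet_Ioi
          fun u hu => hle u (hw.trans hu)
    _ = 1 / s * w ^ (-s) := by
        rw [integral_Ioi_rpow_of_lt h1 hw]
        have : -(s + 1) + 1 = -s := by ring
        rw [this]
        field_simp

/-- The complete integrals over (0, ∞) reproduce the model polynomial, with `aLast_eq` for the last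
coordinate; only tails and the boundary term survive. -/
theorem Phi_sub_modelPoly (hm : 2 ≤ m) {h : Fin m → ℝ} (hh : ∀ i, 0 < h i) (x : Space (m + 1))
    (w v : ℝ) :
    Phi h x w v - modelPoly h x = (∏ j, h j) / 2 * (-(∫ u in Set.Ioi w, 1 / √(S h (u ^ 2))) +
      ∑ i : Fin m, (x i.castSucc ^ 2 - x (Fin.last m) ^ 2) *
        (∫ u in Set.Ioi w, 1 / ((u ^ 2 + h i ^ 2) * √(S h (u ^ 2)))) +
      x (Fin.last m) * v * (1 / √(S h (w ^ 2)))) := by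
  have h0 : primZero h w = (∫ u in Set.Ioi (0 : ℝ), 1 / √(S h (u ^ 2))) -
      ∫ u in Set.Ioi w, 1 / √(S h (u ^ 2)) := by
    rw [primZero, eq_sub_iff_add_eq]
    exact intervalIntegral.integral_interval_add_Ioi (integrable_one_div_sqrt_S hm hh).integrableOn
      (integrable_one_div_sqrt_S hm hh).integrableOn
  have hi : ∀ i, primCoeff h i w =
      (∫ u in Set.Ioi (0 : ℝ), 1 / ((u ^ 2 + h i ^ 2) * √(S h (u ^ 2)))) -
      ∫ u in Set.Ioi w, 1 / ((u ^ 2 + h i ^ 2) * √(S h (u ^ 2))) := fun i => by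
    rw [primCoeff, eq_sub_iff_add_eq]
    exact intervalIntegral.integral_interval_add_Ioi (integrable_coeff_integrand hm hh i).integrableOn
      (integrable_coeff_integrand hm hh i).integrableOn
  rw [Phi, modelPoly, aLast_eq hm hh, aZero, h0]
  simp only [aCoeff, hi]
  generalize (∫ u in Set.Ioi (0 : ℝ), 1 / √(S h (u ^ 2))) = I₀
  generalize (∫ u in Set.Ioi w, 1 / √(S h (u ^ 2))) = T₀
  have hsplit : ∑ i : Fin m, (x i.castSucc ^ 2 - x (Fin.last m) ^ 2) *
      (∫ u in Set.Ioi w, 1 / ((u ^ 2 + h i ^ 2) * √(S h (u ^ 2)))) =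
      ∑ i : Fin m, x i.castSucc ^ 2 * (∫ u in Set.Ioi w, 1 / ((u ^ 2 + h i ^ 2) * √(S h (u ^ 2)))) -
      x (Fin.last m) ^ 2 * ∑ i, (∫ u in Set.Ioi w, 1 / ((u ^ 2 + h i ^ 2) * √(S h (u ^ 2)))) := by
    rw [Finset.mul_sum, ← Finset.sum_sub_distrib]
    exact Finset.sum_congr rfl fun i _ => by ring
  have hA : ∑ i : Fin m, (∏ j, h j) / 2 * (∫ u in Set.Ioi (0 : ℝ), 1 / ((u ^ 2 + h i ^ 2) * √(S h (u ^ 2)))) *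
      x i.castSucc ^ 2 = (∏ j, h j) / 2 * ∑ i : Fin m, x i.castSucc ^ 2 *
        (∫ u in Set.Ioi (0 : ℝ), 1 / ((u ^ 2 + h i ^ 2) * √(S h (u ^ 2)))) := by
    rw [Finset.mul_sum]
    exact Finset.sum_congr rfl fun i _ => by ring
  rw [hsplit, hA, ← Finset.mul_sum]
  simp only [mul_sub, Finset.sum_sub_distrib]
  ring

/-- The constant in the decay estimate for the explicit solution. -/
noncomputable def decayConst (m : ℕ) : ℝ :=
  1 / ((m : ℝ) - 1) * 2 ^ ((m : ℝ) - 1) + m * (1 / ((m : ℝ) + 1) * 2 ^ ((m : ℝ) + 1)) + 2 ^ (m : ℝ)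

/-- The three error terms are of order w^(1-m), ‖x‖² w^(-(m+1)) and ‖x‖ w^(-m), and w is at least
‖x‖/2. An explicit constant, depending on h only through the product, is kept because convergence as
C → 0 needs it uniformly. -/
theorem abs_Phi_sub_modelPoly_le (hm : 2 ≤ m) {h : Fin m → ℝ} (hh : ∀ i, 0 < h i) {x : Space (m + 1)}
    (hx : 2 * √(∑ i, h i ^ 2) < ‖x‖) :
    |Phi h x (wAbs h x) (vSel h x) - modelPoly h x| ≤
      (∏ j, h j) / 2 * decayConst m * ‖x‖ ^ (1 - (m : ℝ)) := by
  obtain ⟨hw0, hs⟩ := wAbs_spec hh x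
  set w := wAbs h x
  set v := vSel h x
  set N := ‖x‖
  have hN : 0 < N := lt_of_le_of_lt (by positivity) hx
  have hσ : 0 ≤ ∑ i, h i ^ 2 := Finset.sum_nonneg fun i _ => by positivity
  have hm' : (2 : ℝ) ≤ m := by exact_mod_cast hm
  have hwN : N / 2 ≤ w := by
    have h1 := hs.norm_sq_eq hh
    have h2 : ∑ i, x i.castSucc ^ 2 / (w ^ 2 + h i ^ 2) * h i ^ 2 ≤ ∑ i, h i ^ 2 := by
      refine Finset.sum_le_sum fun i _ => mul_le_of_le_one_left (sq_nonneg _) ?_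
      have h3 : x i.castSucc ^ 2 / (w ^ 2 + h i ^ 2) ≤ ∑ i, x i.castSucc ^ 2 / (w ^ 2 + h i ^ 2) :=
        Finset.single_le_sum (f := fun i : Fin m => x i.castSucc ^ 2 / (w ^ 2 + h i ^ 2))
          (fun i _ => by positivity) (Finset.mem_univ i)
      have := hs.sum_eq
      nlinarith [sq_nonneg v]
    have h3 : 4 * ∑ i, h i ^ 2 ≤ N ^ 2 := by
      have := pow_le_pow_left₀ (by positivity) hx.le 2
      rw [mul_pow, Real.sq_sqrt hσ] at this
      linarith
    refine le_of_sq_le_sq ?_ hw0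
    change N ^ 2 = _ at h1
    nlinarith
  have hw : 0 < w := lt_of_lt_of_le (by positivity) hwN
  have hpow : ∀ s : ℝ, 0 ≤ s → w ^ (-s) ≤ 2 ^ s * N ^ (-s) := fun s hs0 => by
    calc w ^ (-s) ≤ (N / 2) ^ (-s) := Real.rpow_le_rpow_of_nonpos (by positivity) hwN (by linarith)
      _ = 2 ^ s * N ^ (-s) := by
        rw [Real.div_rpow hN.le (by norm_num), Real.rpow_neg (by norm_num : (0 : ℝ) ≤ 2)]
        field_simp
  have hb0 : |∫ u in Set.Ioi w, 1 / √(S h (u ^ 2))| ≤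
      1 / ((m : ℝ) - 1) * 2 ^ ((m : ℝ) - 1) * N ^ (1 - (m : ℝ)) := by
    refine (tail_bound hw (s := (m : ℝ) - 1) (by linarith) (integrable_one_div_sqrt_S hm hh).integrableOn
      (fun u => by positivity) fun u hu => ?_).trans ?_
    · rw [show -((m : ℝ) - 1 + 1) = -(m : ℝ) by ring]
      exact one_div_sqrt_S_le_rpow h hu
    · rw [mul_assoc, show 1 - (m : ℝ) = -((m : ℝ) - 1) by ring]
      have : (0 : ℝ) ≤ 1 / ((m : ℝ) - 1) := one_div_nonneg.2 (by linarith)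
      exact mul_le_mul_of_nonneg_left (hpow _ (by linarith)) this
  have hbi : ∀ i, |∫ u in Set.Ioi w, 1 / ((u ^ 2 + h i ^ 2) * √(S h (u ^ 2)))| ≤
      1 / ((m : ℝ) + 1) * (2 ^ ((m : ℝ) + 1) * N ^ (-((m : ℝ) + 1))) := fun i => by
    refine (tail_bound hw (s := (m : ℝ) + 1) (by linarith) (integrable_coeff_integrand hm hh i).integrableOn
      (fun u => by positivity) fun u hu => ?_).trans ?_
    · rw [show -((m : ℝ) + 1 + 1) = -((m : ℝ) + 2) by ring]
      exact coeff_integrand_le_rpow h i hu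
    · gcongr
      exact hpow _ (by linarith)
  have hcoord : ∀ j, x j ^ 2 ≤ N ^ 2 := fun j => by
    rw [← sq_abs]
    have := PiLp.norm_apply_le x j
    rw [Real.norm_eq_abs] at this
    gcongr
  have hN2 : N ^ 2 * N ^ (-((m : ℝ) + 1)) = N ^ (1 - (m : ℝ)) := by
    rw [← Real.rpow_two, ← Real.rpow_add hN]; ring_nf
  have hN1 : N * N ^ (-(m : ℝ)) = N ^ (1 - (m : ℝ)) := by
    rw [sub_eq_add_neg, Real.rpow_add hN, Real.rpow_one]
  have hbsum : |∑ i : Fin m, (x i.castSucc ^ 2 - x (Fin.last m) ^ 2) *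
        (∫ u in Set.Ioi w, 1 / ((u ^ 2 + h i ^ 2) * √(S h (u ^ 2))))| ≤
      m * (1 / ((m : ℝ) + 1) * 2 ^ ((m : ℝ) + 1)) * N ^ (1 - (m : ℝ)) := by
    refine (Finset.abs_sum_le_sum_abs _ _).trans ?_
    refine (Finset.sum_le_card_nsmul _ _
      (1 / ((m : ℝ) + 1) * 2 ^ ((m : ℝ) + 1) * N ^ (1 - (m : ℝ))) fun i _ => ?_).trans_eq ?_
    · rw [abs_mul, ← hN2]
      have h1 : |x i.castSucc ^ 2 - x (Fin.last m) ^ 2| ≤ N ^ 2 := by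
        rw [abs_le]
        constructor <;> nlinarith [hcoord i.castSucc, hcoord (Fin.last m), sq_nonneg (x i.castSucc),
          sq_nonneg (x (Fin.last m))]
      calc _ ≤ N ^ 2 * (1 / ((m : ℝ) + 1) * (2 ^ ((m : ℝ) + 1) * N ^ (-((m : ℝ) + 1)))) :=
            mul_le_mul h1 (hbi i) (abs_nonneg _) (by positivity)
        _ = _ := by ring
    · simp only [Finset.card_univ, Fintype.card_fin, nsmul_eq_mul]
      ring
  have hblast : |x (Fin.last m) * v * (1 / √(S h (w ^ 2)))| ≤ 2 ^ (m : ℝ) * N ^ (1 - (m : ℝ)) := by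
    rw [abs_mul, abs_mul, abs_of_nonneg (by positivity : 0 ≤ 1 / √(S h (w ^ 2)))]
    have h1 := PiLp.norm_apply_le x (Fin.last m)
    rw [Real.norm_eq_abs] at h1
    calc |x (Fin.last m)| * |v| * (1 / √(S h (w ^ 2))) ≤ N * 1 * (2 ^ (m : ℝ) * N ^ (-(m : ℝ))) := by
          have := hs.abs_v_le
          have := (one_div_sqrt_S_le_rpow h hw).trans (hpow _ (by positivity))
          gcongr
      _ = _ := by rw [← hN1]; ring
  rw [Phi_sub_modelPoly hm hh, abs_mul, abs_of_pos (by have := prod_h_pos hh; positivity),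
    mul_assoc ((∏ j, h j) / 2)]
  have := prod_h_pos hh
  refine mul_le_mul_of_nonneg_left ?_ (by positivity)
  refine (abs_add_three _ _ _).trans ?_
  rw [abs_neg, decayConst]
  linarith

theorem wAbs_pos_of_mem_outer {h : Fin m → ℝ} (hh : ∀ i, 0 < h i) {x : Space (m + 1)}
    (hx : x ∈ outerRegion h) : 0 < wAbs h x := by
  refine lt_of_le_of_ne (wAbs_spec hh x).1 fun h0 => ?_
  obtain ⟨h1, h2⟩ := (wAbs_eq_zero_iff hh).1 h0.symm
  rcases hx with h3 | h3
  · exact h3 h1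
  · exact absurd h2 (not_le.2 h3)

theorem isBranchOn_model {h : Fin m → ℝ} (hh : ∀ i, 0 < h i) :
    IsBranchOn (model h) (outerRegion h) (gBr h 1 0) :=
  isBranchOn_of_forall fun x hx => (gBr_germ hh (wAbs_spec hh x).2 (notMem_ellipsoid_of_mem_outer hx)
    (by simpa using wAbs_pos_of_mem_outer hh hx)).1

theorem gBr_eq_of_mem_outer {h : Fin m → ℝ} (hh : ∀ i, 0 < h i) {x : Space (m + 1)}
    (hx : x ∈ outerRegion h) : gBr h 1 0 x = Phi h x (wAbs h x) (vSel h x) :=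
  gBr_eq hh (wAbs_spec hh x).2 (by simpa using wAbs_pos_of_mem_outer hh hx)

theorem mem_outerRegion_of_norm_gt {h : Fin m → ℝ} (hh : ∀ i, 0 < h i) {x : Space (m + 1)}
    (hx : 2 * √(∑ i, h i ^ 2) < ‖x‖) : x ∈ outerRegion h :=
  norm_gt_subset_outerRegion hh (by have := Real.sqrt_nonneg (∑ i, h i ^ 2); linarith) hx

theorem norm_rpow_eq_zpow (x : Space (m + 1)) :
    ‖x‖ ^ (1 - (m : ℝ)) = ‖x‖ ^ ((2 : ℤ) - ((m + 1 : ℕ) : ℤ)) := by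
  rw [← Real.rpow_intCast]
  push_cast
  ring_nf

theorem hasAsymptotics_model (hm : 2 ≤ m) {h : Fin m → ℝ} (hh : ∀ i, 0 < h i) :
    HasAsymptotics (model h) (modelPoly h) := by
  refine ⟨2 * √(∑ i, h i ^ 2), gBr h 1 0,
    (isBranchOn_model hh).mono fun x hx => mem_outerRegion_of_norm_gt hh hx, ?_⟩
  refine Asymptotics.IsBigO.of_bound ((∏ j, h j) / 2 * decayConst m) ?_
  filter_upwards [(tendsto_norm_cobounded_atTop (E := Space (m + 1))).eventually_gt_atTop (2 * √(∑ i, h i ^ 2))] with x hx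
  rw [gBr_eq_of_mem_outer hh (mem_outerRegion_of_norm_gt hh hx), ← norm_rpow_eq_zpow, Real.norm_eq_abs,
    Real.norm_of_nonneg (by positivity)]
  exact abs_Phi_sub_modelPoly_le hm hh hx

end Asymptotics
end ZTwo

/-! ### Transport by isometries and scalars; reduction to the explicit function. -/

namespace ZTwo

open InnerProductSpace

section Transport

variable {n : ℕ}

/-- The two-valued function `c • f ∘ A⁻¹`. -/
def transport (A : Space n ≃ₗᵢ[ℝ] Space n) (c : ℝ) (f : TwoValued n) : TwoValued n :=
  fun x => (fun y => c * y) '' f (A.symm x)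

theorem transport_symm_transport (A : Space n ≃ₗᵢ[ℝ] Space n) {c : ℝ} (hc : c ≠ 0) (f : TwoValued n) :
    transport A.symm c⁻¹ (transport A c f) = f := by
  funext x
  simp [transport, Set.image_image, hc]

theorem transport_pair (A : Space n ≃ₗᵢ[ℝ] Space n) (c : ℝ) {f : TwoValued n} {x : Space n} {y : ℝ}
    (h : f (A.symm x) = {y, -y}) : transport A c f x = {c * y, -(c * y)} := by
  rw [transport, h, Set.image_pair, mul_neg]

theorem IsBranchAt.transport (A : Space n ≃ₗᵢ[ℝ] Space n) (c : ℝ) {f : TwoValued n} {x : Space n}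
    {g : Space n → ℝ} (h : IsBranchAt f (A.symm x) g) :
    IsBranchAt (transport A c f) x fun y => c * g (A.symm y) := by
  constructor
  · have h1 := HarmonicAt.comp_isometry A.symm 0 (f := g) (x := x) (by simpa using h.1)
    simp only [zero_add] at h1
    exact h1.const_smul (c := c)
  · have h2 := (A.symm.continuous.tendsto x).eventually h.2
    filter_upwards [h2] with y hy using transport_pair A c hy

theorem IsBranchAt.of_transport (A : Space n ≃ₗᵢ[ℝ] Space n) {c : ℝ} (hc : c ≠ 0) {f : TwoValued n}
    {x : Space n} {g : Space n → ℝ} (h : IsBranchAt (ZTwo.transport A c f) x g) :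
    IsBranchAt f (A.symm x) fun y => c⁻¹ * g (A y) := by
  have h1 := IsBranchAt.transport A.symm c⁻¹ (x := A.symm x) (by simpa using h)
  rwa [transport_symm_transport A hc] at h1

theorem IsContinuation.transport (A : Space n ≃ₗᵢ[ℝ] Space n) (c : ℝ) {f : TwoValued n}
    {γ : ℝ → Space n} {G : ℝ → Space n → ℝ} (h : IsContinuation f γ G) :
    IsContinuation (ZTwo.transport A c f) (fun t => A (γ t)) fun t x => c * G t (A.symm x) := by
  refine ⟨fun t => IsBranchAt.transport A c (by simpa using h.branch t), fun t => ?_⟩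
  filter_upwards [h.locally_constant t] with s hs
  have h1 : Tendsto A.symm (𝓝 (A (γ s))) (𝓝 (γ s)) := by
    simpa using A.symm.continuous.tendsto (A (γ s))
  filter_upwards [h1.eventually hs] with y hy
  rw [hy]

theorem normalCircle_map (A : Space n ≃ₗᵢ[ℝ] Space n) {ν₁ ν₂ ν₁' ν₂' : Space n → Space n}
    (h₁ : ∀ x, ν₁' (A x) = A (ν₁ x)) (h₂ : ∀ x, ν₂' (A x) = A (ν₂ x)) (p : Space n) (r : ℝ) :
    normalCircle ν₁' ν₂' (A p) r = fun θ => A (normalCircle ν₁ ν₂ p r θ) := by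
  funext θ
  simp [normalCircle, h₁, h₂]

theorem LocallyIntegrable.comp_isometry (A : Space n ≃ₗᵢ[ℝ] Space n) {D : Space n → ℝ}
    (hD : LocallyIntegrable D volume) : LocallyIntegrable (fun x => D (A x)) volume := by
  have h1 := locallyIntegrable_map_homeomorph A.toHomeomorph (f := D) (μ := volume)
  have h2 : Measure.map A.toHomeomorph volume = (volume : Measure (Space n)) :=
    A.measurePreserving.map_eq
  rw [h2] at h1
  exact h1.1 hD

theorem IsNondegenerate.transport (A : Space n ≃ₗᵢ[ℝ] Space n) {c : ℝ} (hc : 0 < c)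
    {Z Z' : Set (Space n)} {ν₁ ν₂ ν₁' ν₂' : Space n → Space n} {f : TwoValued n}
    (hf : IsNondegenerate Z ν₁ ν₂ f) (hZ : Z' = A '' Z)
    (h₁ : ∀ x, ν₁' (A x) = A (ν₁ x)) (h₂ : ∀ x, ν₂' (A x) = A (ν₂ x)) :
    IsNondegenerate Z' ν₁' ν₂' (ZTwo.transport A c f) := by
  subst hZ
  have hmem : ∀ x, x ∉ A '' Z → A.symm x ∉ Z := fun x hx hx' => hx ⟨_, hx', by simp⟩
  refine ⟨⟨?_, ?_, ?_, ?_, ?_⟩, ?_⟩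
  · rintro _ ⟨p, hp, rfl⟩
    simp [ZTwo.transport, hf.eq_zero p hp]
  · intro x hx
    obtain ⟨g, hg⟩ := hf.branch _ (hmem x hx)
    exact ⟨_, hg.transport A c⟩
  · rintro _ ⟨p, hp, rfl⟩
    obtain ⟨r₀, hr₀, hall⟩ := hf.monodromy p hp
    refine ⟨r₀, hr₀, fun r h0 h1 => ?_⟩
    obtain ⟨G, hG, hmon⟩ := hall r h0 h1
    rw [normalCircle_map A h₁ h₂]
    refine ⟨_, hG.transport A c, fun θ => ?_⟩
    have h1 : Tendsto A.symm (𝓝 (A (normalCircle ν₁ ν₂ p r θ))) (𝓝 (normalCircle ν₁ ν₂ p r θ)) := by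
      simpa using A.symm.continuous.tendsto (A (normalCircle ν₁ ν₂ p r θ))
    filter_upwards [h1.eventually (hmon θ)] with y hy
    rw [hy, mul_neg]
  · obtain ⟨D, hD, hall⟩ := hf.sq_integrable
    refine ⟨fun x => c ^ 2 * D (A.symm x), (LocallyIntegrable.comp_isometry A.symm hD).smul (c ^ 2),
      fun x g hx hg => ?_⟩
    simp only [hall _ _ (hmem x hx) (hg.of_transport A hc.ne')]
    simp only [LinearIsometryEquiv.apply_symm_apply]
    field_simp
  · obtain ⟨D, hD, hall⟩ := hf.grad_sq_integrable
    refine ⟨fun x => c ^ 2 * D (A.symm x), (LocallyIntegrable.comp_isometry A.symm hD).smul (c ^ 2),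
      fun x g hx hg => ?_⟩
    simp only [hall _ _ (hmem x hx) (hg.of_transport A hc.ne')]
    have hgd : DifferentiableAt ℝ g (A (A.symm x)) := by
      simpa using hg.1.1.differentiableAt (by simp)
    have hcomp : HasFDerivAt (fun y => g (A y))
        ((fderiv ℝ g (A (A.symm x))).comp (A : Space n →L[ℝ] Space n)) (A.symm x) :=
      hgd.hasFDerivAt.comp (A.symm x) (A : Space n →L[ℝ] Space n).hasFDerivAt
    rw [(hcomp.const_mul c⁻¹).fderiv, norm_smul, mul_pow,
      ContinuousLinearMap.opNorm_comp_linearIsometryEquiv, LinearIsometryEquiv.apply_symm_apply,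
      Real.norm_eq_abs, sq_abs]
    field_simp
  · obtain ⟨B, hB, K, r₀, hr₀, hall⟩ := hf.expansion
    refine ⟨fun x => c * B (A.symm x), ?_, c * K, r₀, hr₀, ?_⟩
    · rintro _ ⟨p, hp, rfl⟩
      obtain ⟨hB1, hB2⟩ := hB p hp
      refine ⟨?_, by simpa using ⟨hc.ne', hB2⟩⟩
      refine contDiffAt_const.mul (ContDiffAt.comp (A p) ?_ A.symm.contDiff.contDiffAt)
      simpa using hB1
    · rintro _ ⟨p, hp, rfl⟩ r h0 h1
      obtain ⟨G, hG, hexp⟩ := hall p hp r h0 h1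
      rw [normalCircle_map A h₁ h₂]
      refine ⟨_, hG.transport A c, fun θ => ?_⟩
      simp only [LinearIsometryEquiv.symm_apply_apply]
      have h3 : ((c : ℂ) * B p * Complex.exp ((3 / 2 * θ : ℝ) * Complex.I)).re =
          c * (B p * Complex.exp ((3 / 2 * θ : ℝ) * Complex.I)).re := by
        rw [mul_assoc, Complex.re_ofReal_mul]
      rw [h3]
      calc _ = |c * (G θ (normalCircle ν₁ ν₂ p r θ) -
            r ^ (3 / 2 : ℝ) * (B p * Complex.exp ((3 / 2 * θ : ℝ) * Complex.I)).re)| := by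
              congr 1; ring
        _ ≤ c * (K * r ^ (5 / 2 : ℝ)) := by
            rw [abs_mul, abs_of_pos hc]
            exact mul_le_mul_of_nonneg_left (hexp θ) hc.le
        _ = _ := by ring

theorem HasAsymptotics.transport (A : Space n ≃ₗᵢ[ℝ] Space n) (c : ℝ) {f : TwoValued n}
    {Q : Space n → ℝ} (hf : HasAsymptotics f Q) :
    HasAsymptotics (ZTwo.transport A c f) fun x => c * Q (A.symm x) := by
  obtain ⟨R, g, hg, hO⟩ := hf
  refine ⟨R, fun x => c * g (A.symm x), isBranchOn_of_forall fun x hx => ?_, ?_⟩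
  · refine (hg.isBranchAt (isOpen_lt continuous_const continuous_norm) ?_).transport A c
    simpa using hx
  · have h1 := (hO.comp_tendsto A.symm.antilipschitz.tendsto_cobounded).const_mul_left c
    refine (h1.congr (fun x => ?_) fun x => ?_)
    · simp only [Function.comp]; ring
    · simp

variable {m : ℕ}

theorem ellipsoid_eq_image (A : Space (m + 1) ≃ₗᵢ[ℝ] Space (m + 1)) (h : Fin m → ℝ) :
    ellipsoid A h = A '' ellipsoid (.refl ℝ _) h := by
  simp [ellipsoid]

theorem isEllipsoidal_transport (hm : 2 ≤ m) (A : Space (m + 1) ≃ₗᵢ[ℝ] Space (m + 1)) {h : Fin m → ℝ}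
    (hh : ∀ i, 0 < h i) {c : ℝ} (hc : 0 < c) : IsEllipsoidal A h c (transport A c (model h)) where
  h_pos := hh
  c_pos := hc
  nondegenerate := (isNondegenerate_model hh).transport A hc (ellipsoid_eq_image A h)
    (fun x => by rw [normalOne_refl]; simp [normalOne]) fun x => by simp [normalTwo]
  asymptotics := (hasAsymptotics_model hm hh).transport A c

/-- Pull back to the standard ellipsoid and apply `eq_of_isNondegenerate`. The family is thereby
parametrised by the triples `(A, h, c)`. -/
theorem IsEllipsoidal.eq_transport (hm : 2 ≤ m) {A : Space (m + 1) ≃ₗᵢ[ℝ] Space (m + 1)}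
    {h : Fin m → ℝ} {c : ℝ} {f : TwoValued (m + 1)} (hf : IsEllipsoidal A h c f) :
    f = transport A c (model h) := by
  have hc := hf.c_pos
  have h1 : IsNondegenerate (ellipsoid (.refl ℝ _) h) (normalOne (.refl ℝ _) h)
      (normalTwo (.refl ℝ _)) (transport A.symm c⁻¹ f) := by
    refine hf.nondegenerate.transport A.symm (inv_pos.2 hc) ?_ (fun x => ?_) fun x => ?_
    · rw [ellipsoid_eq_image A, Set.image_image]
      simp
    · rw [normalOne_refl]; simp [normalOne]
    · simp [normalTwo]
  have h2 : HasAsymptotics (transport A.symm c⁻¹ f) (modelPoly h) := by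
    have := hf.asymptotics.transport A.symm c⁻¹
    simpa [hc.ne'] using this
  have h3 := eq_of_isNondegenerate hm hf.h_pos h1 (isNondegenerate_model hf.h_pos) h2
    (hasAsymptotics_model hm hf.h_pos)
  rw [← h3]
  have h4 := transport_symm_transport A.symm (inv_ne_zero hc.ne') f
  rw [inv_inv, LinearIsometryEquiv.symm_symm] at h4
  exact h4.symm

/-- Along a ray κ + t²Q(x) must tend to zero, the exponent 1 - m being negative; this kills Q and
then κ. -/
theorem eq_zero_of_isBigO_of_homogeneous (hm : 2 ≤ m) {κ : ℝ} {Q : Space (m + 1) → ℝ}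
    (hQ : ∀ (t : ℝ) x, Q (t • x) = t ^ 2 * Q x)
    (hO : (fun x => κ + Q x) =O[Bornology.cobounded (Space (m + 1))]
      fun x => ‖x‖ ^ ((2 : ℤ) - ((m + 1 : ℕ) : ℤ))) : κ = 0 ∧ ∀ x, Q x = 0 := by
  have h0 : Tendsto (fun x => κ + Q x) (Bornology.cobounded (Space (m + 1))) (𝓝 0) := by
    refine hO.trans_tendsto ?_
    exact (tendsto_zpow_atTop_zero (by push_cast; omega)).comp tendsto_norm_cobounded_atTop
  have hx : ∀ x : Space (m + 1), x ≠ 0 → Tendsto (fun t : ℝ => κ + t ^ 2 * Q x) atTop (𝓝 0) := by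
    intro x hx
    have h1 : Tendsto (fun t : ℝ => t • x) atTop (Bornology.cobounded (Space (m + 1))) := by
      rw [← tendsto_norm_atTop_iff_cobounded]
      simp only [norm_smul]
      exact tendsto_norm_atTop_atTop.atTop_mul_const (norm_pos_iff.2 hx)
    refine (h0.comp h1).congr fun t => ?_
    simp [hQ]
  have hzero : ∀ x : Space (m + 1), x ≠ 0 → Q x = 0 := by
    intro x hne
    have h1 : Tendsto (fun t : ℝ => (t ^ 2)⁻¹) atTop (𝓝 0) :=
      (tendsto_pow_atTop two_ne_zero).inv_tendsto_atTop
    have h2 := ((hx x hne).sub_const κ).mul h1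
    rw [mul_zero] at h2
    have h3 : Tendsto (fun t : ℝ => (κ + t ^ 2 * Q x - κ) * (t ^ 2)⁻¹) atTop (𝓝 (Q x)) := by
      refine tendsto_const_nhds.congr' ?_
      filter_upwards [eventually_gt_atTop 0] with t ht
      field_simp
      ring
    exact tendsto_nhds_unique h3 h2
  obtain ⟨x, hne⟩ := exists_ne (0 : Space (m + 1))
  refine ⟨?_, fun y => ?_⟩
  · have h1 := hx x hne
    simp only [hzero x hne, mul_zero, add_zero] at h1
    exact tendsto_nhds_unique tendsto_const_nhds h1
  · rcases eq_or_ne y 0 with rfl | hy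
    · have := hQ 0 0
      simpa using this
    · exact hzero y hy

/-- Two branches near infinity agree up to sign, and the opposite sign would give κ + κ' = 0.
Positivity of the constants thus fixes the branch, which is what makes P readable from f. -/
theorem HasAsymptotics.unique (hm : 2 ≤ m) {f : TwoValued (m + 1)} {κ κ' : ℝ}
    {Q Q' : Space (m + 1) → ℝ} (hκ : 0 < κ) (hκ' : 0 < κ')
    (hQ : ∀ (t : ℝ) x, Q (t • x) = t ^ 2 * Q x) (hQ' : ∀ (t : ℝ) x, Q' (t • x) = t ^ 2 * Q' x)
    (hf : HasAsymptotics f fun x => κ + Q x) (hf' : HasAsymptotics f fun x => κ' + Q' x) :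
    κ = κ' ∧ ∀ x, Q x = Q' x := by
  obtain ⟨R, g, hg, hO⟩ := hf
  obtain ⟨R', g', hg', hO'⟩ := hf'
  set ρ := max (max R R') 0
  have hev : ∀ᶠ x in Bornology.cobounded (Space (m + 1)), ρ < ‖x‖ :=
    tendsto_norm_cobounded_atTop.eventually_gt_atTop ρ
  have hb := hg.mono (V := {x | ρ < ‖x‖}) fun x hx =>
    ((le_max_left R R').trans (le_max_left _ 0)).trans_lt hx
  have hb' := hg'.mono (V := {x | ρ < ‖x‖}) fun x hx =>
    ((le_max_right R R').trans (le_max_left _ 0)).trans_lt hx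
  rcases hb.eq_or_eq_neg hb' (isOpen_lt continuous_const continuous_norm)
    (isConnected_norm_gt (by omega) (le_max_right _ _)).isPreconnected with h | h
  · have h1 : (fun x => (κ' - κ) + (Q' x - Q x)) =O[Bornology.cobounded (Space (m + 1))]
        fun x => ‖x‖ ^ ((2 : ℤ) - ((m + 1 : ℕ) : ℤ)) := by
      refine (hO.sub hO').congr' ?_ EventuallyEq.rfl
      filter_upwards [hev] with x hx
      rw [h x hx]; ring
    obtain ⟨h2, h3⟩ := eq_zero_of_isBigO_of_homogeneous hm (fun t x => by rw [hQ, hQ']; ring) h1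
    exact ⟨by linarith, fun x => by linarith [h3 x]⟩
  · have h1 : (fun x => -(κ' + κ) + -(Q' x + Q x)) =O[Bornology.cobounded (Space (m + 1))]
        fun x => ‖x‖ ^ ((2 : ℤ) - ((m + 1 : ℕ) : ℤ)) := by
      refine (hO.add hO').congr' ?_ EventuallyEq.rfl
      filter_upwards [hev] with x hx
      rw [h x hx]; ring
    obtain ⟨h2, h3⟩ := eq_zero_of_isBigO_of_homogeneous hm (fun t x => by rw [hQ, hQ']; ring) h1
    linarith

end Transport
end ZTwo

/-! ### Rigidity: how isometries relate ellipsoidal families. -/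

namespace ZTwo

open InnerProductSpace

section Rigidity

/-- An isometry that intertwines two diagonal quadratic forms only mixes equal eigenvalues. -/
theorem eq_of_intertwine {N : ℕ} (U : Space N ≃ₗᵢ[ℝ] Space N) {d d' : Fin N → ℝ}
    (hd : ∀ x : Space N, ∑ i, d i * x i ^ 2 = ∑ i, d' i * U x i ^ 2) {i j : Fin N}
    (hij : U (EuclideanSpace.single j 1) i ≠ 0) : d j = d' i := by
  have hpol : ∀ x y : Space N, ∑ i, d i * (x i * y i) = ∑ i, d' i * (U x i * U y i) := by
    intro x y
    have h1 := hd (x + y)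
    have h2 := hd (x - y)
    have e1 : ∑ i, d i * (x i * y i) = (∑ i, d i * (x + y) i ^ 2 - ∑ i, d i * (x - y) i ^ 2) / 4 := by
      rw [← Finset.sum_sub_distrib, Finset.sum_div]
      exact Finset.sum_congr rfl fun i _ => by simp only [PiLp.add_apply, PiLp.sub_apply]; ring
    have e2 : ∑ i, d' i * (U x i * U y i) =
        (∑ i, d' i * U (x + y) i ^ 2 - ∑ i, d' i * U (x - y) i ^ 2) / 4 := by
      rw [← Finset.sum_sub_distrib, Finset.sum_div]
      refine Finset.sum_congr rfl fun i _ => ?_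
      simp only [map_add, map_sub, PiLp.add_apply, PiLp.sub_apply]
      ring
    rw [e1, e2, h1, h2]
  -- Evaluating the polarised identity at e_j and U⁻¹e_i puts the same matrix entry of U on both
  -- sides, once with each eigenvalue.
  set x : Space N := EuclideanSpace.single j 1
  set y : Space N := U.symm (EuclideanSpace.single i 1)
  have h1 := hpol x y
  have h2 : ∑ k, d' k * (U x k * U y k) = d' i * U x i := by
    simp [y]
  have h3 : ∑ k, d k * (x k * y k) = d j * y j := by
    simp [x]
  have h4 : y j = U x i := by
    have h5 : inner ℝ x y = inner ℝ (U x) (U y) := (U.inner_map_map x y).symm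
    simpa [x, y, EuclideanSpace.inner_single_left, EuclideanSpace.inner_single_right] using h5
  rw [h2, h3, h4] at h1
  exact mul_right_cancel₀ hij h1

/-- A nonzero determinant has a nonzero term in its Leibniz expansion. The permutation matches the
two lists of eigenvalues with multiplicity, without sorting them. -/
theorem exists_perm_ne_zero {N : ℕ} (U : Space N ≃ₗᵢ[ℝ] Space N) :
    ∃ σ : Equiv.Perm (Fin N), ∀ j, U (EuclideanSpace.single j 1) (σ j) ≠ 0 := by
  set b := (EuclideanSpace.basisFun (Fin N) ℝ).toBasis
  set M := LinearMap.toMatrix b b (U.toLinearEquiv : Space N →ₗ[ℝ] Space N)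
  have hM : ∀ i j, M i j = U (EuclideanSpace.single j 1) i := fun i j => by
    simp [M, b, LinearMap.toMatrix_apply]
  have hdet : M.det ≠ 0 := by
    rw [LinearMap.det_toMatrix]
    exact (LinearEquiv.isUnit_det' U.toLinearEquiv).ne_zero
  rw [Matrix.det_apply] at hdet
  obtain ⟨σ, -, hσ⟩ := Finset.exists_ne_zero_of_sum_ne_zero hdet
  refine ⟨σ, fun j => ?_⟩
  rw [← hM]
  have hprod : ∏ i, M (σ i) i ≠ 0 := fun h0 => hσ (by rw [h0, smul_zero])
  exact Finset.prod_ne_zero_iff.1 hprod j (Finset.mem_univ j)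

/-- U intertwines the two diagonal matrices entry by entry and preserves inner products. In this way
matched eigenvalues may be replaced by any function of the semi-axes. -/
theorem sum_mul_sq_map {N : ℕ} (U : Space N ≃ₗᵢ[ℝ] Space N) {φ φ' : Fin N → ℝ}
    (hφ : ∀ i j, U (EuclideanSpace.single j 1) i ≠ 0 → φ j = φ' i) (x : Space N) :
    ∑ i, φ' i * U x i ^ 2 = ∑ j, φ j * x j ^ 2 := by
  have hexp : ∀ y : Space N, ∀ i, U y i = ∑ j, y j * U (EuclideanSpace.single j 1) i := by
    intro y i
    have h1 : y = ∑ j, y j • EuclideanSpace.single j (1 : ℝ) := by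
      have := (EuclideanSpace.basisFun (Fin N) ℝ).sum_repr y
      simpa using this.symm
    conv_lhs => rw [h1]
    simp [map_sum, map_smul]
  set y : Space N := WithLp.toLp 2 fun j => φ j * x j
  have h1 : ∀ i, φ' i * U x i = U y i := by
    intro i
    rw [hexp, hexp, Finset.mul_sum]
    refine Finset.sum_congr rfl fun j _ => ?_
    by_cases h0 : U (EuclideanSpace.single j 1) i = 0
    · simp [h0]
    · simp only [y, hφ i j h0]; ring
  have h2 : inner ℝ (U x) (U y) = inner ℝ x y := U.inner_map_map x y
  simp only [PiLp.inner_apply, RCLike.inner_apply, conj_trivial] at h2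
  calc ∑ i, φ' i * U x i ^ 2 = ∑ i, U y i * U x i := Finset.sum_congr rfl fun i _ => by rw [← h1]; ring
    _ = ∑ i, y i * x i := h2
    _ = _ := Finset.sum_congr rfl fun j _ => by simp only [y]; ring

variable {m : ℕ}

/-- The quadratic part of `modelPoly`. -/
noncomputable def modelQuad (h : Fin m → ℝ) (x : Space (m + 1)) : ℝ :=
  -(∑ i, aCoeff h i * x i.castSucc ^ 2 + aLast h * x (Fin.last m) ^ 2)

theorem modelPoly_eq (h : Fin m → ℝ) (x : Space (m + 1)) :
    modelPoly h x = aZero h + modelQuad h x := sub_eq_add_neg _ _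

theorem modelQuad_smul (h : Fin m → ℝ) (t : ℝ) (x : Space (m + 1)) :
    modelQuad h (t • x) = t ^ 2 * modelQuad h x := by
  simp only [modelQuad, PiLp.smul_apply, smul_eq_mul, mul_pow]
  rw [mul_neg, mul_add, Finset.mul_sum]
  congr 2
  · exact Finset.sum_congr rfl fun i _ => by ring
  · ring

/-- The relation between two ellipsoidal families whose model polynomials have proportional
quadratic parts in coordinates related by the isometry `U`. -/
structure IsScaledBy (U : Space (m + 1) ≃ₗᵢ[ℝ] Space (m + 1)) (τ : ℝ) (h h' : Fin m → ℝ) : Prop where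
  perm : ∃ σ : Equiv.Perm (Fin m), ∀ i, h i = τ * h' (σ i)
  last_sq : ∀ x, U x (Fin.last m) ^ 2 = x (Fin.last m) ^ 2
  sum_eq : ∀ (φ : ℝ → ℝ) (x : Space (m + 1)),
    ∑ i : Fin m, φ (τ * h' i) * U x i.castSucc ^ 2 = ∑ j : Fin m, φ (h j) * x j.castSucc ^ 2

/-- Matching eigenvalues gives c aᵢ(h) = c' a_{σ i}(h'), hence h is τ times a permutation of h'.
Homogeneity of degree -1 of aᵢ forces c = τ c', and degree 1 of a₀ forces C = τ² C'. -/
theorem exists_isScaledBy (hm : 2 ≤ m) {h h' : Fin m → ℝ} (hh : ∀ i, 0 < h i) (hh' : ∀ i, 0 < h' i)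
    {c c' C C' : ℝ} (hc : 0 < c) (hc' : 0 < c') (hC : c * aZero h = C) (hC' : c' * aZero h' = C')
    (U : Space (m + 1) ≃ₗᵢ[ℝ] Space (m + 1))
    (hU : ∀ x, c * modelQuad h x = c' * modelQuad h' (U x)) :
    ∃ τ > 0, τ ^ 2 * C' = C ∧ c = τ * c' ∧ IsScaledBy U τ h h' := by
  set d : (Fin m → ℝ) → ℝ → Fin (m + 1) → ℝ := fun h c =>
    Fin.snoc (α := fun _ => ℝ) (fun i => c * aCoeff h i) (c * aLast h)
  have hd1 : ∀ (h : Fin m → ℝ) (c : ℝ) (i : Fin m), d h c i.castSucc = c * aCoeff h i := fun h c i => by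
    simp [d]
  have hd2 : ∀ (h : Fin m → ℝ) (c : ℝ), d h c (Fin.last m) = c * aLast h := fun h c => by simp [d]
  have hdsum : ∀ (h : Fin m → ℝ) (c : ℝ) (x : Space (m + 1)),
      ∑ i, d h c i * x i ^ 2 = -(c * modelQuad h x) := fun h c x => by
    rw [Fin.sum_univ_castSucc, modelQuad, mul_neg, neg_neg, mul_add, Finset.mul_sum, hd2]
    simp only [hd1, mul_assoc]
  have hint : ∀ i j, U (EuclideanSpace.single j 1) i ≠ 0 → d h c j = d h' c' i := fun i j hij =>
    eq_of_intertwine U (fun x => by rw [hdsum, hdsum, hU]) hij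
  have hlast : ∀ {h : Fin m → ℝ}, (∀ i, 0 < h i) → aLast h < 0 := fun {h} hh => by
    rw [aLast_eq hm hh, neg_lt_zero]
    exact Finset.sum_pos (fun i _ => aCoeff_pos hm hh i) ⟨⟨0, by omega⟩, Finset.mem_univ _⟩
  -- The last eigenvalue is the only negative one, so U cannot mix the last axis with the others and
  -- the permutation restricts to the first m indices.
  have hne1 : ∀ i : Fin m, d h c i.castSucc ≠ d h' c' (Fin.last m) := fun i => by
    rw [hd1, hd2]
    have := mul_pos hc (aCoeff_pos hm hh i)
    have := mul_neg_of_pos_of_neg hc' (hlast hh')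
    linarith
  have hne2 : ∀ i : Fin m, d h c (Fin.last m) ≠ d h' c' i.castSucc := fun i => by
    rw [hd1, hd2]
    have := mul_pos hc' (aCoeff_pos hm hh' i)
    have := mul_neg_of_pos_of_neg hc (hlast hh)
    linarith
  obtain ⟨ς, hς⟩ := exists_perm_ne_zero U
  have hςne : ∀ i : Fin m, ς i.castSucc ≠ Fin.last m := fun i h0 => by
    have h1 := hς i.castSucc
    rw [h0] at h1
    exact hne1 i (hint _ _ h1)
  set s : Fin m → Fin m := fun i => (ς i.castSucc).castPred (hςne i)
  have hs : ∀ i, (s i).castSucc = ς i.castSucc := fun i => Fin.castSucc_castPred _ _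
  have hsinj : Function.Injective s := fun i j hij => by
    have h1 : ς i.castSucc = ς j.castSucc := by rw [← hs, ← hs, hij]
    exact Fin.castSucc_injective m (ς.injective h1)
  set σ : Equiv.Perm (Fin m) := Equiv.ofBijective s (Finite.injective_iff_bijective.1 hsinj)
  have hσ : ∀ i, c * aCoeff h i = c' * aCoeff h' (σ i) := fun i => by
    have h1 := hς i.castSucc
    rw [← hs] at h1
    have h2 := hint _ _ h1
    rw [hd1, hd1] at h2
    exact h2
  set k : Fin m → ℝ := fun i => h' (σ i)
  have hk : ∀ i, 0 < k i := fun i => hh' _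
  have hkco : ∀ i, aCoeff k i = aCoeff h' (σ i) := fun i => aCoeff_comp_perm σ h' i
  obtain ⟨τ, hτ, hτh⟩ := exists_scale_of_aCoeff hm hh hk (div_pos hc' hc) fun i => by
    rw [hkco, div_mul_eq_mul_div, eq_div_iff hc.ne', ← hσ]; ring
  have hheq : h = fun i => τ * k i := funext hτh
  have hcc : c = τ * c' := by
    have i₀ : Fin m := ⟨0, by omega⟩
    have h1 := hσ i₀
    have h2 : aCoeff h i₀ = τ⁻¹ * aCoeff h' (σ i₀) := by
      rw [← hkco, ← aCoeff_smul hτ k i₀, ← hheq]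
    have h3 := aCoeff_pos hm hh' (σ i₀)
    rw [h2, ← mul_assoc] at h1
    have h4 := mul_right_cancel₀ h3.ne' h1
    field_simp at h4
    linarith
  have hzero : aZero h = τ * aZero h' := by
    rw [hheq, aZero_smul hτ k, aZero_comp_perm σ h']
  -- U may mix axes beyond those paired by σ when eigenvalues coincide; equal coefficients then mean
  -- equal semi-axes.
  have hent : ∀ i j : Fin m, U (EuclideanSpace.single j.castSucc 1) i.castSucc ≠ 0 →
      h j = τ * h' i := fun i j hij => by
    have h1 := hint _ _ hij
    rw [hd1, hd1, hσ] at h1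
    have h2 := mul_left_cancel₀ hc'.ne' h1
    rw [hτh, eq_of_aCoeff_eq hm hh' h2.symm]
  have hgen : ∀ (φ : ℝ → ℝ) (K : ℝ) (x : Space (m + 1)),
      ∑ i : Fin m, φ (τ * h' i) * U x i.castSucc ^ 2 + K * U x (Fin.last m) ^ 2 =
        ∑ j : Fin m, φ (h j) * x j.castSucc ^ 2 + K * x (Fin.last m) ^ 2 := by
    intro φ K x
    have := sum_mul_sq_map U (φ := Fin.snoc (α := fun _ => ℝ) (fun i => φ (h i)) K)
      (φ' := Fin.snoc (α := fun _ => ℝ) (fun i => φ (τ * h' i)) K) (fun i j hij => ?_) x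
    · simpa [Fin.sum_univ_castSucc] using this
    · revert hij
      refine Fin.lastCases ?_ (fun i => ?_) i <;> refine Fin.lastCases ?_ (fun j => ?_) j <;> intro hij
      · simp
      · exact absurd (hint _ _ hij) (hne1 j)
      · exact absurd (hint _ _ hij) (hne2 i)
      · simp [hent i j hij]
  refine ⟨τ, hτ, ?_, hcc, ⟨σ, hτh⟩, fun x => ?_, fun φ x => ?_⟩
  · rw [← hC, ← hC', hcc, hzero]; ring
  · simpa using hgen (fun _ => 0) 1 x
  · simpa using hgen φ 0 x

/-- Everything in `Phi` and in the coordinate equations is either symmetric in the semi-axes or of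
the form ∑ φ(hᵢ)xᵢ², and U preserves the latter. The coordinates change only by the sign of v when U
reverses the last axis. -/
theorem IsScaledBy.model_eq {U : Space (m + 1) ≃ₗᵢ[ℝ] Space (m + 1)} {h h' : Fin m → ℝ}
    (hh : ∀ i, 0 < h i) (hh' : ∀ i, 0 < h' i) (hU : IsScaledBy U 1 h h') (x : Space (m + 1)) :
    model h x = model h' (U x) := by
  obtain ⟨σ, hσ⟩ := hU.perm
  simp only [one_mul] at hσ
  have hheq : h = fun i => h' (σ i) := funext hσ
  have hsum : ∀ φ : ℝ → ℝ, ∑ i : Fin m, φ (h' i) * U x i.castSucc ^ 2 =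
      ∑ j : Fin m, φ (h j) * x j.castSucc ^ 2 := fun φ => by
    simpa using hU.sum_eq φ x
  have hS : S h = S h' := by
    funext y
    rw [hheq]
    exact S_comp_perm σ h' y
  obtain ⟨-, hs⟩ := wAbs_spec hh x
  set w := wAbs h x
  set v := vSel h x
  obtain ⟨v', hv', hlast⟩ : ∃ v', v' ^ 2 = v ^ 2 ∧ x (Fin.last m) * v = U x (Fin.last m) * v' ∧
      U x (Fin.last m) = w * v' := by
    rcases sq_eq_sq_iff_eq_or_eq_neg.1 (hU.last_sq x) with h1 | h1
    · exact ⟨v, rfl, by rw [h1], by rw [h1, hs.last_eq]⟩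
    · exact ⟨-v, by ring, by rw [h1]; ring, by rw [h1, hs.last_eq]; ring⟩
  have hs' : IsSol h' (U x) w v' := by
    refine ⟨hlast.2, ?_⟩
    have h1 := hsum fun a => 1 / (w ^ 2 + a ^ 2)
    simp only [one_div_mul_eq_div] at h1
    rw [hv', h1]
    exact hs.sum_eq
  set ψ : ℝ → ℝ := fun a => ∫ u in (0 : ℝ)..w, 1 / ((u ^ 2 + a ^ 2) * √(S h (u ^ 2)))
  have hψ : ∀ i, primCoeff h i w = ψ (h i) := fun i => rfl
  have hψ' : ∀ i, primCoeff h' i w = ψ (h' i) := fun i => by simp only [ψ, hS]; rfl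
  have hPhi : Phi h x w v = Phi h' (U x) w v' := by
    have h1 := hsum ψ
    have h2 : ∑ i, ψ (h i) = ∑ i, ψ (h' i) := by
      simp only [hσ]
      exact Equiv.sum_comp σ fun i => ψ (h' i)
    have h3 : ∏ i, h i = ∏ i, h' i := by
      simp only [hσ]
      exact Equiv.prod_comp σ h'
    have h4 : primZero h w = primZero h' w := by simp only [primZero, hS]
    simp only [Phi, hψ, hψ', mul_comm (_ ^ 2) (ψ _)]
    rw [h1, h2, h3, h4, hU.last_sq, hlast.1, hS]
  rw [ZTwo.model_eq hh hs, ZTwo.model_eq hh' hs', hPhi]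

theorem IsScaledBy.ellipsoid_eq {A A' : Space (m + 1) ≃ₗᵢ[ℝ] Space (m + 1)} {h h' : Fin m → ℝ}
    {τ : ℝ} (hτ : 0 < τ) (hU : IsScaledBy (A.trans A'.symm) τ h h') :
    ellipsoid A h = τ • ellipsoid A' h' := by
  have hmem : ∀ (A : Space (m + 1) ≃ₗᵢ[ℝ] Space (m + 1)) (h : Fin m → ℝ) (x : Space (m + 1)),
      x ∈ ellipsoid A h ↔ qform h (A.symm x) = 1 ∧ A.symm x (Fin.last m) = 0 := by
    intro A h x
    constructor
    · rintro ⟨y, hy, rfl⟩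
      simpa [qform] using hy
    · exact fun hx => ⟨A.symm x, by simpa [qform] using hx, by simp⟩
  ext x
  rw [Set.mem_smul_set_iff_inv_smul_mem₀ hτ.ne', hmem, hmem, map_smul, qform_smul]
  have h1 := hU.sum_eq (fun a => 1 / a ^ 2) (A.symm x)
  have h2 := hU.last_sq (A.symm x)
  simp only [LinearIsometryEquiv.trans_apply, LinearIsometryEquiv.apply_symm_apply] at h1 h2
  have h3 : τ⁻¹ ^ 2 * qform h' (A'.symm x) = qform h (A.symm x) := by
    rw [qform, qform, Finset.mul_sum]
    simp only [one_div_mul_eq_div] at h1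
    rw [← h1]
    exact Finset.sum_congr rfl fun i _ => by rw [mul_pow]; field_simp
  rw [h3]
  refine and_congr_right fun _ => ?_
  rw [PiLp.smul_apply, smul_eq_mul, mul_eq_zero, or_iff_right (inv_ne_zero hτ.ne'),
    ← sq_eq_zero_iff (a := A'.symm x (Fin.last m)), h2, sq_eq_zero_iff]

end Rigidity
end ZTwo

/-! ### Diagonal form of the polynomial P. -/

namespace ZTwo

open InnerProductSpace

section QuadraticForm

theorem polyFun_smul {n : ℕ} {P : MvPolynomial (Fin n) ℝ} (hP : P.IsHomogeneous 2) (t : ℝ)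
    (x : Space n) : polyFun P (t • x) = t ^ 2 * polyFun P x := by
  simp only [polyFun, MvPolynomial.eval_eq']
  rw [Finset.mul_sum]
  refine Finset.sum_congr rfl fun d hd => ?_
  have h1 : ∑ i, d i = 2 := by
    have := hP (MvPolynomial.mem_support_iff.1 hd)
    rw [← this]
    simp [Finsupp.weight_apply, Finsupp.sum_fintype]
  simp only [PiLp.smul_apply, smul_eq_mul, mul_pow, Finset.prod_mul_distrib, Finset.prod_pow_eq_pow_sum,
    h1]
  ring

theorem contDiff_polyFun {n : ℕ} (P : MvPolynomial (Fin n) ℝ) : ContDiff ℝ ∞ (polyFun P) := by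
  have : polyFun P = fun x : Space n => ∑ d ∈ P.support, P.coeff d * ∏ i, x i ^ d i := by
    funext x
    simp only [polyFun, MvPolynomial.eval_eq']
  rw [this]
  fun_prop

/-- A quadratically homogeneous smooth function is given by its Hessian at the origin. -/
theorem fderiv_fderiv_of_homogeneous {n : ℕ} {p : Space n → ℝ} (hp : ContDiff ℝ ∞ p)
    (hhom : ∀ (t : ℝ) x, p (t • x) = t ^ 2 * p x) (h0 : fderiv ℝ p 0 = 0) (x : Space n) :
    fderiv ℝ (fderiv ℝ p) 0 x = fderiv ℝ p x ∧ fderiv ℝ (fderiv ℝ p) 0 x x = 2 * p x := by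
  have hd : Differentiable ℝ p := hp.differentiable (by simp)
  have hd2 : Differentiable ℝ (fderiv ℝ p) := (hp.fderiv_right (m := ∞) (by simp)).differentiable (by simp)
  have hhom1 : ∀ t : ℝ, fderiv ℝ p (t • x) = t • fderiv ℝ p x := by
    intro t
    rcases eq_or_ne t 0 with rfl | ht
    · simp [h0]
    have h1 : HasFDerivAt (fun y => p (t • y)) (t • fderiv ℝ p (t • x)) x := by
      have h2 : HasFDerivAt (fun y : Space n => t • y) (t • ContinuousLinearMap.id ℝ (Space n)) x :=
        (hasFDerivAt_id x).const_smul t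
      have h3 := (hd (t • x)).hasFDerivAt.comp x h2
      refine h3.congr_fderiv ?_
      ext ξ
      simp
    have h2 : HasFDerivAt (fun y => p (t • y)) (t ^ 2 • fderiv ℝ p x) x := by
      simp only [hhom]
      exact (hd x).hasFDerivAt.const_mul _
    have h3 := h1.unique h2
    rw [pow_two, mul_smul] at h3
    exact smul_right_injective _ ht h3
  have hcurve : ∀ t : ℝ, HasDerivAt (fun t : ℝ => t • x) x t := fun t => by
    simpa using (hasDerivAt_id t).smul_const x
  have hfirst : fderiv ℝ (fderiv ℝ p) 0 x = fderiv ℝ p x := by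
    have h1 : HasDerivAt (fun t : ℝ => fderiv ℝ p (t • x)) (fderiv ℝ (fderiv ℝ p) 0 x) 0 := by
      have h2 : HasFDerivAt (fderiv ℝ p) (fderiv ℝ (fderiv ℝ p) 0) ((0 : ℝ) • x) := by
        rw [zero_smul]
        exact (hd2 0).hasFDerivAt
      exact h2.comp_hasDerivAt (0 : ℝ) (hcurve 0)
    have h2 : HasDerivAt (fun t : ℝ => fderiv ℝ p (t • x)) (fderiv ℝ p x) 0 := by
      simp only [hhom1]
      simpa using (hasDerivAt_id (0 : ℝ)).smul_const (fderiv ℝ p x)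
    exact h1.unique h2
  refine ⟨hfirst, ?_⟩
  rw [hfirst]
  have h1 : HasDerivAt (fun t : ℝ => p (t • x)) (fderiv ℝ p x x) 1 := by
    have h2 : HasFDerivAt p (fderiv ℝ p x) ((1 : ℝ) • x) := by
      rw [one_smul]
      exact (hd x).hasFDerivAt
    exact h2.comp_hasDerivAt (1 : ℝ) (hcurve 1)
  have h2 : HasDerivAt (fun t : ℝ => p (t • x)) (2 * p x) 1 := by
    simp only [hhom]
    simpa using (hasDerivAt_pow 2 (1 : ℝ)).mul_const (p x)
  exact h1.unique h2

/-- An orthonormal basis that diagonalises a symmetric bilinear form. -/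
theorem exists_orthonormalBasis_diag {N : ℕ} (T : Space N →L[ℝ] Space N →L[ℝ] ℝ)
    (hT : ∀ x y, T x y = T y x) :
    ∃ (b : OrthonormalBasis (Fin N) ℝ (Space N)) (l : Fin N → ℝ),
      ∀ i x, T (b i) x = l i * inner ℝ (b i) x := by
  set L : Space N →ₗ[ℝ] Space N :=
    { toFun := fun x => (toDual ℝ (Space N)).symm (T x)
      map_add' := fun x y => by simp
      map_smul' := fun c x => by simp }
  have hL : ∀ x y, inner ℝ (L x) y = T x y := fun x y => by
    simp [L]
  have hsym : L.IsSymmetric := fun x y => by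
    rw [hL, real_inner_comm, hL, hT]
  refine ⟨hsym.eigenvectorBasis (finrank_euclideanSpace_fin), hsym.eigenvalues finrank_euclideanSpace_fin,
    fun i x => ?_⟩
  rw [← hL, hsym.apply_eigenvectorBasis, real_inner_smul_left]
  rfl

variable {m : ℕ}

/-- The set of dimensions contains 0 and is bounded by n, so its supremum is a genuine maximum and
not a default value. -/
theorem exists_negDef_of_morseIndex {n k : ℕ} {p : Space n → ℝ} (hp : morseIndex p 0 = k) :
    ∃ V : Submodule ℝ (Space n), Module.finrank ℝ V = k ∧
      ∀ v ∈ V, v ≠ 0 → fderiv ℝ (fderiv ℝ p) 0 v v < 0 := by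
  have h1 := Nat.sSup_mem (s := {d | ∃ V : Submodule ℝ (Space n), Module.finrank ℝ V = d ∧
    ∀ v ∈ V, v ≠ 0 → fderiv ℝ (fderiv ℝ p) 0 v v < 0})
    ⟨0, ⊥, by simp, fun v hv hne => absurd (by simpa using hv) hne⟩
    ⟨n, fun d ⟨V, hV, _⟩ => by
      rw [← hV]
      simpa using V.finrank_le⟩
  rw [morseIndex] at hp
  rw [hp] at h1
  exact h1

/-- Eigenvalues of the Hessian are nonzero because a null vector would be another critical point,
and their sum is zero by harmonicity, so some eigenvalue is positive. A second positive one would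
span with it a plane meeting the m-dimensional negative subspace. The positive axis is moved to the
last place by a transposition. -/
theorem exists_diagonal_form {P : MvPolynomial (Fin (m + 1)) ℝ} (hhom : P.IsHomogeneous 2)
    (hharm : HarmonicOnNhd (polyFun P) Set.univ) (hcrit : ∀ x, fderiv ℝ (polyFun P) x = 0 ↔ x = 0)
    (hindex : morseIndex (polyFun P) 0 = m) :
    ∃ (A : Space (m + 1) ≃ₗᵢ[ℝ] Space (m + 1)) (b : Fin m → ℝ), (∀ i, 0 < b i) ∧
      ∀ x, polyFun P x = -∑ i, b i * A.symm x i.castSucc ^ 2 +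
        (∑ i, b i) * A.symm x (Fin.last m) ^ 2 := by
  set p := polyFun P
  have hp : ContDiff ℝ ∞ p := contDiff_polyFun P
  have hsecond := fderiv_fderiv_of_homogeneous hp (polyFun_smul hhom) ((hcrit 0).2 rfl)
  set T := fderiv ℝ (fderiv ℝ p) 0
  have hsym : ∀ x y, T x y = T y x := fun x y =>
    (hp.contDiffAt.isSymmSndFDerivAt (by simp; norm_cast)) x y
  obtain ⟨b, l, hbl⟩ := exists_orthonormalBasis_diag T hsym
  have hbb : ∀ i j, T (b i) (b j) = if i = j then l i else 0 := fun i j => by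
    rw [hbl, orthonormal_iff_ite.1 b.orthonormal]
    simp
  have hne : ∀ i, l i ≠ 0 := fun i h0 => by
    have h1 : T (b i) = 0 := by
      ext x
      simp [hbl, h0]
    rw [(hsecond (b i)).1, hcrit] at h1
    exact b.orthonormal.ne_zero i h1
  have htrace : ∑ i, l i = 0 := by
    have h1 : Laplacian.laplacian p 0 = 0 := (hharm 0 (Set.mem_univ 0)).2.self_of_nhds
    rw [laplacian_eq_sum_fderiv b] at h1
    rw [← h1]
    exact Finset.sum_congr rfl fun i _ => by
      have := hbb i i
      rw [if_pos rfl] at this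
      exact this.symm
  obtain ⟨V, hV, hVneg⟩ := exists_negDef_of_morseIndex hindex
  have hone : ∀ i j, 0 < l i → 0 < l j → i = j := by
    intro i j hi hj
    by_contra hij
    have hli : LinearIndependent ℝ ![b i, b j] := by
      have h1 : ![b i, b j] = b ∘ ![i, j] := by
        funext k
        fin_cases k <;> rfl
      rw [h1]
      refine b.orthonormal.linearIndependent.comp _ fun k k' hk => ?_
      fin_cases k <;> fin_cases k' <;> simp_all
    have hW : Module.finrank ℝ (Submodule.span ℝ (Set.range ![b i, b j])) = 2 := by
      rw [finrank_span_eq_card hli]; simp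
    have hnd : ¬ Disjoint V (Submodule.span ℝ (Set.range ![b i, b j])) := by
      intro hdis
      have := Submodule.finrank_add_finrank_le_of_disjoint hdis
      rw [hV, hW, finrank_euclideanSpace_fin] at this
      omega
    rw [Submodule.disjoint_def] at hnd
    push Not at hnd
    obtain ⟨v, hvV, hvW, hv0⟩ := hnd
    have hneg := hVneg v hvV hv0
    change T v v < 0 at hneg
    simp only [Matrix.range_cons, Matrix.range_empty, Set.union_empty, Set.singleton_union] at hvW
    obtain ⟨s, t, rfl⟩ := Submodule.mem_span_pair.1 hvW
    simp only [map_add, map_smul, add_apply, smul_apply, hbb, smul_eq_mul, if_true, hij, Ne.symm hij,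
      if_false, mul_zero, add_zero, zero_add] at hneg
    nlinarith [mul_nonneg (mul_self_nonneg s) hi.le, mul_nonneg (mul_self_nonneg t) hj.le]
  obtain ⟨i₀, hi₀⟩ : ∃ i, 0 < l i := by
    by_contra! hall
    have := (Finset.sum_eq_zero_iff_of_nonpos fun i _ => hall i).1 htrace 0 (Finset.mem_univ _)
    exact hne 0 this
  set e : Fin (m + 1) ≃ Fin (m + 1) := Equiv.swap i₀ (Fin.last m)
  set b' := b.reindex e
  set l' : Fin (m + 1) → ℝ := fun j => l (e j)
  have he : ∀ j, b' j = b (e j) := fun j => by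
    simp [b', OrthonormalBasis.reindex_apply, e]
  have hel : e (Fin.last m) = i₀ := Equiv.swap_apply_right _ _
  have hlneg : ∀ i : Fin m, l' i.castSucc < 0 := fun i => by
    refine lt_of_le_of_ne (not_lt.1 fun h1 => ?_) (hne _)
    have h2 := hone _ _ h1 hi₀
    rw [← hel] at h2
    exact (Fin.castSucc_lt_last i).ne (e.injective h2)
  have hsum : ∑ i : Fin m, l' i.castSucc + l' (Fin.last m) = 0 := by
    rw [← Fin.sum_univ_castSucc, ← htrace]
    exact Equiv.sum_comp e l
  -- The factor 1/2 appears because the Hessian evaluated twice at x is 2 P(x).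
  refine ⟨b'.repr.symm, fun i => -(l' i.castSucc) / 2, fun i => by linarith [hlneg i], fun x => ?_⟩
  have hx : 2 * p x = ∑ j, l' j * b'.repr x j ^ 2 := by
    rw [← (hsecond x).2]
    have h1 : ∀ j, T (b' j) x = l' j * b'.repr x j := fun j => by
      rw [he, hbl, b'.repr_apply_apply, he]
    calc T x x = T (∑ j, b'.repr x j • b' j) x := by rw [b'.sum_repr]
      _ = ∑ j, b'.repr x j * T (b' j) x := by
          simp [map_sum, sum_apply]
      _ = _ := Finset.sum_congr rfl fun j _ => by rw [h1]; ring
  rw [Fin.sum_univ_castSucc] at hx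
  have h2 : l' (Fin.last m) = -∑ i : Fin m, l' i.castSucc := by linarith
  have h3 : ∑ i : Fin m, -(l' i.castSucc) / 2 = -(∑ i : Fin m, l' i.castSucc) / 2 := by
    rw [← Finset.sum_neg_distrib, Finset.sum_div]
  have h4 : ∑ i : Fin m, -(l' i.castSucc) / 2 * b'.repr x i.castSucc ^ 2 =
      -(∑ i : Fin m, l' i.castSucc * b'.repr x i.castSucc ^ 2) / 2 := by
    rw [← Finset.sum_neg_distrib, Finset.sum_div]
    exact Finset.sum_congr rfl fun i _ => by ring
  rw [LinearIsometryEquiv.symm_symm, h3, h4]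
  rw [h2] at hx
  linarith

end QuadraticForm
end ZTwo

/-! ### Existence, uniqueness and the behaviour as C tends to zero. -/

namespace ZTwo

open InnerProductSpace

section Families

variable {m : ℕ}

theorem IsEllipsoidal.coeff_eq (hm : 2 ≤ m) {A : Space (m + 1) ≃ₗᵢ[ℝ] Space (m + 1)} {h : Fin m → ℝ}
    {c C : ℝ} {f : TwoValued (m + 1)} {p : Space (m + 1) → ℝ} (hp : ∀ (t : ℝ) x, p (t • x) = t ^ 2 * p x)
    (hC : 0 < C) (hf : IsEllipsoidal A h c f) (hfp : HasAsymptotics f fun x => C + p x) :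
    c * aZero h = C ∧ ∀ x, c * modelQuad h (A.symm x) = p x := by
  have h1 := hf.asymptotics
  simp only [modelPoly_eq, mul_add] at h1
  exact HasAsymptotics.unique hm (Q := fun x => c * modelQuad h (A.symm x))
    (mul_pos hf.c_pos (aZero_pos hm hf.h_pos)) hC
    (fun t x => by rw [map_smul, modelQuad_smul]; ring) hp h1 hfp

theorem IsEllipsoidal.exists_isScaledBy (hm : 2 ≤ m) {A A' : Space (m + 1) ≃ₗᵢ[ℝ] Space (m + 1)}
    {h h' : Fin m → ℝ} {c c' C C' : ℝ} {f f' : TwoValued (m + 1)} {p : Space (m + 1) → ℝ}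
    (hp : ∀ (t : ℝ) x, p (t • x) = t ^ 2 * p x) (hC : 0 < C) (hC' : 0 < C')
    (hf : IsEllipsoidal A h c f) (hfp : HasAsymptotics f fun x => C + p x)
    (hf' : IsEllipsoidal A' h' c' f') (hfp' : HasAsymptotics f' fun x => C' + p x) :
    ∃ τ > 0, τ ^ 2 * C' = C ∧ c = τ * c' ∧ IsScaledBy (A.trans A'.symm) τ h h' := by
  obtain ⟨h1, h2⟩ := hf.coeff_eq hm hp hC hfp
  obtain ⟨h3, h4⟩ := hf'.coeff_eq hm hp hC' hfp'
  refine ZTwo.exists_isScaledBy hm hf.h_pos hf'.h_pos hf.c_pos hf'.c_pos h1 h3 _ fun x => ?_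
  have h5 := h2 (A x)
  have h6 := h4 (A x)
  rw [LinearIsometryEquiv.symm_apply_apply] at h5
  rw [h5, ← h6]
  rfl

theorem IsEllipsoidal.unique (hm : 2 ≤ m) {A A' : Space (m + 1) ≃ₗᵢ[ℝ] Space (m + 1)}
    {h h' : Fin m → ℝ} {c c' C : ℝ} {f f' : TwoValued (m + 1)} {p : Space (m + 1) → ℝ}
    (hp : ∀ (t : ℝ) x, p (t • x) = t ^ 2 * p x) (hC : 0 < C)
    (hf : IsEllipsoidal A h c f) (hfp : HasAsymptotics f fun x => C + p x)
    (hf' : IsEllipsoidal A' h' c' f') (hfp' : HasAsymptotics f' fun x => C + p x) : f = f' := by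
  obtain ⟨τ, hτ, hτC, hcc, hU⟩ := hf.exists_isScaledBy hm hp hC hC hfp hf' hfp'
  have h1 : τ ^ 2 = 1 := mul_right_cancel₀ hC.ne' (hτC.trans (one_mul C).symm)
  obtain rfl : τ = 1 := (pow_eq_one_iff_of_nonneg hτ.le two_ne_zero).1 h1
  rw [one_mul] at hcc
  subst hcc
  rw [hf.eq_transport hm, hf'.eq_transport hm]
  funext x
  have h2 := hU.model_eq hf.h_pos hf'.h_pos (A.symm x)
  simp only [LinearIsometryEquiv.trans_apply, LinearIsometryEquiv.apply_symm_apply] at h2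
  rw [transport, transport, h2]

/-- Starting from h₀ with aᵢ(h₀) = bᵢ, use semi-axes t h₀ and the same factor c = t: the quadratic
part is unchanged, and the constant becomes t² a₀(h₀), which fixes t. -/
theorem exists_isEllipsoidal (hm : 2 ≤ m) {A : Space (m + 1) ≃ₗᵢ[ℝ] Space (m + 1)} {b : Fin m → ℝ}
    (hb : ∀ i, 0 < b i) {p : Space (m + 1) → ℝ}
    (hp : ∀ x, p x = -∑ i, b i * A.symm x i.castSucc ^ 2 + (∑ i, b i) * A.symm x (Fin.last m) ^ 2)
    {C : ℝ} (hC : 0 < C) :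
    ∃ f h c, IsEllipsoidal A h c f ∧ HasAsymptotics f fun x => C + p x := by
  obtain ⟨h₀, hh₀, hco⟩ := exists_aCoeff_eq hm hb
  have ha := aZero_pos hm hh₀
  set t := √(C / aZero h₀)
  have ht : 0 < t := Real.sqrt_pos.2 (div_pos hC ha)
  have ht2 : t ^ 2 = C / aZero h₀ := Real.sq_sqrt (div_pos hC ha).le
  have hh : ∀ i, 0 < t * h₀ i := fun i => mul_pos ht (hh₀ i)
  have hE := isEllipsoidal_transport hm A hh ht
  refine ⟨_, _, _, hE, ?_⟩
  have h1 : (fun x => t * modelPoly (fun i => t * h₀ i) (A.symm x)) = fun x => C + p x := by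
    funext x
    have h3 : ∑ i, aCoeff (fun i => t * h₀ i) i * A.symm x i.castSucc ^ 2 =
        t⁻¹ * ∑ i, b i * A.symm x i.castSucc ^ 2 := by
      rw [Finset.mul_sum]
      exact Finset.sum_congr rfl fun i _ => by rw [aCoeff_smul ht, hco]; ring
    have h4 : aLast (fun i => t * h₀ i) = -(t⁻¹ * ∑ i, b i) := by
      rw [aLast_eq hm hh, Finset.mul_sum]
      congr 1
      exact Finset.sum_congr rfl fun i _ => by rw [aCoeff_smul ht, hco]
    have h5 : t ^ 2 * aZero h₀ = C := by rw [ht2]; field_simp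
    rw [modelPoly, h3, h4, hp, aZero_smul ht, ← h5]
    field_simp
    ring
  rw [← h1]
  exact hE.asymptotics

theorem norm_le_of_mem_ellipsoid {A : Space (m + 1) ≃ₗᵢ[ℝ] Space (m + 1)} {h : Fin m → ℝ}
    (hh : ∀ i, 0 < h i) {x : Space (m + 1)} (hx : x ∈ ellipsoid A h) : ‖x‖ ≤ √(∑ i, h i ^ 2) := by
  rw [ellipsoid_eq_image] at hx
  obtain ⟨y, hy, rfl⟩ := hx
  obtain ⟨h1, h2⟩ := mem_ellipsoid_refl.1 hy
  rw [LinearIsometryEquiv.norm_map]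
  exact Real.le_sqrt_of_sq_le (norm_sq_le_of_qform_le hh h1.le h2)

/-- The quantitative form of the asymptotics of an ellipsoidal function. -/
theorem IsEllipsoidal.exists_branch (hm : 2 ≤ m) {A : Space (m + 1) ≃ₗᵢ[ℝ] Space (m + 1)}
    {h : Fin m → ℝ} {c : ℝ} {f : TwoValued (m + 1)} (hf : IsEllipsoidal A h c f) :
    ∃ g, ∀ x, 2 * √(∑ i, h i ^ 2) < ‖x‖ → IsBranchAt f x g ∧
      |g x - c * modelPoly h (A.symm x)| ≤
        c * ((∏ j, h j) / 2 * decayConst m * ‖x‖ ^ (1 - (m : ℝ))) := by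
  refine ⟨fun x => c * gBr h 1 0 (A.symm x), fun x hx => ?_⟩
  have hx' : 2 * √(∑ i, h i ^ 2) < ‖A.symm x‖ := by rwa [LinearIsometryEquiv.norm_map]
  have hout := mem_outerRegion_of_norm_gt hf.h_pos hx'
  constructor
  · rw [hf.eq_transport hm]
    exact ((isBranchOn_model hf.h_pos).isBranchAt (isOpen_outerRegion h) hout).transport A c
  · rw [← mul_sub, abs_mul, abs_of_pos hf.c_pos, gBr_eq_of_mem_outer hf.h_pos hout]
    refine mul_le_mul_of_nonneg_left ?_ hf.c_pos.le
    have := abs_Phi_sub_modelPoly_le hm hf.h_pos hx'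
    rwa [LinearIsometryEquiv.norm_map] at this

theorem decayConst_nonneg (hm : 2 ≤ m) : 0 ≤ decayConst m := by
  have hm' : (2 : ℝ) ≤ m := by exact_mod_cast hm
  have : 0 ≤ 1 / ((m : ℝ) - 1) := one_div_nonneg.2 (by linarith)
  unfold decayConst
  positivity

theorem exists_sqrt_lt {s : ℝ} (hs : 0 < s) : ∃ δ : ℝ, 0 < δ ∧ ∀ C : ℝ, 0 < C → C < δ → √C < s :=
  ⟨s ^ 2, by positivity, fun _ _ hC => (Real.sqrt_lt' hs).2 hC⟩

/-- The parameters `(A, h, c)` are chosen independently for each C and are not unique, so only the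
relation `IsScaledBy` to those at C = 1 can hold, with τ = √C. -/
theorem family_scaling
    (hm : 2 ≤ m) {p : Space (m + 1) → ℝ} (hp : ∀ (t : ℝ) x, p (t • x) = t ^ 2 * p x)
    {f : ℝ → TwoValued (m + 1)} {A : ℝ → (Space (m + 1) ≃ₗᵢ[ℝ] Space (m + 1))}
    {h : ℝ → Fin m → ℝ} {c : ℝ → ℝ}
    (hf : ∀ C : ℝ, 0 < C → IsEllipsoidal (A C) (h C) (c C) (f C) ∧
      HasAsymptotics (f C) fun x => C + p x)
    {C : ℝ} (hC : 0 < C) :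
    c C = √C * c 1 ∧ IsScaledBy ((A C).trans (A 1).symm) √C (h C) (h 1) := by
  obtain ⟨τ, hτ, hτC, hcc, hU⟩ := (hf C hC).1.exists_isScaledBy hm hp hC one_pos (hf C hC).2
    (hf 1 one_pos).1 (hf 1 one_pos).2
  rw [mul_one] at hτC
  have : √C = τ := by rw [← hτC, Real.sqrt_sq hτ.le]
  rw [this]
  exact ⟨hcc, hU⟩

theorem family_ellipsoid_eq
    (hm : 2 ≤ m) {p : Space (m + 1) → ℝ} (hp : ∀ (t : ℝ) x, p (t • x) = t ^ 2 * p x)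
    {f : ℝ → TwoValued (m + 1)} {A : ℝ → (Space (m + 1) ≃ₗᵢ[ℝ] Space (m + 1))}
    {h : ℝ → Fin m → ℝ} {c : ℝ → ℝ}
    (hf : ∀ C : ℝ, 0 < C → IsEllipsoidal (A C) (h C) (c C) (f C) ∧
      HasAsymptotics (f C) fun x => C + p x)
    {C : ℝ} (hC : 0 < C) :
    ellipsoid (A C) (h C) = √C • ellipsoid (A 1) (h 1) :=
  (family_scaling hm hp hf hC).2.ellipsoid_eq (Real.sqrt_pos.2 hC)

theorem family_sum_sq
    (hm : 2 ≤ m) {p : Space (m + 1) → ℝ} (hp : ∀ (t : ℝ) x, p (t • x) = t ^ 2 * p x)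
    {f : ℝ → TwoValued (m + 1)} {A : ℝ → (Space (m + 1) ≃ₗᵢ[ℝ] Space (m + 1))}
    {h : ℝ → Fin m → ℝ} {c : ℝ → ℝ}
    (hf : ∀ C : ℝ, 0 < C → IsEllipsoidal (A C) (h C) (c C) (f C) ∧
      HasAsymptotics (f C) fun x => C + p x)
    {C : ℝ} (hC : 0 < C) : √(∑ i, h C i ^ 2) = √C * √(∑ i, h 1 i ^ 2) := by
  obtain ⟨σ, hσ⟩ := (family_scaling hm hp hf hC).2.perm
  have h1 : ∑ i, h C i ^ 2 = C * ∑ i, h 1 i ^ 2 := by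
    simp only [hσ, mul_pow, Real.sq_sqrt hC.le, ← Finset.mul_sum]
    congr 1
    exact Equiv.sum_comp σ fun i => h 1 i ^ 2
  rw [h1, Real.sqrt_mul hC.le]

theorem family_prod
    (hm : 2 ≤ m) {p : Space (m + 1) → ℝ} (hp : ∀ (t : ℝ) x, p (t • x) = t ^ 2 * p x)
    {f : ℝ → TwoValued (m + 1)} {A : ℝ → (Space (m + 1) ≃ₗᵢ[ℝ] Space (m + 1))}
    {h : ℝ → Fin m → ℝ} {c : ℝ → ℝ}
    (hf : ∀ C : ℝ, 0 < C → IsEllipsoidal (A C) (h C) (c C) (f C) ∧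
      HasAsymptotics (f C) fun x => C + p x)
    {C : ℝ} (hC : 0 < C) : ∏ i, h C i = √C ^ m * ∏ i, h 1 i := by
  obtain ⟨σ, hσ⟩ := (family_scaling hm hp hf hC).2.perm
  simp only [hσ, Finset.prod_mul_distrib, Finset.prod_const, Finset.card_univ, Fintype.card_fin]
  congr 1
  exact Equiv.prod_comp σ (h 1)

theorem family_shrink
    (hm : 2 ≤ m) {p : Space (m + 1) → ℝ} (hp : ∀ (t : ℝ) x, p (t • x) = t ^ 2 * p x)
    {f : ℝ → TwoValued (m + 1)} {A : ℝ → (Space (m + 1) ≃ₗᵢ[ℝ] Space (m + 1))}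
    {h : ℝ → Fin m → ℝ} {c : ℝ → ℝ}
    (hf : ∀ C : ℝ, 0 < C → IsEllipsoidal (A C) (h C) (c C) (f C) ∧
      HasAsymptotics (f C) fun x => C + p x)
    {ε : ℝ} (hε : 0 < ε) : ∃ δ : ℝ, 0 < δ ∧ ∀ C : ℝ, 0 < C → C < δ →
    ellipsoid (A C) (h C) ⊆ Metric.ball 0 ε := by
  set ρ := √(∑ i, h 1 i ^ 2)
  have hρ : 0 ≤ ρ := Real.sqrt_nonneg _
  obtain ⟨δ, hδ, hall⟩ := exists_sqrt_lt (s := ε / (ρ + 1)) (by positivity)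
  refine ⟨δ, hδ, fun C hC hCδ x hx => ?_⟩
  rw [mem_ball_zero_iff]
  have h1 := norm_le_of_mem_ellipsoid (hf C hC).1.h_pos hx
  rw [family_sum_sq hm hp hf hC] at h1
  have h2 := hall C hC hCδ
  rw [lt_div_iff₀ (by positivity)] at h2
  have h3 := Real.sqrt_pos.2 hC
  nlinarith

/-- By scaling, c ∏ hⱼ is √C^(m+1) times its value at C = 1. The distance to P off the ball is
therefore at most C plus √C times a fixed constant. -/
theorem family_converge
    (hm : 2 ≤ m) {p : Space (m + 1) → ℝ} (hp : ∀ (t : ℝ) x, p (t • x) = t ^ 2 * p x)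
    {f : ℝ → TwoValued (m + 1)} {A : ℝ → (Space (m + 1) ≃ₗᵢ[ℝ] Space (m + 1))}
    {h : ℝ → Fin m → ℝ} {c : ℝ → ℝ}
    (hf : ∀ C : ℝ, 0 < C → IsEllipsoidal (A C) (h C) (c C) (f C) ∧
      HasAsymptotics (f C) fun x => C + p x)
    {y : Space (m + 1)} {r : ℝ} (hy : (0 : Space (m + 1)) ∈ Metric.ball y r)
    {ε : ℝ} (hε : 0 < ε) : ∃ δ : ℝ, 0 < δ ∧ ∀ C : ℝ, 0 < C → C < δ →
      ellipsoid (A C) (h C) ⊆ Metric.ball y r ∧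
      ∃ g, IsBranchOn (f C) (Metric.ball y r)ᶜ g ∧
        ∀ x ∈ (Metric.ball y r)ᶜ, |g x - p x| < ε := by
  -- The given ball need not be centred at the origin; a centred ball inside it is all that is used.
  obtain ⟨η, hη, hball⟩ := Metric.isOpen_ball.mem_nhds hy |> Metric.mem_nhds_iff.1
  have hfar : ∀ x ∈ (Metric.ball y r)ᶜ, η ≤ ‖x‖ := fun x hx => by
    by_contra! hlt
    exact hx (hball (mem_ball_zero_iff.2 hlt))
  set ρ := √(∑ i, h 1 i ^ 2)
  have hρ : 0 ≤ ρ := Real.sqrt_nonneg _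
  have hc1 := (hf 1 one_pos).1.c_pos
  have hH1 := prod_h_pos (hf 1 one_pos).1.h_pos
  have hK := decayConst_nonneg hm
  set L := c 1 * ((∏ j, h 1 j) / 2 * decayConst m * η ^ (1 - (m : ℝ)))
  have hL : 0 ≤ L := by positivity
  obtain ⟨δ₁, hδ₁, hshrink⟩ := family_shrink hm hp hf hη
  -- The bound 1 gives C ≤ √C, the second makes √C (1 + L) < ε, and the third places the complement
  -- of the ball where the explicit branch and its decay estimate are available.
  obtain ⟨δ, hδ, hall⟩ := exists_sqrt_lt (s := min 1 (min (ε / (1 + L)) (η / (2 * ρ + 1))))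
    (by positivity)
  refine ⟨min δ₁ δ, by positivity, fun C hC hCδ =>
    ⟨(hshrink C hC (hCδ.trans_le (min_le_left _ _))).trans hball, ?_⟩⟩
  have hs := hall C hC (hCδ.trans_le (min_le_right _ _))
  have hs0 := Real.sqrt_pos.2 hC
  set s := √C
  have hs1 : s < 1 := hs.trans_le (min_le_left _ _)
  have hs2 : s * (1 + L) < ε := by
    rw [← lt_div_iff₀ (by positivity)]
    exact hs.trans_le ((min_le_right _ _).trans (min_le_left _ _))
  have hs3 : s * (2 * ρ + 1) < η := by
    rw [← lt_div_iff₀ (by positivity)]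
    exact hs.trans_le ((min_le_right _ _).trans (min_le_right _ _))
  have hsC : C = s ^ 2 := (Real.sq_sqrt hC.le).symm
  have hrad : ∀ x ∈ (Metric.ball y r)ᶜ, 2 * √(∑ i, h C i ^ 2) < ‖x‖ := fun x hx => by
    rw [family_sum_sq hm hp hf hC]
    have := hfar x hx
    change 2 * (s * ρ) < ‖x‖
    nlinarith
  obtain ⟨g, hg⟩ := (hf C hC).1.exists_branch hm
  refine ⟨g, isBranchOn_of_forall fun x hx => (hg x (hrad x hx)).1, fun x hx => ?_⟩
  obtain ⟨e1, e2⟩ := (hf C hC).1.coeff_eq hm hp hC (hf C hC).2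
  have h1 := (hg x (hrad x hx)).2
  rw [modelPoly_eq, mul_add, e1, e2, family_prod hm hp hf hC, (family_scaling hm hp hf hC).1] at h1
  change |g x - (C + p x)| ≤ s * c 1 * (s ^ m * (∏ j, h 1 j) / 2 * decayConst m * ‖x‖ ^ (1 - (m : ℝ))) at h1
  have hm' : (2 : ℝ) ≤ m := by exact_mod_cast hm
  have h2 : ‖x‖ ^ (1 - (m : ℝ)) ≤ η ^ (1 - (m : ℝ)) :=
    Real.rpow_le_rpow_of_nonpos hη (hfar x hx) (by linarith)
  have h3 : s ^ m ≤ 1 := pow_le_one₀ hs0.le hs1.le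
  have h4 : s * c 1 * (s ^ m * (∏ j, h 1 j) / 2 * decayConst m * ‖x‖ ^ (1 - (m : ℝ))) ≤ s * L := by
    calc s * c 1 * (s ^ m * (∏ j, h 1 j) / 2 * decayConst m * ‖x‖ ^ (1 - (m : ℝ)))
        ≤ s * c 1 * (1 * (∏ j, h 1 j) / 2 * decayConst m * η ^ (1 - (m : ℝ))) := by gcongr
      _ = s * L := by simp only [L]; ring
  have h5 : C ≤ s := by rw [hsC]; nlinarith
  calc |g x - p x| = |(g x - (C + p x)) + C| := by ring_nf
    _ ≤ |g x - (C + p x)| + |C| := abs_add_le _ _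
    _ ≤ s * L + s := by rw [abs_of_pos hC]; linarith
    _ < ε := by linarith

end Families
end ZTwo

/-! ### The main theorem, with n = m + 1. -/

theorem proposition1p2 (m : ℕ) (hm : 3 ≤ m + 1) (P : MvPolynomial (Fin (m + 1)) ℝ)
    (hhom : P.IsHomogeneous 2)
    (hharm : InnerProductSpace.HarmonicOnNhd (ZTwo.polyFun P) Set.univ)
    (hcrit : ∀ x, fderiv ℝ (ZTwo.polyFun P) x = 0 ↔ x = 0)
    (hindex : ZTwo.morseIndex (ZTwo.polyFun P) 0 = m) :
    (∀ C : ℝ, 0 < C → ∃! f : ZTwo.TwoValued (m + 1),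
      (∃ A h c, ZTwo.IsEllipsoidal A h c f) ∧
        ZTwo.HasAsymptotics f fun x => C + ZTwo.polyFun P x) ∧
    (∀ (f : ℝ → ZTwo.TwoValued (m + 1))
      (A : ℝ → (ZTwo.Space (m + 1) ≃ₗᵢ[ℝ] ZTwo.Space (m + 1)))
      (h : ℝ → Fin m → ℝ) (c : ℝ → ℝ),
      (∀ C : ℝ, 0 < C → ZTwo.IsEllipsoidal (A C) (h C) (c C) (f C) ∧
        ZTwo.HasAsymptotics (f C) fun x => C + ZTwo.polyFun P x) →
      (∀ C : ℝ, 0 < C →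
        ZTwo.ellipsoid (A C) (h C) = √C • ZTwo.ellipsoid (A 1) (h 1)) ∧
      (∀ ε : ℝ, 0 < ε → ∃ δ : ℝ, 0 < δ ∧ ∀ C : ℝ, 0 < C → C < δ →
        ZTwo.ellipsoid (A C) (h C) ⊆ Metric.ball 0 ε) ∧
      (∀ (y : ZTwo.Space (m + 1)) (r : ℝ), 0 ∈ Metric.ball y r →
        ∀ ε : ℝ, 0 < ε → ∃ δ : ℝ, 0 < δ ∧ ∀ C : ℝ, 0 < C → C < δ →
          ZTwo.ellipsoid (A C) (h C) ⊆ Metric.ball y r ∧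
          ∃ g, ZTwo.IsBranchOn (f C) (Metric.ball y r)ᶜ g ∧
            ∀ x ∈ (Metric.ball y r)ᶜ, |g x - ZTwo.polyFun P x| < ε)) ∧
    Set.MapsTo (ZTwo.coeffMap (m := m)) (ZTwo.cone m) (ZTwo.cone m) ∧
    Set.SurjOn (ZTwo.coeffMap (m := m)) (ZTwo.cone m) (ZTwo.cone m) := by
  have hm2 : 2 ≤ m := by omega
  have hp := ZTwo.polyFun_smul hhom
  refine ⟨fun C hC => ?_, fun f A h c hf => ⟨fun C hC => ZTwo.family_ellipsoid_eq hm2 hp hf hC,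
    fun ε hε => ZTwo.family_shrink hm2 hp hf hε,
    fun y r hy ε hε => ZTwo.family_converge hm2 hp hf hy hε⟩,
    ZTwo.coeffMap_mapsTo hm2, ZTwo.coeffMap_surjOn hm2⟩
  obtain ⟨A, b, hb, hPA⟩ := ZTwo.exists_diagonal_form hhom hharm hcrit hindex
  obtain ⟨f, h, c, hf, hfp⟩ := ZTwo.exists_isEllipsoidal hm2 hb hPA hC
  refine ⟨f, ⟨⟨A, h, c, hf⟩, hfp⟩, ?_⟩
  rintro f' ⟨⟨A', h', c', hf'⟩, hfp'⟩
  exact hf'.unique hm2 hp hC hfp' hf hfp
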